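/- Work over $\mathbb C$. For parameters $a=(a_1,\dots,a_5)$ with all $a_i\ne 0$, $a_1\neq a_2$, $a_3\neq a_4$, let $X_a$ be the surface obtained from $\mathbb P^1\times\mathbb P^1$ by blowing up successively $$P_1=(a_1,0),\ P_2=(a_2,0),\ P_3=(0,a_3),\ P_4=(0,a_4),\ P_5=(1,\infty),\ P_6=(\infty,1),\ P_7=(\infty,\infty),$$ and the point $P_8$ given by $y/x=a_5$ on the exceptional curve over $P_7$. Let $E_i$ be the total transform of $P_i$ and $H_x,H_y$ the classes of $x=\mathrm{const}$, $y=\mathrm{const}$, so that $\mathrm{Pic}(X_a)=\mathbb ZH_x\oplus\mathbb ZH_y\oplus\bigoplus_{i=1}^8\mathbb ZE_i$ and $-K=2H_x+2H_y-\sum_{i=1}^8E_i$. Put $q(a)=-\dfrac{a_3a_4}{a_1a_2a_5}$. **(1) The HKY mapping is of type i-2.** Let $t\in\mathbb C$, $t\ne0$, and $X=X_{(t,-t,t,-t,1)}$. The mapping $$\varphi:\quad \bar x=\frac{(x-t)(x+t)}{y(x-1)},\qquad \bar y=x$$ lifts to an automorphism of $X$. One has $\dim|-K_X|=0$ and $\dim|-2K_X|=1$,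 i.e. $X$ is a Halphen surface of index $2$. The linear system $|-2K_X|$ is the pencil $\alpha f+\beta g=0$ of degree $(4,4)$ with $f=x^2y^2$ and $$g=2x^2y^3+2x^3y^2+x^2y^4+x^4y^2-2x^3y^3-2xy^4-2x^4y+x^4+y^4+2t^2(xy^2+x^2y-y^2-x^2)+t^4 .$$ It defines an elliptic fibration: $k=g/f$ is a morphism $X\to\mathbb P^1$, and for all but finitely many $c\in\mathbb C$ the fibre $k=c$ is a nonsingular irreducible curve of genus one. The ratio $k=g/f$ is conserved, $k\circ\varphi=k$. Hence $\varphi$ is of type i-2: it is an automorphism that maps every fibre of the fibration $|-2K_X|$ of a Halphen surface of index $2$ to itself. **(2) The surfaces $X_a$ and the parameter $q$.** Put $D_0=H_y-E_1-E_2$, $D_1=H_x-E_6-E_7$, $D_2=E_7-E_8$, $D_3=H_y-E_5-E_7$, $D_4=H_x-E_3-E_4$. On every $X_a$ these are the classes of irreducible curves (the strict transforms of $y=0$, $x=\infty$, of the exceptional curve over $P_7$, of $y=\infty$ and of $x=0$), $-K=\sum_{k} D_k$, and $(D_i\cdot D_j)$ is minus the Cartan matrix of type $A_4^{(1)}$.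 The orthogonal complement $Q$ of the $D_k$ in $\mathrm{Pic}(X_a)$ is generated by $$\alpha_0=H_x+H_y-E_1-E_3-E_7-E_8,\ \alpha_1=E_1-E_2,\ \alpha_2=H_x-E_1-E_5,\ \alpha_3=H_y-E_3-E_6,\ \alpha_4=E_3-E_4,$$ with $(\alpha_i\cdot\alpha_j)$ also minus the Cartan matrix of type $A_4^{(1)}$ and $\sum_j\alpha_j=-K$. The period map $\chi$ of $(X_a,\sum_k D_k)$ satisfies $$e^{\chi(\alpha_0)}=-\tfrac{a_3}{a_1a_5},\quad e^{\chi(\alpha_1)}=\tfrac{a_1}{a_2},\quad e^{\chi(\alpha_2)}=\tfrac1{a_1},\quad e^{\chi(\alpha_3)}=a_3,\quad e^{\chi(\alpha_4)}=\tfrac{a_4}{a_3},\quad e^{\chi(-K)}=q(a).$$ Here $e^{\chi(\lambda)}$, for $\lambda\in Q$, is the class of the restriction of the line bundle of $\lambda$ to the cycle $D=\sum_k D_k$ in $\mathrm{Pic}^0(D)\cong\mathbb C^\times$. **(3) Deautonomization to $qP(A_4^{(1)})$, with $q=-1$ for the HKY mapping.** Let $$T(a)=\left(\frac{a_4}{q},\frac{a_3}{q},a_1,a_2,\frac1{a_5}\right),\qquad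 q=q(a).$$ Then $T(a)$ satisfies the same conditions as $a$, $q(T(a))=q(a)$ and $T^4(a)=(a_1q^{-2},a_2q^{-2},a_3q^{-2},a_4q^{-2},a_5)$. For every $a$ the mapping $$\varphi_a:\quad \bar x=\frac{a_5(x-a_1)(x-a_2)}{y(x-1)},\qquad \bar y=x$$ lifts to an isomorphism $X_a\to X_{T(a)}$. If $a_1\ne1$ and $a_2\neq 1$, it acts on the Picard lattices by one and the same isometry $\Phi$ (independent of $a$), which satisfies $\Phi(D_k)=D_{k+1}$ (indices mod $5$) and $$\Phi:(\alpha_0,\alpha_1,\alpha_2,\alpha_3,\alpha_4)\mapsto(\alpha_2+\alpha_3+\alpha_4,\,-\alpha_4,\,-\alpha_3,\,\alpha_0+\alpha_3+\alpha_4,\,\alpha_1).$$ Its fourth power is a nontrivial translation of the root lattice: with $\delta=-K$, $$\Phi^4:(\alpha_0,\alpha_1,\alpha_2,\alpha_3,\alpha_4)\mapsto(\alpha_0,\alpha_1,\alpha_2-2\delta,\alpha_3+2\delta,\alpha_4).$$ The HKY mapping is the case $a=(t,-t,t,-t,1)$ of $\varphi_a$; this $a$ is a fixed point of $T$, and $q(a)=-1$.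 -/

import Mathlib

namespace HKY

noncomputable section

open MvPolynomial

/-! ### Rational surfaces as sets of local rings

A nonsingular projective surface with function field `ℂ(x, y)` is given by the set of the local
rings of its closed points, which are subrings of `ℂ(x, y)`. A birational map between two such
surfaces is an isomorphism exactly when its pull-back matches the two sets of local rings. -/

/-- The function field `ℂ(x, y)` of `ℙ¹ × ℙ¹`. -/
abbrev FuncField : Type := FractionRing (MvPolynomial (Fin 2) ℂ)

/-- A polynomial in `x, y`, seen as a rational function. -/
def ofPoly (p : MvPolynomial (Fin 2) ℂ) : FuncField :=
  algebraMap (MvPolynomial (Fin 2) ℂ) FuncField p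

/-- The coordinate function `x`. -/
def cx : FuncField := ofPoly (X 0)

/-- The coordinate function `y`. -/
def cy : FuncField := ofPoly (X 1)

/-- The constant functions. -/
def cst (c : ℂ) : FuncField := algebraMap ℂ FuncField c

/-- The local ring `ℂ[u, v]_{(u, v)}`: all `p(u, v) / q(u, v)` with `q(0, 0) ≠ 0`. It is the local
ring of a nonsingular point at which `u, v` are local coordinates centred at the point. -/
def localRing (u v : FuncField) : Subalgebra ℂ FuncField where
  carrier := {r | ∃ p q : MvPolynomial (Fin 2) ℂ, constantCoeff q ≠ 0 ∧
    aeval ![u, v] q ≠ 0 ∧ r * aeval ![u, v] q = aeval ![u, v] p}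
  mul_mem' := by
    rintro r s ⟨p, q, h1, h2, h3⟩ ⟨p', q', h1', h2', h3'⟩
    refine ⟨p * p', q * q', ?_, ?_, ?_⟩
    · rw [map_mul]; exact mul_ne_zero h1 h1'
    · rw [map_mul]; exact mul_ne_zero h2 h2'
    · rw [map_mul, map_mul, ← h3, ← h3']; ring
  add_mem' := by
    rintro r s ⟨p, q, h1, h2, h3⟩ ⟨p', q', h1', h2', h3'⟩
    refine ⟨p * q' + p' * q, q * q', ?_, ?_, ?_⟩
    · rw [map_mul]; exact mul_ne_zero h1 h1'
    · rw [map_mul]; exact mul_ne_zero h2 h2'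
    · rw [map_mul, map_add, map_mul, map_mul, ← h3, ← h3']; ring
  algebraMap_mem' := by
    intro c
    refine ⟨C c, 1, by simp, by simp, by simp⟩

/-- `r` is regular and invertible at the point with local ring `R`. -/
def UnitAt (R : Subalgebra ℂ FuncField) (r : FuncField) : Prop :=
  r ≠ 0 ∧ r ∈ R ∧ r⁻¹ ∈ R

/-- `r` is regular and vanishes at the point with local ring `R`. -/
def VanishesAt (R : Subalgebra ℂ FuncField) (r : FuncField) : Prop :=
  r ∈ R ∧ ¬ UnitAt R r

/-- The maximal ideal of a local ring. -/
def maxIdeal (R : Subalgebra ℂ FuncField) : Ideal R :=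
  Ideal.span {r : R | VanishesAt R r}

/-- Local coordinates on `ℙ¹`: `z - c` at the point `c`, and `1 / z` at infinity. -/
def lineParams (z : FuncField) : Set FuncField :=
  {w | w = z⁻¹ ∨ ∃ c : ℂ, w = z - cst c}

/-- The surface `ℙ¹ × ℙ¹`. -/
def P1P1 : Set (Subalgebra ℂ FuncField) :=
  {R | ∃ u ∈ lineParams cx, ∃ v ∈ lineParams cy, R = localRing u v}

/-- The blow-up of a surface at the point with local coordinates `u, v`: the point is replaced by
the points of the exceptional curve, one for each value of `v / u` in `ℂ` and one for `∞`. -/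
def blowUp (M : Set (Subalgebra ℂ FuncField)) (u v : FuncField) :
    Set (Subalgebra ℂ FuncField) :=
  (M \ {localRing u v}) ∪ {R | ∃ c : ℂ, R = localRing u (v / u - cst c)} ∪ {localRing (u / v) v}

/-- `φ` is the pull-back of functions along an isomorphism from the surface `M` to the surface
`M'`. -/
def IsPullbackOfIso (φ : FuncField ≃ₐ[ℂ] FuncField) (M M' : Set (Subalgebra ℂ FuncField)) : Prop :=
  (fun R : Subalgebra ℂ FuncField => R.map (φ : FuncField →ₐ[ℂ] FuncField)) '' M' = M

/-! ### The family of surfaces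

The parameters `a₁, …, a₅` are `a 0, …, a 4`. -/

/-- Local coordinates at the centres `P₁, …, P₈` of the blow-ups. `P₈` is the point `y / x = a₅` on
the exceptional curve over `P₇ = (∞, ∞)`. -/
def centre (a : Fin 5 → ℂ) : Fin 8 → FuncField × FuncField :=
  ![(cx - cst (a 0), cy), (cx - cst (a 1), cy), (cx, cy - cst (a 2)), (cx, cy - cst (a 3)),
    (cx - 1, cy⁻¹), (cx⁻¹, cy - 1), (cx⁻¹, cy⁻¹), (cx⁻¹, cx / cy - cst (a 4)⁻¹)]

/-- `ℙ¹ × ℙ¹` blown up successively at `P₁, …, P₈`. -/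
def surface (a : Fin 5 → ℂ) : Set (Subalgebra ℂ FuncField) :=
  (List.finRange 8).foldl (fun M i => blowUp M (centre a i).1 (centre a i).2) P1P1

/-- The parameters for which the eight centres are distinct and in the position considered. -/
def Admissible (a : Fin 5 → ℂ) : Prop :=
  (∀ i, a i ≠ 0) ∧ a 0 ≠ a 1 ∧ a 2 ≠ a 3

/-! ### Divisor classes -/

/-- The Picard lattice `ℤ H_x ⊕ ℤ H_y ⊕ ℤ E₁ ⊕ ⋯ ⊕ ℤ E₈`, in this order of coordinates. -/
abbrev Pic : Type := Fin 10 → ℤ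

/-- The intersection form. -/
def inter (l m : Pic) : ℤ :=
  l 0 * m 1 + l 1 * m 0 - ∑ i : Fin 8, l (i.natAdd 2) * m (i.natAdd 2)

/-- The anticanonical class `-K = 2 H_x + 2 H_y - E₁ - ⋯ - E₈`. -/
def antiK : Pic := ![2, 2, -1, -1, -1, -1, -1, -1, -1, -1]

open Classical in
/-- A local equation of the divisor `{z = ∞}`. -/
def poleEq (z : FuncField) (R : Subalgebra ℂ FuncField) : FuncField :=
  if z ∈ R then 1 else z⁻¹

open Classical in
/-- A local equation of the total transform of the point with local coordinates `u, v`: a generator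
of the ideal `(u, v)` if the point with local ring `R` lies over that point, and `1` otherwise. -/
def excEq (u v : FuncField) (R : Subalgebra ℂ FuncField) : FuncField :=
  if VanishesAt R u ∧ VanishesAt R v then (if v / u ∈ R then u else v) else 1

/-- A local equation at `R` of the divisor `h₀ H_x + h₁ H_y + ∑ eᵢ Eᵢ`, where `H_x, H_y` are
represented by `{x = ∞}, {y = ∞}` and `Eᵢ` is the total transform of `Pᵢ`. -/
def localEq (a : Fin 5 → ℂ) (l : Pic) (R : Subalgebra ℂ FuncField) : FuncField :=
  poleEq cx R ^ l 0 * poleEq cy R ^ l 1 *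
    ∏ i : Fin 8, excEq (centre a i).1 (centre a i).2 R ^ l (i.natAdd 2)

/-- The space of global sections of the line bundle of the class `l`: the rational functions `s`
such that the divisor `div s + l` is effective. -/
def sections (a : Fin 5 → ℂ) (l : Pic) : Submodule ℂ FuncField where
  carrier := {s | ∀ R ∈ surface a, s * localEq a l R ∈ R}
  add_mem' := by
    intro s s' h h' R hR
    rw [add_mul]
    exact R.add_mem (h R hR) (h' R hR)
  zero_mem' := by
    intro R _
    rw [zero_mul]
    exact R.zero_mem
  smul_mem' := by
    intro c s h R hR
    rw [smul_mul_assoc]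
    exact R.smul_mem (h R hR) c

/-- The dimension of the linear system `|l|`. -/
def dimLinSys (a : Fin 5 → ℂ) (l : Pic) : ℤ :=
  (Module.finrank ℂ (sections a l) : ℤ) - 1

/-- The divisor `div s + l` is an irreducible reduced curve: there is a valuation ring `V` (the
local ring of its generic point) such that at every point of the surface the ideal of the divisor
consists of the functions that vanish on the curve. -/
def IsPrimeDivisor (a : Fin 5 → ℂ) (l : Pic) (s : FuncField) : Prop :=
  ∃ V : ValuationSubring FuncField,
    (∃ R ∈ surface a, ∀ r ∈ R, r ∈ V) ∧
    ∀ R ∈ surface a,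
      ((∀ r ∈ R, r ∈ V) →
        ∀ r ∈ R, r ∈ V.nonunits ↔ ∃ r' ∈ R, r = s * localEq a l R * r') ∧
      (¬ (∀ r ∈ R, r ∈ V) → UnitAt R (s * localEq a l R))

/-- `Φ` is the push-forward of divisor classes along the isomorphism `surface a → surface b` with
pull-back `φ`: for every class `l` the pull-back of `Φ l` is linearly equivalent to `l`. -/
def InducesOnPic (φ : FuncField ≃ₐ[ℂ] FuncField) (a b : Fin 5 → ℂ) (Φ : Pic → Pic) : Prop :=
  ∀ l : Pic, ∃ h : FuncField, h ≠ 0 ∧ ∀ R ∈ surface b,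
    UnitAt (R.map (φ : FuncField →ₐ[ℂ] FuncField))
      (h * localEq a l (R.map (φ : FuncField →ₐ[ℂ] FuncField)) / φ (localEq b (Φ l) R))

/-! ### The anticanonical cycle, the root lattice and the period map -/

/-- The classes `D₀ = H_y - E₁ - E₂`, `D₁ = H_x - E₆ - E₇`, `D₂ = E₇ - E₈`,
`D₃ = H_y - E₅ - E₇`, `D₄ = H_x - E₃ - E₄`. -/
def clsD : Fin 5 → Pic :=
  ![![0, 1, -1, -1, 0, 0, 0, 0, 0, 0],
    ![1, 0, 0, 0, 0, 0, 0, -1, -1, 0],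
    ![0, 0, 0, 0, 0, 0, 0, 0, 1, -1],
    ![0, 1, 0, 0, 0, 0, -1, 0, -1, 0],
    ![1, 0, 0, 0, -1, -1, 0, 0, 0, 0]]

/-- The sections defining `D₀, …, D₄` (the strict transforms of `{y = 0}`, `{x = ∞}`, of the
exceptional curve over `P₇`, of `{y = ∞}` and of `{x = 0}`). -/
def secD : Fin 5 → FuncField := ![cy, 1, 1, 1, cx]

/-- The point with local ring `R` lies on the curve `D_k`. -/
def OnD (a : Fin 5 → ℂ) (k : Fin 5) (R : Subalgebra ℂ FuncField) : Prop :=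
  VanishesAt R (secD k * localEq a (clsD k) R)

/-- The classes `α₀ = H_x + H_y - E₁ - E₃ - E₇ - E₈`, `α₁ = E₁ - E₂`, `α₂ = H_x - E₁ - E₅`,
`α₃ = H_y - E₃ - E₆`, `α₄ = E₃ - E₄`. -/
def root : Fin 5 → Pic :=
  ![![1, 1, -1, 0, -1, 0, 0, 0, -1, -1],
    ![0, 0, 1, -1, 0, 0, 0, 0, 0, 0],
    ![1, 0, -1, 0, 0, 0, -1, 0, 0, 0],
    ![0, 1, 0, 0, -1, 0, 0, -1, 0, 0],
    ![0, 0, 0, 0, 1, -1, 0, 0, 0, 0]]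

/-- The Cartan matrix of the affine root system `A₄⁽¹⁾`. -/
def cartanA4 (i j : Fin 5) : ℤ :=
  if i = j then 2 else if i = j + 1 ∨ j = i + 1 then -1 else 0

/-- `c = exp χ(l)`, where `χ` is the period map of the pair `(X, D)`. For a class `l` of degree zero
on every `D_k` this is the class of the line bundle of `l` restricted to the cycle
`D = D₀ + ⋯ + D₄` in `Pic⁰(D) = ℂˣ`: if `ψ_k` is a rational function with the same divisor as `l`
along `D_k`, then `c` is the product of the values of `ψ_{k+1} / ψ_k` at the nodes
`D_k ∩ D_{k+1}`. -/
def IsExpPeriod (a : Fin 5 → ℂ) (l : Pic) (c : ℂ) : Prop :=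
  ∃ (ψ : Fin 5 → FuncField) (e : Fin 5 → ℂ),
    (∀ k, ∀ R ∈ surface a, OnD a k R → UnitAt R (ψ k / localEq a l R)) ∧
    (∀ k, ∀ R ∈ surface a, OnD a k R → OnD a (k + 1) R →
      VanishesAt R (ψ (k + 1) / ψ k - cst (e k))) ∧
    c = ∏ k, e k

/-! ### Elliptic fibrations and the cases of the classification -/

/-- The pencil `α f + β g = 0` defines an elliptic fibration on the surface: `g / f` is a morphism to
`ℙ¹`, and for all but finitely many `c` the fibre `g / f = c` is nonsingular at every point of the
surface, and the curve `g - c f = 0` is irreducible with the function field of an elliptic curve. -/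
def IsEllipticFibration (a : Fin 5 → ℂ) (f g : MvPolynomial (Fin 2) ℂ) : Prop :=
  (∀ R ∈ surface a, ofPoly g / ofPoly f ∈ R ∨ (ofPoly g / ofPoly f)⁻¹ ∈ R) ∧
  {c : ℂ | ¬ ((∀ R ∈ surface a, ∀ h : ofPoly g / ofPoly f - cst c ∈ R,
        (⟨ofPoly g / ofPoly f - cst c, h⟩ : R) ∉ maxIdeal R ^ 2) ∧
      Irreducible (g - C c * f) ∧
      ∃ W : WeierstrassCurve ℂ, W.IsElliptic ∧
        Nonempty (FractionRing (MvPolynomial (Fin 2) ℂ ⧸ Ideal.span {g - C c * f}) ≃ₐ[ℂ]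
          W.toAffine.FunctionField))}.Finite

/-- The surface is a Halphen surface of index `m`. -/
def IsHalphen (a : Fin 5 → ℂ) (m : ℕ) : Prop :=
  (∀ k : ℕ, 1 ≤ k → k < m → dimLinSys a ((k : ℤ) • antiK) = 0) ∧
    dimLinSys a ((m : ℤ) • antiK) = 1

/-- Case i-`m`: the map with pull-back `φ` is an automorphism of a Halphen surface of index `m` and
maps every fibre of the elliptic fibration given by the pencil `|-mK|`, which is spanned by `f` and
`g`, to itself. -/
def IsCaseI (a : Fin 5 → ℂ) (φ : FuncField ≃ₐ[ℂ] FuncField) (m : ℕ)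
    (f g : MvPolynomial (Fin 2) ℂ) : Prop :=
  IsHalphen a m ∧
  sections a ((m : ℤ) • antiK) = Submodule.span ℂ {ofPoly f, ofPoly g} ∧
  IsEllipticFibration a f g ∧
  IsPullbackOfIso φ (surface a) (surface a) ∧
  φ (ofPoly g / ofPoly f) = ofPoly g / ofPoly f

/-! ### The HKY mapping and its deautonomization -/

/-- The parameters of the space of initial conditions of the HKY mapping. -/
def hkyParam (t : ℂ) : Fin 5 → ℂ := ![t, -t, t, -t, 1]

/-- The polynomial `f = x²y²`. -/
def hkyF : MvPolynomial (Fin 2) ℂ := X 0 ^ 2 * X 1 ^ 2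

/-- The polynomial `g`. -/
def hkyG (t : ℂ) : MvPolynomial (Fin 2) ℂ :=
  2 * X 0 ^ 2 * X 1 ^ 3 + 2 * X 0 ^ 3 * X 1 ^ 2 + X 0 ^ 2 * X 1 ^ 4 + X 0 ^ 4 * X 1 ^ 2
    - 2 * X 0 ^ 3 * X 1 ^ 3 - 2 * X 0 * X 1 ^ 4 - 2 * X 0 ^ 4 * X 1 + X 0 ^ 4 + X 1 ^ 4
    + 2 * C t ^ 2 * (X 0 * X 1 ^ 2 + X 0 ^ 2 * X 1 - X 1 ^ 2 - X 0 ^ 2) + C t ^ 4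

/-- The parameter `q`. -/
def qParam (a : Fin 5 → ℂ) : ℂ := -(a 2 * a 3) / (a 0 * a 1 * a 4)

/-- The evolution of the parameters. -/
def evolve (a : Fin 5 → ℂ) : Fin 5 → ℂ :=
  ![a 3 / qParam a, a 2 / qParam a, a 0, a 1, (a 4)⁻¹]

/-- `φ` is the pull-back of functions along the deautonomized mapping
`(x, y) ↦ (a₅ (x - a₁) (x - a₂) / (y (x - 1)), x)`. -/
def IsDeautonomized (a : Fin 5 → ℂ) (φ : FuncField ≃ₐ[ℂ] FuncField) : Prop :=
  φ cx = cst (a 4) * (cx - cst (a 0)) * (cx - cst (a 1)) / (cy * (cx - 1)) ∧ φ cy = cx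

end

end HKY

namespace HKY

noncomputable section

open MvPolynomial

/-! ### Coordinates of the function field -/

/-! The surfaces are studied point by point. If `u, v` generate the function field, they are
algebraically independent, and substituting elements of any `ℂ`-algebra for `u, v` is well defined
on the rational functions for which a denominator becomes a unit (`HasEv`). With values in `ℂ` this
decides which functions are regular at a point and when two charts describe the same point
(`localRing_eq`). With values in the dual numbers it gives first derivatives, in power series the
restriction to an arc, and in `ℂ(T)` the restriction to a curve. `mem_surface_iff` lists the points
of `X_a` and `Pt.localEq_eq` gives the local equations of all divisor classes there. The geometric
assertions thereby become finite lists of explicit computations.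

The mapping sends `y` back to `x`, so it carries the fibre `x = d` to the fibre `ȳ = d`, with `x̄ =
F(d) / y` and `F = a₅(x - a₁)(x - a₂)/(x - 1)`. Where `F` has neither zero nor pole this is an
isomorphism of lines. At the zeros and poles of `F` a fibre is exchanged with an exceptional curve,
and the remaining exceptional curves are carried to one another by affine maps of their coordinates.
The parameters `T(a)` are those for which the centres match; for instance `x̄ = F(0)/a₃` is the
image of `P₃`. This case analysis is `IsMapping.hasImage`. It gives one inclusion between the sets
of local rings; the other follows because the mapping composed with the exchange of `x` and `y` is
an involution. The same analysis compares local equations and so yields the action on the Picard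
lattice (`IsMapping.inducesOnPic`). The identities in the lattice itself are finite checks.

Each `D_k` receives a valuation ring that dominates the functions vanishing on it, and at every
point the explicit equation of `D_k` is either a coordinate defining the curve or a unit. The period
map is computed from rational functions having the divisor of `α_j` along each component, compared
at the five nodes of the cycle.

For the HKY mapping the key formula is `k = A² + 2 + 4t²/x - 4t²/x²` with `xA = (x - 1)y + (x² -
t²)/y - x²`, together with its mirror image in `x` and `y`. The mapping turns the mirror image into
the formula itself, because it interchanges the two summands `(x - 1)y` and `(x² - t²)/y`; hence `k`
is conserved. The formula also shows that `k` has poles of order exactly two along the anticanonical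
cycle and is regular elsewhere, so `g` is a section of `-2K`. Conversely a section of `-2K` is a
polynomial of bidegree `(4, 4)` with double points at the eight centres, and these linear conditions
leave only `f` and `g`. Sections of `-K` follow on multiplying by `xy`.

Finitely many critical values of `k` are found from dual numbers (`exists_jet_off`). For
irreducibility, the fibre is a quartic in `y` over `ℂ(x)` invariant under `y ↦ (x² - t²)/((x -
1)y)`; a factorization would make one of two explicit polynomials in `x` a square. For the genus,
put `w = (x - 1)y + (x² - t²)/y`. The equation `k = c` becomes the conic `(w - x²)² = (c - 2)x² -
4t²x + 4t²`, which has a rational parameter `p`, and recovering `y` from `w` adjoins the square root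
of a quartic in `p`. Moving one of its four simple roots to infinity gives a Weierstrass equation.
-/

theorem cx_def : cx = algebraMap (MvPolynomial (Fin 2) ℂ) FuncField (X 0) := rfl

theorem cy_def : cy = algebraMap (MvPolynomial (Fin 2) ℂ) FuncField (X 1) := rfl

theorem aeval_cx_cy (p : MvPolynomial (Fin 2) ℂ) : aeval ![cx, cy] p = ofPoly p := by
  have : (aeval ![cx, cy] : MvPolynomial (Fin 2) ℂ →ₐ[ℂ] FuncField) =
      IsScalarTower.toAlgHom ℂ (MvPolynomial (Fin 2) ℂ) FuncField := by
    ext i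
    fin_cases i <;> simp [cx_def, cy_def]
  rw [this]
  rfl

theorem ofPoly_injective : Function.Injective ofPoly :=
  IsFractionRing.injective (MvPolynomial (Fin 2) ℂ) FuncField

/-- The functions `u, v` generate the function field. -/
def IsCoord (u v : FuncField) : Prop := IntermediateField.adjoin ℂ {u, v} = ⊤

theorem isCoord_cx_cy : IsCoord cx cy := by
  rw [IsCoord, eq_top_iff]
  intro r _
  obtain ⟨p, q, hq, rfl⟩ := IsFractionRing.div_surjective (A := MvPolynomial (Fin 2) ℂ) r
  have key : ∀ p : MvPolynomial (Fin 2) ℂ,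
      algebraMap _ FuncField p ∈ IntermediateField.adjoin ℂ {cx, cy} := by
    intro p
    change ofPoly p ∈ _
    rw [← aeval_cx_cy]
    have : aeval ![cx, cy] p ∈ Algebra.adjoin ℂ (Set.range ![cx, cy]) := by
      rw [Algebra.adjoin_range_eq_range_aeval]
      exact ⟨p, rfl⟩
    rw [Matrix.range_cons, Matrix.range_cons, Matrix.range_empty, Set.union_empty,
      Set.singleton_union] at this
    exact IntermediateField.algebra_adjoin_le_adjoin _ _ this
  exact div_mem (key p) (key q)

theorem IsCoord.of_mem {u v u' v' : FuncField} (h : IsCoord u v)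
    (hu : u ∈ IntermediateField.adjoin ℂ {u', v'})
    (hv : v ∈ IntermediateField.adjoin ℂ {u', v'}) : IsCoord u' v' := by
  rw [IsCoord, eq_top_iff, ← h, IntermediateField.adjoin_le_iff]
  rintro r (rfl | rfl)
  · exact hu
  · exact hv

section adjoin

variable {u v : FuncField}

theorem left_mem_adjoin : u ∈ IntermediateField.adjoin ℂ {u, v} :=
  IntermediateField.subset_adjoin _ _ (by simp)

theorem right_mem_adjoin : v ∈ IntermediateField.adjoin ℂ {u, v} :=
  IntermediateField.subset_adjoin _ _ (by simp)

theorem cst_mem (L : IntermediateField ℂ FuncField) (c : ℂ) : cst c ∈ L :=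
  L.algebraMap_mem c

end adjoin

theorem IsCoord.swap {u v : FuncField} (h : IsCoord u v) : IsCoord v u :=
  h.of_mem right_mem_adjoin left_mem_adjoin

/-- The independent pair `x, y` shows that the transcendence degree is at least two. The field is
the fraction field of `ℂ[u, v]`, hence algebraic over it, so two elements `u, v` can only be a
transcendence basis. -/
theorem IsCoord.algebraicIndependent {u v : FuncField} (h : IsCoord u v) :
    AlgebraicIndependent ℂ ![u, v] := by
  have h0 : AlgebraicIndependent ℂ ![cx, cy] := by
    rw [algebraicIndependent_iff_injective_aeval]
    intro p q hpq
    simp only [aeval_cx_cy] at hpq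
    exact ofPoly_injective hpq
  have hle : (Cardinal.mk (Fin 2)) ≤ Algebra.trdeg ℂ FuncField := h0.cardinalMk_le_trdeg
  have hfr : ∀ z : FuncField, ∃ a b : Algebra.adjoin ℂ (Set.range ![u, v]),
      z = algebraMap _ _ a / algebraMap _ _ b := by
    intro z
    have hz : z ∈ IntermediateField.adjoin ℂ (Set.range ![u, v]) := by
      rw [Matrix.range_cons, Matrix.range_cons, Matrix.range_empty, Set.union_empty,
        Set.singleton_union, h]
      trivial
    obtain ⟨a, ha, b, hb, e⟩ := IntermediateField.mem_adjoin_iff_div.mp hz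
    exact ⟨⟨a, ha⟩, ⟨b, hb⟩, e⟩
  have : IsFractionRing (Algebra.adjoin ℂ (Set.range ![u, v])) FuncField :=
    .of_field _ _ hfr
  have : Algebra.IsAlgebraic (Algebra.adjoin ℂ (Set.range ![u, v])) FuncField :=
    IsLocalization.isAlgebraic _ (nonZeroDivisors (Algebra.adjoin ℂ (Set.range ![u, v])))
  exact (Algebra.IsAlgebraic.isTranscendenceBasis_of_le_trdeg_of_finite ℂ ![u, v] hle).1

theorem IsCoord.aeval_injective {u v : FuncField} (h : IsCoord u v) :
    Function.Injective (aeval ![u, v] : MvPolynomial (Fin 2) ℂ →ₐ[ℂ] FuncField) :=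
  algebraicIndependent_iff_injective_aeval.mp h.algebraicIndependent

theorem IsCoord.aeval_ne_zero {u v : FuncField} (h : IsCoord u v) {p : MvPolynomial (Fin 2) ℂ}
    (hp : p ≠ 0) : aeval ![u, v] p ≠ 0 := by
  rw [← map_zero (aeval ![u, v] : MvPolynomial (Fin 2) ℂ →ₐ[ℂ] FuncField)]
  exact h.aeval_injective.ne hp

theorem IsCoord.left_ne_cst {u v : FuncField} (h : IsCoord u v) (c : ℂ) : u ≠ cst c := by
  intro e
  have : (X 0 : MvPolynomial (Fin 2) ℂ) = C c := by
    apply h.aeval_injective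
    simp [e, cst]
  have h1 := congrArg (eval ![c + 1, 0]) this
  simp at h1

theorem IsCoord.right_ne_cst {u v : FuncField} (h : IsCoord u v) (c : ℂ) : v ≠ cst c :=
  h.swap.left_ne_cst c

@[simp] theorem cst_zero : cst 0 = 0 := map_zero _
@[simp] theorem cst_one : cst 1 = 1 := map_one _
theorem cst_add (a b : ℂ) : cst (a + b) = cst a + cst b := map_add _ _ _
theorem cst_sub (a b : ℂ) : cst (a - b) = cst a - cst b := map_sub _ _ _
theorem cst_neg (a : ℂ) : cst (-a) = -cst a := map_neg _ _
theorem cst_mul (a b : ℂ) : cst (a * b) = cst a * cst b := map_mul _ _ _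
theorem cst_inv (a : ℂ) : cst a⁻¹ = (cst a)⁻¹ := map_inv₀ _ _
theorem cst_pow (a : ℂ) (n : ℕ) : cst (a ^ n) = cst a ^ n := map_pow _ _ _
theorem cst_injective : Function.Injective cst := (algebraMap ℂ FuncField).injective
theorem cst_ne_zero {a : ℂ} (h : a ≠ 0) : cst a ≠ 0 := by
  rw [← cst_zero]; exact cst_injective.ne h

theorem IsCoord.left_ne_zero {u v : FuncField} (h : IsCoord u v) : u ≠ 0 := by
  simpa using h.left_ne_cst 0

theorem IsCoord.right_ne_zero {u v : FuncField} (h : IsCoord u v) : v ≠ 0 := by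
  simpa using h.right_ne_cst 0

/-- The automorphism of the function field with prescribed images of `x, y`. -/
theorem IsCoord.exists_algEquiv {u v : FuncField} (h : IsCoord u v) :
    ∃ φ : FuncField ≃ₐ[ℂ] FuncField, φ cx = u ∧ φ cy = v := by
  let φ₀ : FuncField →ₐ[ℂ] FuncField := IsFractionRing.liftAlgHom h.aeval_injective
  have hφ : ∀ p, φ₀ (ofPoly p) = aeval ![u, v] p := fun p =>
    IsFractionRing.lift_algebraMap (g := (aeval ![u, v] :
      MvPolynomial (Fin 2) ℂ →ₐ[ℂ] FuncField).toRingHom) h.aeval_injective p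
  have hx : φ₀ cx = u := by rw [cx, hφ]; simp
  have hy : φ₀ cy = v := by rw [cy, hφ]; simp
  have hs : Function.Surjective φ₀ := by
    rw [← AlgHom.fieldRange_eq_top, eq_top_iff, ← h, IntermediateField.adjoin_le_iff]
    rintro r (rfl | rfl)
    · exact ⟨cx, hx⟩
    · exact ⟨cy, hy⟩
  exact ⟨AlgEquiv.ofBijective φ₀ ⟨φ₀.toRingHom.injective, hs⟩, hx, hy⟩

/-! ### Elementary changes of coordinates -/

theorem IsCoord.sub_cst {u v : FuncField} (h : IsCoord u v) (c : ℂ) : IsCoord u (v - cst c) := by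
  refine h.of_mem left_mem_adjoin ?_
  have := add_mem (right_mem_adjoin (u := u) (v := v - cst c)) (cst_mem _ c)
  simpa using this

theorem IsCoord.inv {u v : FuncField} (h : IsCoord u v) : IsCoord u v⁻¹ := by
  refine h.of_mem left_mem_adjoin ?_
  have := inv_mem (right_mem_adjoin (u := u) (v := v⁻¹))
  simpa using this

/-- Multiplication of the second coordinate by a function of the first one. -/
theorem IsCoord.mul_right {u v w : FuncField} (h : IsCoord u v) (hw : w ≠ 0)
    (hm : w ∈ IntermediateField.adjoin ℂ {u}) : IsCoord u (v * w) := by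
  refine h.of_mem left_mem_adjoin ?_
  have hm' : w ∈ IntermediateField.adjoin ℂ {u, v * w} :=
    IntermediateField.adjoin.mono ℂ _ _ (by simp) hm
  have := div_mem (right_mem_adjoin (u := u) (v := v * w)) hm'
  rwa [mul_div_cancel_right₀ _ hw] at this

theorem IsCoord.div {u v : FuncField} (h : IsCoord u v) : IsCoord u (v / u) := by
  rw [div_eq_mul_inv]
  exact h.mul_right (inv_ne_zero h.left_ne_zero)
    (inv_mem (IntermediateField.subset_adjoin _ _ (by simp)))

theorem IsCoord.div' {u v : FuncField} (h : IsCoord u v) : IsCoord (u / v) v :=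
  h.swap.div.swap

/-! ### Values and expansions of functions at a point -/

section HasEv

variable {A : Type*} [CommRing A] [Algebra ℂ A]

/-- The substitution `u = s, v = t` maps the function `r` to `α`. -/
def HasEv (u v : FuncField) (s t : A) (r : FuncField) (α : A) : Prop :=
  ∃ p q : MvPolynomial (Fin 2) ℂ, IsUnit (aeval ![s, t] q) ∧
    r * aeval ![u, v] q = aeval ![u, v] p ∧ aeval ![s, t] p = α * aeval ![s, t] q

variable {u v : FuncField} {s t : A} {r r' : FuncField} {α β : A}

theorem HasEv.aeval (p : MvPolynomial (Fin 2) ℂ) :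
    HasEv u v s t (MvPolynomial.aeval ![u, v] p) (MvPolynomial.aeval ![s, t] p) :=
  ⟨p, 1, by simp, by simp, by simp⟩

theorem HasEv.cst (c : ℂ) : HasEv u v s t (cst c) (algebraMap ℂ A c) := by
  simpa [HKY.cst] using HasEv.aeval (u := u) (v := v) (s := s) (t := t) (C c)

theorem HasEv.left : HasEv u v s t u s := by
  simpa using HasEv.aeval (u := u) (v := v) (s := s) (t := t) (X 0)

theorem HasEv.right : HasEv u v s t v t := by
  simpa using HasEv.aeval (u := u) (v := v) (s := s) (t := t) (X 1)

theorem HasEv.add (h : HasEv u v s t r α) (h' : HasEv u v s t r' β) :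
    HasEv u v s t (r + r') (α + β) := by
  obtain ⟨p, q, h1, h2, h3⟩ := h
  obtain ⟨p', q', h1', h2', h3'⟩ := h'
  refine ⟨p * q' + p' * q, q * q', ?_, ?_, ?_⟩
  · rw [map_mul]; exact h1.mul h1'
  · simp only [map_mul, map_add, ← h2, ← h2']; ring
  · simp only [map_mul, map_add, h3, h3']; ring

theorem HasEv.mul (h : HasEv u v s t r α) (h' : HasEv u v s t r' β) :
    HasEv u v s t (r * r') (α * β) := by
  obtain ⟨p, q, h1, h2, h3⟩ := h
  obtain ⟨p', q', h1', h2', h3'⟩ := h'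
  refine ⟨p * p', q * q', ?_, ?_, ?_⟩
  · rw [map_mul]; exact h1.mul h1'
  · simp only [map_mul, ← h2, ← h2']; ring
  · simp only [map_mul, h3, h3']; ring

theorem HasEv.congr (h : HasEv u v s t r α) (hr : r = r') (hα : α = β) : HasEv u v s t r' β := by
  rwa [← hr, ← hα]

theorem HasEv.one : HasEv u v s t 1 (1 : A) := by
  simpa using HasEv.cst (u := u) (v := v) (s := s) (t := t) 1

theorem HasEv.zero : HasEv u v s t 0 (0 : A) := by
  simpa using HasEv.cst (u := u) (v := v) (s := s) (t := t) 0

theorem HasEv.neg (h : HasEv u v s t r α) : HasEv u v s t (-r) (-α) :=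
  ((HasEv.cst (-1)).mul h).congr (by simp [cst_neg]) (by simp)

theorem HasEv.sub (h : HasEv u v s t r α) (h' : HasEv u v s t r' β) :
    HasEv u v s t (r - r') (α - β) :=
  (h.add h'.neg).congr (sub_eq_add_neg _ _).symm (sub_eq_add_neg _ _).symm

theorem HasEv.pow (h : HasEv u v s t r α) (n : ℕ) : HasEv u v s t (r ^ n) (α ^ n) := by
  induction n with
  | zero => simpa using HasEv.one
  | succ n ih => rw [pow_succ, pow_succ]; exact ih.mul h

/-- Two fractions for the same function satisfy `p q' = p' q` as polynomials, because `u, v` are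
algebraically independent, and a polynomial identity survives every substitution. -/
theorem HasEv.unique (hc : IsCoord u v) (h : HasEv u v s t r α) (h' : HasEv u v s t r β) :
    α = β := by
  obtain ⟨p, q, h1, h2, h3⟩ := h
  obtain ⟨p', q', h1', h2', h3'⟩ := h'
  have e : p * q' = p' * q := by
    apply hc.aeval_injective
    simp only [map_mul, ← h2, ← h2']; ring
  have e' := congrArg (MvPolynomial.aeval ![s, t]) e
  simp only [map_mul, h3, h3'] at e'
  refine (h1.mul h1').mul_right_cancel ?_
  linear_combination e'

theorem HasEv.inv [Nontrivial A] (hc : IsCoord u v) (h : HasEv u v s t r α) (hαβ : α * β = 1) :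
    HasEv u v s t r⁻¹ β := by
  obtain ⟨p, q, h1, h2, h3⟩ := h
  have hα : IsUnit α := IsUnit.of_mul_eq_one _ hαβ
  have hp : IsUnit (MvPolynomial.aeval ![s, t] p) := by rw [h3]; exact hα.mul h1
  have hp0 : MvPolynomial.aeval ![u, v] p ≠ 0 := hc.aeval_ne_zero (by
    rintro rfl; simp at hp)
  have hr : r ≠ 0 := by rintro rfl; rw [zero_mul] at h2; exact hp0 h2.symm
  refine ⟨q, p, hp, ?_, ?_⟩
  · rw [← h2, inv_mul_cancel_left₀ hr]
  · rw [h3, ← mul_assoc, mul_comm β, hαβ, one_mul]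

/-- Used to pass from a first order expansion to its value at the point. -/
theorem HasEv.map {B : Type*} [CommRing B] [Algebra ℂ B] (f : A →ₐ[ℂ] B)
    (h : HasEv u v s t r α) : HasEv u v (f s) (f t) r (f α) := by
  obtain ⟨p, q, h1, h2, h3⟩ := h
  have key : ∀ p : MvPolynomial (Fin 2) ℂ,
      MvPolynomial.aeval ![f s, f t] p = f (MvPolynomial.aeval ![s, t] p) := by
    intro p
    have : (MvPolynomial.aeval ![f s, f t] : MvPolynomial (Fin 2) ℂ →ₐ[ℂ] B) =
        f.comp (MvPolynomial.aeval ![s, t]) := by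
      ext i; fin_cases i <;> simp
    rw [this]; rfl
  exact ⟨p, q, by rw [key]; exact h1.map f, h2, by rw [key, key, h3, map_mul]⟩

end HasEv

theorem aeval_zero_zero (p : MvPolynomial (Fin 2) ℂ) :
    aeval ![(0 : ℂ), 0] p = constantCoeff p := by
  have : ![(0 : ℂ), 0] = 0 := by ext i; fin_cases i <;> rfl
  rw [this, aeval_zero]
  simp

/-- The function `r` is regular with value `c` at the point with local coordinates `u, v`. -/
abbrev HasVal (u v : FuncField) (r : FuncField) (c : ℂ) : Prop := HasEv u v (0 : ℂ) 0 r c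

section HasVal

variable {u v u' v' r r' : FuncField} {c d : ℂ}

theorem HasVal.cst (c : ℂ) : HasVal u v (cst c) c := HasEv.cst c

theorem HasVal.inv (hc : IsCoord u v) (h : HasVal u v r c) (h0 : c ≠ 0) : HasVal u v r⁻¹ c⁻¹ :=
  HasEv.inv hc h (mul_inv_cancel₀ h0)

theorem HasVal.div (hc : IsCoord u v) (h : HasVal u v r c) (h' : HasVal u v r' d) (h0 : d ≠ 0) :
    HasVal u v (r / r') (c / d) := by
  rw [div_eq_mul_inv, div_eq_mul_inv]; exact HasEv.mul h (h'.inv hc h0)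

theorem HasVal.ne_zero (hc : IsCoord u v) (h : HasVal u v r c) (h0 : c ≠ 0) : r ≠ 0 := by
  rintro rfl
  exact h0 (h.unique hc HasEv.zero)

theorem mem_localRing_iff (hc : IsCoord u v) : r ∈ localRing u v ↔ ∃ c, HasVal u v r c := by
  constructor
  · rintro ⟨p, q, h1, h2, h3⟩
    refine ⟨constantCoeff p / constantCoeff q, p, q, ?_, h3, ?_⟩
    · rw [aeval_zero_zero]; exact h1.isUnit
    · rw [aeval_zero_zero, aeval_zero_zero, div_mul_cancel₀ _ h1]
  · rintro ⟨c, p, q, h1, h2, h3⟩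
    rw [aeval_zero_zero] at h1
    refine ⟨p, q, h1.ne_zero, hc.aeval_ne_zero ?_, h2⟩
    rintro rfl
    simp at h1

/-- A substitution extends from polynomials to the local ring once it makes every denominator that
does not vanish at the point invertible. Dual numbers and power series, with `s, t` in the maximal
ideal, have this property. -/
theorem HasEv.of_mem {A : Type*} [CommRing A] [Algebra ℂ A] {s t : A}
    (hu : ∀ q : MvPolynomial (Fin 2) ℂ, constantCoeff q ≠ 0 → IsUnit (MvPolynomial.aeval ![s, t] q))
    (h : r ∈ localRing u v) : ∃ α, HasEv u v s t r α := by
  obtain ⟨p, q, h1, h2, h3⟩ := h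
  obtain ⟨b, hb⟩ := (hu q h1).exists_right_inv
  refine ⟨MvPolynomial.aeval ![s, t] p * b, p, q, hu q h1, h3, ?_⟩
  rw [mul_assoc, mul_comm b, hb, mul_one]

theorem HasVal.mem (hc : IsCoord u v) (h : HasVal u v r c) : r ∈ localRing u v :=
  (mem_localRing_iff hc).mpr ⟨c, h⟩

theorem unitAt_localRing_iff (hc : IsCoord u v) :
    UnitAt (localRing u v) r ↔ ∃ c, c ≠ 0 ∧ HasVal u v r c := by
  constructor
  · rintro ⟨h0, h1, h2⟩
    obtain ⟨c, hr⟩ := (mem_localRing_iff hc).mp h1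
    obtain ⟨d, hr'⟩ := (mem_localRing_iff hc).mp h2
    refine ⟨c, ?_, hr⟩
    rintro rfl
    have := HasEv.mul hr hr'
    rw [mul_inv_cancel₀ h0] at this
    simpa using this.unique hc HasEv.one
  · rintro ⟨c, h0, h⟩
    exact ⟨h.ne_zero hc h0, h.mem hc, (h.inv hc h0).mem hc⟩

theorem HasVal.unitAt (hc : IsCoord u v) (h : HasVal u v r c) (h0 : c ≠ 0) :
    UnitAt (localRing u v) r :=
  (unitAt_localRing_iff hc).mpr ⟨c, h0, h⟩

theorem vanishesAt_localRing_iff (hc : IsCoord u v) :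
    VanishesAt (localRing u v) r ↔ HasVal u v r 0 := by
  rw [VanishesAt, unitAt_localRing_iff hc, mem_localRing_iff hc]
  constructor
  · rintro ⟨⟨c, h⟩, h'⟩
    by_cases h0 : c = 0
    · rwa [← h0]
    · exact absurd ⟨c, h0, h⟩ h'
  · intro h
    refine ⟨⟨0, h⟩, ?_⟩
    rintro ⟨c, h0, h'⟩
    exact h0 (h'.unique hc h)

/-- A function whose inverse vanishes is not regular. -/
theorem HasVal.notMem (hc : IsCoord u v) (h : HasVal u v r⁻¹ 0) (h0 : r ≠ 0) :
    r ∉ localRing u v := by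
  intro hm
  obtain ⟨c, hr⟩ := (mem_localRing_iff hc).mp hm
  have := HasEv.mul hr h
  rw [mul_inv_cancel₀ h0, mul_zero] at this
  exact zero_ne_one (this.unique hc HasEv.one)

theorem HasVal.aeval (hu : HasVal u v u' c) (hv : HasVal u v v' d) (p : MvPolynomial (Fin 2) ℂ) :
    HasVal u v (MvPolynomial.aeval ![u', v'] p) (MvPolynomial.aeval ![c, d] p) := by
  induction p using MvPolynomial.induction_on with
  | C a => simpa [HKY.cst] using HasVal.cst (u := u) (v := v) a
  | add p q hp hq => simp only [map_add]; exact HasEv.add hp hq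
  | mul_X p i hp =>
    simp only [map_mul, aeval_X]
    refine HasEv.mul hp ?_
    fin_cases i
    · exact hu
    · exact hv

/-- Since `u', v'` vanish at the point, a denominator `q(u', v')` has there the value `q(0, 0) ≠ 0`.
-/
theorem localRing_le (hc : IsCoord u v) (hu : HasVal u v u' 0) (hv : HasVal u v v' 0) :
    localRing u' v' ≤ localRing u v := by
  rintro r ⟨p, q, h1, h2, h3⟩
  have hp := hu.aeval hv p
  have hq := hu.aeval hv q
  rw [eq_div_of_mul_eq h2 h3]
  refine (HasVal.div hc hp hq ?_).mem hc
  rwa [aeval_zero_zero]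

/-- The main criterion for two charts to be centred at the same point: each pair of coordinates
vanishes at the centre of the other. -/
theorem localRing_eq (hc : IsCoord u v) (hc' : IsCoord u' v') (hu : HasVal u v u' 0)
    (hv : HasVal u v v' 0) (hu' : HasVal u' v' u 0) (hv' : HasVal u' v' v 0) :
    localRing u' v' = localRing u v :=
  le_antisymm (localRing_le hc hu hv) (localRing_le hc' hu' hv')

theorem HasVal.of_localRing_eq (hc : IsCoord u v) (hc' : IsCoord u' v')
    (e : localRing u v = localRing u' v') (h : HasVal u v r c) : HasVal u' v' r c := by
  have h1 : VanishesAt (localRing u v) (r - HKY.cst c) := by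
    rw [vanishesAt_localRing_iff hc]
    exact (HasEv.sub h (HasVal.cst c)).congr rfl (sub_self c)
  rw [e, vanishesAt_localRing_iff hc'] at h1
  exact (HasEv.add h1 (HasVal.cst c)).congr (sub_add_cancel _ _) (zero_add _)

theorem localRing_swap (u v : FuncField) : localRing v u = localRing u v := by
  have key : ∀ u v : FuncField, localRing u v ≤ localRing v u := by
    rintro u v r ⟨p, q, h1, h2, h3⟩
    have e : ∀ p : MvPolynomial (Fin 2) ℂ,
        MvPolynomial.aeval ![v, u] (rename (Equiv.swap 0 1) p) = MvPolynomial.aeval ![u, v] p := by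
      intro p
      rw [aeval_rename]
      congr 2
      ext i; fin_cases i <;> simp
    refine ⟨rename (Equiv.swap 0 1) p, rename (Equiv.swap 0 1) q, ?_, ?_, ?_⟩
    · rwa [constantCoeff_rename]
    · rwa [e]
    · rw [e, e, h3]
  exact le_antisymm (key _ _) (key _ _)

theorem map_localRing (φ : FuncField ≃ₐ[ℂ] FuncField) (u v : FuncField) :
    (localRing u v).map (φ : FuncField →ₐ[ℂ] FuncField) = localRing (φ u) (φ v) := by
  have e : ∀ (φ : FuncField ≃ₐ[ℂ] FuncField) (u v : FuncField) (p : MvPolynomial (Fin 2) ℂ),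
      φ (MvPolynomial.aeval ![u, v] p) = MvPolynomial.aeval ![φ u, φ v] p := by
    intro φ u v p
    have : (MvPolynomial.aeval ![φ u, φ v] : MvPolynomial (Fin 2) ℂ →ₐ[ℂ] FuncField) =
        (φ : FuncField →ₐ[ℂ] FuncField).comp (MvPolynomial.aeval ![u, v]) := by
      ext i; fin_cases i <;> simp
    rw [this]; rfl
  ext r
  rw [Subalgebra.mem_map]
  constructor
  · rintro ⟨r, ⟨p, q, h1, h2, h3⟩, rfl⟩
    refine ⟨p, q, h1, ?_, ?_⟩
    · rw [← e]; simpa using h2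
    · rw [← e, ← e, ← h3, map_mul]; rfl
  · rintro ⟨p, q, h1, h2, h3⟩
    refine ⟨φ.symm r, ⟨p, q, h1, ?_, ?_⟩, φ.apply_symm_apply r⟩
    · rw [← e] at h2; simpa using h2
    · apply φ.injective
      rw [map_mul, e, e, φ.apply_symm_apply, h3]

theorem IsCoord.map (φ : FuncField ≃ₐ[ℂ] FuncField) (h : IsCoord u v) :
    IsCoord (φ u) (φ v) := by
  rw [IsCoord, eq_top_iff]
  intro r _
  have hr : φ.symm r ∈ IntermediateField.adjoin ℂ {u, v} := by rw [h]; trivial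
  have := IntermediateField.adjoin_map ℂ {u, v} (φ : FuncField →ₐ[ℂ] FuncField)
  rw [Set.image_pair] at this
  change _ ∈ IntermediateField.adjoin ℂ {(φ : FuncField →ₐ[ℂ] FuncField) u, (φ : FuncField →ₐ[ℂ] FuncField) v}
  rw [← this]
  exact ⟨φ.symm r, hr, φ.apply_symm_apply r⟩

end HasVal

section UnitAt

variable {R : Subalgebra ℂ FuncField} {r s : FuncField}

theorem UnitAt.mul (h : UnitAt R r) (h' : UnitAt R s) : UnitAt R (r * s) :=
  ⟨mul_ne_zero h.1 h'.1, R.mul_mem h.2.1 h'.2.1, by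
    rw [mul_inv]; exact R.mul_mem h.2.2 h'.2.2⟩

theorem UnitAt.inv (h : UnitAt R r) : UnitAt R r⁻¹ :=
  ⟨inv_ne_zero h.1, h.2.2, by rw [inv_inv]; exact h.2.1⟩

theorem UnitAt.div (h : UnitAt R r) (h' : UnitAt R s) : UnitAt R (r / s) := by
  rw [div_eq_mul_inv]; exact h.mul h'.inv

theorem UnitAt.one : UnitAt R 1 := ⟨one_ne_zero, R.one_mem, by rw [inv_one]; exact R.one_mem⟩

theorem UnitAt.pow (h : UnitAt R r) (n : ℕ) : UnitAt R (r ^ n) := by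
  induction n with
  | zero => simpa using UnitAt.one
  | succ n ih => rw [pow_succ]; exact ih.mul h

theorem UnitAt.zpow (h : UnitAt R r) (n : ℤ) : UnitAt R (r ^ n) := by
  cases n with
  | ofNat n => simpa using h.pow n
  | negSucc n => rw [zpow_negSucc]; exact (h.pow _).inv

end UnitAt

/-! ### The points of the surfaces -/

/-- The local coordinate `z - c` or `1 / z` of `ℙ¹`, where `none` stands for the point `∞`. -/
def par (z : FuncField) : Option ℂ → FuncField
  | some c => z - cst c
  | none => z⁻¹

/-- The value of `z` in `ℙ¹`, where `none` stands for the point `∞`. -/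
def HasPVal (u v z : FuncField) (p : Option ℂ) : Prop := HasVal u v (par z p) 0

section HasPVal

variable {u v z r : FuncField} {c d : ℂ} {p q : Option ℂ}

@[simp] theorem par_some (z : FuncField) (c : ℂ) : par z (some c) = z - cst c := rfl

@[simp] theorem par_none (z : FuncField) : par z none = z⁻¹ := rfl

theorem HasVal.sub_self (h : HasVal u v z c) : HasVal u v (z - HKY.cst c) 0 :=
  (HasEv.sub h (HasVal.cst c)).congr rfl (_root_.sub_self c)

theorem HasVal.of_sub (h : HasVal u v (z - HKY.cst c) 0) : HasVal u v z c :=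
  (HasEv.add h (HasVal.cst c)).congr (sub_add_cancel _ _) (zero_add c)

theorem hasPVal_some : HasPVal u v z (some c) ↔ HasVal u v z c :=
  ⟨fun h => HasVal.of_sub h, fun h => HasVal.sub_self h⟩

theorem hasPVal_none : HasPVal u v z none ↔ HasVal u v z⁻¹ 0 := Iff.rfl

theorem HasVal.inv_unique (hc : IsCoord u v) (hz : z ≠ 0) (h : HasVal u v z⁻¹ 0)
    (h' : HasVal u v z d) : False := by
  have := HasEv.mul h' h
  rw [mul_inv_cancel₀ hz, mul_zero] at this
  exact zero_ne_one (this.unique hc HasEv.one)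

theorem HasPVal.unique (hc : IsCoord u v) (hz : z ≠ 0) (h : HasPVal u v z p)
    (h' : HasPVal u v z q) : p = q := by
  rcases p with _ | c <;> rcases q with _ | d
  · rfl
  · exact (HasVal.inv_unique hc hz h (hasPVal_some.mp h')).elim
  · exact (HasVal.inv_unique hc hz h' (hasPVal_some.mp h)).elim
  · rw [hasPVal_some] at h h'
    rw [h.unique hc h']

end HasPVal

theorem cx_ne_zero : cx ≠ 0 := isCoord_cx_cy.left_ne_zero

theorem cy_ne_zero : cy ≠ 0 := isCoord_cx_cy.right_ne_zero

theorem cx_ne_cst (c : ℂ) : cx ≠ cst c := isCoord_cx_cy.left_ne_cst c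

theorem cy_ne_cst (c : ℂ) : cy ≠ cst c := isCoord_cx_cy.right_ne_cst c

theorem IsCoord.par_right {u v : FuncField} (h : IsCoord u v) (q : Option ℂ) :
    IsCoord u (par v q) := by
  rcases q with _ | c
  · exact h.inv
  · exact h.sub_cst c

theorem isCoord_par (p q : Option ℂ) : IsCoord (par cx p) (par cy q) :=
  ((isCoord_cx_cy.par_right q).swap.par_right p).swap

/-- A point of a blow-up: a point of `ℙ¹ × ℙ¹`, or a point of one of the exceptional curves. -/
inductive Pt : Type
  | base (p q : Option ℂ)
  | exc (i : Fin 8) (c : ℂ)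
  | corner (i : Fin 8)

/-- The first coordinates of the centres in `ℙ¹ × ℙ¹`. -/
def cenX (a : Fin 5 → ℂ) : Fin 8 → Option ℂ :=
  ![some (a 0), some (a 1), some 0, some 0, some 1, none, none, none]

/-- The second coordinates of the centres in `ℙ¹ × ℙ¹`. -/
def cenY (a : Fin 5 → ℂ) : Fin 8 → Option ℂ :=
  ![some 0, some 0, some (a 2), some (a 3), none, some 1, none, none]

namespace Pt

/-- The first local coordinate at a point. -/
def u (a : Fin 5 → ℂ) : Pt → FuncField
  | base p _ => par cx p
  | exc i _ => (centre a i).1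
  | corner i => (centre a i).1 / (centre a i).2

/-- The second local coordinate at a point. -/
def v (a : Fin 5 → ℂ) : Pt → FuncField
  | base _ q => par cy q
  | exc i c => (centre a i).2 / (centre a i).1 - cst c
  | corner i => (centre a i).2

/-- The point is not one of the centres. -/
def Valid (a : Fin 5 → ℂ) : Pt → Prop
  | base p q => ∀ i : Fin 8, ¬ (p = cenX a i ∧ q = cenY a i)
  | exc i c => i = 6 → c ≠ (a 4)⁻¹
  | corner _ => True

/-- The local ring of a point. -/
def ring (a : Fin 5 → ℂ) (P : Pt) : Subalgebra ℂ FuncField := localRing (P.u a) (P.v a)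

/-- The first coordinate of the image in `ℙ¹ × ℙ¹`. -/
def xval (a : Fin 5 → ℂ) : Pt → Option ℂ
  | base p _ => p
  | exc i _ => cenX a i
  | corner i => cenX a i

/-- The second coordinate of the image in `ℙ¹ × ℙ¹`. -/
def yval (a : Fin 5 → ℂ) : Pt → Option ℂ
  | base _ q => q
  | exc i _ => cenY a i
  | corner i => cenY a i

/-- The local equation of `z = ∞` at a point where `z` has the given value. -/
def pole (z : FuncField) : Option ℂ → FuncField
  | some _ => 1
  | none => z⁻¹

/-- The local equation of the total transform of the centre `P_i`. -/
def excE (a : Fin 5 → ℂ) (i : Fin 8) : Pt → FuncField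
  | base _ _ => 1
  | exc j _ => if i = j then (centre a j).1 else if i = 6 ∧ j = 7 then cx⁻¹ else 1
  | corner j => if i = j then (centre a j).2 else if i = 6 ∧ j = 7 then cx⁻¹ else 1

end Pt

theorem centre_eq_par (a : Fin 5 → ℂ) {i : Fin 8} (hi : i ≠ 7) :
    centre a i = (par cx (cenX a i), par cy (cenY a i)) := by
  fin_cases i <;> simp [centre, cenX, cenY] at hi ⊢

theorem isCoord_centre (a : Fin 5 → ℂ) (i : Fin 8) : IsCoord (centre a i).1 (centre a i).2 := by
  by_cases hi : i = 7
  · subst hi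
    change IsCoord cx⁻¹ (cx / cy - cst (a 4)⁻¹)
    refine IsCoord.sub_cst ?_ _
    have := (isCoord_par none none).div
    simp only [par_none] at this
    rwa [show cy⁻¹ / cx⁻¹ = cx / cy by rw [div_inv_eq_mul, div_eq_mul_inv, mul_comm]] at this
  · rw [centre_eq_par a hi]
    exact isCoord_par _ _

theorem Pt.isCoord (a : Fin 5 → ℂ) (P : Pt) : IsCoord (P.u a) (P.v a) := by
  rcases P with ⟨p, q⟩ | ⟨i, c⟩ | i
  · exact isCoord_par p q
  · exact (isCoord_centre a i).div.sub_cst c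
  · exact (isCoord_centre a i).div'

section blowUpVal

variable {u v : FuncField}

theorem hasVal_exc_ratio (c : ℂ) : HasVal u (v / u - cst c) (v / u) c :=
  HasVal.of_sub HasEv.right

theorem hasVal_exc_right (hc : IsCoord u v) (c : ℂ) : HasVal u (v / u - cst c) v 0 :=
  (HasEv.mul (hasVal_exc_ratio c) HasEv.left).congr (div_mul_cancel₀ _ hc.left_ne_zero)
    (mul_zero c)

theorem hasVal_corner_left (hc : IsCoord u v) : HasVal (u / v) v u 0 :=
  (HasEv.mul HasEv.left HasEv.right).congr (div_mul_cancel₀ _ hc.right_ne_zero) (mul_zero 0)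

end blowUpVal

theorem Pt.hasVal_centre_left (a : Fin 5 → ℂ) (i : Fin 8) (c : ℂ) :
    HasVal ((exc i c).u a) ((exc i c).v a) (centre a i).1 0 ∧
    HasVal ((exc i c).u a) ((exc i c).v a) (centre a i).2 0 ∧
    HasVal ((corner i).u a) ((corner i).v a) (centre a i).1 0 ∧
    HasVal ((corner i).u a) ((corner i).v a) (centre a i).2 0 :=
  ⟨HasEv.left, hasVal_exc_right (isCoord_centre a i) c, hasVal_corner_left (isCoord_centre a i),
    HasEv.right⟩

/-- Only `P₈` is not given by product coordinates; there `1/y = (1/x)(x/y)` vanishes because `x/y`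
is regular. -/
theorem hasPVal_of_centre (a : Fin 5 → ℂ) (i : Fin 8) {u v : FuncField}
    (h1 : HasVal u v (centre a i).1 0) (h2 : HasVal u v (centre a i).2 0) :
    HasPVal u v cx (cenX a i) ∧ HasPVal u v cy (cenY a i) := by
  by_cases hi : i = 7
  · subst hi
    refine ⟨h1, ?_⟩
    have h3 : HasVal u v (cx / cy) (a 4)⁻¹ := HasVal.of_sub h2
    refine (HasEv.mul h1 h3).congr ?_ (zero_mul _)
    change cx⁻¹ * (cx / cy) = cy⁻¹
    field_simp [cx_ne_zero, cy_ne_zero]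
  · rw [centre_eq_par a hi] at h1 h2
    exact ⟨h1, h2⟩

theorem Pt.hasPVal (a : Fin 5 → ℂ) (P : Pt) :
    HasPVal (P.u a) (P.v a) cx (P.xval a) ∧ HasPVal (P.u a) (P.v a) cy (P.yval a) := by
  rcases P with ⟨p, q⟩ | ⟨i, c⟩ | i
  · exact ⟨HasEv.left, HasEv.right⟩
  · have := Pt.hasVal_centre_left a i c
    exact hasPVal_of_centre a i this.1 this.2.1
  · have := Pt.hasVal_centre_left a i 0
    exact hasPVal_of_centre a i this.2.2.1 this.2.2.2

/-- The index `7` is excluded because `P₈` lies over `P₇` and shares its image. -/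
theorem cen_injective {a : Fin 5 → ℂ} (ha : Admissible a) {i j : Fin 8} (hi : i ≠ 7) (hj : j ≠ 7)
    (hx : cenX a i = cenX a j) (hy : cenY a i = cenY a j) : i = j := by
  obtain ⟨h0, h1, h2⟩ := ha
  have := h0 0
  have := h0 1
  have := h0 2
  have := h0 3
  fin_cases i <;> fin_cases j <;> simp_all [cenX, cenY]

/-- At a point which does not lie over `P_i`, the coordinates of `P_i` do not both vanish. -/
theorem not_vanish_centre {a : Fin 5 → ℂ} (ha : Admissible a) {i : Fin 8} {P : Pt}
    (hP : P.Valid a) (h : ∀ c, P ≠ Pt.exc i c) (h' : P ≠ Pt.corner i)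
    (h'' : i = 6 → (∀ c, P ≠ Pt.exc 7 c) ∧ P ≠ Pt.corner 7)
    (h1 : HasVal (P.u a) (P.v a) (centre a i).1 0) (h2 : HasVal (P.u a) (P.v a) (centre a i).2 0) :
    False := by
  have hc := P.isCoord a
  have hv := P.hasPVal a
  have hw := hasPVal_of_centre a i h1 h2
  have ex := hv.1.unique hc cx_ne_zero hw.1
  have ey := hv.2.unique hc cy_ne_zero hw.2
  -- Except for `P₇` and `P₈` the centres have distinct images in `ℙ¹ × ℙ¹`. So a point of another
  -- exceptional curve can lie over `P_i` only if it is on the curve over `P₇` and the centre is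
  -- `P₈`. This last case is decided by the position `x/y = 1/a₅` on that curve.
  have key : ∀ j : Fin 8, cenX a j = cenX a i → cenY a j = cenY a i → i ≠ j → ¬ (i = 6 ∧ j = 7) →
      i = 7 ∧ j = 6 := by
    intro j e1 e2 hne hne'
    by_cases hi : i = 7
    · subst hi
      refine ⟨rfl, ?_⟩
      exact cen_injective ha (Ne.symm hne) (by decide) e1 e2
    · by_cases hj : j = 7
      · subst hj
        exact absurd ⟨(cen_injective ha (by decide) hi (i := 6) e1 e2).symm, rfl⟩ hne'
      · exact absurd (cen_injective ha hj hi e1 e2).symm hne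
  rcases P with ⟨p, q⟩ | ⟨j, c⟩ | j
  · exact hP i ⟨ex, ey⟩
  · obtain ⟨rfl, rfl⟩ := key j ex ey (fun e => h c (by rw [e])) (fun e => (h'' e.1).1 c (by rw [e.2]))
    have e1 : HasVal (((Pt.exc 6 c).u a)) ((Pt.exc 6 c).v a) (cx / cy) c :=
      (hasVal_exc_ratio c).congr (by
        change cy⁻¹ / cx⁻¹ = cx / cy
        rw [div_inv_eq_mul, div_eq_mul_inv, mul_comm]) rfl
    have e2 : HasVal (((Pt.exc 6 c).u a)) ((Pt.exc 6 c).v a) (cx / cy) (a 4)⁻¹ := HasVal.of_sub h2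
    exact hP rfl (e1.unique hc e2)
  · obtain ⟨rfl, rfl⟩ := key j ex ey (fun e => h' (by rw [e])) (fun e => (h'' e.1).2 (by rw [e.2]))
    have e2 : HasVal (((Pt.corner 6).u a)) ((Pt.corner 6).v a) (cx / cy) (a 4)⁻¹ := HasVal.of_sub h2
    refine HasVal.inv_unique hc (div_ne_zero cx_ne_zero cy_ne_zero) ?_ e2
    refine HasEv.left.congr ?_ rfl
    change cx⁻¹ / cy⁻¹ = (cx / cy)⁻¹
    rw [div_inv_eq_mul, inv_div, div_eq_mul_inv, mul_comm]

/-- The point with local ring `R` lies on the exceptional curve of the blow-up with centre `P_i`. -/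
def IsExceptional (a : Fin 5 → ℂ) (R : Subalgebra ℂ FuncField) (i : Fin 8) : Prop :=
  (∃ c, R = localRing (centre a i).1 ((centre a i).2 / (centre a i).1 - cst c)) ∨
    R = localRing ((centre a i).1 / (centre a i).2) (centre a i).2

/-- A blow-up removes its centre and adds an exceptional curve. Hence a final point is either an
original point that is never a centre, or a point of the `i`-th exceptional curve that is not one of
the later centres. As the list is increasing, "later" means a larger index, and the induction splits
off the last blow-up. -/
theorem mem_foldl_blowUp (a : Fin 5 → ℂ) (R : Subalgebra ℂ FuncField)
    (M : Set (Subalgebra ℂ FuncField)) (L : List (Fin 8)) (hL : L.Pairwise (· < ·)) :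
    R ∈ L.foldl (fun M i => blowUp M (centre a i).1 (centre a i).2) M ↔
      (R ∈ M ∧ ∀ j ∈ L, R ≠ localRing (centre a j).1 (centre a j).2) ∨
      ∃ i ∈ L, IsExceptional a R i ∧
        ∀ j ∈ L, i < j → R ≠ localRing (centre a j).1 (centre a j).2 := by
  induction L using List.reverseRecOn with
  | nil => simp
  | append_singleton L k ih =>
    rw [List.pairwise_append] at hL
    obtain ⟨hL, -, hk⟩ := hL
    rw [List.foldl_append, List.foldl_cons, List.foldl_nil]
    have hstep : ∀ N : Set (Subalgebra ℂ FuncField),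
        R ∈ blowUp N (centre a k).1 (centre a k).2 ↔
          (R ∈ N ∧ R ≠ localRing (centre a k).1 (centre a k).2) ∨ IsExceptional a R k := by
      intro N
      constructor
      · rintro ((h | h) | h)
        · exact Or.inl h
        · exact Or.inr (Or.inl h)
        · exact Or.inr (Or.inr h)
      · rintro (h | h | h)
        · exact Or.inl (Or.inl h)
        · exact Or.inl (Or.inr h)
        · exact Or.inr h
    rw [hstep, ih hL]
    constructor
    · rintro (⟨⟨h1, h2⟩ | ⟨i, hi, h1, h2⟩, h3⟩ | h)
      · refine Or.inl ⟨h1, fun j hj => ?_⟩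
        rcases List.mem_append.mp hj with hj | hj
        · exact h2 j hj
        · rw [List.mem_singleton.mp hj]; exact h3
      · refine Or.inr ⟨i, List.mem_append_left _ hi, h1, fun j hj hij => ?_⟩
        rcases List.mem_append.mp hj with hj | hj
        · exact h2 j hj hij
        · rw [List.mem_singleton.mp hj]; exact h3
      · refine Or.inr ⟨k, by simp, h, fun j hj hkj => ?_⟩
        rcases List.mem_append.mp hj with hj | hj
        · exact absurd (hk j hj k (by simp)) (lt_asymm hkj)
        · rw [List.mem_singleton.mp hj] at hkj; exact absurd hkj (lt_irrefl _)
    · rintro (⟨h1, h2⟩ | ⟨i, hi, h1, h2⟩)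
      · exact Or.inl ⟨Or.inl ⟨h1, fun j hj => h2 j (List.mem_append_left _ hj)⟩, h2 k (by simp)⟩
      · rcases List.mem_append.mp hi with hi | hi
        · exact Or.inl ⟨Or.inr ⟨i, hi, h1, fun j hj => h2 j (List.mem_append_left _ hj)⟩,
            h2 k (by simp) (hk i hi k (by simp))⟩
        · rw [List.mem_singleton.mp hi] at h1; exact Or.inr h1

theorem mem_surface_iff_foldl (a : Fin 5 → ℂ) (R : Subalgebra ℂ FuncField) :
    R ∈ surface a ↔
      (R ∈ P1P1 ∧ ∀ j, R ≠ localRing (centre a j).1 (centre a j).2) ∨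
      ∃ i, IsExceptional a R i ∧ ∀ j, i < j → R ≠ localRing (centre a j).1 (centre a j).2 := by
  rw [surface, mem_foldl_blowUp a R _ _ (List.pairwise_lt_finRange 8)]
  simp

theorem mem_P1P1_iff (R : Subalgebra ℂ FuncField) :
    R ∈ P1P1 ↔ ∃ p q, R = localRing (par cx p) (par cy q) := by
  have key : ∀ z w : FuncField, w ∈ lineParams z ↔ ∃ p, w = par z p := by
    intro z w
    constructor
    · rintro (h | ⟨c, h⟩)
      · exact ⟨none, h⟩
      · exact ⟨some c, h⟩
    · rintro ⟨_ | c, h⟩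
      · exact Or.inl h
      · exact Or.inr ⟨c, h⟩
  constructor
  · rintro ⟨u, hu, v, hv, rfl⟩
    obtain ⟨p, rfl⟩ := (key _ _).mp hu
    obtain ⟨q, rfl⟩ := (key _ _).mp hv
    exact ⟨p, q, rfl⟩
  · rintro ⟨p, q, rfl⟩
    exact ⟨_, (key _ _).mpr ⟨p, rfl⟩, _, (key _ _).mpr ⟨q, rfl⟩, rfl⟩

theorem Pt.ring_ne_centre {a : Fin 5 → ℂ} (ha : Admissible a) {i : Fin 8} {P : Pt}
    (hP : P.Valid a) (h : ∀ c, P ≠ exc i c) (h' : P ≠ corner i)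
    (h'' : i = 6 → (∀ c, P ≠ exc 7 c) ∧ P ≠ corner 7) :
    P.ring a ≠ localRing (centre a i).1 (centre a i).2 := by
  intro e
  have hc := P.isCoord a
  have hc' := isCoord_centre a i
  exact not_vanish_centre ha hP h h' h'' (HasVal.of_localRing_eq hc' hc e.symm HasEv.left)
    (HasVal.of_localRing_eq hc' hc e.symm HasEv.right)

/-- The points of the surface. -/
theorem mem_surface_iff {a : Fin 5 → ℂ} (ha : Admissible a) (R : Subalgebra ℂ FuncField) :
    R ∈ surface a ↔ ∃ P : Pt, P.Valid a ∧ R = P.ring a := by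
  rw [mem_surface_iff_foldl]
  constructor
  · rintro (⟨h, hne⟩ | ⟨i, ⟨c, rfl⟩ | rfl, hne⟩)
    · obtain ⟨p, q, rfl⟩ := (mem_P1P1_iff R).mp h
      refine ⟨Pt.base p q, ?_, rfl⟩
      rintro i ⟨rfl, rfl⟩
      -- The entries of index `7` record the image of `P₈`, which is `P₇`; the centre removed from
      -- `ℙ¹ × ℙ¹` is the one of index `6`.
      by_cases hi : i = 7
      · subst hi
        exact hne 6 (by rw [centre_eq_par a (by decide)]; rfl)
      · exact hne i (by rw [centre_eq_par a hi])
    · refine ⟨Pt.exc i c, ?_, rfl⟩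
      rintro rfl rfl
      refine hne 7 (by decide) ?_
      change localRing cx⁻¹ (cy⁻¹ / cx⁻¹ - _) = localRing cx⁻¹ (cx / cy - _)
      rw [div_inv_eq_mul, div_eq_mul_inv, mul_comm]
    · exact ⟨Pt.corner i, trivial, rfl⟩
  · rintro ⟨P, hP, rfl⟩
    rcases P with ⟨p, q⟩ | ⟨i, c⟩ | i
    · refine Or.inl ⟨(mem_P1P1_iff _).mpr ⟨p, q, rfl⟩, fun j => ?_⟩
      exact Pt.ring_ne_centre ha hP (by simp) (by simp) (by simp)
    · refine Or.inr ⟨i, Or.inl ⟨c, rfl⟩, fun j hj => ?_⟩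
      refine Pt.ring_ne_centre ha hP ?_ (by simp) ?_
      · intro d e
        rw [Pt.exc.injEq] at e
        exact hj.ne e.1
      · rintro rfl
        refine ⟨fun d e => ?_, by simp⟩
        rw [Pt.exc.injEq] at e
        rw [e.1] at hj
        exact absurd hj (by decide)
    · refine Or.inr ⟨i, Or.inr rfl, fun j hj => ?_⟩
      refine Pt.ring_ne_centre ha hP (by simp) ?_ ?_
      · intro e
        rw [Pt.corner.injEq] at e
        exact hj.ne e
      · rintro rfl
        refine ⟨by simp, fun e => ?_⟩
        rw [Pt.corner.injEq] at e
        rw [e] at hj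
        exact absurd hj (by decide)

/-! ### Local equations -/

theorem poleEq_of_hasPVal {u v z : FuncField} {p : Option ℂ} (hc : IsCoord u v) (hz : z ≠ 0)
    (h : HasPVal u v z p) : poleEq z (localRing u v) = Pt.pole z p := by
  rcases p with _ | c
  · exact if_neg (HasVal.notMem hc h hz)
  · exact if_pos (HasVal.mem hc (hasPVal_some.mp h))

theorem Pt.poleEq_cx (a : Fin 5 → ℂ) (P : Pt) : poleEq cx (P.ring a) = pole cx (P.xval a) :=
  poleEq_of_hasPVal (P.isCoord a) cx_ne_zero (P.hasPVal a).1

theorem Pt.poleEq_cy (a : Fin 5 → ℂ) (P : Pt) : poleEq cy (P.ring a) = pole cy (P.yval a) :=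
  poleEq_of_hasPVal (P.isCoord a) cy_ne_zero (P.hasPVal a).2

theorem excEq_eq_one {u v s t : FuncField} (hc : IsCoord s t)
    (h : HasVal s t u 0 → HasVal s t v 0 → False) : excEq u v (localRing s t) = 1 := by
  refine if_neg ?_
  rw [vanishesAt_localRing_iff hc, vanishesAt_localRing_iff hc]
  exact fun h' => h h'.1 h'.2

theorem excEq_eq_left {u v s t : FuncField} {c : ℂ} (hc : IsCoord s t) (h : HasVal s t u 0)
    (h' : HasVal s t v 0) (h'' : HasVal s t (v / u) c) : excEq u v (localRing s t) = u := by
  rw [excEq, vanishesAt_localRing_iff hc, vanishesAt_localRing_iff hc, if_pos ⟨h, h'⟩,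
    if_pos (h''.mem hc)]

theorem Pt.excEq_eq {a : Fin 5 → ℂ} (ha : Admissible a) {P : Pt} (hP : P.Valid a) (i : Fin 8) :
    excEq (centre a i).1 (centre a i).2 (P.ring a) = P.excE a i := by
  have hc := P.isCoord a
  -- Points over `P₈` also lie over `P₇`. There `x/y` is regular, so the ideal `(1/x, 1/y)` is
  -- generated by `1/x`.
  have h76 : ∀ P : Pt, HasVal (P.u a) (P.v a) (centre a 7).1 0 →
      HasVal (P.u a) (P.v a) (centre a 7).2 0 →
      excEq (centre a 6).1 (centre a 6).2 (P.ring a) = cx⁻¹ := by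
    intro P h1 h2
    have hw := hasPVal_of_centre a 7 h1 h2
    refine excEq_eq_left (c := (a 4)⁻¹) (P.isCoord a) hw.1 hw.2 ?_
    refine HasVal.of_sub (h2.congr ?_ rfl)
    change cx / cy - _ = cy⁻¹ / cx⁻¹ - _
    rw [div_inv_eq_mul, div_eq_mul_inv, mul_comm]
  rcases P with ⟨p, q⟩ | ⟨j, c⟩ | j
  · exact excEq_eq_one hc (not_vanish_centre ha hP (by simp) (by simp) (by simp))
  · have hv := Pt.hasVal_centre_left a j c
    rw [excE]
    split_ifs with h1 h2
    · subst h1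
      exact excEq_eq_left hc hv.1 hv.2.1 (hasVal_exc_ratio c)
    · obtain ⟨rfl, rfl⟩ := h2
      exact h76 _ hv.1 hv.2.1
    · refine excEq_eq_one hc (not_vanish_centre ha hP ?_ (by simp) ?_)
      · intro d e
        rw [exc.injEq] at e
        exact h1 e.1.symm
      · intro hi
        refine ⟨fun d e => ?_, by simp⟩
        rw [exc.injEq] at e
        exact h2 ⟨hi, e.1⟩
  · have hv := Pt.hasVal_centre_left a j 0
    have hj := isCoord_centre a j
    rw [excE]
    split_ifs with h1 h2
    · subst h1
      rw [excEq, ring, vanishesAt_localRing_iff hc, vanishesAt_localRing_iff hc,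
        if_pos ⟨hv.2.2.1, hv.2.2.2⟩, if_neg]
      refine HasVal.notMem hc ?_ (div_ne_zero hj.right_ne_zero hj.left_ne_zero)
      rw [inv_div]
      exact HasEv.left
    · obtain ⟨rfl, rfl⟩ := h2
      exact h76 _ hv.2.2.1 hv.2.2.2
    · refine excEq_eq_one hc (not_vanish_centre ha hP (by simp) ?_ ?_)
      · intro e
        rw [corner.injEq] at e
        exact h1 e.symm
      · intro hi
        refine ⟨by simp, fun e => ?_⟩
        rw [corner.injEq] at e
        exact h2 ⟨hi, e⟩

theorem Pt.localEq_eq {a : Fin 5 → ℂ} (ha : Admissible a) {P : Pt} (hP : P.Valid a) (l : Pic) :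
    localEq a l (P.ring a) =
      pole cx (P.xval a) ^ l 0 * pole cy (P.yval a) ^ l 1 *
        ∏ i : Fin 8, P.excE a i ^ l (i.natAdd 2) := by
  rw [localEq, Pt.poleEq_cx, Pt.poleEq_cy]
  congr 1
  exact Finset.prod_congr rfl fun i _ => by rw [Pt.excEq_eq ha hP]

/-! ### Equality of local rings -/

section LocalRing

variable {z w U A B E u v : FuncField} {U₀ A₀ B₀ E₀ A₁ B₁ E₁ c e : ℂ}

/-- Along `z = 0` the factor `U` is constant, so the value `e` of `w` corresponds to the value `U₀
e` of `Uw`. The hypothesis on `U` allows any second coordinate because `U` has to be evaluated in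
both charts. -/
theorem localRing_mul_sub (hc : IsCoord z w) (hc2 : IsCoord z (U * w))
    (hU : ∀ t, IsCoord z t → HasVal z t U U₀) (h0 : U₀ ≠ 0) (e : ℂ) :
    localRing z (U * w - cst (U₀ * e)) = localRing z (w - cst e) := by
  have h1 := hc.sub_cst e
  have h2 := hc2.sub_cst (U₀ * e)
  have hU2 := hU _ h2
  have hU0 := hU2.ne_zero h2 h0
  refine localRing_eq h1 h2 HasEv.left ?_ HasEv.left ?_
  · exact HasVal.sub_self (HasEv.mul (hU _ h1) (HasVal.of_sub HasEv.right))
  · refine HasVal.sub_self ?_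
    refine (HasVal.div h2 (HasVal.of_sub (HasEv.right : HasVal z _ _ 0)) hU2 h0).congr ?_ ?_
    · field_simp
    · field_simp

theorem localRing_inv_sub (hc : IsCoord z w) (he : e ≠ 0) :
    localRing z (w⁻¹ - cst e⁻¹) = localRing z (w - cst e) := by
  have h1 := hc.sub_cst e
  have h2 := hc.inv.sub_cst e⁻¹
  refine localRing_eq h1 h2 HasEv.left ?_ HasEv.left ?_
  · exact HasVal.sub_self ((HasVal.of_sub HasEv.right).inv h1 he)
  · refine HasVal.sub_self ?_
    have := (HasVal.of_sub (HasEv.right : HasVal z (w⁻¹ - cst e⁻¹) _ 0)).inv h2 (inv_ne_zero he)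
    rwa [inv_inv, inv_inv] at this

/-- The two affine charts of an exceptional curve. -/
theorem localRing_exc_swap (hc : IsCoord u v) (he : e ≠ 0) :
    localRing u (v / u - cst e) = localRing v (u / v - cst e⁻¹) := by
  have h1 := hc.div.sub_cst e
  have h2 := hc.swap.div.sub_cst e⁻¹
  have r1 : HasVal u (v / u - cst e) (v / u) e := HasVal.of_sub HasEv.right
  have r2 : HasVal v (u / v - cst e⁻¹) (u / v) e⁻¹ := HasVal.of_sub HasEv.right
  refine (localRing_eq h1 h2 ?_ ?_ ?_ ?_).symm
  · exact hasVal_exc_right hc e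
  · refine HasVal.sub_self ?_
    have := r1.inv h1 he
    rwa [inv_div] at this
  · exact hasVal_exc_right hc.swap e⁻¹
  · refine HasVal.sub_self ?_
    have := r2.inv h2 (inv_ne_zero he)
    rwa [inv_div, inv_inv] at this

/-- For two exceptional curves whose coordinates are related by the affine map `w ↦ A₀ + B₀ w`,
while their equations differ by the factor `E`. The functions `A, B, E` are evaluated in both
charts, and solving for `w` in the second chart requires `B₁ ≠ 0`. -/
theorem localRing_affine (hc : IsCoord z w) (hc2 : IsCoord u v) (eu : u = z * E)
    (ev : v = A + B * w - cst c)
    (hE : HasVal z (w - cst e) E E₀) (hA : HasVal z (w - cst e) A A₀)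
    (hB : HasVal z (w - cst e) B B₀) (hE' : HasVal u v E E₁) (hA' : HasVal u v A A₁)
    (hB' : HasVal u v B B₁) (hE₁ : E₁ ≠ 0) (hB₁ : B₁ ≠ 0) (h1 : A₀ + B₀ * e = c)
    (h2 : A₁ + B₁ * e = c) : localRing u v = localRing z (w - cst e) := by
  have hc1 := hc.sub_cst e
  have E0 := hE'.ne_zero hc2 hE₁
  have B0 := hB'.ne_zero hc2 hB₁
  refine localRing_eq hc1 hc2 ?_ ?_ ?_ ?_
  · rw [eu]
    exact (HasEv.mul HasEv.left hE).congr rfl (zero_mul _)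
  · rw [ev]
    exact HasVal.sub_self ((HasEv.add hA (HasEv.mul hB (HasVal.of_sub HasEv.right))).congr rfl h1)
  · exact (HasVal.div hc2 HasEv.left hE' hE₁).congr (by rw [eu]; field_simp) (zero_div _)
  · refine HasVal.sub_self ?_
    refine (HasVal.div hc2 (HasEv.sub (HasEv.add HasEv.right (HasVal.cst c)) hA') hB' hB₁).congr
      (by rw [ev]; field_simp; ring) ?_
    rw [← h2]; field_simp; ring

/-- The point `w = ∞` of the curve in `localRing_affine`. Dividing by `w`, the affine expression
becomes `A w⁻¹ + B`, which has the nonzero value `B₀` there. The second conclusion serves to compare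
the equations of the exceptional curves. -/
theorem localRing_affine_corner (hc : IsCoord z w) (hc2 : IsCoord u v)
    (eu : u = (A + B * w)⁻¹) (ev : v = z * E * (A + B * w))
    (hE : HasVal w⁻¹ (z * w) E E₀) (hA : HasVal w⁻¹ (z * w) A A₀)
    (hB : HasVal w⁻¹ (z * w) B B₀) (hE' : HasVal u v E E₁) (hA' : HasVal u v A A₁)
    (hB' : HasVal u v B B₁) (hE₁ : E₁ ≠ 0) (hB₀ : B₀ ≠ 0) (hB₁ : B₁ ≠ 0) :
    localRing u v = localRing w⁻¹ (z * w) ∧ HasVal w⁻¹ (z * w) (w / (A + B * w)) B₀⁻¹ := by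
  have w0 := hc.right_ne_zero
  have hc1 : IsCoord w⁻¹ (z * w) := by
    refine hc.of_mem ?_ ?_
    · have := mul_mem (left_mem_adjoin (u := w⁻¹) (v := z * w)) right_mem_adjoin
      rwa [show w⁻¹ * (z * w) = z by field_simp] at this
    · have := inv_mem (left_mem_adjoin (u := w⁻¹) (v := z * w))
      rwa [inv_inv] at this
  have E0 := hE'.ne_zero hc2 hE₁
  have B0 := hB'.ne_zero hc2 hB₁
  have u0 := hc2.left_ne_zero
  have s0 : A + B * w ≠ 0 := by
    intro h; rw [h, inv_zero] at eu; exact u0 eu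
  have k1 : HasVal w⁻¹ (z * w) (A * w⁻¹ + B) B₀ :=
    (HasEv.add (HasEv.mul hA HasEv.left) hB).congr rfl (by ring)
  have k2 : HasVal w⁻¹ (z * w) (w / (A + B * w)) B₀⁻¹ :=
    (k1.inv hc1 hB₀).congr (by
      rw [show A * w⁻¹ + B = (A + B * w) / w by field_simp, inv_div]) rfl
  have kz : HasVal w⁻¹ (z * w) z 0 :=
    (HasEv.mul HasEv.left HasEv.right).congr (by field_simp) (mul_zero 0)
  have l1 : HasVal u v (1 - A * u) 1 :=
    (HasEv.sub HasEv.one (HasEv.mul hA' HasEv.left)).congr rfl (by ring)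
  have l0 := l1.ne_zero hc2 one_ne_zero
  have lw : (1 - A * u) = B * w * u := by rw [eu]; field_simp; ring
  refine ⟨localRing_eq hc1 hc2 ?_ ?_ ?_ ?_, k2⟩
  · exact (HasEv.mul HasEv.left k2).congr (by rw [eu]; field_simp) (zero_mul _)
  · rw [ev]
    refine (HasEv.mul hE (HasEv.add (HasEv.mul hA kz) (HasEv.mul hB HasEv.right))).congr
      (by ring) (by ring)
  · refine (HasVal.div hc2 (HasEv.mul hB' HasEv.left) l1 one_ne_zero).congr ?_ (by simp)
    rw [lw]; field_simp
  · refine (HasEv.mul (HasVal.div hc2 HasEv.right hE' hE₁) (HasVal.div hc2 l1 hB' hB₁)).congr ?_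
      (by simp)
    rw [lw, ev, eu]; field_simp

/-- At a point where `z` vanishes `U` is a unit, so both coordinates change by unit factors only. -/
theorem localRing_unit_corner (hc : IsCoord z w) (hc2 : IsCoord (U * w) (z / (U * w)))
    (hU : ∀ s t, IsCoord s t → HasVal s t z 0 → HasVal s t U U₀) (h0 : U₀ ≠ 0) :
    localRing (U * w) (z / (U * w)) = localRing w (z / w) := by
  have hc1 := hc.swap.div
  have w0 := hc.right_ne_zero
  have kz : HasVal w (z / w) z 0 :=
    (HasEv.mul HasEv.left HasEv.right).congr (by field_simp) (mul_zero 0)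
  have hU1 := hU _ _ hc1 kz
  have U0 : U ≠ 0 := hU1.ne_zero hc1 h0
  have kz2 : HasVal (U * w) (z / (U * w)) z 0 :=
    (HasEv.mul HasEv.left HasEv.right).congr (by field_simp) (mul_zero 0)
  have hU2 := hU _ _ hc2 kz2
  refine localRing_eq hc1 hc2 ?_ ?_ ?_ ?_
  · exact (HasEv.mul hU1 HasEv.left).congr rfl (mul_zero _)
  · exact (HasVal.div hc1 HasEv.right hU1 h0).congr (by field_simp) (zero_div _)
  · exact (HasVal.div hc2 HasEv.left hU2 h0).congr (by field_simp) (zero_div _)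
  · exact (HasEv.mul hU2 HasEv.right).congr (by field_simp) (mul_zero _)

end LocalRing

/-! ### Replacing a coordinate by a unit times it or its inverse -/

section Scaling

variable {z w U W : FuncField} {U₀ : ℂ}

theorem localRing_sub_of_eq_mul (hc : IsCoord z w) (hc2 : IsCoord z W) (hW : W = U * w)
    (hU : ∀ t, IsCoord z t → HasVal z t U U₀) (h0 : U₀ ≠ 0) (c : ℂ) :
    localRing z (W - cst c) = localRing z (w - cst (c / U₀)) := by
  subst hW
  rw [← localRing_mul_sub hc hc2 hU h0, mul_div_cancel₀ _ h0]

theorem localRing_of_eq_mul (hc : IsCoord z w) (hc2 : IsCoord z W) (hW : W = U * w)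
    (hU : ∀ t, IsCoord z t → HasVal z t U U₀) (h0 : U₀ ≠ 0) :
    localRing z W = localRing z w := by
  simpa using localRing_sub_of_eq_mul hc hc2 hW hU h0 0

theorem localRing_sub_of_eq_div (hc : IsCoord z w) (hc2 : IsCoord z W) (hW : W = U / w)
    (hU : ∀ t, IsCoord z t → HasVal z t U U₀) (h0 : U₀ ≠ 0) {c : ℂ} (hc0 : c ≠ 0) :
    localRing z (W - cst c) = localRing z (w - cst (U₀ / c)) := by
  rw [localRing_sub_of_eq_mul hc.inv hc2 (by rw [hW, div_eq_mul_inv]) hU h0,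
    ← localRing_inv_sub hc (div_ne_zero h0 hc0), inv_div]

theorem localRing_of_eq_div (hc : IsCoord z w) (hc2 : IsCoord z W) (hW : W = U / w)
    (hU : ∀ t, IsCoord z t → HasVal z t U U₀) (h0 : U₀ ≠ 0) :
    localRing z W = localRing z w⁻¹ :=
  localRing_of_eq_mul hc.inv hc2 (by rw [hW, div_eq_mul_inv]) hU h0

end Scaling

/-! ### The rational function of `x` in the mapping -/

/-- The function `k (x - α) (x - β) / (x - 1)`. -/
def ratF (k α β : ℂ) : FuncField := cst k * (cx - cst α) * (cx - cst β) / (cx - 1)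

theorem ratF_comm (k α β : ℂ) : ratF k α β = ratF k β α := by
  rw [ratF, ratF]; ring

theorem cx_sub_cst_ne_zero (c : ℂ) : cx - cst c ≠ 0 := sub_ne_zero.mpr (cx_ne_cst c)

theorem cx_sub_one_ne_zero : cx - 1 ≠ 0 := by simpa using cx_sub_cst_ne_zero 1

theorem ratF_ne_zero {k : ℂ} (hk : k ≠ 0) (α β : ℂ) : ratF k α β ≠ 0 :=
  div_ne_zero (mul_ne_zero (mul_ne_zero (cst_ne_zero hk) (cx_sub_cst_ne_zero α))
    (cx_sub_cst_ne_zero β)) cx_sub_one_ne_zero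

section values

variable {s t : FuncField} {k α β d : ℂ}

theorem HasVal.sub_cst {r : FuncField} (h : HasVal s t r d) (c : ℂ) :
    HasVal s t (r - HKY.cst c) (d - c) := HasEv.sub h (HasVal.cst c)

theorem HasVal.sub_one {r : FuncField} (h : HasVal s t r d) : HasVal s t (r - 1) (d - 1) := by
  simpa using h.sub_cst 1

theorem hasVal_ratF (hc : IsCoord s t) (hx : HasVal s t cx d) (hd : d ≠ 1) :
    HasVal s t (ratF k α β) (k * (d - α) * (d - β) / (d - 1)) :=
  HasVal.div hc (HasEv.mul (HasEv.mul (HasVal.cst k) (hx.sub_cst α)) (hx.sub_cst β)) hx.sub_one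
    (sub_ne_zero.mpr hd)

theorem hasVal_ratF_div (hc : IsCoord s t) (hx : HasVal s t cx α) (hd : α ≠ 1) :
    HasVal s t (ratF k α β / (cx - cst α)) (k * (α - β) / (α - 1)) :=
  (HasVal.div hc (HasEv.mul (HasVal.cst k) (hx.sub_cst β)) hx.sub_one
    (sub_ne_zero.mpr hd)).congr (by
      have := cx_sub_cst_ne_zero α
      rw [ratF]; field_simp) rfl

theorem hasVal_ratF_mul (hx : HasVal s t cx 1) :
    HasVal s t (ratF k α β * (cx - 1)) (k * (1 - α) * (1 - β)) :=
  (HasEv.mul (HasEv.mul (HasVal.cst k) (hx.sub_cst α)) (hx.sub_cst β)).congr (by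
      have := cx_sub_one_ne_zero
      rw [ratF]; field_simp) rfl

/-- For `α = 1` the factors in numerator and denominator cancel. This is the degenerate case in
which `P₁` or `P₂` lies on the fibre `x = 1` through `P₅`. -/
theorem hasVal_ratF_one (hx : HasVal s t cx 1) :
    HasVal s t (ratF k 1 β) (k * (1 - β)) :=
  (HasEv.mul (HasVal.cst k) (hx.sub_cst β)).congr (by
      have := cx_sub_one_ne_zero
      rw [ratF, cst_one]; field_simp) rfl

/-- At `x = ∞` the function `(x - α) / x` has the value `1`. -/
theorem hasVal_sub_div (hx : HasVal s t cx⁻¹ 0) (α : ℂ) : HasVal s t ((cx - cst α) / cx) 1 :=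
  (HasEv.sub HasEv.one (HasEv.mul (HasVal.cst α) hx)).congr
    (by have := cx_ne_zero; field_simp) (by simp)

theorem hasVal_ratF_div_cx (hc : IsCoord s t) (hx : HasVal s t cx⁻¹ 0) :
    HasVal s t (ratF k α β / cx) k :=
  (HasEv.mul (HasVal.cst k) (HasVal.div hc (HasEv.mul (hasVal_sub_div hx α)
    (hasVal_sub_div hx β)) (hasVal_sub_div hx 1) one_ne_zero)).congr (by
      have := cx_ne_zero
      have := cx_sub_one_ne_zero
      rw [ratF, cst_one]; field_simp) (by simp)

/-- The second term of the expansion of `F` at infinity. It enters the affine maps between the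
exceptional curves over points with `x = ∞`, where the leading terms cancel. -/
theorem hasVal_ratF_sub (hc : IsCoord s t) (hx : HasVal s t cx⁻¹ 0) :
    HasVal s t (ratF k α β - cst k * cx) (k * (1 - α - β)) :=
  (HasEv.mul (HasVal.cst k) (HasVal.div hc (HasEv.add (HasVal.cst (1 - α - β))
    (HasEv.mul (HasVal.cst (α * β)) hx))
    (hasVal_sub_div hx 1) one_ne_zero)).congr (by
      have := cx_ne_zero
      have := cx_sub_one_ne_zero
      rw [ratF, cst_one, cst_sub, cst_sub, cst_mul, cst_one]; field_simp; ring) (by simp)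

/-- The derivative of `F` at `0`, where `F(0) = -kαβ`. It enters the affine maps between the
exceptional curves over points with `x = 0`. -/
theorem hasVal_ratF_sub_div (hc : IsCoord s t) (hx : HasVal s t cx 0) :
    HasVal s t ((ratF k α β + cst (k * α * β)) / cx) (k * (α + β - α * β)) :=
  (HasVal.div hc (HasEv.mul (HasVal.cst k) (hx.sub_cst (α + β - α * β)))
    hx.sub_one (by simp)).congr (by
      have := cx_ne_zero
      have := cx_sub_one_ne_zero
      rw [ratF]
      simp only [cst_sub, cst_mul, cst_add]
      field_simp; ring) (by ring)

end values


/-! ### The images of the points under the mapping -/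

theorem UnitAt.congr {R : Subalgebra ℂ FuncField} {r r' : FuncField} (h : UnitAt R r)
    (e : r = r') : UnitAt R r' := e ▸ h

theorem Pt.valid_some_some {a : Fin 5 → ℂ} {p q : ℂ} :
    (base (some p) (some q)).Valid a ↔
      (q = 0 → p ≠ a 0 ∧ p ≠ a 1) ∧ (p = 0 → q ≠ a 2 ∧ q ≠ a 3) := by
  simp only [Valid, Fin.forall_fin_succ]
  simp [cenX, cenY]
  tauto

theorem Pt.valid_some_none {a : Fin 5 → ℂ} {p : ℂ} :
    (base (some p) none).Valid a ↔ p ≠ 1 := by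
  simp only [Valid, Fin.forall_fin_succ]
  simp [cenX, cenY]

theorem Pt.valid_none_some {a : Fin 5 → ℂ} {q : ℂ} :
    (base none (some q)).Valid a ↔ q ≠ 1 := by
  simp only [Valid, Fin.forall_fin_succ]
  simp [cenX, cenY]

theorem Pt.not_valid_none_none {a : Fin 5 → ℂ} : ¬ (base none none).Valid a := by
  simp only [Valid, Fin.forall_fin_succ]
  simp [cenX, cenY]

/-- The local equations of the divisor classes at the corresponding points `P'` and `P` are
compatible with the action on the Picard lattice. -/
structure PicCompat (φ : FuncField ≃ₐ[ℂ] FuncField) (a : Fin 5 → ℂ) (P P' : Pt) : Prop where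
  hy : UnitAt (P'.ring a) (cy / ((cx - cst (a 0)) * (cx - cst (a 1))) * Pt.pole cy (P'.yval a) /
    φ (Pt.pole cx (P.xval (evolve a)) * Pt.pole cy (P.yval (evolve a)) ^ 2 /
      (P.excE (evolve a) 2 * P.excE (evolve a) 3 * P.excE (evolve a) 5 * P.excE (evolve a) 6)))
  h0 : P.yval (evolve a) = some (a 0) →
    UnitAt (P'.ring a) (P'.excE a 0 * φ (P.excE (evolve a) 2) / (cx - cst (a 0)))
  h1 : P.yval (evolve a) = some (a 1) →
    UnitAt (P'.ring a) (P'.excE a 1 * φ (P.excE (evolve a) 3) / (cx - cst (a 1)))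
  h4 : P.yval (evolve a) = some 1 →
    UnitAt (P'.ring a) (P'.excE a 4 * φ (P.excE (evolve a) 5) / (cx - 1))
  h2 : P.yval (evolve a) = some 0 →
    UnitAt (P'.ring a) (P'.excE a 2 / φ (P.excE (evolve a) 0))
  h3 : P.yval (evolve a) = some 0 →
    UnitAt (P'.ring a) (P'.excE a 3 / φ (P.excE (evolve a) 1))
  h5 : P.yval (evolve a) = none →
    UnitAt (P'.ring a) (P'.excE a 5 / φ (P.excE (evolve a) 7))
  h7 : P.yval (evolve a) = none →
    UnitAt (P'.ring a) (P'.excE a 7 / φ (P.excE (evolve a) 4))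
  h6 : P.yval (evolve a) = none →
    UnitAt (P'.ring a) (P'.excE a 6 * φ (P.excE (evolve a) 6) / cx⁻¹)

/-- The point `P` of the surface with parameters `evolve a` corresponds to a point of the surface
with parameters `a`. -/
def HasImage (φ : FuncField ≃ₐ[ℂ] FuncField) (a : Fin 5 → ℂ) (P : Pt) : Prop :=
  ∃ P' : Pt, P'.Valid a ∧ P'.xval a = P.yval (evolve a) ∧
    localRing (φ (P.u (evolve a))) (φ (P.v (evolve a))) = P'.ring a ∧
    (a 0 ≠ 1 → a 1 ≠ 1 → PicCompat φ a P P')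

/-- The pull-back along the mapping, in terms of `ratF`. -/
structure IsMapping (φ : FuncField ≃ₐ[ℂ] FuncField) (a : Fin 5 → ℂ) : Prop where
  adm : Admissible a
  map_x : φ cx = ratF (a 4) (a 0) (a 1) / cy
  map_y : φ cy = cx

namespace IsMapping

variable {φ : FuncField ≃ₐ[ℂ] FuncField} {a : Fin 5 → ℂ}

theorem map_cst (φ : FuncField ≃ₐ[ℂ] FuncField) (c : ℂ) : φ (cst c) = cst c := φ.commutes c

theorem map_par (φ : FuncField ≃ₐ[ℂ] FuncField) (z : FuncField) (p : Option ℂ) :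
    φ (par z p) = par (φ z) p := by
  rcases p with _ | c
  · exact map_inv₀ φ z
  · rw [par_some, map_sub, map_cst, par_some]

theorem map_x' (h : IsMapping φ a) : φ cx = ratF (a 4) (a 1) (a 0) / cy := by
  rw [h.map_x, ratF_comm]

theorem isCoord (h : IsMapping φ a) : IsCoord (φ cx) cx := by
  have := isCoord_cx_cy.map φ
  rwa [h.map_y] at this

theorem x_ne_zero (h : IsMapping φ a) : φ cx ≠ 0 := h.isCoord.left_ne_zero

theorem ratF_eq (h : IsMapping φ a) : ratF (a 4) (a 0) (a 1) = φ cx * cy := by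
  rw [h.map_x, div_mul_cancel₀ _ cy_ne_zero]

theorem ne (h : IsMapping φ a) (i : Fin 5) : a i ≠ 0 := h.adm.1 i

end IsMapping

/-! ### The fibres of `ȳ` and the points of `ℙ¹ × ℙ¹` -/

namespace IsMapping

variable {φ : FuncField ≃ₐ[ℂ] FuncField} {a : Fin 5 → ℂ}

/-! Units at a point in terms of the value of `x`. -/

theorem unitAt_sub {s t : FuncField} (hc : IsCoord s t) {d : ℂ} (hx : HasVal s t cx d) {c : ℂ}
    (h : d ≠ c) : UnitAt (localRing s t) (cx - cst c) :=
  (hx.sub_cst c).unitAt hc (sub_ne_zero.mpr h)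

theorem unitAt_sub_div {s t : FuncField} (hc : IsCoord s t) (hx : HasVal s t cx⁻¹ 0) (c : ℂ) :
    UnitAt (localRing s t) ((cx - cst c) / cx) :=
  (hasVal_sub_div hx c).unitAt hc one_ne_zero

/-- The common value is `F(0)`. On `x = 0` the mapping is `x̄ = F(0)/y`, so `P₃` and `P₄` go to the
points of `ȳ = 0` with `x̄ = F(0)/a₃` and `x̄ = F(0)/a₄`. This forces the first two evolved
parameters. -/
theorem q_mul (h : IsMapping φ a) : a 2 * evolve a 0 = -(a 4 * a 0 * a 1) ∧
    a 3 * evolve a 1 = -(a 4 * a 0 * a 1) := by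
  have := h.ne 0
  have := h.ne 1
  have := h.ne 2
  have := h.ne 3
  have := h.ne 4
  constructor
  · simp only [evolve, qParam, Matrix.cons_val_zero]
    field_simp
  · simp only [evolve, qParam, Matrix.cons_val_one, Matrix.cons_val_zero]
    field_simp

theorem evolve_ne (h : IsMapping φ a) (i : Fin 5) : evolve a i ≠ 0 := by
  have h0 := h.ne 0
  have h1 := h.ne 1
  have h2 := h.ne 2
  have h3 := h.ne 3
  have h4 := h.ne 4
  have hq : qParam a ≠ 0 := by
    simp only [qParam]
    exact div_ne_zero (neg_ne_zero.mpr (mul_ne_zero h2 h3)) (mul_ne_zero (mul_ne_zero h0 h1) h4)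
  fin_cases i
  · exact div_ne_zero h3 hq
  · exact div_ne_zero h2 hq
  · exact h0
  · exact h1
  · exact inv_ne_zero h4

theorem map_base (h : IsMapping φ a) (p q : Option ℂ) :
    localRing (φ ((Pt.base p q).u (evolve a))) (φ ((Pt.base p q).v (evolve a))) =
      localRing (par cx q) (par (φ cx) p) := by
  change localRing (φ (par cx p)) (φ (par cy q)) = _
  rw [map_par, map_par, h.map_y, localRing_swap]

theorem isCoord_map (h : IsMapping φ a) (p q : Option ℂ) : IsCoord (par cx q) (par (φ cx) p) :=
  ((h.isCoord.par_right q).swap.par_right p)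

theorem isCoord_map' (h : IsMapping φ a) (q : Option ℂ) : IsCoord (par cx q) (φ cx) :=
  (h.isCoord.par_right q).swap

theorem isCoord_y (q : Option ℂ) : IsCoord (par cx q) cy :=
  (isCoord_cx_cy.swap.par_right q).swap

/-- Where `F` has neither a zero nor a pole, the fibre `ȳ = d` comes from the fibre `x = d` by `x̄ =
F(d)/y`, with `0` and `∞` interchanged. -/
theorem hasImage_base_generic (h : IsMapping φ a) {p : Option ℂ} {d : ℂ}
    (hP : (Pt.base p (some d)).Valid (evolve a)) (hd0 : d ≠ a 0) (hd1 : d ≠ a 1) (hd : d ≠ 1) :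
    HasImage φ a (Pt.base p (some d)) := by
  set F := ratF (a 4) (a 0) (a 1) with hF
  set F₀ := a 4 * (d - a 0) * (d - a 1) / (d - 1) with hF₀
  have hF0 : F₀ ≠ 0 := div_ne_zero (mul_ne_zero (mul_ne_zero (h.ne 4) (sub_ne_zero.mpr hd0))
    (sub_ne_zero.mpr hd1)) (sub_ne_zero.mpr hd)
  have hxv : ∀ t, HasVal (par cx (some d)) t cx d := fun t => HasVal.of_sub HasEv.left
  have hU : ∀ t, IsCoord (par cx (some d)) t → HasVal (par cx (some d)) t F F₀ :=
    fun t ht => hasVal_ratF ht (hxv t) hd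
  have hy := isCoord_y (some d)
  have hne0 : cx - cst (a 0) ≠ 0 := cx_sub_cst_ne_zero _
  have hne1 : cx - cst (a 1) ≠ 0 := cx_sub_cst_ne_zero _
  have hX : φ cx = F / cy := h.map_x
  have y0 := cy_ne_zero
  have compat : ∀ (q : Option ℂ), UnitAt ((Pt.base (some d) q).ring a)
      (cy * Pt.pole cy q / φ (Pt.pole cx p)) →
      PicCompat φ a (Pt.base p (some d)) (Pt.base (some d) q) := by
    intro q hq
    have hc := Pt.isCoord a (Pt.base (some d) q)
    refine ⟨?_, ?_, ?_, ?_, ?_, ?_, ?_, ?_, ?_⟩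
    · refine UnitAt.congr ((hq.div (unitAt_sub hc (hxv _) hd0)).div
        (unitAt_sub hc (hxv _) hd1)) ?_
      simp only [Pt.yval, Pt.xval, Pt.excE, Pt.pole, one_pow, mul_one, div_one]
      field_simp
    all_goals
      intro e
      simp [Pt.yval, hd0, hd1, hd] at e
    all_goals
      exact UnitAt.congr UnitAt.one (by simp [Pt.excE])
  rcases p with _ | c
  · refine ⟨Pt.base (some d) (some 0), ?_, rfl, ?_, fun _ _ => compat _ ?_⟩
    · rw [Pt.valid_some_some]
      exact ⟨fun _ => ⟨hd0, hd1⟩, fun _ => ⟨(h.ne 2).symm, (h.ne 3).symm⟩⟩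
    · rw [h.map_base]
      refine (localRing_of_eq_mul (U := F⁻¹) (U₀ := F₀⁻¹) hy (h.isCoord_map _ _) ?_ ?_
        (inv_ne_zero hF0)).trans ?_
      · rw [par_none, hX, inv_div, div_eq_inv_mul]
      · exact fun t ht => (hU t ht).inv ht hF0
      · simp [Pt.ring, Pt.u, Pt.v]
    · have hc := Pt.isCoord a (Pt.base (some d) (some 0))
      refine UnitAt.congr ((hU _ hc).unitAt hc hF0) ?_
      simp only [Pt.pole, map_inv₀, hX, mul_one]
      rw [inv_div, div_div_cancel₀ y0]
  · by_cases hc0 : c = 0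
    · subst hc0
      refine ⟨Pt.base (some d) none, ?_, rfl, ?_, fun _ _ => compat _ ?_⟩
      · rwa [Pt.valid_some_none]
      · rw [h.map_base]
        refine (localRing_of_eq_div hy (h.isCoord_map _ _) ?_ hU hF0)
        simp [hX]
      · refine UnitAt.congr UnitAt.one ?_
        simp [Pt.pole, y0]
    · refine ⟨Pt.base (some d) (some (F₀ / c)), ?_, rfl, ?_, fun _ _ => compat _ ?_⟩
      · rw [Pt.valid_some_some]
        refine ⟨fun _ => ⟨hd0, hd1⟩, fun e => ?_⟩
        -- On the fibre over `0` the centres have to correspond: `F(0)/c` is `a₃` or `a₄` only if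
        -- `c` is one of the evolved parameters, and those points were excluded.
        have hv := (Pt.valid_some_some.mp hP).1 e
        have hq := h.q_mul
        subst e
        have e0 : F₀ = -(a 4 * a 0 * a 1) := by rw [hF₀]; ring
        constructor
        · intro e1
          apply hv.1
          rw [div_eq_iff hc0, e0, ← hq.1] at e1
          exact (mul_left_cancel₀ (h.ne 2) e1).symm
        · intro e1
          apply hv.2
          rw [div_eq_iff hc0, e0, ← hq.2] at e1
          exact (mul_left_cancel₀ (h.ne 3) e1).symm
      · rw [h.map_base]
        exact (localRing_sub_of_eq_div hy (h.isCoord_map' _) hX hU hF0 hc0)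
      · have hc := Pt.isCoord a (Pt.base (some d) (some (F₀ / c)))
        refine UnitAt.congr ((HasVal.of_sub HasEv.right : HasVal _ _ cy (F₀ / c)).unitAt hc
          (div_ne_zero hF0 hc0)) ?_
        simp [Pt.pole]

/-- `F` has a simple pole at `1` with residue `K`, so the line `ȳ = 1` comes from the exceptional
curve over `P₅ = (1, ∞)`: there `x̄` is `K` times the coordinate `y⁻¹/(x - 1)`. The point at
infinity of this line is a centre. -/
theorem hasImage_base_one (h : IsMapping φ a) {c : ℂ}
    (h0 : a 0 ≠ 1) (h1 : a 1 ≠ 1) : HasImage φ a (Pt.base (some c) (some 1)) := by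
  set F := ratF (a 4) (a 0) (a 1) with hF
  set K := a 4 * (1 - a 0) * (1 - a 1) with hK
  have hK0 : K ≠ 0 := mul_ne_zero (mul_ne_zero (h.ne 4) (sub_ne_zero.mpr h0.symm))
    (sub_ne_zero.mpr h1.symm)
  have hxv : ∀ t, HasVal (cx - 1) t cx 1 := fun t => HasVal.of_sub (by simpa using HasEv.left)
  have hne0 : cx - cst (a 0) ≠ 0 := cx_sub_cst_ne_zero _
  have hne1 : cx - cst (a 1) ≠ 0 := cx_sub_cst_ne_zero _
  have hne := cx_sub_one_ne_zero
  have hX : φ cx = F / cy := h.map_x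
  have y0 := cy_ne_zero
  have hz : par cx (some 1) = cx - 1 := by simp
  refine ⟨Pt.exc 4 (c / K), fun e => absurd e (by decide), rfl, ?_, fun _ _ => ?_⟩
  · rw [h.map_base]
    have hcy : IsCoord (cx - 1) cy := hz ▸ isCoord_y (some 1)
    have := localRing_sub_of_eq_mul (z := cx - 1) (W := φ cx) (w := cy⁻¹ / (cx - 1))
      (U := F * (cx - 1)) (U₀ := K) hcy.inv.div (hz ▸ h.isCoord_map' (some 1))
      (by rw [hX]; field_simp) (fun t ht => hasVal_ratF_mul (hxv t)) hK0 c
    rw [hz]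
    exact this
  · have hc := Pt.isCoord a (Pt.exc 4 (c / K))
    have hx : HasVal ((Pt.exc 4 (c / K)).u a) ((Pt.exc 4 (c / K)).v a) cx 1 := hxv _
    refine ⟨?_, ?_, ?_, ?_, ?_, ?_, ?_, ?_, ?_⟩
    · refine UnitAt.congr ((UnitAt.one.div (unitAt_sub hc hx h0.symm)).div
        (unitAt_sub hc hx h1.symm)) ?_
      simp [Pt.yval, Pt.xval, Pt.excE, Pt.pole, cenY]
      field_simp
    all_goals
      intro e
      simp [Pt.yval, h0.symm, h1.symm] at e
    · refine UnitAt.congr UnitAt.one ?_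
      simp [Pt.excE, centre, hne]

/-- Since `F/x` tends to `a₅`, the line `ȳ = ∞` comes from the exceptional curve over `P₇`. The
excluded point `x̄ = 1` is the image of `P₈`. -/
theorem hasImage_base_inf (h : IsMapping φ a) {c : ℂ} (hP : c ≠ 1) :
    HasImage φ a (Pt.base (some c) none) := by
  set F := ratF (a 4) (a 0) (a 1) with hF
  have hxv : ∀ t, HasVal cx⁻¹ t cx⁻¹ 0 := fun t => HasEv.left
  have hne0 : cx - cst (a 0) ≠ 0 := cx_sub_cst_ne_zero _
  have hne1 : cx - cst (a 1) ≠ 0 := cx_sub_cst_ne_zero _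
  have hX : φ cx = F / cy := h.map_x
  have y0 := cy_ne_zero
  have x0 := cx_ne_zero
  refine ⟨Pt.exc 6 (c / a 4), fun _ e => ?_, rfl, ?_, fun _ _ => ?_⟩
  · rw [div_eq_iff (h.ne 4), inv_mul_cancel₀ (h.ne 4)] at e
    exact hP e
  · rw [h.map_base]
    exact localRing_sub_of_eq_mul (z := cx⁻¹) (W := φ cx) (w := cy⁻¹ / cx⁻¹)
      (U := F / cx) (U₀ := a 4) (isCoord_y none).inv.div (h.isCoord_map' none)
      (by rw [hX]; field_simp) (fun t ht => hasVal_ratF_div_cx ht (hxv t)) (h.ne 4) c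
  · have hc := Pt.isCoord a (Pt.exc 6 (c / a 4))
    have hx : HasVal ((Pt.exc 6 (c / a 4)).u a) ((Pt.exc 6 (c / a 4)).v a) cx⁻¹ 0 := hxv _
    refine ⟨?_, ?_, ?_, ?_, ?_, ?_, ?_, ?_, ?_⟩
    · refine UnitAt.congr ((UnitAt.one.div (unitAt_sub_div hc hx (a 0))).div
        (unitAt_sub_div hc hx (a 1))) ?_
      simp [Pt.yval, Pt.xval, Pt.excE, Pt.pole, cenY, h.map_y]
      field_simp
    all_goals
      intro e
      simp [Pt.yval] at e
    · exact UnitAt.congr UnitAt.one (by simp [Pt.excE])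
    · exact UnitAt.congr UnitAt.one (by simp [Pt.excE])
    · exact UnitAt.congr UnitAt.one (by simp [Pt.excE, centre, x0])

end IsMapping

/-! ### The fibres over the zeros of `F`, and the curves over `P₃` and `P₄` of the target -/

theorem IsCoord.div'' {u v : FuncField} (h : IsCoord u v) : IsCoord u (u / v) := by
  have := h.div.inv
  rwa [inv_div] at this

/-- The indices that belong to one of the two zeros of `(x - a₀)(x - a₁)`. -/
inductive IsRootIndex : Fin 5 → Fin 5 → Fin 5 → Fin 8 → Fin 8 → Prop
  | left : IsRootIndex 0 1 2 0 2
  | right : IsRootIndex 1 0 3 1 3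

theorem IsRootIndex.ne {i j m : Fin 5} {k l : Fin 8} (hij : IsRootIndex i j m k l) {a : Fin 5 → ℂ}
    (ha : Admissible a) : a i ≠ a j := by
  cases hij
  exacts [ha.2.1, ha.2.1.symm]

namespace IsMapping

variable {φ : FuncField ≃ₐ[ℂ] FuncField} {a : Fin 5 → ℂ} {i j m : Fin 5} {k l : Fin 8}

theorem map_x_root (h : IsMapping φ a) (hij : IsRootIndex i j m k l) :
    φ cx = ratF (a 4) (a i) (a j) / cy := by
  cases hij
  exacts [h.map_x, h.map_x']

/-- At a simple zero of `F` write `x̄ = (F/(x - a_i)) / (y/(x - a_i))`. The first factor is a unit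
with value `G₀`, so the line `ȳ = a_i` comes from the exceptional curve over `(a_i, 0)`. -/
theorem hasImage_base_root (h : IsMapping φ a) (hij : IsRootIndex i j m k l) {p : Option ℂ}
    (hP : (Pt.base p (some (a i))).Valid (evolve a)) (hd : a i ≠ 1) :
    HasImage φ a (Pt.base p (some (a i))) := by
  set F := ratF (a 4) (a i) (a j) with hF
  set G₀ := a 4 * (a i - a j) / (a i - 1) with hG₀
  have hne := hij.ne h.adm
  have hG0 : G₀ ≠ 0 := div_ne_zero (mul_ne_zero (h.ne 4) (sub_ne_zero.mpr hne))
    (sub_ne_zero.mpr hd)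
  have hxv : ∀ t, HasVal (cx - cst (a i)) t cx (a i) := fun t => HasVal.of_sub HasEv.left
  have hU : ∀ t, IsCoord (cx - cst (a i)) t →
      HasVal (cx - cst (a i)) t (F / (cx - cst (a i))) G₀ :=
    fun t ht => hasVal_ratF_div ht (hxv t) hd
  have hw : IsCoord (cx - cst (a i)) (cy / (cx - cst (a i))) := (isCoord_y (some (a i))).div
  have hne0 : cx - cst (a i) ≠ 0 := cx_sub_cst_ne_zero _
  have hne1 : cx - cst (a j) ≠ 0 := cx_sub_cst_ne_zero _
  have hne2 := cx_sub_one_ne_zero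
  have hX : φ cx = F / cy := h.map_x_root hij
  have y0 := cy_ne_zero
  have F0 : F ≠ 0 := ratF_ne_zero (h.ne 4) _ _
  rcases p with _ | c
  · refine ⟨Pt.exc k 0, fun e => absurd e (by cases hij <;> decide), by cases hij <;> rfl, ?_, fun _ _ => ?_⟩
    · rw [h.map_base]
      have key := localRing_sub_of_eq_mul (U := (F / (cx - cst (a i)))⁻¹) (U₀ := G₀⁻¹)
        (W := (φ cx)⁻¹) hw (h.isCoord_map none (some (a i))) (by rw [hX]; field_simp)
        (fun t ht => (hU t ht).inv ht hG0) (inv_ne_zero hG0) 0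
      rw [zero_div, cst_zero, sub_zero, ← cst_zero] at key
      cases hij <;> exact key
    · have hc := Pt.isCoord a (Pt.exc k 0)
      cases hij
      all_goals
        refine ⟨?_, ?_, ?_, ?_, ?_, ?_, ?_, ?_, ?_⟩
        · refine UnitAt.congr (((HasVal.cst (a 4)).unitAt hc (h.ne 4)).div
            ((hxv _).sub_one.unitAt hc (sub_ne_zero.mpr hd))) ?_
          simp [Pt.yval, Pt.xval, Pt.excE, Pt.pole, cenY, hX, hF, ratF]
          field_simp
        all_goals
          intro e
          simp [Pt.yval, hne, hd, h.ne] at e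
        · exact UnitAt.congr UnitAt.one (by simp [Pt.excE, centre, hne0])
  · have hc0 : c ≠ 0 := by
      rintro rfl
      have := (Pt.valid_some_some.mp hP).2 rfl
      cases hij <;> simp [evolve] at this
    refine ⟨Pt.exc k (G₀ / c), fun e => absurd e (by cases hij <;> decide), by cases hij <;> rfl, ?_, fun _ _ => ?_⟩
    · rw [h.map_base]
      have key := localRing_sub_of_eq_div (W := φ cx) hw (h.isCoord_map' (some (a i)))
        (by rw [hX]; field_simp) hU hG0 hc0
      cases hij <;> exact key
    · have hc := Pt.isCoord a (Pt.exc k (G₀ / c))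
      cases hij
      all_goals
        refine ⟨?_, ?_, ?_, ?_, ?_, ?_, ?_, ?_, ?_⟩
        · refine UnitAt.congr (((hasVal_exc_ratio (G₀ / c)).unitAt hc (div_ne_zero hG0 hc0)).div
            (unitAt_sub hc (hxv _) hne)) ?_
          simp [Pt.yval, Pt.xval, Pt.excE, Pt.pole, cenY, centre]
          field_simp
          exact div_self hne0
        all_goals
          intro e
          simp [Pt.yval, hne, hd, h.ne] at e
        · exact UnitAt.congr UnitAt.one (by simp [Pt.excE, centre, hne0])

/-- The zero and the pole of `F` at `1` cancel, so the fibre corresponds to a fibre as in the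
generic case. The curves are then matched differently, which is why the comparison of divisor
classes assumes `a₁, a₂ ≠ 1`. -/
theorem hasImage_base_root_of_eq_one (h : IsMapping φ a) (hij : IsRootIndex i j m k l) {p : Option ℂ}
    (hP : (Pt.base p (some (a i))).Valid (evolve a)) (hd : a i = 1) :
    HasImage φ a (Pt.base p (some (a i))) := by
  set F := ratF (a 4) (a i) (a j) with hF
  have hne := hij.ne h.adm
  set F₀ := a 4 * (1 - a j) with hF₀
  have hF0 : F₀ ≠ 0 := mul_ne_zero (h.ne 4) (by rw [← hd]; exact sub_ne_zero.mpr hne)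
  have hxv : ∀ t, HasVal (cx - cst (a i)) t cx 1 := fun t => hd ▸ HasVal.of_sub HasEv.left
  have hU : ∀ t, IsCoord (cx - cst (a i)) t → HasVal (cx - cst (a i)) t F F₀ := by
    intro t _
    have := hasVal_ratF_one (k := a 4) (β := a j) (hxv t)
    simpa only [hF, hd] using this
  have hX : φ cx = F / cy := h.map_x_root hij
  rcases p with _ | c
  · exact absurd hd (Pt.valid_none_some.mp hP)
  · have hc0 : c ≠ 0 := by
      rintro rfl
      have := (Pt.valid_some_some.mp hP).2 rfl
      cases hij <;> simp [evolve] at this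
    refine ⟨Pt.base (some (a i)) (some (F₀ / c)), ?_, by cases hij <;> rfl, ?_, fun _ _ => by cases hij <;> contradiction⟩
    · rw [Pt.valid_some_some]
      exact ⟨fun e => absurd e (div_ne_zero hF0 hc0), fun e => absurd e (h.ne i)⟩
    · rw [h.map_base]
      have hy : IsCoord (cx - cst (a i)) cy := isCoord_y (some (a i))
      exact localRing_sub_of_eq_div (W := φ cx) hy (h.isCoord_map' (some (a i))) hX hU hF0 hc0

theorem map_centre_root (h : IsMapping φ a) (hij : IsRootIndex i j m k l) : φ (centre (evolve a) l).1 = φ cx ∧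
    φ (centre (evolve a) l).2 = cx - cst (a i) := by
  have e : centre (evolve a) l = (cx, cy - cst (a i)) := by cases hij <;> rfl
  rw [e, map_sub, h.map_y, map_cst]
  exact ⟨rfl, rfl⟩

/-- The coordinate of the curve over `(0, a_i)` is `(x - a_i)/x̄ = y / (F/(x - a_i))`, so this curve
comes from the fibre `x = a_i`. The value `0` would be the centre `(a_i, 0)` itself; it is replaced
by the point where the strict transform of the fibre meets the exceptional curve. -/
theorem hasImage_exc_root (h : IsMapping φ a) (hij : IsRootIndex i j m k l) (hd : a i ≠ 1) (c : ℂ) :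
    HasImage φ a (Pt.exc l c) := by
  set F := ratF (a 4) (a i) (a j) with hF
  set G₀ := a 4 * (a i - a j) / (a i - 1) with hG₀
  have hne := hij.ne h.adm
  have hG0 : G₀ ≠ 0 := div_ne_zero (mul_ne_zero (h.ne 4) (sub_ne_zero.mpr hne))
    (sub_ne_zero.mpr hd)
  have hxv : ∀ t, HasVal (cx - cst (a i)) t cx (a i) := fun t => HasVal.of_sub HasEv.left
  have hG : ∀ s t, IsCoord s t → HasVal s t (cx - cst (a i)) 0 →
      HasVal s t (F / (cx - cst (a i))) G₀ :=
    fun s t ht hs => hasVal_ratF_div ht (HasVal.of_sub hs) hd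
  have hy : IsCoord (cx - cst (a i)) cy := isCoord_y (some (a i))
  have hXc : IsCoord (φ cx) (cx - cst (a i)) := h.isCoord.sub_cst _
  have hne0 : cx - cst (a i) ≠ 0 := cx_sub_cst_ne_zero _
  have hne1 : cx - cst (a j) ≠ 0 := cx_sub_cst_ne_zero _
  have hne2 := cx_sub_one_ne_zero
  have hX : φ cx = F / cy := h.map_x_root hij
  have y0 := cy_ne_zero
  have k0 : cst (a 4) ≠ 0 := cst_ne_zero (h.ne 4)
  have F0 : F ≠ 0 := ratF_ne_zero (h.ne 4) _ _
  -- The product of `y` and `x̄` is `F`, so this quotient is simply `a₅/(x - 1)`.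
  have ehy : ∀ R : Subalgebra ℂ FuncField, UnitAt R (cst (a 4) / (cx - 1)) →
      UnitAt R (cy * φ cx / ((cx - cst (a i)) * (cx - cst (a j)))) := by
    intro R hR
    refine UnitAt.congr hR ?_
    rw [hX, hF, ratF]
    field_simp
  by_cases hc0 : c = 0
  · subst hc0
    refine ⟨Pt.corner k, trivial, by cases hij <;> rfl, ?_, fun _ _ => ?_⟩
    · change localRing (φ (centre (evolve a) l).1)
        (φ ((centre (evolve a) l).2 / (centre (evolve a) l).1 - cst 0)) = _
      rw [cst_zero, sub_zero, map_div₀, (h.map_centre_root hij).1, (h.map_centre_root hij).2]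
      have e : φ cx = F / (cx - cst (a i)) * ((cx - cst (a i)) / cy) := by
        rw [hX]; field_simp
      have hc2 := hXc.div
      rw [e] at hc2 ⊢
      refine (localRing_unit_corner hy.div'' hc2 hG hG0).trans ?_
      rw [div_div_cancel₀ (hy.left_ne_zero)]
      cases hij <;> rfl
    · have hc := Pt.isCoord a (Pt.corner k)
      have hz : HasVal ((Pt.corner k).u a) ((Pt.corner k).v a) (cx - cst (a i)) 0 :=
        by
        cases hij <;> exact hasVal_corner_left (isCoord_centre a _)
      cases hij
      all_goals
        refine ⟨?_, ?_, ?_, ?_, ?_, ?_, ?_, ?_, ?_⟩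
        · refine UnitAt.congr (ehy _ (((HasVal.cst (a 4)).unitAt hc (h.ne 4)).div
            ((HasVal.of_sub hz).sub_one.unitAt hc (sub_ne_zero.mpr hd)))) ?_
          simp [Pt.yval, Pt.xval, Pt.excE, Pt.pole, cenX, cenY, evolve, centre]
          try field_simp
        all_goals
          intro e
          simp [Pt.yval, cenY, evolve, hne, hd, h.ne] at e
        · refine UnitAt.congr ((hG _ _ hc hz).unitAt hc hG0) ?_
          simp [Pt.excE, centre, hX]
          field_simp
  · have eqr : localRing (φ ((Pt.exc l c).u (evolve a))) (φ ((Pt.exc l c).v (evolve a))) =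
        (Pt.base (some (a i)) (some (G₀ / c⁻¹))).ring a := by
      change localRing (φ (centre (evolve a) l).1)
        (φ ((centre (evolve a) l).2 / (centre (evolve a) l).1 - cst c)) = _
      rw [map_sub, map_cst, map_div₀, (h.map_centre_root hij).1, (h.map_centre_root hij).2,
        localRing_exc_swap hXc hc0]
      exact localRing_sub_of_eq_div hy hXc.swap.div (by rw [hX]; field_simp)
        (fun t ht => hG _ t ht HasEv.left) hG0 (inv_ne_zero hc0)
    refine ⟨Pt.base (some (a i)) (some (G₀ / c⁻¹)), ?_, by cases hij <;> rfl, eqr, fun _ _ => ?_⟩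
    · rw [Pt.valid_some_some]
      exact ⟨fun e => absurd e (div_ne_zero hG0 (inv_ne_zero hc0)), fun e => absurd e (h.ne i)⟩
    · have hc := Pt.isCoord a (Pt.base (some (a i)) (some (G₀ / c⁻¹)))
      cases hij
      all_goals
        refine ⟨?_, ?_, ?_, ?_, ?_, ?_, ?_, ?_, ?_⟩
        · refine UnitAt.congr (ehy _ (((HasVal.cst (a 4)).unitAt hc (h.ne 4)).div
            ((hxv _).sub_one.unitAt hc (sub_ne_zero.mpr hd)))) ?_
          simp [Pt.yval, Pt.xval, Pt.excE, Pt.pole, cenX, cenY, evolve, centre]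
          try field_simp
        all_goals
          intro e
          simp [Pt.yval, cenY, evolve, hne, hd, h.ne] at e
        · refine UnitAt.congr (((hG _ _ hc HasEv.left).unitAt hc hG0).div
            ((HasVal.of_sub HasEv.right : HasVal _ _ cy (G₀ / c⁻¹)).unitAt hc
              (div_ne_zero hG0 (inv_ne_zero hc0)))) ?_
          simp [Pt.excE, centre, hX]
          field_simp

/-- The remaining point of the curve over `(0, a_i)` has `(x - a_i)/x̄ = ∞`, hence `y = ∞` on the
fibre `x = a_i`. -/
theorem hasImage_corner_root (h : IsMapping φ a) (hij : IsRootIndex i j m k l) (hd : a i ≠ 1) :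
    HasImage φ a (Pt.corner l) := by
  set F := ratF (a 4) (a i) (a j) with hF
  set G₀ := a 4 * (a i - a j) / (a i - 1) with hG₀
  have hne := hij.ne h.adm
  have hG0 : G₀ ≠ 0 := div_ne_zero (mul_ne_zero (h.ne 4) (sub_ne_zero.mpr hne))
    (sub_ne_zero.mpr hd)
  have hxv : ∀ t, HasVal (cx - cst (a i)) t cx (a i) := fun t => HasVal.of_sub HasEv.left
  have hy : IsCoord (cx - cst (a i)) cy := isCoord_y (some (a i))
  have hXc : IsCoord (φ cx) (cx - cst (a i)) := h.isCoord.sub_cst _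
  have hne0 : cx - cst (a i) ≠ 0 := cx_sub_cst_ne_zero _
  have hne1 : cx - cst (a j) ≠ 0 := cx_sub_cst_ne_zero _
  have hX : φ cx = F / cy := h.map_x_root hij
  have y0 := cy_ne_zero
  refine ⟨Pt.base (some (a i)) none, ?_, by cases hij <;> rfl, ?_, fun _ _ => ?_⟩
  · rwa [Pt.valid_some_none]
  · change localRing (φ ((centre (evolve a) l).1 / (centre (evolve a) l).2))
      (φ (centre (evolve a) l).2) = _
    rw [map_div₀, (h.map_centre_root hij).1, (h.map_centre_root hij).2, localRing_swap]
    exact localRing_of_eq_div (U := F / (cx - cst (a i))) hy hXc.swap.div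
      (by rw [hX]; field_simp) (fun t ht => hasVal_ratF_div ht (hxv t) hd) hG0
  · have hc := Pt.isCoord a (Pt.base (some (a i)) none)
    cases hij
    all_goals
      refine ⟨?_, ?_, ?_, ?_, ?_, ?_, ?_, ?_, ?_⟩
      · refine UnitAt.congr (UnitAt.one.div (unitAt_sub hc (hxv _) hne)) ?_
        simp [Pt.yval, Pt.xval, Pt.excE, Pt.pole, cenX, cenY, evolve, centre, h.map_y, map_cst]
        field_simp
      all_goals
        intro e
        simp [Pt.yval, cenY, evolve, hne, hd, h.ne] at e
      · refine UnitAt.congr UnitAt.one ?_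
        simp [Pt.excE, centre, h.map_y, map_cst, evolve, hne0]

/-- After the cancellation `x̄/(x - 1)` is a unit times `y⁻¹/(x - 1)`, so the curve over `(0, 1)`
comes from the curve over `P₅ = (1, ∞)` instead of a fibre. -/
theorem hasImage_exc_root_of_eq_one (h : IsMapping φ a) (hij : IsRootIndex i j m k l)
    (hd : a i = 1) (c : ℂ) :
    HasImage φ a (Pt.exc l c) ∧ HasImage φ a (Pt.corner l) := by
  set F := ratF (a 4) (a i) (a j) with hF
  have hne := hij.ne h.adm
  set F₀ := a 4 * (1 - a j) with hF₀
  have hF0 : F₀ ≠ 0 := mul_ne_zero (h.ne 4) (by rw [← hd]; exact sub_ne_zero.mpr hne)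
  have hFv : ∀ s t, IsCoord s t → HasVal s t (cx - 1) 0 → HasVal s t F F₀ := by
    intro s t _ hx
    have := hasVal_ratF_one (k := a 4) (β := a j) (HasVal.of_sub (by rwa [cst_one]) :
      HasVal s t cx 1)
    rwa [hF, hd]
  have ez : cx - cst (a i) = cx - 1 := by rw [hd, cst_one]
  have hy : IsCoord (cx - 1) cy := ez ▸ isCoord_y (some (a i))
  have hXc : IsCoord (φ cx) (cx - 1) := ez ▸ h.isCoord.sub_cst _
  have hne2 := cx_sub_one_ne_zero
  have hX : φ cx = F / cy := h.map_x_root hij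
  have y0 := cy_ne_zero
  have hv : ∀ P : Pt, P.yval (evolve a) = some (a i) → some 1 = P.yval (evolve a) := by
    intro P e; rw [e, hd]
  constructor
  · by_cases hc0 : c = 0
    · subst hc0
      refine ⟨Pt.corner 4, trivial, hv _ (by cases hij <;> rfl), ?_, fun _ _ => by cases hij <;> contradiction⟩
      change localRing (φ (centre (evolve a) l).1)
        (φ ((centre (evolve a) l).2 / (centre (evolve a) l).1 - cst 0)) = _
      rw [cst_zero, sub_zero, map_div₀, (h.map_centre_root hij).1, (h.map_centre_root hij).2, ez]
      have e : φ cx = F * cy⁻¹ := by rw [hX, div_eq_mul_inv]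
      have hc2 := hXc.div
      rw [e] at hc2 ⊢
      refine (localRing_unit_corner hy.inv hc2 hFv hF0).trans ?_
      rw [localRing_swap]
      rfl
    · refine ⟨Pt.exc 4 (c⁻¹ / F₀), fun e => absurd e (by cases hij <;> decide), hv _ (by cases hij <;> rfl), ?_,
        fun _ _ => by cases hij <;> contradiction⟩
      change localRing (φ (centre (evolve a) l).1)
        (φ ((centre (evolve a) l).2 / (centre (evolve a) l).1 - cst c)) = _
      rw [map_sub, map_cst, map_div₀, (h.map_centre_root hij).1, (h.map_centre_root hij).2, ez,
        localRing_exc_swap hXc hc0]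
      exact localRing_sub_of_eq_mul (U := F) hy.inv.div hXc.swap.div (by rw [hX]; field_simp)
        (fun t ht => hFv _ t ht HasEv.left) hF0 _
  · refine ⟨Pt.exc 4 0, fun e => absurd e (by cases hij <;> decide), hv _ (by cases hij <;> rfl), ?_,
      fun _ _ => by cases hij <;> contradiction⟩
    change localRing (φ ((centre (evolve a) l).1 / (centre (evolve a) l).2))
      (φ (centre (evolve a) l).2) = _
    rw [map_div₀, (h.map_centre_root hij).1, (h.map_centre_root hij).2, localRing_swap, ez]
    refine (localRing_of_eq_mul (U := F) (w := cy⁻¹ / (cx - 1)) hy.inv.div hXc.swap.div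
      (by rw [hX]; field_simp) (fun t ht => hFv _ t ht HasEv.left) hF0).trans ?_
    change _ = localRing (cx - 1) (cy⁻¹ / (cx - 1) - cst 0)
    rw [cst_zero, sub_zero]

end IsMapping

/-! ### The curves over `P₆` and `P₇` of the target -/

namespace IsMapping

variable {φ : FuncField ≃ₐ[ℂ] FuncField} {a : Fin 5 → ℂ}

theorem map_centre_five (h : IsMapping φ a) : φ (centre (evolve a) 5).1 = (φ cx)⁻¹ ∧
    φ (centre (evolve a) 5).2 = cx - 1 := by
  have e : centre (evolve a) 5 = (cx⁻¹, cy - 1) := rfl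
  rw [e, map_sub, h.map_y, map_one, map_inv₀]
  exact ⟨rfl, rfl⟩

/-- The coordinate of the curve over `P₆ = (∞, 1)` is `(x - 1) x̄ = (F (x - 1))/y`, with numerator
of value `K` at `x = 1`. So the curve comes from the fibre `x = 1`, on which `y = ∞` has to be
replaced by a point over `P₅`. -/
theorem hasImage_exc_five (h : IsMapping φ a) (h0 : a 0 ≠ 1) (h1 : a 1 ≠ 1) (c : ℂ) :
    HasImage φ a (Pt.exc 5 c) ∧ HasImage φ a (Pt.corner 5) := by
  set F := ratF (a 4) (a 0) (a 1) with hF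
  set K := a 4 * (1 - a 0) * (1 - a 1) with hK
  have hK0 : K ≠ 0 := mul_ne_zero (mul_ne_zero (h.ne 4) (sub_ne_zero.mpr h0.symm))
    (sub_ne_zero.mpr h1.symm)
  have hxv : ∀ s t, HasVal s t (cx - 1) 0 → HasVal s t cx 1 :=
    fun s t hx => HasVal.of_sub (by simpa using hx)
  have hKv : ∀ s t, IsCoord s t → HasVal s t (cx - 1) 0 → HasVal s t (F * (cx - 1)) K :=
    fun s t _ hx => hasVal_ratF_mul (hxv s t hx)
  have hKi : ∀ s t, IsCoord s t → HasVal s t (cx - 1) 0 → HasVal s t (F * (cx - 1))⁻¹ K⁻¹ :=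
    fun s t hc hx => (hKv s t hc hx).inv hc hK0
  have hz : par cx (some 1) = cx - 1 := by simp
  have hy : IsCoord (cx - 1) cy := hz ▸ isCoord_y (some 1)
  have hXc : IsCoord (φ cx)⁻¹ (cx - 1) := (by
    have := h.isCoord.sub_cst 1
    rw [cst_one] at this
    exact this.swap.inv.swap)
  have hne0 : cx - cst (a 0) ≠ 0 := cx_sub_cst_ne_zero _
  have hne1 : cx - cst (a 1) ≠ 0 := cx_sub_cst_ne_zero _
  have hne := cx_sub_one_ne_zero
  have hX : φ cx = F / cy := h.map_x
  have X0 := h.x_ne_zero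
  have y0 := cy_ne_zero
  have F0 : F ≠ 0 := ratF_ne_zero (h.ne 4) _ _
  constructor
  · by_cases hc0 : c = 0
    · subst hc0
      refine ⟨Pt.corner 4, trivial, rfl, ?_, fun _ _ => ?_⟩
      · change localRing (φ (centre (evolve a) 5).1)
          (φ ((centre (evolve a) 5).2 / (centre (evolve a) 5).1 - cst 0)) = _
        rw [cst_zero, sub_zero, map_div₀, h.map_centre_five.1, h.map_centre_five.2]
        have e : (φ cx)⁻¹ = (F * (cx - 1))⁻¹ * ((cx - 1) / cy⁻¹) := by
          rw [hX]; field_simp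
        have hc2 := hXc.div
        rw [e] at hc2 ⊢
        refine (localRing_unit_corner hy.inv.div'' hc2 hKi (inv_ne_zero hK0)).trans ?_
        rw [div_div_cancel₀ hne]
        rfl
      · have hc := Pt.isCoord a (Pt.corner 4)
        have hxz : HasVal ((Pt.corner 4).u a) ((Pt.corner 4).v a) (cx - 1) 0 :=
          hasVal_corner_left (isCoord_centre a 4)
        have hx := hxv _ _ hxz
        refine ⟨?_, ?_, ?_, ?_, ?_, ?_, ?_, ?_, ?_⟩
        · refine UnitAt.congr ((UnitAt.one.div (unitAt_sub hc hx h0.symm)).div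
            (unitAt_sub hc hx h1.symm)) ?_
          simp [Pt.yval, Pt.xval, Pt.excE, Pt.pole, cenX, cenY, centre, X0]
          field_simp
        all_goals
          intro e
          simp [Pt.yval, cenY, h0.symm, h1.symm] at e
        · refine UnitAt.congr ((hKi _ _ hc hxz).unitAt hc (inv_ne_zero hK0)) ?_
          simp [Pt.excE, centre, hX]
          field_simp
    · have eqr : localRing (φ ((Pt.exc 5 c).u (evolve a))) (φ ((Pt.exc 5 c).v (evolve a))) =
          (Pt.base (some 1) (some (c⁻¹ / K⁻¹))).ring a := by
        change localRing (φ (centre (evolve a) 5).1)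
          (φ ((centre (evolve a) 5).2 / (centre (evolve a) 5).1 - cst c)) = _
        rw [map_sub, map_cst, map_div₀, h.map_centre_five.1, h.map_centre_five.2,
          localRing_exc_swap hXc hc0, Pt.ring, Pt.u, Pt.v, hz]
        exact localRing_sub_of_eq_mul (U := (F * (cx - 1))⁻¹) hy hXc.swap.div
          (by rw [hX]; field_simp) (fun t ht => hKi _ t ht HasEv.left) (inv_ne_zero hK0) _
      have hv0 : c⁻¹ / K⁻¹ ≠ 0 := div_ne_zero (inv_ne_zero hc0) (inv_ne_zero hK0)
      refine ⟨Pt.base (some 1) (some (c⁻¹ / K⁻¹)), ?_, rfl, eqr, fun _ _ => ?_⟩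
      · rw [Pt.valid_some_some]
        exact ⟨fun e => absurd e hv0, fun e => absurd e one_ne_zero⟩
      · have hc := Pt.isCoord a (Pt.base (some 1) (some (c⁻¹ / K⁻¹)))
        have hxz : HasVal ((Pt.base (some 1) (some (c⁻¹ / K⁻¹))).u a)
            ((Pt.base (some 1) (some (c⁻¹ / K⁻¹))).v a) (cx - 1) 0 := by
          rw [← hz]; exact HasEv.left
        have hx := hxv _ _ hxz
        have hyv : HasVal ((Pt.base (some 1) (some (c⁻¹ / K⁻¹))).u a)
            ((Pt.base (some 1) (some (c⁻¹ / K⁻¹))).v a) cy (c⁻¹ / K⁻¹) := HasVal.of_sub HasEv.right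
        refine ⟨?_, ?_, ?_, ?_, ?_, ?_, ?_, ?_, ?_⟩
        · refine UnitAt.congr (((hyv.unitAt hc hv0).div (unitAt_sub hc hx h0.symm)).div
            (unitAt_sub hc hx h1.symm)) ?_
          simp [Pt.yval, Pt.xval, Pt.excE, Pt.pole, cenX, cenY, centre, X0]
          field_simp
        all_goals
          intro e
          simp [Pt.yval, cenY, h0.symm, h1.symm] at e
        · refine UnitAt.congr (((hKi _ _ hc hxz).unitAt hc (inv_ne_zero hK0)).mul
            (hyv.unitAt hc hv0)) ?_
          simp [Pt.excE, centre, hX]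
          field_simp
  · refine ⟨Pt.base (some 1) (some 0), ?_, rfl, ?_, fun _ _ => ?_⟩
    · rw [Pt.valid_some_some]
      exact ⟨fun _ => ⟨h0.symm, h1.symm⟩, fun e => absurd e one_ne_zero⟩
    · change localRing (φ ((centre (evolve a) 5).1 / (centre (evolve a) 5).2))
        (φ (centre (evolve a) 5).2) = _
      rw [map_div₀, h.map_centre_five.1, h.map_centre_five.2, localRing_swap, Pt.ring, Pt.u, Pt.v,
        hz, par_some, cst_zero, sub_zero]
      exact localRing_of_eq_mul (U := (F * (cx - 1))⁻¹) hy hXc.swap.div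
          (by rw [hX]; field_simp) (fun t ht => hKi _ t ht HasEv.left) (inv_ne_zero hK0)
    · have hc := Pt.isCoord a (Pt.base (some 1) (some 0))
      refine ⟨?_, ?_, ?_, ?_, ?_, ?_, ?_, ?_, ?_⟩
      · refine UnitAt.congr ((HasVal.cst (a 4)).unitAt hc (h.ne 4)) ?_
        simp [Pt.yval, Pt.xval, Pt.excE, Pt.pole, cenX, cenY, centre, h.map_y, hX, hF, ratF]
        field_simp
      all_goals
        intro e
        simp [Pt.yval, cenY, h0.symm, h1.symm] at e
      · refine UnitAt.congr UnitAt.one ?_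
        simp [Pt.excE, centre, h.map_y, hne]

/-- If `F` is a unit at `x = 1`, then `1/x̄` is a unit times `y`, and the curve over `(∞, 1)` comes
from the curve over the centre `(1, 0)`. -/
theorem hasImage_exc_five_of_eq_one (h : IsMapping φ a) {i : Fin 8} {β : ℂ} (hβ : β ≠ 1)
    (hX : φ cx = ratF (a 4) 1 β / cy) (hi : centre a i = (cx - 1, cy)) (hi' : cenX a i = some 1)
    (hi6 : i ≠ 6) (hne : ¬ (a 0 ≠ 1 ∧ a 1 ≠ 1)) (c : ℂ) :
    HasImage φ a (Pt.exc 5 c) ∧ HasImage φ a (Pt.corner 5) := by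
  set F := ratF (a 4) 1 β with hF
  set F₀ := a 4 * (1 - β) with hF₀
  have hF1 : F₀ ≠ 0 := mul_ne_zero (h.ne 4) (sub_ne_zero.mpr hβ.symm)
  have hF0 : F₀⁻¹ ≠ 0 := inv_ne_zero hF1
  have hFv : ∀ s t, IsCoord s t → HasVal s t (cx - 1) 0 → HasVal s t F⁻¹ F₀⁻¹ := by
    intro s t hc hx
    exact (hasVal_ratF_one (HasVal.of_sub (by rwa [cst_one]))).inv hc hF1
  have hz : par cx (some 1) = cx - 1 := by simp
  have hy : IsCoord (cx - 1) cy := hz ▸ isCoord_y (some 1)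
  have hXc : IsCoord (φ cx)⁻¹ (cx - 1) := (by
    have := h.isCoord.sub_cst 1
    rw [cst_one] at this
    exact this.swap.inv.swap)
  have hne2 := cx_sub_one_ne_zero
  have y0 := cy_ne_zero
  constructor
  · by_cases hc0 : c = 0
    · subst hc0
      refine ⟨Pt.corner i, trivial, hi', ?_, fun h0 h1 => absurd ⟨h0, h1⟩ hne⟩
      change localRing (φ (centre (evolve a) 5).1)
          (φ ((centre (evolve a) 5).2 / (centre (evolve a) 5).1 - cst 0)) = _
      rw [cst_zero, sub_zero, map_div₀, h.map_centre_five.1, h.map_centre_five.2]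
      have e : (φ cx)⁻¹ = F⁻¹ * cy := by rw [hX]; field_simp
      have hc2 := hXc.div
      rw [e] at hc2 ⊢
      refine (localRing_unit_corner hy hc2 hFv hF0).trans ?_
      rw [localRing_swap, Pt.ring, Pt.u, Pt.v, hi]
    · refine ⟨Pt.exc i (c⁻¹ / F₀⁻¹), fun e => absurd e hi6, hi', ?_,
        fun h0 h1 => absurd ⟨h0, h1⟩ hne⟩
      change localRing (φ (centre (evolve a) 5).1)
          (φ ((centre (evolve a) 5).2 / (centre (evolve a) 5).1 - cst c)) = _
      rw [map_sub, map_cst, map_div₀, h.map_centre_five.1, h.map_centre_five.2,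
        localRing_exc_swap hXc hc0, Pt.ring, Pt.u, Pt.v, hi]
      exact localRing_sub_of_eq_mul (U := F⁻¹) hy.div hXc.swap.div
        (by rw [hX]; field_simp) (fun t ht => hFv _ t ht HasEv.left) hF0 _
  · refine ⟨Pt.exc i 0, fun e => absurd e hi6, hi', ?_, fun h0 h1 => absurd ⟨h0, h1⟩ hne⟩
    change localRing (φ ((centre (evolve a) 5).1 / (centre (evolve a) 5).2))
        (φ (centre (evolve a) 5).2) = _
    rw [map_div₀, h.map_centre_five.1, h.map_centre_five.2, localRing_swap, Pt.ring, Pt.u, Pt.v,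
      hi, cst_zero, sub_zero]
    exact localRing_of_eq_mul (U := F⁻¹) hy.div hXc.swap.div
        (by rw [hX]; field_simp) (fun t ht => hFv _ t ht HasEv.left) hF0

theorem map_centre_six (h : IsMapping φ a) : φ (centre (evolve a) 6).1 = (φ cx)⁻¹ ∧
    φ (centre (evolve a) 6).2 = cx⁻¹ := by
  have e : centre (evolve a) 6 = (cx⁻¹, cy⁻¹) := rfl
  rw [e, map_inv₀, map_inv₀, h.map_y]
  exact ⟨rfl, rfl⟩

/-- The coordinate `x̄/ȳ = (F/x)/y` equals `a₅/y` on `x = ∞`, so the curve over `P₇` comes from the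
line `x = ∞`. The point `P₈` of the target corresponds to `y = 1`, that is to `P₆`. -/
theorem hasImage_exc_six (h : IsMapping φ a) {c : ℂ} (hc4 : c ≠ (evolve a 4)⁻¹) :
    HasImage φ a (Pt.exc 6 c) := by
  set F := ratF (a 4) (a 0) (a 1) with hF
  have hx : ∀ s t, HasVal s t cx⁻¹ 0 → HasVal s t cx⁻¹ 0 := fun _ _ h => h
  have hU : ∀ s t, IsCoord s t → HasVal s t cx⁻¹ 0 → HasVal s t (F / cx)⁻¹ (a 4)⁻¹ :=
    fun s t hc hx => (hasVal_ratF_div_cx hc hx).inv hc (h.ne 4)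
  have hy : IsCoord cx⁻¹ cy := isCoord_y none
  have hXc : IsCoord (φ cx)⁻¹ cx⁻¹ := h.isCoord.inv.swap.inv.swap
  have hne0 : cx - cst (a 0) ≠ 0 := cx_sub_cst_ne_zero _
  have hne1 : cx - cst (a 1) ≠ 0 := cx_sub_cst_ne_zero _
  have hX : φ cx = F / cy := h.map_x
  have X0 := h.x_ne_zero
  have y0 := cy_ne_zero
  have x0 := cx_ne_zero
  have F0 : F ≠ 0 := ratF_ne_zero (h.ne 4) _ _
  have k0 := inv_ne_zero (h.ne 4)
  by_cases hc0 : c = 0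
  · subst hc0
    refine ⟨Pt.corner 6, trivial, rfl, ?_, fun _ _ => ?_⟩
    · change localRing (φ (centre (evolve a) 6).1)
          (φ ((centre (evolve a) 6).2 / (centre (evolve a) 6).1 - cst 0)) = _
      rw [cst_zero, sub_zero, map_div₀, h.map_centre_six.1, h.map_centre_six.2]
      have e : (φ cx)⁻¹ = (F / cx)⁻¹ * (cx⁻¹ / cy⁻¹) := by
        rw [hX]; field_simp
      have hc2 := hXc.div
      rw [e] at hc2 ⊢
      refine (localRing_unit_corner hy.inv.div'' hc2 hU k0).trans ?_
      rw [div_div_cancel₀ (inv_ne_zero x0)]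
      rfl
    · have hc := Pt.isCoord a (Pt.corner 6)
      have hx : HasVal ((Pt.corner 6).u a) ((Pt.corner 6).v a) cx⁻¹ 0 :=
        hasVal_corner_left (isCoord_centre a 6)
      refine ⟨?_, ?_, ?_, ?_, ?_, ?_, ?_, ?_, ?_⟩
      · refine UnitAt.congr ((UnitAt.one.div (unitAt_sub_div hc hx (a 0))).div
          (unitAt_sub_div hc hx (a 1))) ?_
        simp [Pt.yval, Pt.xval, Pt.excE, Pt.pole, cenX, cenY, centre, h.map_y]
        field_simp
      all_goals
        intro e
        simp [Pt.yval, cenY] at e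
      · exact UnitAt.congr UnitAt.one (by simp [Pt.excE])
      · exact UnitAt.congr UnitAt.one (by simp [Pt.excE])
      · refine UnitAt.congr ((hU _ _ hc hx).unitAt hc k0) ?_
        simp [Pt.excE, centre, hX]
        field_simp
  · have hv0 : c⁻¹ / (a 4)⁻¹ ≠ 0 := div_ne_zero (inv_ne_zero hc0) k0
    refine ⟨Pt.base none (some (c⁻¹ / (a 4)⁻¹)), ?_, rfl, ?_, fun _ _ => ?_⟩
    · rw [Pt.valid_none_some]
      intro e
      apply hc4
      rw [div_eq_one_iff_eq k0] at e
      simp only [evolve, Matrix.cons_val]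
      rw [← e, inv_inv]
    · change localRing (φ (centre (evolve a) 6).1)
          (φ ((centre (evolve a) 6).2 / (centre (evolve a) 6).1 - cst c)) = _
      rw [map_sub, map_cst, map_div₀, h.map_centre_six.1, h.map_centre_six.2,
        localRing_exc_swap hXc hc0]
      exact localRing_sub_of_eq_mul (U := (F / cx)⁻¹) hy hXc.swap.div
        (by rw [hX]; field_simp) (fun t ht => hU _ t ht HasEv.left) k0 _
    · have hc := Pt.isCoord a (Pt.base none (some (c⁻¹ / (a 4)⁻¹)))
      have hx : HasVal ((Pt.base none (some (c⁻¹ / (a 4)⁻¹))).u a)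
        ((Pt.base none (some (c⁻¹ / (a 4)⁻¹))).v a) cx⁻¹ 0 := HasEv.left
      have hyv : HasVal ((Pt.base none (some (c⁻¹ / (a 4)⁻¹))).u a)
        ((Pt.base none (some (c⁻¹ / (a 4)⁻¹))).v a) cy (c⁻¹ / (a 4)⁻¹) := HasVal.of_sub HasEv.right
      have hyu := hyv.unitAt hc hv0
      refine ⟨?_, ?_, ?_, ?_, ?_, ?_, ?_, ?_, ?_⟩
      · refine UnitAt.congr ((hyu.div (unitAt_sub_div hc hx (a 0))).div
          (unitAt_sub_div hc hx (a 1))) ?_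
        simp [Pt.yval, Pt.xval, Pt.excE, Pt.pole, cenX, cenY, centre, h.map_y]
        field_simp
      all_goals
        intro e
        simp [Pt.yval, cenY] at e
      · exact UnitAt.congr UnitAt.one (by simp [Pt.excE])
      · exact UnitAt.congr UnitAt.one (by simp [Pt.excE])
      · refine UnitAt.congr (((hU _ _ hc hx).unitAt hc k0).mul hyu) ?_
        simp [Pt.excE, centre, hX]
        field_simp

theorem hasImage_corner_six (h : IsMapping φ a) : HasImage φ a (Pt.corner 6) := by
  set F := ratF (a 4) (a 0) (a 1) with hF
  have hU : ∀ s t, IsCoord s t → HasVal s t cx⁻¹ 0 → HasVal s t (F / cx)⁻¹ (a 4)⁻¹ :=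
    fun s t hc hx => (hasVal_ratF_div_cx hc hx).inv hc (h.ne 4)
  have hy : IsCoord cx⁻¹ cy := isCoord_y none
  have hXc : IsCoord (φ cx)⁻¹ cx⁻¹ := h.isCoord.inv.swap.inv.swap
  have hne0 : cx - cst (a 0) ≠ 0 := cx_sub_cst_ne_zero _
  have hne1 : cx - cst (a 1) ≠ 0 := cx_sub_cst_ne_zero _
  have hX : φ cx = F / cy := h.map_x
  have y0 := cy_ne_zero
  have x0 := cx_ne_zero
  have F0 : F ≠ 0 := ratF_ne_zero (h.ne 4) _ _
  refine ⟨Pt.base none (some 0), ?_, rfl, ?_, fun _ _ => ?_⟩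
  · rw [Pt.valid_none_some]
    exact zero_ne_one
  · change localRing (φ ((centre (evolve a) 6).1 / (centre (evolve a) 6).2))
      (φ (centre (evolve a) 6).2) = _
    rw [map_div₀, h.map_centre_six.1, h.map_centre_six.2, localRing_swap, Pt.ring, Pt.u, Pt.v,
      par_some, cst_zero, sub_zero]
    exact localRing_of_eq_mul (U := (F / cx)⁻¹) hy hXc.swap.div
        (by rw [hX]; field_simp) (fun t ht => hU _ t ht HasEv.left) (inv_ne_zero (h.ne 4))
  · have hc := Pt.isCoord a (Pt.base none (some 0))
    have hx : HasVal ((Pt.base none (some 0)).u a) ((Pt.base none (some 0)).v a) cx⁻¹ 0 :=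
      HasEv.left
    refine ⟨?_, ?_, ?_, ?_, ?_, ?_, ?_, ?_, ?_⟩
    · refine UnitAt.congr ((((hasVal_ratF_div_cx (k := a 4) (α := a 0) (β := a 1) hc hx).unitAt hc
        (h.ne 4)).div (unitAt_sub_div hc hx (a 0))).div (unitAt_sub_div hc hx (a 1))) ?_
      simp [Pt.yval, Pt.xval, Pt.excE, Pt.pole, cenX, cenY, centre, h.map_y, hX]
      field_simp
      rw [hF]
    all_goals
      intro e
      simp [Pt.yval, cenY] at e
    · exact UnitAt.congr UnitAt.one (by simp [Pt.excE])
    · exact UnitAt.congr UnitAt.one (by simp [Pt.excE])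
    · refine UnitAt.congr UnitAt.one ?_
      simp [Pt.excE, centre, h.map_y, x0]

end IsMapping

/-! ### The curves over `P₁` and `P₂` of the target -/

namespace IsMapping

variable {φ : FuncField ≃ₐ[ℂ] FuncField} {a : Fin 5 → ℂ} {i j m : Fin 5} {k l : Fin 8}

theorem q_mul_root (h : IsMapping φ a) (hij : IsRootIndex i j m k l) :
    a m * evolve a i = -(a 4 * a 0 * a 1) := by
  cases hij
  exacts [h.q_mul.1, h.q_mul.2]

theorem map_centre_zero_root (h : IsMapping φ a) (hij : IsRootIndex i j m k l) :
    φ (centre (evolve a) k).1 = φ cx - cst (evolve a i) ∧ φ (centre (evolve a) k).2 = cx := by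
  have e : centre (evolve a) k = (cx - cst (evolve a i), cy) := by cases hij <;> rfl
  rw [e, map_sub, h.map_y, map_cst]
  exact ⟨rfl, rfl⟩

/-- The centre `(b, 0)` of the target, with `b = F(0)/a_m`, is the image of the centre `(0, a_m)`.
Both are blown up, and the map of the exceptional curves is the one induced by the differential. -/
theorem hasImage_exc_zero_root (h : IsMapping φ a) (hij : IsRootIndex i j m k l) (c : ℂ) :
    HasImage φ a (Pt.exc k c) ∧ HasImage φ a (Pt.corner k) := by
  set F := ratF (a 4) (a 0) (a 1) with hF
  set F₀ := -(a 4 * a 0 * a 1) with hF₀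
  set b := evolve a i with hb
  have hb0 : b ≠ 0 := h.evolve_ne i
  have hq : a m * b = F₀ := h.q_mul_root hij
  have ha2 : a m ≠ 0 := h.ne m
  have x0 := cx_ne_zero
  have y0 := cy_ne_zero
  have hX : φ cx = F / cy := h.map_x
  have hXc : IsCoord (φ cx - cst b) cx := (h.isCoord.swap.sub_cst b).swap
  have X0 : φ cx - cst b ≠ 0 := hXc.left_ne_zero
  have yc0 : cy - cst (a m) ≠ 0 := sub_ne_zero.mpr (cy_ne_cst _)
  have hw : IsCoord cx ((cy - cst (a m)) / cx) := (isCoord_cx_cy.sub_cst (a m)).div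
  have hFv : ∀ s t, IsCoord s t → HasVal s t cx 0 → HasVal s t F F₀ := by
    intro s t hc hx
    exact (hasVal_ratF hc hx zero_ne_one).congr rfl (by rw [hF₀]; ring)
  have hyX : ∀ s t, IsCoord s t → HasVal s t cx 0 → HasVal s t (φ cx - cst b) 0 →
      HasVal s t cy (a m) := by
    intro s t hc hx hX'
    refine (HasVal.div hc (hFv s t hc hx) (HasVal.of_sub hX') hb0).congr ?_ ?_
    · rw [hX, div_div_cancel₀ (ratF_ne_zero (h.ne 4) _ _)]
    · rw [← hq, mul_div_cancel_right₀ _ hb0]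
  -- From `F(0) = a_m b` one has `x̄ - b = (F - F(0))/y - b (y - a_m)/y`. Division by `x` gives an
  -- affine function of `(y - a_m)/x` whose coefficients are constant along the exceptional curve.
  set A := (F + cst (a 4 * a 0 * a 1)) / cx / cy with hA
  set A₀ := a 4 * (a 0 + a 1 - a 0 * a 1) / a m with hA₀
  set B := -cst b / cy with hB
  set B₀ := -b / a m with hB₀
  have hAv : ∀ s t, IsCoord s t → HasVal s t cx 0 → HasVal s t cy (a m) → HasVal s t A A₀ :=
    fun s t hc hx hy => HasVal.div hc (hasVal_ratF_sub_div hc hx) hy ha2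
  have hBv : ∀ s t, IsCoord s t → HasVal s t cy (a m) → HasVal s t B B₀ :=
    fun s t hc hy => HasVal.div hc (HasEv.neg (HasVal.cst b)) hy ha2
  have hB0 : B₀ ≠ 0 := div_ne_zero (neg_ne_zero.mpr hb0) ha2
  have key : (φ cx - cst b) / cx = A + B * ((cy - cst (a m)) / cx) := by
    have e : cst (a 4 * a 0 * a 1) = - (cst (a m) * cst b) := by
      rw [← cst_mul, hq, hF₀, cst_neg, neg_neg]
    rw [hX, hA, hB, e]
    field_simp
    ring
  have aff : ∀ c', localRing cx ((φ cx - cst b) / cx - cst c') =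
      (Pt.exc l ((c' - A₀) / B₀)).ring a := by
    intro c'
    have hc1 := hw.sub_cst ((c' - A₀) / B₀)
    have hc2 := hXc.swap.div.sub_cst c'
    have ha := hasVal_exc_right hXc.swap c'
    have hy1 : HasVal cx ((cy - cst (a m)) / cx - cst ((c' - A₀) / B₀)) cy (a m) :=
      HasVal.of_sub (hasVal_exc_right (isCoord_cx_cy.sub_cst (a m)) _)
    have hy2 := hyX _ _ hc2 HasEv.left ha
    have er : (Pt.exc l ((c' - A₀) / B₀)).ring a =
        localRing cx ((cy - cst (a m)) / cx - cst ((c' - A₀) / B₀)) := by cases hij <;> rfl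
    rw [er]
    refine localRing_affine (A := A) (B := B) (c := c') (E := 1) hw hc2 (mul_one _).symm
      (by rw [key]) HasEv.one (hAv _ _ hc1 HasEv.left hy1) (hBv _ _ hc1 hy1) HasEv.one
      (hAv _ _ hc2 HasEv.left hy2) (hBv _ _ hc2 hy2) one_ne_zero hB0 ?_ ?_ <;> field_simp <;> ring
  have compat : ∀ P' : Pt, P'.xval a = some 0 → P'.yval a = some (a m) →
      (∀ n, n ≠ l → P'.excE a n = 1) →
      ∀ P : Pt, P.xval (evolve a) = some b → P.yval (evolve a) = some 0 →
      (∀ j, j ≠ k → P.excE (evolve a) j = 1) →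
      UnitAt (P'.ring a) (P'.excE a l / φ (P.excE (evolve a) k)) → PicCompat φ a P P' := by
    intro P' hx' hy' hl P hx hy hj hu
    have hc := P'.isCoord a
    have hv := P'.hasPVal a
    rw [hx', hy', hasPVal_some, hasPVal_some] at hv
    cases hij
    all_goals
      refine ⟨?_, ?_, ?_, ?_, ?_, ?_, ?_, ?_, ?_⟩
      · refine UnitAt.congr (((hv.2.unitAt hc ha2).div
          (unitAt_sub hc hv.1 (h.ne 0).symm)).div (unitAt_sub hc hv.1 (h.ne 1).symm)) ?_
        rw [hx, hy, hy', hj 2 (by decide), hj 3 (by decide), hj 5 (by decide), hj 6 (by decide)]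
        simp [Pt.pole]
        field_simp
      all_goals
        intro e
        simp [hy, (h.ne 0).symm, (h.ne 1).symm] at e
    exacts [hu, UnitAt.congr UnitAt.one (by rw [hl 3 (by decide), hj 1 (by decide), map_one, div_one]),
      UnitAt.congr UnitAt.one (by rw [hl 2 (by decide), hj 0 (by decide), map_one, div_one]), hu]
  have e0 : ∀ c', (∀ j, j ≠ k → (Pt.exc k c').excE (evolve a) j = 1) ∧
      ∀ j, j ≠ k → (Pt.corner k).excE (evolve a) j = 1 :=
    fun c' => ⟨fun j hj => by cases hij <;> simp [Pt.excE, hj],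
      fun j hj => by cases hij <;> simp [Pt.excE, hj]⟩
  have ek : ∀ c', (Pt.exc k c').excE (evolve a) k = φ.symm (φ cx - cst b) ∧
      (Pt.corner k).excE (evolve a) k = φ.symm cx := by
    intro c'
    rw [← (h.map_centre_zero_root hij).1, ← (h.map_centre_zero_root hij).2]
    simp only [AlgEquiv.symm_apply_apply]
    cases hij <;> simp [Pt.excE]
  have el : ∀ c', (Pt.exc l c').excE a l = cx ∧ (Pt.corner l).excE a l = cy - cst (a m) := by
    intro c'
    cases hij <;> simp [Pt.excE, centre]
  have vl : ∀ c', (Pt.exc l c').xval a = some 0 ∧ (Pt.exc l c').yval a = some (a m) ∧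
      (∀ n, n ≠ l → (Pt.exc l c').excE a n = 1) ∧ ∀ n, n ≠ l → (Pt.corner l).excE a n = 1 := by
    intro c'
    refine ⟨?_, ?_, fun n hn => ?_, fun n hn => ?_⟩
    all_goals cases hij
    all_goals first | rfl | simp [Pt.excE, hn]
  have vk : (Pt.exc k c).xval (evolve a) = some b ∧ (Pt.exc k c).yval (evolve a) = some 0 := by
    constructor
    all_goals cases hij
    all_goals rfl
  constructor
  · by_cases hc0 : c = 0
    · subst hc0
      have e : localRing (φ ((Pt.exc k 0).u (evolve a))) (φ ((Pt.exc k 0).v (evolve a))) =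
          localRing (cx / (φ cx - cst b)) (φ cx - cst b) := by
        change localRing (φ (centre (evolve a) k).1)
          (φ ((centre (evolve a) k).2 / (centre (evolve a) k).1 - cst 0)) = _
        rw [cst_zero, sub_zero, map_div₀, (h.map_centre_zero_root hij).1,
          (h.map_centre_zero_root hij).2, localRing_swap]
      have hc2 := hXc.swap.div'
      have hxv : HasVal (cx / (φ cx - cst b)) (φ cx - cst b) cx 0 := hasVal_corner_left hXc.swap
      have hy2 := hyX _ _ hc2 hxv HasEv.right
      have hP := Pt.isCoord a (Pt.corner l)
      have hcw : (Pt.corner l).ring a = localRing ((cy - cst (a m)) / cx)⁻¹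
          (cx * ((cy - cst (a m)) / cx)) := by
        rw [inv_div, mul_div_cancel₀ _ x0]; cases hij <;> rfl
      have hpv := (Pt.corner l).hasPVal a
      have hPx : HasVal ((cy - cst (a m)) / cx)⁻¹ (cx * ((cy - cst (a m)) / cx)) cx 0 := by
        rw [inv_div, mul_div_cancel₀ _ x0]; cases hij <;> exact hasPVal_some.mp hpv.1
      have hPy : HasVal ((cy - cst (a m)) / cx)⁻¹ (cx * ((cy - cst (a m)) / cx)) cy (a m) := by
        rw [inv_div, mul_div_cancel₀ _ x0]; cases hij <;> exact hasPVal_some.mp hpv.2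
      have hP1 : IsCoord ((cy - cst (a m)) / cx)⁻¹ (cx * ((cy - cst (a m)) / cx)) := by
        rw [inv_div, mul_div_cancel₀ _ x0]; cases hij <;> exact hP
      have main := localRing_affine_corner (E := 1) (A := A) (B := B) hw hc2
        (by rw [← key, inv_div]) (by rw [← key]; field_simp) HasEv.one
        (hAv _ _ hP1 hPx hPy) (hBv _ _ hP1 hPy) HasEv.one (hAv _ _ hc2 hxv hy2)
        (hBv _ _ hc2 hy2) one_ne_zero hB0 hB0
      refine ⟨Pt.corner l, trivial, by cases hij <;> rfl, ?_, fun _ _ => ?_⟩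
      · rw [e, main.1, hcw]
      · refine compat (Pt.corner l) (vl 0).1 (vl 0).2.1 (vl 0).2.2.2 _ vk.1 vk.2 (e0 0).1 ?_
        rw [hcw]
        refine UnitAt.congr (main.2.unitAt hP1 (inv_ne_zero hB0)) ?_
        rw [← key]
        rw [(ek 0).1, (el 0).2, AlgEquiv.apply_symm_apply]
        field_simp
    · have e : localRing (φ ((Pt.exc k c).u (evolve a))) (φ ((Pt.exc k c).v (evolve a))) =
          localRing cx ((φ cx - cst b) / cx - cst c⁻¹) := by
        change localRing (φ (centre (evolve a) k).1)
          (φ ((centre (evolve a) k).2 / (centre (evolve a) k).1 - cst c)) = _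
        rw [map_sub, map_cst, map_div₀, (h.map_centre_zero_root hij).1,
          (h.map_centre_zero_root hij).2,
          localRing_exc_swap hXc hc0]
      refine ⟨Pt.exc l ((c⁻¹ - A₀) / B₀), fun e => absurd e (by cases hij <;> decide),
        by cases hij <;> rfl, by rw [e, aff], fun _ _ => ?_⟩
      refine compat _ (vl _).1 (vl _).2.1 (vl _).2.2.1 _ vk.1 vk.2 (e0 c).1 ?_
      rw [← aff]
      refine UnitAt.congr (((hasVal_exc_ratio c⁻¹).unitAt (hXc.swap.div.sub_cst c⁻¹)
        (inv_ne_zero hc0)).inv) ?_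
      rw [(ek c).1, (el _).1, AlgEquiv.apply_symm_apply, inv_div]
  · refine ⟨Pt.exc l ((0 - A₀) / B₀), fun e => absurd e (by cases hij <;> decide),
      by cases hij <;> rfl, ?_, fun _ _ => ?_⟩
    · rw [← aff, cst_zero, sub_zero]
      change localRing (φ ((centre (evolve a) k).1 / (centre (evolve a) k).2))
        (φ (centre (evolve a) k).2) = _
      rw [map_div₀, (h.map_centre_zero_root hij).1, (h.map_centre_zero_root hij).2, localRing_swap]
    · refine compat _ (vl _).1 (vl _).2.1 (vl _).2.2.1 (Pt.corner k) vk.1 vk.2 (e0 0).2 ?_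
      refine UnitAt.congr UnitAt.one ?_
      rw [(ek 0).2, (el _).1, AlgEquiv.apply_symm_apply, div_self x0]

end IsMapping

/-! ### The curves over `P₅` and `P₈` of the target -/

namespace IsMapping

variable {φ : FuncField ≃ₐ[ℂ] FuncField} {a : Fin 5 → ℂ}

theorem map_centre_four (h : IsMapping φ a) :
    φ (centre (evolve a) 4).1 = φ cx - 1 ∧ φ (centre (evolve a) 4).2 = cx⁻¹ := by
  have e : centre (evolve a) 4 = (cx - 1, cy⁻¹) := rfl
  rw [e, map_sub, map_inv₀, h.map_y, map_one]
  exact ⟨rfl, rfl⟩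

/-- At `P₅` of the target `x = ∞` and `F/y = 1`. As `F` behaves like `a₅x`, this means `x/y = 1/a₅`,
so the curve over `P₅` comes from the curve over `P₈`. -/
theorem hasImage_exc_four (h : IsMapping φ a) (c : ℂ) :
    HasImage φ a (Pt.exc 4 c) ∧ HasImage φ a (Pt.corner 4) := by
  set F := ratF (a 4) (a 0) (a 1) with hF
  set k := a 4 with hk
  have hk0 : k ≠ 0 := h.ne 4
  have x0 := cx_ne_zero
  have y0 := cy_ne_zero
  have kc0 := cst_ne_zero hk0
  have F0 : F ≠ 0 := ratF_ne_zero (h.ne 4) _ _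
  have hX : φ cx = F / cy := h.map_x
  have hXc : IsCoord (φ cx - 1) cx⁻¹ := by
    have := (h.isCoord.swap.sub_cst 1).swap.inv
    rwa [cst_one] at this
  have X0 : φ cx - 1 ≠ 0 := hXc.left_ne_zero
  set m := cx / cy - cst k⁻¹ with hm
  have hm0 : IsCoord cx⁻¹ m := isCoord_centre a 7
  have mne := hm0.right_ne_zero
  have hw : IsCoord cx⁻¹ (m / cx⁻¹) := hm0.div
  have hmX : ∀ s t, IsCoord s t → HasVal s t cx⁻¹ 0 → HasVal s t (φ cx - 1) 0 →
      HasVal s t (cx / cy) k⁻¹ := by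
    intro s t hc hx hX'
    have h1 : HasVal s t (φ cx) 1 := HasVal.of_sub (by rwa [cst_one])
    refine (HasVal.div hc h1 (hasVal_ratF_div_cx (α := a 0) (β := a 1) hc hx) hk0).congr ?_ (one_div k)
    rw [hX]
    field_simp
    rw [div_self F0]
  -- The identity is `x(x̄ - 1) = (F - kx)(x/y) + k · x(x/y - 1/k)`, in which `F - kx` is regular at
  -- infinity.
  set A := (F - cst k * cx) * (cx / cy) with hA
  set A₀ := k * (1 - a 0 - a 1) * k⁻¹ with hA₀
  set B := cst k with hB
  have hAv : ∀ s t, IsCoord s t → HasVal s t cx⁻¹ 0 → HasVal s t (cx / cy) k⁻¹ → HasVal s t A A₀ :=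
    fun s t hc hx hy => HasEv.mul (hasVal_ratF_sub hc hx) hy
  have key : (φ cx - 1) / cx⁻¹ = A + B * (m / cx⁻¹) := by
    rw [hX, hA, hm, cst_inv, ← hB]
    field_simp
    ring
  have aff : ∀ c', localRing cx⁻¹ ((φ cx - 1) / cx⁻¹ - cst c') =
      (Pt.exc 7 ((c' - A₀) / k)).ring a := by
    intro c'
    have hc1 := hw.sub_cst ((c' - A₀) / k)
    have hc2 := hXc.swap.div.sub_cst c'
    have ha := hasVal_exc_right hXc.swap c'
    have hy1 : HasVal cx⁻¹ (m / cx⁻¹ - cst ((c' - A₀) / k)) (cx / cy) k⁻¹ :=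
      HasVal.of_sub (hasVal_exc_right hm0 _)
    have hy2 := hmX _ _ hc2 HasEv.left ha
    change localRing cx⁻¹ ((φ cx - 1) / cx⁻¹ - cst c') =
      localRing cx⁻¹ (m / cx⁻¹ - cst ((c' - A₀) / k))
    refine localRing_affine (A := A) (B := B) (c := c') (E := 1) hw hc2 (mul_one _).symm
      (by rw [key]) HasEv.one (hAv _ _ hc1 HasEv.left hy1) (HasVal.cst k) HasEv.one
      (hAv _ _ hc2 HasEv.left hy2) (HasVal.cst k) one_ne_zero hk0 ?_ ?_ <;> field_simp <;> ring
  have compat : ∀ P' : Pt, P'.xval a = none → P'.yval a = none → P'.excE a 5 = 1 →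
      P'.excE a 6 = cx⁻¹ → ∀ P : Pt, P.xval (evolve a) = some 1 → P.yval (evolve a) = none →
      (∀ j, j ≠ 4 → P.excE (evolve a) j = 1) →
      UnitAt (P'.ring a) (P'.excE a 7 / φ (P.excE (evolve a) 4)) → PicCompat φ a P P' := by
    intro P' hx' hy' h5 h6 P hx hy hj hu
    have hc := P'.isCoord a
    have hv := (P'.hasPVal a).1
    rw [hx', hasPVal_none] at hv
    have hne0 : cx - cst (a 0) ≠ 0 := cx_sub_cst_ne_zero _
    have hne1 : cx - cst (a 1) ≠ 0 := cx_sub_cst_ne_zero _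
    refine ⟨?_, ?_, ?_, ?_, ?_, ?_, ?_, ?_, ?_⟩
    · refine UnitAt.congr ((UnitAt.one.div (unitAt_sub_div hc hv (a 0))).div
        (unitAt_sub_div hc hv (a 1))) ?_
      rw [hx, hy, hy', hj 2 (by decide), hj 3 (by decide), hj 5 (by decide), hj 6 (by decide)]
      simp [Pt.pole, h.map_y]
      field_simp
    all_goals
      intro e
      simp [hy] at e
    · exact UnitAt.congr UnitAt.one (by rw [h5, hj 7 (by decide), map_one, div_one])
    · exact hu
    · refine UnitAt.congr UnitAt.one ?_
      rw [h6, hj 6 (by decide), map_one, mul_one, div_self (inv_ne_zero x0)]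
  have e0 : ∀ c', (∀ j, j ≠ 4 → (Pt.exc 4 c').excE (evolve a) j = 1) ∧
      ∀ j, j ≠ 4 → (Pt.corner 4).excE (evolve a) j = 1 :=
    fun c' => ⟨fun j hj => by simp [Pt.excE, hj], fun j hj => by simp [Pt.excE, hj]⟩
  constructor
  · by_cases hc0 : c = 0
    · subst hc0
      have e : localRing (φ ((Pt.exc 4 0).u (evolve a))) (φ ((Pt.exc 4 0).v (evolve a))) =
          localRing (cx⁻¹ / (φ cx - 1)) (φ cx - 1) := by
        change localRing (φ (centre (evolve a) 4).1)
          (φ ((centre (evolve a) 4).2 / (centre (evolve a) 4).1 - cst 0)) = _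
        rw [cst_zero, sub_zero, map_div₀, h.map_centre_four.1, h.map_centre_four.2, localRing_swap]
      have hc2 := hXc.swap.div'
      have hxv : HasVal (cx⁻¹ / (φ cx - 1)) (φ cx - 1) cx⁻¹ 0 := hasVal_corner_left hXc.swap
      have hy2 := hmX _ _ hc2 hxv HasEv.right
      have ecw : cx⁻¹ * (m / cx⁻¹) = m := mul_div_cancel₀ _ (inv_ne_zero x0)
      have hcw : (Pt.corner 7).ring a = localRing (m / cx⁻¹)⁻¹ (cx⁻¹ * (m / cx⁻¹)) := by
        rw [inv_div, ecw]; rfl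
      have hPx : HasVal (m / cx⁻¹)⁻¹ (cx⁻¹ * (m / cx⁻¹)) cx⁻¹ 0 := by
        rw [inv_div, ecw]; exact ((Pt.corner 7).hasPVal a).1
      have hPy : HasVal (m / cx⁻¹)⁻¹ (cx⁻¹ * (m / cx⁻¹)) (cx / cy) k⁻¹ := by
        rw [inv_div, ecw]; exact HasVal.of_sub HasEv.right
      have hP1 : IsCoord (m / cx⁻¹)⁻¹ (cx⁻¹ * (m / cx⁻¹)) := by
        rw [inv_div, ecw]; exact Pt.isCoord a (Pt.corner 7)
      have main := localRing_affine_corner (E := 1) (A := A) (B := B) hw hc2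
        (by rw [← key, inv_div]) (by rw [← key]; field_simp) HasEv.one
        (hAv _ _ hP1 hPx hPy) (HasVal.cst k) HasEv.one (hAv _ _ hc2 hxv hy2)
        (HasVal.cst k) one_ne_zero hk0 hk0
      refine ⟨Pt.corner 7, trivial, rfl, ?_, fun _ _ => ?_⟩
      · rw [e, main.1, hcw]
      · refine compat _ rfl rfl (by simp [Pt.excE]) (by simp [Pt.excE]) _ rfl rfl (e0 0).1 ?_
        rw [hcw]
        refine UnitAt.congr (main.2.unitAt hP1 (inv_ne_zero hk0)) ?_
        rw [← key]
        simp only [Pt.excE, if_true, h.map_centre_four.1]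
        change _ = m / (φ cx - 1)
        field_simp
    · have e : localRing (φ ((Pt.exc 4 c).u (evolve a))) (φ ((Pt.exc 4 c).v (evolve a))) =
          localRing cx⁻¹ ((φ cx - 1) / cx⁻¹ - cst c⁻¹) := by
        change localRing (φ (centre (evolve a) 4).1)
          (φ ((centre (evolve a) 4).2 / (centre (evolve a) 4).1 - cst c)) = _
        rw [map_sub, map_cst, map_div₀, h.map_centre_four.1, h.map_centre_four.2,
          localRing_exc_swap hXc hc0]
      refine ⟨Pt.exc 7 ((c⁻¹ - A₀) / k), fun e => absurd e (by decide), rfl,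
        by rw [e, aff], fun _ _ => ?_⟩
      refine compat _ rfl rfl (by simp [Pt.excE]) (by simp [Pt.excE]) _ rfl rfl (e0 c).1 ?_
      rw [← aff]
      refine UnitAt.congr (((hasVal_exc_ratio c⁻¹).unitAt (hXc.swap.div.sub_cst c⁻¹)
        (inv_ne_zero hc0)).inv) ?_
      simp only [Pt.excE, if_true, h.map_centre_four.1, inv_div]
      rfl
  · refine ⟨Pt.exc 7 ((0 - A₀) / k), fun e => absurd e (by decide), rfl, ?_, fun _ _ => ?_⟩
    · rw [← aff, cst_zero, sub_zero]
      change localRing (φ ((centre (evolve a) 4).1 / (centre (evolve a) 4).2))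
        (φ (centre (evolve a) 4).2) = _
      rw [map_div₀, h.map_centre_four.1, h.map_centre_four.2, localRing_swap]
    · refine compat _ rfl rfl (by simp [Pt.excE]) (by simp [Pt.excE]) _ rfl rfl (e0 0).2 ?_
      refine UnitAt.congr UnitAt.one ?_
      simp only [Pt.excE, if_true, h.map_centre_four.2]
      change 1 = cx⁻¹ / cx⁻¹
      rw [div_self (inv_ne_zero x0)]

theorem map_centre_seven (h : IsMapping φ a) :
    φ (centre (evolve a) 7).1 = (φ cx)⁻¹ ∧
      φ (centre (evolve a) 7).2 = φ cx / cx - cst (a 4) := by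
  have e : centre (evolve a) 7 = (cx⁻¹, cx / cy - cst (a 4)⁻¹⁻¹) := rfl
  rw [e, map_sub, map_inv₀, map_div₀, h.map_y, map_cst, inv_inv]
  exact ⟨rfl, rfl⟩

/-- At `P₈` of the target `x̄ = ∞` and `x̄/x = a₅`. Since `F/x` tends to `a₅`, this forces `x = ∞`
and `y = 1`, so the curve over `P₈` comes from the curve over `P₆`. -/
theorem hasImage_exc_seven (h : IsMapping φ a) (c : ℂ) :
    HasImage φ a (Pt.exc 7 c) ∧ HasImage φ a (Pt.corner 7) := by
  set F := ratF (a 4) (a 0) (a 1) with hF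
  set k := a 4 with hk
  have hk0 : k ≠ 0 := h.ne 4
  have x0 := cx_ne_zero
  have y0 := cy_ne_zero
  have kc0 := cst_ne_zero hk0
  have F0 : F ≠ 0 := ratF_ne_zero (h.ne 4) _ _
  have hX : φ cx = F / cy := h.map_x
  have X0 := h.x_ne_zero
  set n := φ cx / cx - cst k with hn
  have hXc : IsCoord (φ cx)⁻¹ n := by
    have := (isCoord_centre (evolve a) 7).map φ
    rwa [h.map_centre_seven.1, h.map_centre_seven.2] at this
  have n0 := hXc.right_ne_zero
  have hm0 : IsCoord cx⁻¹ (cy - 1) := isCoord_centre a 5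
  have mne := hm0.right_ne_zero
  have hw : IsCoord cx⁻¹ ((cy - 1) / cx⁻¹) := hm0.div
  -- in the chart of the image
  have hv1 : ∀ s t, IsCoord s t → HasVal s t cx⁻¹ 0 → HasVal s t (cy - 1) 0 →
      HasVal s t cy 1 ∧ HasVal s t (φ cx / cx) k := by
    intro s t hc hx hy
    have h1 : HasVal s t cy 1 := HasVal.of_sub (by rwa [cst_one])
    refine ⟨h1, (HasVal.div hc (hasVal_ratF_div_cx (α := a 0) (β := a 1) hc hx) h1 one_ne_zero).congr ?_ (div_one k)⟩
    rw [hX]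
    field_simp
    rw [hF]
  -- in the chart of the point
  have hv2 : ∀ s t, IsCoord s t → HasVal s t (φ cx)⁻¹ 0 → HasVal s t n 0 →
      HasVal s t cx⁻¹ 0 ∧ HasVal s t cy 1 ∧ HasVal s t (φ cx / cx) k := by
    intro s t hc hx hy
    have h1 : HasVal s t (φ cx / cx) k := HasVal.of_sub hy
    have h2 : HasVal s t cx⁻¹ 0 := (HasEv.mul hx h1).congr (by field_simp) (zero_mul k)
    refine ⟨h2, (HasVal.div hc (hasVal_ratF_div_cx (k := k) (α := a 0) (β := a 1) hc h2) h1
      hk0).congr ?_ (div_self hk0), h1⟩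
    rw [hX, ← hF]
    field_simp
  -- The identity is `x̄(x̄/x - k) = (x̄/x)/y · ((F - kx) - k · x(y - 1))`. The equations `1/x̄` and
  -- `1/x` of the two curves differ by the unit `x/x̄`, which plays the role of `E`.
  set A := (F - cst k * cx) * (φ cx / cx) / cy with hA
  set A₀ := k * (1 - a 0 - a 1) * k / 1 with hA₀
  set B := -(cst k * (φ cx / cx)) / cy with hB
  set B₀ := -(k * k) / 1 with hB₀
  have hB0 : B₀ ≠ 0 := div_ne_zero (neg_ne_zero.mpr (mul_ne_zero hk0 hk0)) one_ne_zero
  have hAv : ∀ s t, IsCoord s t → HasVal s t cx⁻¹ 0 → HasVal s t cy 1 →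
      HasVal s t (φ cx / cx) k → HasVal s t A A₀ :=
    fun s t hc hx hy hr => HasVal.div hc (HasEv.mul (hasVal_ratF_sub hc hx) hr) hy one_ne_zero
  have hBv : ∀ s t, IsCoord s t → HasVal s t cy 1 → HasVal s t (φ cx / cx) k → HasVal s t B B₀ :=
    fun s t hc hy hr => HasVal.div hc (HasEv.neg (HasEv.mul (HasVal.cst k) hr)) hy one_ne_zero
  have hEv : ∀ s t, IsCoord s t → HasVal s t (φ cx / cx) k → HasVal s t (cx / φ cx) k⁻¹ :=
    fun s t hc hr => (hr.inv hc hk0).congr (inv_div _ _) rfl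
  have key : n / (φ cx)⁻¹ = A + B * ((cy - 1) / cx⁻¹) := by
    rw [hn, hA, hB]
    have e : F = φ cx * cy := h.ratF_eq
    rw [e]
    field_simp
    ring
  have compat : ∀ P' : Pt, P'.xval a = none → P'.yval a = some 1 → P'.excE a 6 = 1 →
      P'.excE a 7 = 1 → ∀ P : Pt, P.xval (evolve a) = none → P.yval (evolve a) = none →
      (∀ j, j ≠ 6 → j ≠ 7 → P.excE (evolve a) j = 1) → P.excE (evolve a) 6 = cx⁻¹ →
      HasVal (P'.u a) (P'.v a) (φ cx / cx) k →
      UnitAt (P'.ring a) (P'.excE a 5 / φ (P.excE (evolve a) 7)) → PicCompat φ a P P' := by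
    intro P' hx' hy' h5 h6 P hx hy hj hj6 hr hu
    have hc := P'.isCoord a
    have hv := P'.hasPVal a
    rw [hx', hy', hasPVal_none, hasPVal_some] at hv
    have hne0 : cx - cst (a 0) ≠ 0 := cx_sub_cst_ne_zero _
    have hne1 : cx - cst (a 1) ≠ 0 := cx_sub_cst_ne_zero _
    refine ⟨?_, ?_, ?_, ?_, ?_, ?_, ?_, ?_, ?_⟩
    · refine UnitAt.congr (((hv.2.unitAt hc one_ne_zero).div (unitAt_sub_div hc hv.1 (a 0))).div
        (unitAt_sub_div hc hv.1 (a 1))) ?_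
      rw [hx, hy, hy', hj 2 (by decide) (by decide), hj 3 (by decide) (by decide),
        hj 5 (by decide) (by decide), hj6]
      simp [Pt.pole, h.map_y]
      field_simp
    all_goals
      intro e
      simp [hy] at e
    · exact hu
    · exact UnitAt.congr UnitAt.one (by
        rw [h6, hj 4 (by decide) (by decide), map_one, div_one])
    · refine UnitAt.congr ((hEv _ _ hc hr).unitAt hc (inv_ne_zero hk0)) ?_
      rw [h5, hj6, map_inv₀]
      field_simp
  have e0 : ∀ c', (∀ j, j ≠ 6 → j ≠ 7 → (Pt.exc 7 c').excE (evolve a) j = 1) ∧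
      ∀ j, j ≠ 6 → j ≠ 7 → (Pt.corner 7).excE (evolve a) j = 1 :=
    fun c' => ⟨fun j hj hj' => by simp [Pt.excE, hj, hj'], fun j hj hj' => by simp [Pt.excE, hj, hj']⟩
  have eu : (φ cx)⁻¹ = cx⁻¹ * (cx / φ cx) := by field_simp
  constructor
  · have hc1 := hw.sub_cst ((c - A₀) / B₀)
    have hc2 := hXc.div.sub_cst c
    have e : localRing (φ ((Pt.exc 7 c).u (evolve a))) (φ ((Pt.exc 7 c).v (evolve a))) =
        localRing (φ cx)⁻¹ (n / (φ cx)⁻¹ - cst c) := by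
      change localRing (φ (centre (evolve a) 7).1)
        (φ ((centre (evolve a) 7).2 / (centre (evolve a) 7).1 - cst c)) = _
      rw [map_sub, map_cst, map_div₀, h.map_centre_seven.1, h.map_centre_seven.2]
    have k1 := hv1 _ _ hc1 HasEv.left (hasVal_exc_right hm0 _)
    obtain ⟨k2, k3, k4⟩ := hv2 _ _ hc2 HasEv.left (hasVal_exc_right hXc _)
    refine ⟨Pt.exc 5 ((c - A₀) / B₀), fun e => absurd e (by decide), rfl, ?_, fun _ _ => ?_⟩
    · rw [e]
      change localRing (φ cx)⁻¹ (n / (φ cx)⁻¹ - cst c) =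
        localRing cx⁻¹ ((cy - 1) / cx⁻¹ - cst ((c - A₀) / B₀))
      refine localRing_affine (A := A) (B := B) (c := c) (E := cx / φ cx) hw hc2 eu
        (by rw [key]) (hEv _ _ hc1 k1.2) (hAv _ _ hc1 HasEv.left k1.1 k1.2) (hBv _ _ hc1 k1.1 k1.2)
        (hEv _ _ hc2 k4) (hAv _ _ hc2 k2 k3 k4) (hBv _ _ hc2 k3 k4) (inv_ne_zero hk0) hB0
        ?_ ?_ <;> field_simp <;> ring
    · refine compat _ rfl rfl (by simp [Pt.excE]) (by simp [Pt.excE]) _ rfl rfl (e0 c).1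
        (by simp [Pt.excE]) k1.2 ?_
      refine UnitAt.congr (k1.2.unitAt hc1 hk0) ?_
      simp only [Pt.excE, if_true, h.map_centre_seven.1]
      change _ = cx⁻¹ / (φ cx)⁻¹
      field_simp
  · have ecw : cx⁻¹ * ((cy - 1) / cx⁻¹) = cy - 1 := mul_div_cancel₀ _ (inv_ne_zero x0)
    have hc1 : IsCoord ((cy - 1) / cx⁻¹)⁻¹ (cx⁻¹ * ((cy - 1) / cx⁻¹)) := by
      rw [inv_div, ecw]; exact Pt.isCoord a (Pt.corner 5)
    have hc2 := hXc.div'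
    have e : localRing (φ ((Pt.corner 7).u (evolve a))) (φ ((Pt.corner 7).v (evolve a))) =
        localRing ((φ cx)⁻¹ / n) n := by
      change localRing (φ ((centre (evolve a) 7).1 / (centre (evolve a) 7).2))
        (φ (centre (evolve a) 7).2) = _
      rw [map_div₀, h.map_centre_seven.1, h.map_centre_seven.2]
    have hcw : (Pt.corner 5).ring a =
        localRing ((cy - 1) / cx⁻¹)⁻¹ (cx⁻¹ * ((cy - 1) / cx⁻¹)) := by
      rw [inv_div, ecw]; rfl
    have hPx : HasVal ((cy - 1) / cx⁻¹)⁻¹ (cx⁻¹ * ((cy - 1) / cx⁻¹)) cx⁻¹ 0 := by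
      rw [inv_div, ecw]; exact ((Pt.corner 5).hasPVal a).1
    have hPy : HasVal ((cy - 1) / cx⁻¹)⁻¹ (cx⁻¹ * ((cy - 1) / cx⁻¹)) (cy - 1) 0 := by
      rw [ecw]; exact HasEv.right
    have k1 := hv1 _ _ hc1 hPx hPy
    obtain ⟨k2, k3, k4⟩ := hv2 _ _ hc2 (hasVal_corner_left hXc) HasEv.right
    have main := localRing_affine_corner (E := cx / φ cx) (A := A) (B := B) hw hc2
      (by rw [← key, inv_div]) (by rw [← key]; field_simp) (hEv _ _ hc1 k1.2)
      (hAv _ _ hc1 hPx k1.1 k1.2) (hBv _ _ hc1 k1.1 k1.2) (hEv _ _ hc2 k4)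
      (hAv _ _ hc2 k2 k3 k4) (hBv _ _ hc2 k3 k4) (inv_ne_zero hk0) hB0 hB0
    refine ⟨Pt.corner 5, trivial, rfl, ?_, fun _ _ => ?_⟩
    · rw [e, main.1, hcw]
    · have kr : HasVal ((Pt.corner 5).u a) ((Pt.corner 5).v a) (φ cx / cx) k := by
        have := k1.2
        rwa [inv_div, ecw] at this
      refine compat _ rfl rfl (by simp [Pt.excE]) (by simp [Pt.excE]) _ rfl rfl (e0 0).2
        (by simp [Pt.excE]) kr ?_
      rw [hcw]
      refine UnitAt.congr ((main.2.unitAt hc1 (inv_ne_zero hB0)).mul (k1.2.unitAt hc1 hk0)) ?_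
      rw [← key]
      simp only [Pt.excE, if_true, h.map_centre_seven.2]
      change _ = (cy - 1) / n
      field_simp

end IsMapping

/-! ### The mapping is an isomorphism of surfaces -/

namespace IsMapping

variable {φ : FuncField ≃ₐ[ℂ] FuncField} {a : Fin 5 → ℂ}

theorem hasImage_five (h : IsMapping φ a) (c : ℂ) :
    HasImage φ a (Pt.exc 5 c) ∧ HasImage φ a (Pt.corner 5) := by
  by_cases h0 : a 0 = 1
  · refine h.hasImage_exc_five_of_eq_one (i := 0) (β := a 1) ?_ ?_ ?_ ?_ (by decide)
      (fun e => e.1 h0) c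
    · rw [← h0]; exact h.adm.2.1.symm
    · rw [← h0]; exact h.map_x
    · change (cx - cst (a 0), cy) = _
      rw [h0, cst_one]
    · change some (a 0) = _
      rw [h0]
  by_cases h1 : a 1 = 1
  · refine h.hasImage_exc_five_of_eq_one (i := 1) (β := a 0) h0 ?_ ?_ ?_ (by decide)
      (fun e => e.2 h1) c
    · rw [← h1]; exact h.map_x'
    · change (cx - cst (a 1), cy) = _
      rw [h1, cst_one]
    · change some (a 1) = _
      rw [h1]
  exact h.hasImage_exc_five h0 h1 c

theorem hasImage (h : IsMapping φ a) {P : Pt} (hP : P.Valid (evolve a)) : HasImage φ a P := by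
  rcases P with ⟨p, q⟩ | ⟨i, c⟩ | i
  · rcases q with _ | d
    · rcases p with _ | c
      · exact absurd hP Pt.not_valid_none_none
      · exact h.hasImage_base_inf (Pt.valid_some_none.mp hP)
    · by_cases hd0 : d = a 0
      · subst hd0
        by_cases hd : a 0 = 1
        · exact h.hasImage_base_root_of_eq_one .left hP hd
        · exact h.hasImage_base_root .left hP hd
      by_cases hd1 : d = a 1
      · subst hd1
        by_cases hd : a 1 = 1
        · exact h.hasImage_base_root_of_eq_one .right hP hd
        · exact h.hasImage_base_root .right hP hd
      by_cases hd : d = 1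
      · subst hd
        rcases p with _ | c
        · exact absurd rfl (Pt.valid_none_some.mp hP)
        · exact h.hasImage_base_one (Ne.symm hd0) (Ne.symm hd1)
      · exact h.hasImage_base_generic hP hd0 hd1 hd
  · fin_cases i
    · exact (h.hasImage_exc_zero_root .left c).1
    · exact (h.hasImage_exc_zero_root .right c).1
    · by_cases hd : a 0 = 1
      · exact (h.hasImage_exc_root_of_eq_one .left hd c).1
      · exact h.hasImage_exc_root .left hd c
    · by_cases hd : a 1 = 1
      · exact (h.hasImage_exc_root_of_eq_one .right hd c).1
      · exact h.hasImage_exc_root .right hd c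
    · exact (h.hasImage_exc_four c).1
    · exact (h.hasImage_five c).1
    · exact h.hasImage_exc_six (hP rfl)
    · exact (h.hasImage_exc_seven c).1
  · fin_cases i
    · exact (h.hasImage_exc_zero_root .left 0).2
    · exact (h.hasImage_exc_zero_root .right 0).2
    · by_cases hd : a 0 = 1
      · exact (h.hasImage_exc_root_of_eq_one .left hd 0).2
      · exact h.hasImage_corner_root .left hd
    · by_cases hd : a 1 = 1
      · exact (h.hasImage_exc_root_of_eq_one .right hd 0).2
      · exact h.hasImage_corner_root .right hd
    · exact (h.hasImage_exc_four 0).2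
    · exact (h.hasImage_five 0).2
    · exact h.hasImage_corner_six
    · exact (h.hasImage_exc_seven 0).2
theorem map_mem_surface (h : IsMapping φ a) (hb : Admissible (evolve a))
    {R : Subalgebra ℂ FuncField} (hR : R ∈ surface (evolve a)) :
    R.map (φ : FuncField →ₐ[ℂ] FuncField) ∈ surface a := by
  obtain ⟨P, hP, rfl⟩ := (mem_surface_iff hb R).mp hR
  obtain ⟨P', hP', -, e, -⟩ := h.hasImage hP
  exact (mem_surface_iff h.adm _).mpr ⟨P', hP', by rw [Pt.ring, map_localRing, e]⟩

end IsMapping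

theorem exists_isMapping {a : Fin 5 → ℂ} (ha : Admissible a) :
    ∃ φ : FuncField ≃ₐ[ℂ] FuncField, IsMapping φ a := by
  have hc : IsCoord (ratF (a 4) (a 0) (a 1) / cy) cx := by
    rw [div_eq_inv_mul]
    refine (isCoord_cx_cy.inv.mul_right (ratF_ne_zero (ha.1 4) _ _) ?_).swap
    have hx : cx ∈ IntermediateField.adjoin ℂ {cx} :=
      IntermediateField.mem_adjoin_simple_self ℂ cx
    exact div_mem (mul_mem (mul_mem (cst_mem _ _) (sub_mem hx (cst_mem _ _)))
      (sub_mem hx (cst_mem _ _))) (sub_mem hx (one_mem _))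
  obtain ⟨φ, h1, h2⟩ := hc.exists_algEquiv
  exact ⟨φ, ha, h1, h2⟩

theorem IsMapping.isDeautonomized {φ : FuncField ≃ₐ[ℂ] FuncField} {a : Fin 5 → ℂ}
    (h : IsMapping φ a) : IsDeautonomized a φ := by
  refine ⟨?_, h.map_y⟩
  rw [h.map_x, ratF, div_div, mul_comm cy]

theorem qParam_ne_zero {a : Fin 5 → ℂ} (ha : Admissible a) : qParam a ≠ 0 :=
  div_ne_zero (neg_ne_zero.mpr (mul_ne_zero (ha.1 2) (ha.1 3)))
    (mul_ne_zero (mul_ne_zero (ha.1 0) (ha.1 1)) (ha.1 4))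

theorem Admissible.evolve {a : Fin 5 → ℂ} (ha : Admissible a) : Admissible (evolve a) := by
  have hq := qParam_ne_zero ha
  refine ⟨fun i => ?_, fun e => ?_, ha.2.1⟩
  · fin_cases i
    · exact div_ne_zero (ha.1 3) hq
    · exact div_ne_zero (ha.1 2) hq
    · exact ha.1 0
    · exact ha.1 1
    · exact inv_ne_zero (ha.1 4)
  · exact ha.2.2 ((div_left_inj' hq).mp e).symm

/-! ### The symmetry exchanging the coordinates -/

/-- The parameters of the surface obtained by exchanging `x` and `y`. -/
def swapParam (a : Fin 5 → ℂ) : Fin 5 → ℂ := ![a 2, a 3, a 0, a 1, (a 4)⁻¹]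

theorem Admissible.swapParam {a : Fin 5 → ℂ} (ha : Admissible a) : Admissible (swapParam a) := by
  refine ⟨fun i => ?_, ha.2.2, ha.2.1⟩
  fin_cases i
  · exact ha.1 2
  · exact ha.1 3
  · exact ha.1 0
  · exact ha.1 1
  · exact inv_ne_zero (ha.1 4)

theorem exists_swap : ∃ σ : FuncField ≃ₐ[ℂ] FuncField, σ cx = cy ∧ σ cy = cx :=
  isCoord_cx_cy.swap.exists_algEquiv

section swap

variable {σ : FuncField ≃ₐ[ℂ] FuncField} {a : Fin 5 → ℂ}

/-- The permutation of the exceptional curves under the exchange of the coordinates. -/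
def swapIdx : Fin 8 → Fin 8 := ![2, 3, 0, 1, 5, 4, 6, 7]

theorem map_centre_swap (hx : σ cx = cy) (hy : σ cy = cx) {i : Fin 8} (hi : i ≠ 7) :
    σ (centre a i).1 = (centre (swapParam a) (swapIdx i)).2 ∧
      σ (centre a i).2 = (centre (swapParam a) (swapIdx i)).1 := by
  have hc : ∀ c, σ (cst c) = cst c := fun c => σ.commutes c
  fin_cases i <;> simp [centre, swapParam, swapIdx, hx, hy, hc] at hi ⊢

/-- The exchange of coordinates permutes the centres in `ℙ¹ × ℙ¹` and replaces `a₅` by its inverse.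
Only over `P₈` are the local coordinates not permuted, because `1/x` was preferred to `1/y` in their
choice; this is the auxiliary statement at the end. -/
theorem exists_swap_pt (ha : Admissible a) (hx : σ cx = cy) (hy : σ cy = cx) {P : Pt}
    (hP : P.Valid a) :
    ∃ P' : Pt, P'.Valid (swapParam a) ∧ localRing (σ (P.u a)) (σ (P.v a)) =
      P'.ring (swapParam a) := by
  have hc : ∀ c, σ (cst c) = cst c := fun c => σ.commutes c
  rcases P with ⟨p, q⟩ | ⟨i, c⟩ | i
  · refine ⟨Pt.base q p, ?_, ?_⟩
    · rcases p with _ | p <;> rcases q with _ | q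
      · exact absurd hP Pt.not_valid_none_none
      · exact Pt.valid_some_none.mpr (Pt.valid_none_some.mp hP)
      · exact Pt.valid_none_some.mpr (Pt.valid_some_none.mp hP)
      · have := Pt.valid_some_some.mp hP
        exact Pt.valid_some_some.mpr ⟨this.2, this.1⟩
    · change localRing (σ (par cx p)) (σ (par cy q)) = localRing (par cx q) (par cy p)
      rw [IsMapping.map_par, IsMapping.map_par, hx, hy, localRing_swap]
  · by_cases hi : i = 7
    · subst hi
      obtain ⟨P', h1, h2, -⟩ := seven ha hx hy c
      exact ⟨P', h1, h2⟩
    have hcen := map_centre_swap (a := a) hx hy hi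
    have hcc := isCoord_centre (swapParam a) (swapIdx i)
    have e : localRing (σ ((Pt.exc i c).u a)) (σ ((Pt.exc i c).v a)) =
        localRing (centre (swapParam a) (swapIdx i)).2
          ((centre (swapParam a) (swapIdx i)).1 / (centre (swapParam a) (swapIdx i)).2
            - cst c) := by
      change localRing (σ (centre a i).1) (σ ((centre a i).2 / (centre a i).1 - cst c)) = _
      rw [map_sub, map_div₀, hc, hcen.1, hcen.2]
    rw [e]
    by_cases hc0 : c = 0
    · subst hc0
      refine ⟨Pt.corner (swapIdx i), trivial, ?_⟩
      rw [cst_zero, sub_zero, localRing_swap]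
      rfl
    · refine ⟨Pt.exc (swapIdx i) c⁻¹, fun e6 => ?_, localRing_exc_swap hcc.swap hc0⟩
      have : i = 6 := by revert e6; fin_cases i <;> simp [swapIdx]
      have h6 := hP this
      change c⁻¹ ≠ (a 4)⁻¹⁻¹
      exact fun e' => h6 (inv_injective e')
  · by_cases hi : i = 7
    · subst hi
      obtain ⟨P', h1, -, h2⟩ := seven ha hx hy 0
      exact ⟨Pt.corner 7, trivial, h2⟩
    have hcen := map_centre_swap (a := a) hx hy hi
    refine ⟨Pt.exc (swapIdx i) 0, fun e6 => ?_, ?_⟩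
    · exact (inv_ne_zero (inv_ne_zero (ha.1 4))).symm
    · change localRing (σ ((centre a i).1 / (centre a i).2)) (σ (centre a i).2) =
        localRing (centre (swapParam a) (swapIdx i)).1
          ((centre (swapParam a) (swapIdx i)).2 / (centre (swapParam a) (swapIdx i)).1 - cst 0)
      rw [map_div₀, hcen.1, hcen.2, cst_zero, sub_zero, localRing_swap]
where
  seven (ha : Admissible a) (hx : σ cx = cy) (hy : σ cy = cx) (c : ℂ) :
      ∃ P' : Pt, P'.Valid (swapParam a) ∧
        localRing (σ ((Pt.exc 7 c).u a)) (σ ((Pt.exc 7 c).v a)) = P'.ring (swapParam a) ∧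
        localRing (σ ((Pt.corner 7).u a)) (σ ((Pt.corner 7).v a)) =
          (Pt.corner 7).ring (swapParam a) := by
    have hc : ∀ c, σ (cst c) = cst c := fun c => σ.commutes c
    have x0 := cx_ne_zero
    have y0 := cy_ne_zero
    have a0 := ha.1 4
    set k := a 4 with hk
    have k0 := cst_ne_zero a0
    set m := cx / cy - cst k with hm
    set n := cy / cx - cst k⁻¹ with hn
    have hw0 : IsCoord cx⁻¹ m := by
      have := isCoord_centre (swapParam a) 7
      change IsCoord cx⁻¹ (cx / cy - cst k⁻¹⁻¹) at this
      rwa [inv_inv] at this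
    have hw : IsCoord cx⁻¹ (m / cx⁻¹) := hw0.div
    have hv0 : IsCoord cy⁻¹ n := by
      have := (isCoord_centre a 7).map σ
      change IsCoord (σ cx⁻¹) (σ (cx / cy - cst k⁻¹)) at this
      rwa [map_sub, map_div₀, map_inv₀, hx, hy, hc] at this
    set B := -cst k⁻¹ * (cy / cx) * (cy / cx) with hB
    set B₀ := -k⁻¹ * k⁻¹ * k⁻¹ with hB₀
    have hB0 : B₀ ≠ 0 := mul_ne_zero (mul_ne_zero (neg_ne_zero.mpr (inv_ne_zero a0))
      (inv_ne_zero a0)) (inv_ne_zero a0)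
    have hBv : ∀ s t, HasVal s t (cy / cx) k⁻¹ → HasVal s t B B₀ := fun s t h =>
      HasEv.mul (HasEv.mul (HasEv.neg (HasVal.cst _)) h) h
    -- With `k = a₅⁻¹⁻¹`, the identity is `y/x - 1/k = -(1/k)(y/x)(x/y - k)`, multiplied by `y =
    -- (y/x) · x`.
    have key : n / cy⁻¹ = 0 + B * (m / cx⁻¹) := by
      rw [hn, hB, hm, cst_inv]
      field_simp
      ring
    have h7 : centre (swapParam a) 7 = (cx⁻¹, m) := by
      change (cx⁻¹, cx / cy - cst k⁻¹⁻¹) = _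
      rw [inv_inv]
    have eE : cy⁻¹ = cx⁻¹ * (cx / cy) := by field_simp
    have inv1 : ∀ s t, IsCoord s t → HasVal s t (cx / cy) k → HasVal s t (cy / cx) k⁻¹ :=
      fun s t hst h => (h.inv hst a0).congr (inv_div _ _) rfl
    have inv2 : ∀ s t, IsCoord s t → HasVal s t (cy / cx) k⁻¹ → HasVal s t (cx / cy) k :=
      fun s t hst h => (h.inv hst (inv_ne_zero a0)).congr (inv_div _ _) (inv_inv _)
    refine ⟨Pt.exc 7 ((c - 0) / B₀), fun e => absurd e (by decide), ?_, ?_⟩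
    · change localRing (σ cx⁻¹) (σ ((cx / cy - cst k⁻¹) / cx⁻¹ - cst c)) =
        localRing (centre (swapParam a) 7).1
          ((centre (swapParam a) 7).2 / (centre (swapParam a) 7).1 - cst ((c - 0) / B₀))
      rw [h7, map_sub, map_div₀, map_sub, map_div₀, map_inv₀, hx, hy, hc, hc, ← hn]
      have hc1 := hw.sub_cst ((c - 0) / B₀)
      have hc2 := hv0.div.sub_cst c
      have hr1 : HasVal cx⁻¹ (m / cx⁻¹ - cst ((c - 0) / B₀)) (cx / cy) k :=
        HasVal.of_sub (hasVal_exc_right hw0 _)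
      have hr2 : HasVal cy⁻¹ (n / cy⁻¹ - cst c) (cy / cx) k⁻¹ :=
        HasVal.of_sub (hasVal_exc_right hv0 _)
      refine localRing_affine (A := 0) (B := B) (c := c) (E := cx / cy) hw hc2 eE
        (by rw [key]) hr1 HasEv.zero (hBv _ _ (inv1 _ _ hc1 hr1)) (inv2 _ _ hc2 hr2) HasEv.zero
        (hBv _ _ hr2) a0 hB0 ?_ ?_ <;> field_simp <;> ring
    · have ecw : cx⁻¹ * (m / cx⁻¹) = m := mul_div_cancel₀ _ (inv_ne_zero x0)
      have hc1 : IsCoord (m / cx⁻¹)⁻¹ (cx⁻¹ * (m / cx⁻¹)) := by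
        rw [inv_div, ecw]; exact hw0.div'
      have hr1 : HasVal (m / cx⁻¹)⁻¹ (cx⁻¹ * (m / cx⁻¹)) (cx / cy) k := by
        rw [inv_div, ecw]; exact HasVal.of_sub HasEv.right
      have hc2 := hv0.div'
      have hr2 : HasVal (cy⁻¹ / n) n (cy / cx) k⁻¹ := HasVal.of_sub HasEv.right
      change localRing (σ (cx⁻¹ / (cx / cy - cst k⁻¹))) (σ (cx / cy - cst k⁻¹)) =
        localRing ((centre (swapParam a) 7).1 / (centre (swapParam a) 7).2)
          (centre (swapParam a) 7).2
      rw [h7, map_div₀, map_sub, map_div₀, map_inv₀, hx, hy, hc, ← hn]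
      have main := localRing_affine_corner (E := cx / cy) (A := 0) (B := B) hw hc2
        (by rw [← key, inv_div]) (by rw [← key]; field_simp) hr1 HasEv.zero
        (hBv _ _ (inv1 _ _ hc1 hr1)) (inv2 _ _ hc2 hr2) HasEv.zero (hBv _ _ hr2) a0 hB0 hB0
      rw [main.1, inv_div, ecw]

theorem map_swap_mem_surface (ha : Admissible a) (hx : σ cx = cy) (hy : σ cy = cx)
    {R : Subalgebra ℂ FuncField} (hR : R ∈ surface a) :
    R.map (σ : FuncField →ₐ[ℂ] FuncField) ∈ surface (swapParam a) := by
  obtain ⟨P, hP, rfl⟩ := (mem_surface_iff ha R).mp hR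
  obtain ⟨P', hP', e⟩ := exists_swap_pt ha hx hy hP
  exact (mem_surface_iff ha.swapParam _).mpr ⟨P', hP', by rw [Pt.ring, map_localRing, e]⟩

end swap

theorem algEquiv_eq_refl {ψ : FuncField ≃ₐ[ℂ] FuncField} (hx : ψ cx = cx) (hy : ψ cy = cy)
    (r : FuncField) : ψ r = r := by
  have hp : ∀ p, ψ (ofPoly p) = ofPoly p := by
    intro p
    have e : (ψ : FuncField →ₐ[ℂ] FuncField).comp (aeval ![cx, cy]) = aeval ![cx, cy] := by
      ext i
      fin_cases i
      · simpa using hx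
      · simpa using hy
    rw [← aeval_cx_cy]
    exact DFunLike.congr_fun e p
  obtain ⟨p, q, -, rfl⟩ := IsFractionRing.div_surjective (A := MvPolynomial (Fin 2) ℂ) r
  rw [map_div₀]
  exact congrArg₂ _ (hp p) (hp q)

/-- That points correspond to points gives one inclusion. For the other, the mapping is reversible:
composed with the exchange of `x` and `y` it is an involution. So its inverse is again a mapping of
the family, conjugated by the exchange, and the inclusion already proved applies to it. -/
theorem IsMapping.isPullbackOfIso {φ : FuncField ≃ₐ[ℂ] FuncField} {a : Fin 5 → ℂ}
    (h : IsMapping φ a) : IsPullbackOfIso φ (surface a) (surface (evolve a)) := by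
  have hb := h.adm.evolve
  refine Set.Subset.antisymm ?_ fun R hR => ?_
  · rintro _ ⟨R, hR, rfl⟩
    exact h.map_mem_surface hb hR
  obtain ⟨σ, hx, hy⟩ := exists_swap
  -- The mapping involves only `a₁, a₂, a₅`, so `a₃, a₄` may be changed. With this choice `T(a')` is
  -- the exchange of `a`, and the exchange of `a'` is `T(a)`, which makes the chain of three
  -- inclusions close up.
  set a' : Fin 5 → ℂ := ![a 0, a 1, evolve a 0, evolve a 1, a 4] with ha'
  have adm' : Admissible a' := by
    refine ⟨fun i => ?_, h.adm.2.1, hb.2.1⟩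
    fin_cases i
    · exact h.ne 0
    · exact h.ne 1
    · exact hb.1 0
    · exact hb.1 1
    · exact h.ne 4
  have h' : IsMapping φ a' := ⟨adm', h.map_x, h.map_y⟩
  have e1 : evolve a' = swapParam a := by
    have n0 := h.ne 0
    have n1 := h.ne 1
    have n2 := h.ne 2
    have n3 := h.ne 3
    have n4 := h.ne 4
    ext i
    fin_cases i <;> simp [ha', evolve, swapParam, qParam] <;> field_simp
  have e2 : swapParam a' = evolve a := by
    ext i
    fin_cases i <;> rfl
  have s1 := map_swap_mem_surface h.adm hx hy hR
  rw [← e1] at s1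
  have s2 := h'.map_mem_surface adm'.evolve s1
  have s3 := map_swap_mem_surface adm' hx hy s2
  rw [e2] at s3
  refine ⟨_, s3, ?_⟩
  have hφ : ∀ r, φ (σ (φ (σ r))) = r := by
    refine fun r => (algEquiv_eq_refl (ψ := (σ.trans φ).trans (σ.trans φ)) ?_ ?_ r)
    · change φ (σ (φ (σ cx))) = cx
      rw [hx, h.map_y, hx, h.map_y]
    · change φ (σ (φ (σ cy))) = cy
      have hF : φ (σ (ratF (a 4) (a 0) (a 1))) = ratF (a 4) (a 0) (a 1) := by
        have hc : ∀ c, σ (cst c) = cst c := fun c => σ.commutes c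
        simp only [ratF, map_div₀, map_mul, map_sub, map_one, hc, map_cst, hx, h.map_y]
      rw [hy, h.map_x, map_div₀, map_div₀, hF, hy, h.ratF_eq,
        mul_div_cancel_left₀ _ h.x_ne_zero]
  ext r
  simp only [Subalgebra.mem_map]
  constructor
  · rintro ⟨_, ⟨_, ⟨_, ⟨r, hr, rfl⟩, rfl⟩, rfl⟩, rfl⟩
    exact (hφ r).symm ▸ hr
  · intro hr
    exact ⟨_, ⟨_, ⟨_, ⟨r, hr, rfl⟩, rfl⟩, rfl⟩, hφ r⟩

/-! ### The action on the Picard lattice -/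

/-- The action of the mapping on the Picard lattice. -/
def picMap : Pic ≃ₗ[ℤ] Pic where
  toFun l := ![l 1, l 0 + 2 * l 1 + l 2 + l 3 + l 6 + l 8, l 4, l 5, -l 1 - l 2, -l 1 - l 3, l 9,
    -l 1 - l 6, -l 1 - l 8, l 7]
  invFun m := ![m 1 + 2 * m 0 + m 4 + m 5 + m 7 + m 8, m 0, -m 0 - m 4, -m 0 - m 5, m 2, m 3,
    -m 0 - m 7, m 9, -m 0 - m 8, m 6]
  map_add' l m := by
    ext i
    fin_cases i <;> simp <;> ring
  map_smul' c l := by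
    ext i
    fin_cases i <;> simp <;> ring
  left_inv l := by
    ext i
    fin_cases i <;> simp
    ring
  right_inv l := by
    ext i
    fin_cases i <;> simp
    ring

theorem picMap_apply (l : Pic) : picMap l = ![l 1, l 0 + 2 * l 1 + l 2 + l 3 + l 6 + l 8, l 4, l 5,
    -l 1 - l 2, -l 1 - l 3, l 9, -l 1 - l 6, -l 1 - l 8, l 7] := rfl

theorem inter_picMap (l m : Pic) : inter (picMap l) (picMap m) = inter l m := by
  simp [inter, picMap_apply, Fin.sum_univ_eight]
  ring

theorem picMap_clsD (k : Fin 5) : picMap (clsD k) = clsD (k + 1) := by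
  rw [picMap_apply]
  revert k
  decide

theorem picMap_root (j : Fin 5) : picMap (root j) =
    ![root 2 + root 3 + root 4, -root 4, -root 3, root 0 + root 3 + root 4, root 1] j := by
  rw [picMap_apply]
  revert j
  decide

theorem picMap_four_root (j : Fin 5) : picMap (picMap (picMap (picMap (root j)))) =
    root j + (![0, 0, -2, 2, 0] : Fin 5 → ℤ) j • antiK := by
  simp only [picMap_apply]
  revert j
  decide

theorem sum_clsD : ∑ k, clsD k = antiK := by decide

theorem sum_root : ∑ j, root j = antiK := by decide

theorem inter_clsD (i j : Fin 5) : inter (clsD i) (clsD j) = -cartanA4 i j := by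
  revert i j
  decide

theorem inter_root (i j : Fin 5) : inter (root i) (root j) = -cartanA4 i j := by
  revert i j
  decide

/-- Each of `E₈, E₂, E₅, E₆, E₄` occurs in exactly one of `α₀, …, α₄`, with coefficient `-1`. These
coordinates determine the combination, and the five orthogonality relations account for the other
five coordinates. -/
theorem orthogonal_clsD_iff (l : Pic) :
    (∀ k, inter l (clsD k) = 0) ↔ l ∈ Submodule.span ℤ (Set.range root) := by
  constructor
  · intro h
    have h0 := h 0
    have h1 := h 1
    have h2 := h 2
    have h3 := h 3
    have h4 := h 4
    simp [inter, clsD, Fin.sum_univ_eight] at h0 h1 h2 h3 h4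
    have e : l = (-l 9) • root 0 + (-l 3) • root 1 + (-l 6) • root 2 + (-l 7) • root 3 +
        (-l 5) • root 4 := by
      ext i
      fin_cases i <;> simp [root] <;> linarith
    rw [e]
    have hr : ∀ (c : ℤ) j, c • root j ∈ Submodule.span ℤ (Set.range root) := fun c j =>
      Submodule.smul_mem _ _ (Submodule.subset_span ⟨j, rfl⟩)
    exact add_mem (add_mem (add_mem (add_mem (hr _ _) (hr _ _)) (hr _ _)) (hr _ _)) (hr _ _)
  · intro h k
    induction h using Submodule.span_induction with
    | mem x hx =>
      obtain ⟨j, rfl⟩ := hx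
      revert j k
      decide
    | zero => simp [inter]
    | add x y _ _ hx hy =>
      have : inter (x + y) (clsD k) = inter x (clsD k) + inter y (clsD k) := by
        simp [inter, Fin.sum_univ_eight]
        ring
      rw [this, hx, hy, add_zero]
    | smul c x _ hx =>
      have : inter (c • x) (clsD k) = c * inter x (clsD k) := by
        simp [inter, Fin.sum_univ_eight]
        ring
      rw [this, hx, mul_zero]

/-! ### The evolution of the parameters -/

theorem qParam_evolve {a : Fin 5 → ℂ} (ha : Admissible a) : qParam (evolve a) = qParam a := by
  have n0 := ha.1 0
  have n1 := ha.1 1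
  have n2 := ha.1 2
  have n3 := ha.1 3
  have n4 := ha.1 4
  simp [evolve, qParam]
  field_simp

theorem evolve_four {a : Fin 5 → ℂ} (ha : Admissible a) :
    evolve^[4] a = ![a 0 / qParam a ^ 2, a 1 / qParam a ^ 2, a 2 / qParam a ^ 2,
      a 3 / qParam a ^ 2, a 4] := by
  have h1 := qParam_evolve ha
  have h2 := qParam_evolve ha.evolve
  have h3 := qParam_evolve ha.evolve.evolve
  have e : ∀ b, evolve b = ![b 3 / qParam b, b 2 / qParam b, b 0, b 1, (b 4)⁻¹] := fun _ => rfl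
  change evolve (evolve (evolve (evolve a))) = _
  rw [e (evolve (evolve (evolve a))), h3, e (evolve (evolve a)), h2, e (evolve a), h1, e a]
  ext i
  fin_cases i <;> simp [div_div, sq]

theorem admissible_hkyParam {t : ℂ} (ht : t ≠ 0) : Admissible (hkyParam t) := by
  have : t ≠ -t := fun e => ht (by linear_combination e / 2)
  refine ⟨fun i => ?_, this, this⟩
  fin_cases i <;> simp [hkyParam, ht]

theorem qParam_hkyParam {t : ℂ} (ht : t ≠ 0) : qParam (hkyParam t) = -1 := by
  simp [qParam, hkyParam, ht]

theorem evolve_hkyParam {t : ℂ} (ht : t ≠ 0) : evolve (hkyParam t) = hkyParam t := by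
  rw [evolve, qParam_hkyParam ht]
  ext i
  fin_cases i <;> simp [hkyParam, div_neg]

/-! ### The comparison of divisor classes under the mapping -/

theorem Pt.excE_eq_one_of_xval {a : Fin 5 → ℂ} {P : Pt} {i : Fin 8} (h : P.xval a ≠ cenX a i) :
    P.excE a i = 1 := by
  rcases P with ⟨p, q⟩ | ⟨j, c⟩ | j
  · rfl
  all_goals
    simp only [excE]
    rw [if_neg (by rintro rfl; exact h rfl),
      if_neg (by rintro ⟨rfl, rfl⟩; exact h rfl)]

theorem Pt.excE_eq_one_of_yval {a : Fin 5 → ℂ} {P : Pt} {i : Fin 8} (h : P.yval a ≠ cenY a i) :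
    P.excE a i = 1 := by
  rcases P with ⟨p, q⟩ | ⟨j, c⟩ | j
  · rfl
  all_goals
    simp only [excE]
    rw [if_neg (by rintro rfl; exact h rfl),
      if_neg (by rintro ⟨rfl, rfl⟩; exact h rfl)]

theorem Pt.excE_ne_zero (a : Fin 5 → ℂ) (P : Pt) (i : Fin 8) : P.excE a i ≠ 0 := by
  have x0 := cx_ne_zero
  rcases P with ⟨p, q⟩ | ⟨j, c⟩ | j
  · exact one_ne_zero
  · simp only [excE]
    split_ifs
    · exact (isCoord_centre a j).left_ne_zero
    · exact inv_ne_zero x0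
    · exact one_ne_zero
  · simp only [excE]
    split_ifs
    · exact (isCoord_centre a j).right_ne_zero
    · exact inv_ne_zero x0
    · exact one_ne_zero

theorem Pt.pole_ne_zero {z : FuncField} (hz : z ≠ 0) (p : Option ℂ) : pole z p ≠ 0 := by
  rcases p with _ | p
  · exact inv_ne_zero hz
  · exact one_ne_zero

namespace IsMapping

variable {φ : FuncField ≃ₐ[ℂ] FuncField} {a : Fin 5 → ℂ}

theorem map_pole (h : IsMapping φ a) (q : Option ℂ) : φ (Pt.pole cy q) = Pt.pole cx q := by
  rcases q with _ | q
  · exact (map_inv₀ φ cy).trans (by rw [h.map_y]; rfl)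
  · exact map_one φ

/-- The local equation of a fibre `x = c` up to the one of `x = ∞` is a unit off that fibre. -/
theorem unitAt_sub_mul_pole {P : Pt} {c : ℂ} (hx : P.xval a ≠ some c) :
    UnitAt (P.ring a) ((cx - cst c) * Pt.pole cx (P.xval a)) := by
  have hc := P.isCoord a
  have hv := (P.hasPVal a).1
  rcases hp : P.xval a with _ | d
  · rw [hp, hasPVal_none] at hv
    refine (unitAt_sub_div hc hv c).congr ?_
    rw [div_eq_mul_inv]
    rfl
  · rw [hp, hasPVal_some] at hv
    rw [hp] at hx
    refine (unitAt_sub hc hv (fun e => hx (by rw [e]))).congr ?_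
    exact (mul_one _).symm

/-- For exceptional curves that are mapped to one another. Off the fibre containing the centre both
equations are `1`, so only the points on the fibre need the compatibility. -/
theorem unitAt_exc_div {P P' : Pt} (hxy : P'.xval a = P.yval (evolve a))
    {i j : Fin 8} (hij : cenX a i = cenY (evolve a) j)
    (hu : P.yval (evolve a) = cenX a i → UnitAt (P'.ring a) (P'.excE a i / φ (P.excE (evolve a) j))) :
    UnitAt (P'.ring a) (P'.excE a i / φ (P.excE (evolve a) j)) := by
  by_cases hp : P.yval (evolve a) = cenX a i
  · exact hu hp
  · rw [Pt.excE_eq_one_of_xval (by rwa [hxy]), Pt.excE_eq_one_of_yval (by rwa [← hij]), map_one,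
      div_one]
    exact UnitAt.one

/-- The total fibre `x = c` is the sum of the exceptional curve `E_i` and the pull-back of `E_j`,
and it is linearly equivalent to `x = ∞`, the pull-back of `ȳ = ∞`. -/
theorem unitAt_exc_mul (h : IsMapping φ a) {P P' : Pt} (hxy : P'.xval a = P.yval (evolve a))
    {i j : Fin 8} {c : ℂ} (hi : cenX a i = some c) (hij : cenX a i = cenY (evolve a) j)
    (hu : P.yval (evolve a) = some c →
      UnitAt (P'.ring a) (P'.excE a i * φ (P.excE (evolve a) j) / (cx - cst c))) :
    UnitAt (P'.ring a) (P'.excE a i * φ (P.excE (evolve a) j) /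
      ((cx - cst c) * φ (Pt.pole cy (P.yval (evolve a))))) := by
  rw [h.map_pole]
  by_cases hp : P.yval (evolve a) = some c
  · refine (hu hp).congr ?_
    rw [hp]
    simp [Pt.pole]
  · rw [Pt.excE_eq_one_of_xval (by rwa [hxy, hi]),
      Pt.excE_eq_one_of_yval (by rwa [← hij, hi]), map_one, one_mul, ← hxy]
    exact UnitAt.one.div (unitAt_sub_mul_pole (by rwa [hxy]))

theorem inducesOnPic (h : IsMapping φ a) (h0 : a 0 ≠ 1) (h1 : a 1 ≠ 1) :
    InducesOnPic φ a (evolve a) picMap := by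
  intro l
  have n0 := cx_sub_cst_ne_zero (a 0)
  have n1 := cx_sub_cst_ne_zero (a 1)
  have n4 := cx_sub_cst_ne_zero 1
  have y0 := cy_ne_zero
  have x0 := cx_ne_zero
  have hy0 : cy / ((cx - cst (a 0)) * (cx - cst (a 1))) ≠ 0 := div_ne_zero y0 (mul_ne_zero n0 n1)
  -- The factors are the functions by which `H_y, E₁, E₂, E₅` differ from the pull-backs of their
  -- images. For the other generators the represented divisors agree, and no factor is needed.
  refine ⟨(cy / ((cx - cst (a 0)) * (cx - cst (a 1)))) ^ l 1 * (cx - cst (a 0)) ^ (-l 2) *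
    (cx - cst (a 1)) ^ (-l 3) * (cx - cst 1) ^ (-l 6), ?_, ?_⟩
  · exact mul_ne_zero (mul_ne_zero (mul_ne_zero (zpow_ne_zero _ hy0) (zpow_ne_zero _ n0))
      (zpow_ne_zero _ n1)) (zpow_ne_zero _ n4)
  intro R hR
  obtain ⟨P, hP, rfl⟩ := (mem_surface_iff h.adm.evolve R).mp hR
  obtain ⟨P', hP', hxy, e, hcompat⟩ := h.hasImage hP
  have hC := hcompat h0 h1
  have eR : (P.ring (evolve a)).map (φ : FuncField →ₐ[ℂ] FuncField) = P'.ring a := by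
    rw [Pt.ring, map_localRing, e]
  rw [eR, Pt.localEq_eq h.adm hP', Pt.localEq_eq h.adm.evolve hP, picMap_apply]
  have u0 : UnitAt (P'.ring a) (Pt.pole cx (P'.xval a) / φ (Pt.pole cy (P.yval (evolve a)))) := by
    rw [h.map_pole, hxy, div_self (Pt.pole_ne_zero x0 _)]
    exact UnitAt.one
  have u2 := h.unitAt_exc_mul hxy (i := 0) (j := 2) rfl rfl hC.h0
  have u3 := h.unitAt_exc_mul hxy (i := 1) (j := 3) rfl rfl hC.h1
  have u6 := h.unitAt_exc_mul hxy (i := 4) (j := 5) rfl rfl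
    (fun e => by rw [cst_one]; exact hC.h4 e)
  have u4 := unitAt_exc_div (φ := φ) hxy (i := 2) (j := 0) rfl hC.h2
  have u5 := unitAt_exc_div (φ := φ) hxy (i := 3) (j := 1) rfl hC.h3
  have u7 := unitAt_exc_div (φ := φ) hxy (i := 5) (j := 7) rfl hC.h5
  have u9 := unitAt_exc_div (φ := φ) hxy (i := 7) (j := 4) rfl hC.h7
  have u8 : UnitAt (P'.ring a) (P'.excE a 6 * φ (P.excE (evolve a) 6) /
      φ (Pt.pole cy (P.yval (evolve a)))) := by
    rw [h.map_pole]
    by_cases hp : P.yval (evolve a) = none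
    · refine (hC.h6 hp).congr ?_
      rw [hp]
      rfl
    · rw [Pt.excE_eq_one_of_xval (by rwa [hxy]), Pt.excE_eq_one_of_yval (i := 6) (by exact hp)]
      rcases hq : P.yval (evolve a) with _ | q
      · exact absurd hq hp
      · exact UnitAt.one.congr (by simp [Pt.pole])
  -- There is one unit for each of the ten generators; their product with exponents `l i` is the
  -- required unit. What remains is an identity between monomials with integer exponents in
  -- independent symbols.
  refine UnitAt.congr (((((((((u0.zpow (l 0)).mul (hC.hy.zpow (l 1))).mul (u2.zpow (l 2))).mul
    (u3.zpow (l 3))).mul (u4.zpow (l 4))).mul (u5.zpow (l 5))).mul (u6.zpow (l 6))).mul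
    (u7.zpow (l 7))).mul (u8.zpow (l 8)) |>.mul (u9.zpow (l 9))) ?_
  have hφ : ∀ {r}, r ≠ 0 → φ r ≠ 0 := fun hr => (map_ne_zero φ).mpr hr
  have p1 := Pt.pole_ne_zero x0 (P'.xval a)
  have p2 := Pt.pole_ne_zero y0 (P'.yval a)
  have p3 := hφ (Pt.pole_ne_zero x0 (P.xval (evolve a)))
  have p4 := hφ (Pt.pole_ne_zero y0 (P.yval (evolve a)))
  have q := fun i => P'.excE_ne_zero a i
  have r := fun i => hφ (P.excE_ne_zero (evolve a) i)
  simp only [Fin.prod_univ_eight, map_mul, map_div₀, map_zpow₀, map_pow]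
  have q0 := q 0
  have q1 := q 1
  have q2 := q 2
  have q3 := q 3
  have q4 := q 4
  have q5 := q 5
  have q6 := q 6
  have q7 := q 7
  have r0 := r 0
  have r1 := r 1
  have r2 := r 2
  have r3 := r 3
  have r4 := r 4
  have r5 := r 5
  have r6 := r 6
  have r7 := r 7
  generalize Pt.pole cx (P'.xval a) = b1 at *
  generalize Pt.pole cy (P'.yval a) = b2 at *
  generalize φ (Pt.pole cx (P.xval (evolve a))) = b3 at *
  generalize φ (Pt.pole cy (P.yval (evolve a))) = b4 at *
  generalize P'.excE a 0 = c0 at *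
  generalize P'.excE a 1 = c1 at *
  generalize P'.excE a 2 = c2 at *
  generalize P'.excE a 3 = c3 at *
  generalize P'.excE a 4 = c4 at *
  generalize P'.excE a 5 = c5 at *
  generalize P'.excE a 6 = c6 at *
  generalize P'.excE a 7 = c7 at *
  generalize φ (P.excE (evolve a) 0) = d0 at *
  generalize φ (P.excE (evolve a) 1) = d1 at *
  generalize φ (P.excE (evolve a) 2) = d2 at *
  generalize φ (P.excE (evolve a) 3) = d3 at *
  generalize φ (P.excE (evolve a) 4) = d4 at *
  generalize φ (P.excE (evolve a) 5) = d5 at *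
  generalize φ (P.excE (evolve a) 6) = d6 at *
  generalize φ (P.excE (evolve a) 7) = d7 at *
  generalize cx - cst (a 0) = m0 at *
  generalize cx - cst (a 1) = m1 at *
  generalize cx - cst 1 = m4 at *
  generalize cy = y at *
  change _ = _ * (b1 ^ l 0 * b2 ^ l 1 * (c0 ^ l 2 * c1 ^ l 3 * c2 ^ l 4 * c3 ^ l 5 * c4 ^ l 6 *
    c5 ^ l 7 * c6 ^ l 8 * c7 ^ l 9)) / (b3 ^ l 1 * b4 ^ (l 0 + 2 * l 1 + l 2 + l 3 + l 6 + l 8) *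
    (d0 ^ l 4 * d1 ^ l 5 * d2 ^ (-l 1 - l 2) * d3 ^ (-l 1 - l 3) * d4 ^ l 9 * d5 ^ (-l 1 - l 6) *
    d6 ^ (-l 1 - l 8) * d7 ^ l 7))
  simp only [div_zpow, mul_zpow, zpow_add₀ p4, zpow_sub₀ r2, zpow_sub₀ r3, zpow_sub₀ r5,
    zpow_sub₀ r6, zpow_neg, ← zpow_natCast, ← zpow_mul]
  push_cast
  field_simp

end IsMapping

/-! ### The components of the anticanonical cycle -/

section generic

variable {V : ValuationSubring FuncField} {s t u v τ : FuncField}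

/-- The function `τ` is a unit at the generic point of the curve with valuation ring `V`. -/
def VUnit (V : ValuationSubring FuncField) (τ : FuncField) : Prop := τ ≠ 0 ∧ τ ∈ V ∧ τ⁻¹ ∈ V

/-- The residue class of `τ` in the residue field of `V` is transcendental. -/
def IsGeneric (V : ValuationSubring FuncField) (τ : FuncField) : Prop :=
  ∀ e : ℂ, VUnit V (τ - cst e)

theorem VUnit.notMem_nonunits (h : VUnit V τ) : τ ∉ V.nonunits := by
  rw [V.mem_nonunits_iff_or]
  exact fun h' => h'.elim h.1 (fun h' => h' h.2.2)

theorem VUnit.inv (h : VUnit V τ) : VUnit V τ⁻¹ :=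
  ⟨inv_ne_zero h.1, h.2.2, by rw [inv_inv]; exact h.2.1⟩

theorem VUnit.mul (h : VUnit V τ) (h' : VUnit V s) : VUnit V (τ * s) :=
  ⟨mul_ne_zero h.1 h'.1, mul_mem h.2.1 h'.2.1, by rw [mul_inv]; exact mul_mem h.2.2 h'.2.2⟩

theorem VUnit.div (h : VUnit V τ) (h' : VUnit V s) : VUnit V (τ / s) := by
  rw [div_eq_mul_inv]; exact h.mul h'.inv

theorem vUnit_cst (hcst : ∀ c, cst c ∈ V) {c : ℂ} (h : c ≠ 0) : VUnit V (cst c) :=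
  ⟨cst_ne_zero h, hcst c, by rw [← cst_inv]; exact hcst _⟩

theorem mul_mem_nonunits (h : s ∈ V.nonunits) (ht : t ∈ V) : s * t ∈ V.nonunits := by
  rw [V.mem_nonunits_iff] at h ⊢
  rw [map_mul]
  exact mul_lt_one_of_lt_of_le h ((V.valuation_le_one_iff _).mpr ht)

theorem VUnit.add_nonunit (h : VUnit V τ) (h' : s ∈ V.nonunits) : VUnit V (τ + s) := by
  have hm : τ + s ∈ V := add_mem h.2.1 (V.nonunits_le h')
  have hn : τ + s ∉ V.nonunits := by
    intro h''
    have := sub_mem h'' h'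
    rw [add_sub_cancel_right] at this
    exact h.notMem_nonunits this
  rw [V.mem_nonunits_iff_or, not_or, not_not] at hn
  exact ⟨hn.1, hm, hn.2⟩

/-- The quotient of a unit by a nonunit is not regular. -/
theorem VUnit.div_nonunit (h : VUnit V τ) (h0 : s ≠ 0) (h' : s ∈ V.nonunits) : τ / s ∉ V := by
  intro hm
  have h1 : s⁻¹ ∈ V := by
    have := mul_mem h.2.2 hm
    rwa [← mul_div_assoc, inv_mul_cancel₀ h.1, one_div] at this
  rw [V.mem_nonunits_iff_or] at h'
  exact h'.elim h0 (fun h' => h' h1)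

/-- Restriction to the curve `u = 0` is the substitution `u = 0, v = T` with values in `ℂ(T)`. The
functions vanishing on the curve form a proper ideal of the ring of restrictable functions, and some
valuation ring dominates it. There `v - e` is a unit, since `T - e ≠ 0` in `ℂ(T)`. -/
theorem exists_valuationSubring (hc : IsCoord u v) :
    ∃ V : ValuationSubring FuncField, u ∈ V.nonunits ∧ IsGeneric V v ∧ ∀ c, cst c ∈ V := by
  let K := FractionRing (Polynomial ℂ)
  let T : K := algebraMap (Polynomial ℂ) K Polynomial.X
  let S : Subring FuncField :=
    { carrier := {r | ∃ α : K, HasEv u v 0 T r α}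
      mul_mem' := fun ⟨_, h⟩ ⟨_, h'⟩ => ⟨_, h.mul h'⟩
      one_mem' := ⟨1, HasEv.one⟩
      add_mem' := fun ⟨_, h⟩ ⟨_, h'⟩ => ⟨_, h.add h'⟩
      zero_mem' := ⟨0, HasEv.zero⟩
      neg_mem' := fun ⟨_, h⟩ => ⟨_, h.neg⟩ }
  let I : Ideal S :=
    { carrier := {r | HasEv u v 0 T (r : FuncField) (0 : K)}
      add_mem' := fun h h' => (h.add h').congr rfl (add_zero 0)
      zero_mem' := HasEv.zero
      smul_mem' := fun c r h => by
        obtain ⟨α, hα⟩ := c.2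
        exact (hα.mul h).congr rfl (mul_zero α) }
  have hI : I ≠ ⊤ := by
    intro e
    have h1 : (1 : S) ∈ I := e ▸ Submodule.mem_top
    exact zero_ne_one (HasEv.unique hc h1 HasEv.one)
  obtain ⟨V, hV, hVI⟩ := Ideal.image_subset_nonunits_valuationSubring I hI
  refine ⟨V, hVI ⟨⟨u, 0, HasEv.left⟩, HasEv.left, rfl⟩, fun e => ?_, fun c =>
    hV ⟨_, HasEv.cst c⟩⟩
  have h1 : HasEv u v 0 T (v - cst e) (T - algebraMap ℂ K e) := HasEv.right.sub (HasEv.cst e)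
  refine ⟨sub_ne_zero.mpr (hc.right_ne_cst e), hV ⟨_, h1⟩,
    hV ⟨_, HasEv.inv hc h1 (mul_inv_cancel₀ ?_)⟩⟩
  have e1 : T - algebraMap ℂ K e =
      algebraMap (Polynomial ℂ) K (Polynomial.X - Polynomial.C e) := by
    rw [map_sub]
    rfl
  rw [e1, Ne, IsFractionRing.to_map_eq_zero_iff]
  exact Polynomial.X_sub_C_ne_zero e

theorem IsGeneric.vUnit (h : IsGeneric V τ) : VUnit V τ := by simpa using h 0

theorem IsGeneric.sub_cst (h : IsGeneric V τ) (c : ℂ) : IsGeneric V (τ - cst c) := by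
  intro e
  rw [sub_sub, ← cst_add]
  exact h _

theorem IsGeneric.inv (hcst : ∀ c, cst c ∈ V) (h : IsGeneric V τ) : IsGeneric V τ⁻¹ := by
  intro e
  by_cases he : e = 0
  · simpa [he] using h.vUnit.inv
  -- The identity is `τ⁻¹ - e = -e (τ - e⁻¹)/τ`.
  · have e0 := cst_ne_zero he
    have τ0 := h.vUnit.1
    have := ((vUnit_cst hcst (neg_ne_zero.mpr he)).mul (h e⁻¹)).div h.vUnit
    convert this using 1
    rw [cst_neg, cst_inv]
    field_simp
    ring

/-- The polynomial `P` is the restriction to the curve on which the first coordinate vanishes. -/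
theorem exists_eq_add_X_zero_mul (p : MvPolynomial (Fin 2) ℂ) :
    ∃ (P : Polynomial ℂ) (p₁ : MvPolynomial (Fin 2) ℂ),
      p = Polynomial.aeval (X 1) P + X 0 * p₁ := by
  induction p using MvPolynomial.induction_on with
  | C c => exact ⟨Polynomial.C c, 0, by simp⟩
  | add p q hp hq =>
    obtain ⟨P, p₁, rfl⟩ := hp
    obtain ⟨Q, q₁, rfl⟩ := hq
    exact ⟨P + Q, p₁ + q₁, by rw [map_add]; ring⟩
  | mul_X p i hp =>
    obtain ⟨P, p₁, rfl⟩ := hp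
    fin_cases i
    · exact ⟨0, Polynomial.aeval (X 1) P + X 0 * p₁, by simp; ring⟩
    · exact ⟨P * Polynomial.X, p₁ * X 1, by simp; ring⟩

/-- Over `ℂ` the polynomial splits into linear factors, and each factor has a unit value by
genericity. -/
theorem IsGeneric.vUnit_aeval (hcst : ∀ c, cst c ∈ V) (ht : IsGeneric V t) {P : Polynomial ℂ}
    (hP : P ≠ 0) : VUnit V (Polynomial.aeval t P) := by
  rw [(IsAlgClosed.splits P).eq_prod_roots, map_mul, Polynomial.aeval_C]
  refine VUnit.mul (vUnit_cst hcst (Polynomial.leadingCoeff_ne_zero.mpr hP)) ?_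
  induction P.roots using Multiset.induction_on with
  | empty => simpa using vUnit_cst hcst one_ne_zero
  | cons r R ih =>
    rw [Multiset.map_cons, Multiset.prod_cons, map_mul]
    refine VUnit.mul ?_ ih
    simpa [cst] using ht r

/-- At a point on the curve `V`, with local equation `s`. -/
theorem localRing_on_curve (hcst : ∀ c, cst c ∈ V) (hs : s ∈ V.nonunits) (ht : IsGeneric V t)
    {E : FuncField} (hE : UnitAt (localRing s t) (E / s)) (s0 : s ≠ 0) :
    (∀ r ∈ localRing s t, r ∈ V) ∧ ∀ r ∈ localRing s t, r ∈ V.nonunits ↔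
      ∃ r' ∈ localRing s t, r = E * r' := by
  have hsV : s ∈ V := V.nonunits_le hs
  have hV : ∀ p : MvPolynomial (Fin 2) ℂ, aeval ![s, t] p ∈ V := by
    intro p
    induction p using MvPolynomial.induction_on with
    | C c => simpa [cst] using hcst c
    | add p q hp hq => rw [map_add]; exact add_mem hp hq
    | mul_X p i hp =>
      rw [map_mul, aeval_X]
      refine mul_mem hp ?_
      fin_cases i
      · exact hsV
      · exact ht.vUnit.2.1
  have hev : ∀ (P : Polynomial ℂ) (p₁ : MvPolynomial (Fin 2) ℂ), aeval ![s, t] (Polynomial.aeval (X 1) P + X 0 * p₁) =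
      Polynomial.aeval t P + s * aeval ![s, t] p₁ := by
    intro P p₁
    rw [map_add, map_mul, ← Polynomial.aeval_algHom_apply
      (aeval ![s, t] : MvPolynomial (Fin 2) ℂ →ₐ[ℂ] FuncField), aeval_X, aeval_X]
    rfl
  have hsV' : ∀ p : MvPolynomial (Fin 2) ℂ, s * aeval ![s, t] p ∈ V.nonunits := fun p => mul_mem_nonunits hs (hV p)
  have hq : ∀ q : MvPolynomial (Fin 2) ℂ, constantCoeff q ≠ 0 → VUnit V (aeval ![s, t] q) := by
    intro q h
    obtain ⟨Q, q₁, rfl⟩ := exists_eq_add_X_zero_mul q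
    rw [hev]
    refine (ht.vUnit_aeval hcst ?_).add_nonunit (hsV' _)
    rintro rfl
    simp at h
  have hRV : ∀ r ∈ localRing s t, r ∈ V := by
    rintro r ⟨p, q, h1, h2, h3⟩
    rw [← eq_div_iff h2, div_eq_mul_inv] at h3
    rw [h3]
    exact mul_mem (hV p) (hq q h1).2.2
  refine ⟨hRV, fun r hr => ⟨fun hn => ?_, ?_⟩⟩
  · obtain ⟨p, q, h1, h2, h3⟩ := hr
    obtain ⟨P, p₁, rfl⟩ := exists_eq_add_X_zero_mul p
    -- If the numerator did not vanish on the curve, it would be a unit of `V`, contrary to `r`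
    -- being a nonunit.
    have hP : P = 0 := by
      by_contra hP
      have := mul_mem_nonunits hn (hV q)
      rw [h3, hev] at this
      exact ((ht.vUnit_aeval hcst hP).add_nonunit (hsV' p₁)).notMem_nonunits this
    rw [hev, hP, map_zero, zero_add] at h3
    have hr1 : aeval ![s, t] p₁ / aeval ![s, t] q ∈ localRing s t :=
      ⟨p₁, q, h1, h2, div_mul_cancel₀ _ h2⟩
    refine ⟨_, mul_mem hE.2.2 hr1, ?_⟩
    have E0 : E ≠ 0 := fun e => hE.1 (by rw [e, zero_div])
    rw [eq_div_of_mul_eq h2 h3]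
    field_simp
  · rintro ⟨r', hr', rfl⟩
    have : E * r' = s * (E / s * r') := by field_simp
    rw [this]
    exact mul_mem_nonunits hs (hRV _ (mul_mem hE.2.1 hr'))

end generic

/-! ### Explicit equations of the components `D_k` -/

section eqD

variable {a : Fin 5 → ℂ} {P : Pt}

theorem eqD_zero (ha : Admissible a) (hP : P.Valid a) :
    secD 0 * localEq a (clsD 0) (P.ring a) =
      cy * Pt.pole cy (P.yval a) / (P.excE a 0 * P.excE a 1) := by
  rw [Pt.localEq_eq ha hP, Fin.prod_univ_eight]
  simp [clsD, secD]
  field_simp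

theorem eqD_one (ha : Admissible a) (hP : P.Valid a) :
    secD 1 * localEq a (clsD 1) (P.ring a) =
      Pt.pole cx (P.xval a) / (P.excE a 5 * P.excE a 6) := by
  rw [Pt.localEq_eq ha hP, Fin.prod_univ_eight]
  simp [clsD, secD]
  field_simp

theorem eqD_two (ha : Admissible a) (hP : P.Valid a) :
    secD 2 * localEq a (clsD 2) (P.ring a) = P.excE a 6 / P.excE a 7 := by
  rw [Pt.localEq_eq ha hP, Fin.prod_univ_eight]
  simp [clsD, secD]
  field_simp

theorem eqD_three (ha : Admissible a) (hP : P.Valid a) :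
    secD 3 * localEq a (clsD 3) (P.ring a) =
      Pt.pole cy (P.yval a) / (P.excE a 4 * P.excE a 6) := by
  rw [Pt.localEq_eq ha hP, Fin.prod_univ_eight]
  simp [clsD, secD]
  field_simp

theorem eqD_four (ha : Admissible a) (hP : P.Valid a) :
    secD 4 * localEq a (clsD 4) (P.ring a) =
      cx * Pt.pole cx (P.xval a) / (P.excE a 2 * P.excE a 3) := by
  rw [Pt.localEq_eq ha hP, Fin.prod_univ_eight]
  simp [clsD, secD]
  field_simp

end eqD

/-- The valuation ring `V` belongs to the curve `u = 0`, on which `v` is a coordinate. -/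
structure IsCurve (V : ValuationSubring FuncField) (u v : FuncField) : Prop where
  nonunit : u ∈ V.nonunits
  ne_zero : u ≠ 0
  generic : IsGeneric V v
  cst_mem : ∀ c, cst c ∈ V

theorem exists_isCurve {u v : FuncField} (hc : IsCoord u v) : ∃ V, IsCurve V u v := by
  obtain ⟨V, h1, h2, h3⟩ := exists_valuationSubring hc
  exact ⟨V, h1, hc.left_ne_zero, h2, h3⟩

theorem IsCurve.vUnit_one {V : ValuationSubring FuncField} : VUnit V 1 :=
  ⟨one_ne_zero, one_mem V, by rw [inv_one]; exact one_mem V⟩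

theorem IsCurve.inv_notMem {V : ValuationSubring FuncField} {u v : FuncField}
    (h : IsCurve V u v) : u⁻¹ ∉ V := by
  rw [← one_div]
  exact vUnit_one.div_nonunit h.ne_zero h.nonunit

/-- The coordinates at the generic point of the component `D_k`. -/
def curveCoord : Fin 5 → FuncField × FuncField :=
  ![(cy, cx), (cx⁻¹, cy), (cx⁻¹, cx / cy), (cy⁻¹, cx), (cx, cy)]

theorem isCoord_curveCoord (k : Fin 5) : IsCoord (curveCoord k).1 (curveCoord k).2 := by
  have h1 : IsCoord cx⁻¹ cy := isCoord_cx_cy.swap.inv.swap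
  have h2 : IsCoord cx⁻¹ (cx / cy) := by
    have := (isCoord_par none none).div
    have e : (cx / cy : FuncField) = par cy none / par cx none := by
      simp only [par]
      rw [inv_div_inv]
    rw [e]
    exact this
  fin_cases k
  · exact isCoord_cx_cy.swap
  · exact h1
  · exact h2
  · exact isCoord_cx_cy.inv.swap
  · exact isCoord_cx_cy

/-- The points of the component `D_k`. -/
def OnCurve (P : Pt) : Fin 5 → Prop :=
  ![(∃ p, P = Pt.base p (some 0)) ∨ P = Pt.exc 0 0 ∨ P = Pt.exc 1 0,
    (∃ d, P = Pt.base none (some d)) ∨ P = Pt.corner 5 ∨ P = Pt.corner 6,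
    (∃ c, P = Pt.exc 6 c) ∨ P = Pt.corner 6 ∨ P = Pt.corner 7,
    (∃ c, P = Pt.base (some c) none) ∨ P = Pt.exc 4 0 ∨ P = Pt.exc 6 0,
    (∃ q, P = Pt.base (some 0) q) ∨ P = Pt.corner 2 ∨ P = Pt.corner 3]

theorem exc_ratio_mem (a : Fin 5 → ℂ) (i : Fin 8) (c : ℂ) :
    (centre a i).2 / (centre a i).1 ∈ (Pt.exc i c).ring a :=
  (hasVal_exc_ratio c).mem ((Pt.exc i c).isCoord a)

theorem exc_ratio_inv_mem (a : Fin 5 → ℂ) (i : Fin 8) {c : ℂ} (h : c ≠ 0) :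
    (centre a i).1 / (centre a i).2 ∈ (Pt.exc i c).ring a := by
  have := (hasVal_exc_ratio (u := (centre a i).1) (v := (centre a i).2) c).inv
    ((Pt.exc i c).isCoord a) h
  rw [inv_div] at this
  exact this.mem ((Pt.exc i c).isCoord a)

theorem exc_ratio_unitAt (a : Fin 5 → ℂ) (i : Fin 8) {c : ℂ} (h : c ≠ 0) :
    UnitAt ((Pt.exc i c).ring a) ((centre a i).2 / (centre a i).1) :=
  (hasVal_exc_ratio c).unitAt ((Pt.exc i c).isCoord a) h

theorem corner_ratio_mem (a : Fin 5 → ℂ) (i : Fin 8) :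
    (centre a i).1 / (centre a i).2 ∈ (Pt.corner i).ring a :=
  HasVal.mem ((Pt.corner i).isCoord a) (c := 0) HasEv.left

/-- On the exceptional curve over `P₈` the ratio `x / y` has the value `1 / a₅`. -/
theorem hasVal_ratio_seven (a : Fin 5 → ℂ) {P : Pt}
    (h : (∃ c, P = Pt.exc 7 c) ∨ P = Pt.corner 7) :
    HasVal (P.u a) (P.v a) (cx / cy) (a 4)⁻¹ := by
  rcases h with ⟨c, rfl⟩ | rfl
  · exact HasVal.of_sub (hasVal_exc_right (isCoord_centre a 7) c)
  · exact HasVal.of_sub HasEv.right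

/-! ### Points off a component -/

section offCurve

variable {a : Fin 5 → ℂ} {P : Pt} {V : ValuationSubring FuncField}

theorem mem_of_xval {d : ℂ} (h : P.xval a = some d) : cx ∈ P.ring a := by
  have := (P.hasPVal a).1
  rw [h, hasPVal_some] at this
  exact this.mem (P.isCoord a)

theorem mem_of_yval {d : ℂ} (h : P.yval a = some d) : cy ∈ P.ring a := by
  have := (P.hasPVal a).2
  rw [h, hasPVal_some] at this
  exact this.mem (P.isCoord a)

theorem inv_mem_of_xval (h : P.xval a ≠ some 0) :
    cx⁻¹ ∈ P.ring a ∧ UnitAt (P.ring a) (cx * Pt.pole cx (P.xval a)) := by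
  have := (P.hasPVal a).1
  rcases hp : P.xval a with _ | d
  · rw [hp, hasPVal_none] at this
    exact ⟨this.mem (P.isCoord a), UnitAt.one.congr (mul_inv_cancel₀ cx_ne_zero).symm⟩
  · rw [hp, hasPVal_some] at this
    have hd : d ≠ 0 := by rintro rfl; exact h hp
    exact ⟨(this.inv (P.isCoord a) hd).mem (P.isCoord a),
      (this.unitAt (P.isCoord a) hd).congr (mul_one _).symm⟩

theorem inv_mem_of_yval (h : P.yval a ≠ some 0) :
    cy⁻¹ ∈ P.ring a ∧ UnitAt (P.ring a) (cy * Pt.pole cy (P.yval a)) := by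
  have := (P.hasPVal a).2
  rcases hp : P.yval a with _ | d
  · rw [hp, hasPVal_none] at this
    exact ⟨this.mem (P.isCoord a), UnitAt.one.congr (mul_inv_cancel₀ cy_ne_zero).symm⟩
  · rw [hp, hasPVal_some] at this
    have hd : d ≠ 0 := by rintro rfl; exact h hp
    exact ⟨(this.inv (P.isCoord a) hd).mem (P.isCoord a),
      (this.unitAt (P.isCoord a) hd).congr (mul_one _).symm⟩

/-- The equation is found to be a unit in each chart. That the curve does not pass through the point
is witnessed by a regular function with a pole along the curve: `1/y` where `y` does not vanish, and
the slope `(x - a_i)/y` on an exceptional curve. The other components are treated in the same way.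
-/
theorem off_zero (ha : Admissible a) (hP : P.Valid a) (hon : ¬ OnCurve P 0) :
    UnitAt (P.ring a) (secD 0 * localEq a (clsD 0) (P.ring a)) ∧
      (IsCurve V cy cx → ∃ r ∈ P.ring a, r ∉ V) := by
  have y0 := cy_ne_zero
  rw [eqD_zero ha hP]
  by_cases hy : P.yval a = some 0
  swap
  · have h := inv_mem_of_yval hy
    refine ⟨h.2.congr ?_, fun hV => ⟨_, h.1, hV.inv_notMem⟩⟩
    rw [Pt.excE_eq_one_of_yval (i := 0) hy, Pt.excE_eq_one_of_yval (i := 1) hy, mul_one, div_one]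
  have key : ∀ c, IsCurve V cy cx → (cx - cst c) / cy ∉ V := fun c hV =>
    (hV.generic c).div_nonunit hV.ne_zero hV.nonunit
  have n0 := cx_sub_cst_ne_zero (a 0)
  have n1 := cx_sub_cst_ne_zero (a 1)
  rcases P with ⟨p, q⟩ | ⟨i, c⟩ | i
  · exact absurd (Or.inl ⟨p, by rw [show q = some 0 from hy]⟩) hon
  · have : i = 0 ∨ i = 1 := by
      revert hy
      have := ha.1 2
      have := ha.1 3
      fin_cases i <;> simp [Pt.yval, cenY, *]
    rcases this with rfl | rfl
    · have hc : c ≠ 0 := by rintro rfl; exact hon (Or.inr (Or.inl rfl))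
      refine ⟨(exc_ratio_unitAt a 0 hc).congr ?_, fun hV => ⟨_, exc_ratio_inv_mem a 0 hc, key _ hV⟩⟩
      simp [Pt.excE, Pt.yval, cenY, Pt.pole]
      rfl
    · have hc : c ≠ 0 := by rintro rfl; exact hon (Or.inr (Or.inr rfl))
      refine ⟨(exc_ratio_unitAt a 1 hc).congr ?_, fun hV => ⟨_, exc_ratio_inv_mem a 1 hc, key _ hV⟩⟩
      simp [Pt.excE, Pt.yval, cenY, Pt.pole]
      rfl
  · have : i = 0 ∨ i = 1 := by
      revert hy
      have := ha.1 2
      have := ha.1 3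
      fin_cases i <;> simp [Pt.yval, cenY, *]
    rcases this with rfl | rfl
    · refine ⟨UnitAt.one.congr ?_, fun hV => ⟨_, corner_ratio_mem a 0, key _ hV⟩⟩
      simp [Pt.excE, Pt.yval, cenY, Pt.pole, centre, y0]
    · refine ⟨UnitAt.one.congr ?_, fun hV => ⟨_, corner_ratio_mem a 1, key _ hV⟩⟩
      simp [Pt.excE, Pt.yval, cenY, Pt.pole, centre, y0]

theorem off_four (ha : Admissible a) (hP : P.Valid a) (hon : ¬ OnCurve P 4) :
    UnitAt (P.ring a) (secD 4 * localEq a (clsD 4) (P.ring a)) ∧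
      (IsCurve V cx cy → ∃ r ∈ P.ring a, r ∉ V) := by
  have x0 := cx_ne_zero
  rw [eqD_four ha hP]
  by_cases hy : P.xval a = some 0
  swap
  · have h := inv_mem_of_xval hy
    refine ⟨h.2.congr ?_, fun hV => ⟨_, h.1, hV.inv_notMem⟩⟩
    rw [Pt.excE_eq_one_of_xval (i := 2) hy, Pt.excE_eq_one_of_xval (i := 3) hy, mul_one, div_one]
  have key : ∀ c, IsCurve V cx cy → (cy - cst c) / cx ∉ V := fun c hV =>
    (hV.generic c).div_nonunit hV.ne_zero hV.nonunit
  rcases P with ⟨p, q⟩ | ⟨i, c⟩ | i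
  · exact absurd (Or.inl ⟨q, by rw [show p = some 0 from hy]⟩) hon
  · have : i = 2 ∨ i = 3 := by
      revert hy
      have := ha.1 0
      have := ha.1 1
      fin_cases i <;> simp [Pt.xval, cenX, *]
    rcases this with rfl | rfl
    · refine ⟨UnitAt.one.congr ?_, fun hV => ⟨_, exc_ratio_mem a 2 c, key _ hV⟩⟩
      simp [Pt.excE, Pt.xval, cenX, Pt.pole, centre, x0]
    · refine ⟨UnitAt.one.congr ?_, fun hV => ⟨_, exc_ratio_mem a 3 c, key _ hV⟩⟩
      simp [Pt.excE, Pt.xval, cenX, Pt.pole, centre, x0]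
  · have : i = 2 ∨ i = 3 := by
      revert hy
      have := ha.1 0
      have := ha.1 1
      fin_cases i <;> simp [Pt.xval, cenX, *]
    rcases this with rfl | rfl
    · exact absurd (Or.inr (Or.inl rfl)) hon
    · exact absurd (Or.inr (Or.inr rfl)) hon

theorem off_one (ha : Admissible a) (hP : P.Valid a) (hon : ¬ OnCurve P 1) :
    UnitAt (P.ring a) (secD 1 * localEq a (clsD 1) (P.ring a)) ∧
      (IsCurve V cx⁻¹ cy → ∃ r ∈ P.ring a, r ∉ V) := by
  have x0 := cx_ne_zero
  have y0 := cy_ne_zero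
  rw [eqD_one ha hP]
  rcases hx : P.xval a with _ | d
  swap
  · refine ⟨UnitAt.one.congr ?_, fun hV => ⟨_, mem_of_xval hx, ?_⟩⟩
    · rw [Pt.excE_eq_one_of_xval (i := 5) (by rw [hx]; exact Option.some_ne_none d),
        Pt.excE_eq_one_of_xval (i := 6) (by rw [hx]; exact Option.some_ne_none d)]
      simp [Pt.pole]
    · simpa using hV.inv_notMem
  have key : ∀ τ, VUnit V τ → IsCurve V cx⁻¹ cy → τ / cx⁻¹ ∉ V := fun τ hτ hV =>
    hτ.div_nonunit hV.ne_zero hV.nonunit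
  have key2 : IsCurve V cx⁻¹ cy → cx / cy ∉ V := fun hV => by
    have := key _ hV.generic.vUnit.inv hV
    rwa [div_inv_eq_mul, mul_comm, ← div_eq_mul_inv] at this
  rcases P with ⟨p, q⟩ | ⟨i, c⟩ | i
  · rcases q with _ | q
    · have : p = none := hx
      subst this
      exact absurd hP Pt.not_valid_none_none
    · exact absurd (Or.inl ⟨q, by rw [show p = none from hx]⟩) hon
  · have : i = 5 ∨ i = 6 ∨ i = 7 := by
      revert hx
      fin_cases i <;> simp [Pt.xval, cenX]
    rcases this with rfl | rfl | rfl
    · refine ⟨UnitAt.one.congr ?_, fun hV => ⟨_, exc_ratio_mem a 5 c, key (cy - 1) ?_ hV⟩⟩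
      · simp [Pt.excE, Pt.pole, centre, x0]
      · simpa using hV.generic 1
    · refine ⟨UnitAt.one.congr ?_, fun hV => ⟨_, exc_ratio_mem a 6 c, key cy⁻¹ ?_ hV⟩⟩
      · simp [Pt.excE, Pt.pole, centre, x0]
      · exact hV.generic.vUnit.inv
    · refine ⟨UnitAt.one.congr ?_, fun hV => ⟨_, (hasVal_ratio_seven a (Or.inl ⟨c, rfl⟩)).mem
        (Pt.isCoord a _), key2 hV⟩⟩
      simp [Pt.excE, Pt.pole, x0]
  · have : i = 5 ∨ i = 6 ∨ i = 7 := by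
      revert hx
      fin_cases i <;> simp [Pt.xval, cenX]
    rcases this with rfl | rfl | rfl
    · exact absurd (Or.inr (Or.inl rfl)) hon
    · exact absurd (Or.inr (Or.inr rfl)) hon
    · refine ⟨UnitAt.one.congr ?_, fun hV => ⟨_, (hasVal_ratio_seven a (Or.inr rfl)).mem
        (Pt.isCoord a _), key2 hV⟩⟩
      simp [Pt.excE, Pt.pole, x0]

theorem off_three (ha : Admissible a) (hP : P.Valid a) (hon : ¬ OnCurve P 3) :
    UnitAt (P.ring a) (secD 3 * localEq a (clsD 3) (P.ring a)) ∧
      (IsCurve V cy⁻¹ cx → ∃ r ∈ P.ring a, r ∉ V) := by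
  have x0 := cx_ne_zero
  have y0 := cy_ne_zero
  have a4 := ha.1 4
  rw [eqD_three ha hP]
  rcases hx : P.yval a with _ | d
  swap
  · refine ⟨UnitAt.one.congr ?_, fun hV => ⟨_, mem_of_yval hx, ?_⟩⟩
    · rw [Pt.excE_eq_one_of_yval (i := 4) (by rw [hx]; exact Option.some_ne_none d),
        Pt.excE_eq_one_of_yval (i := 6) (by rw [hx]; exact Option.some_ne_none d)]
      simp [Pt.pole]
    · simpa using hV.inv_notMem
  have key : ∀ τ, VUnit V τ → IsCurve V cy⁻¹ cx → τ / cy⁻¹ ∉ V := fun τ hτ hV =>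
    hτ.div_nonunit hV.ne_zero hV.nonunit
  have key2 : IsCurve V cy⁻¹ cx → cy / cx ∉ V := fun hV => by
    have := key _ hV.generic.vUnit.inv hV
    rwa [div_inv_eq_mul, mul_comm, ← div_eq_mul_inv] at this
  have key3 : ∀ P : Pt, ((∃ c, P = Pt.exc 7 c) ∨ P = Pt.corner 7) →
      UnitAt (P.ring a) (cx / cy) := fun P h =>
    (hasVal_ratio_seven a h).unitAt (Pt.isCoord a _) (inv_ne_zero a4)
  rcases P with ⟨p, q⟩ | ⟨i, c⟩ | i
  · have : q = none := hx
    subst this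
    rcases p with _ | p
    · exact absurd hP Pt.not_valid_none_none
    · exact absurd (Or.inl ⟨p, rfl⟩) hon
  · have : i = 4 ∨ i = 6 ∨ i = 7 := by
      revert hx
      fin_cases i <;> simp [Pt.yval, cenY]
    rcases this with rfl | rfl | rfl
    · have hc : c ≠ 0 := by rintro rfl; exact hon (Or.inr (Or.inl rfl))
      refine ⟨(exc_ratio_unitAt a 4 hc).congr ?_, fun hV =>
        ⟨_, exc_ratio_inv_mem a 4 hc, key (cx - 1) ?_ hV⟩⟩
      · simp [Pt.excE, Pt.pole, centre]
      · simpa using hV.generic 1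
    · have hc : c ≠ 0 := by rintro rfl; exact hon (Or.inr (Or.inr rfl))
      refine ⟨(exc_ratio_unitAt a 6 hc).congr ?_, fun hV =>
        ⟨_, exc_ratio_inv_mem a 6 hc, key cx⁻¹ hV.generic.vUnit.inv hV⟩⟩
      simp [Pt.excE, Pt.pole, centre]
    · have h7 := key3 (Pt.exc 7 c) (Or.inl ⟨c, rfl⟩)
      refine ⟨h7.congr ?_, fun hV => ⟨_, h7.2.2, by rw [inv_div]; exact key2 hV⟩⟩
      simp [Pt.excE, Pt.pole]
      field_simp
  · have : i = 4 ∨ i = 6 ∨ i = 7 := by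
      revert hx
      fin_cases i <;> simp [Pt.yval, cenY]
    rcases this with rfl | rfl | rfl
    · refine ⟨UnitAt.one.congr ?_, fun hV => ⟨_, corner_ratio_mem a 4, key (cx - 1) ?_ hV⟩⟩
      · simp [Pt.excE, Pt.pole, centre, y0]
      · simpa using hV.generic 1
    · refine ⟨UnitAt.one.congr ?_, fun hV =>
        ⟨_, corner_ratio_mem a 6, key cx⁻¹ hV.generic.vUnit.inv hV⟩⟩
      simp [Pt.excE, Pt.pole, centre, y0]
    · have h7 := key3 (Pt.corner 7) (Or.inr rfl)
      refine ⟨h7.congr ?_, fun hV => ⟨_, h7.2.2, by rw [inv_div]; exact key2 hV⟩⟩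
      simp [Pt.excE, Pt.pole]
      field_simp

theorem off_two (ha : Admissible a) (hP : P.Valid a) (hon : ¬ OnCurve P 2) :
    UnitAt (P.ring a) (secD 2 * localEq a (clsD 2) (P.ring a)) ∧
      (IsCurve V cx⁻¹ (cx / cy) → ∃ r ∈ P.ring a, r ∉ V) := by
  have x0 := cx_ne_zero
  have y0 := cy_ne_zero
  rw [eqD_two ha hP]
  rcases hx : P.xval a with _ | d
  swap
  · refine ⟨UnitAt.one.congr ?_, fun hV => ⟨_, mem_of_xval hx, ?_⟩⟩
    · rw [Pt.excE_eq_one_of_xval (i := 6) (by rw [hx]; exact Option.some_ne_none d),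
        Pt.excE_eq_one_of_xval (i := 7) (by rw [hx]; exact Option.some_ne_none d), div_one]
    · simpa using hV.inv_notMem
  have key : ∀ τ, VUnit V τ → IsCurve V cx⁻¹ (cx / cy) → τ / cx⁻¹ ∉ V := fun τ hτ hV =>
    hτ.div_nonunit hV.ne_zero hV.nonunit
  rcases hy : P.yval a with _ | d
  swap
  · refine ⟨UnitAt.one.congr ?_, fun hV => ⟨_, mem_of_yval hy, ?_⟩⟩
    · rw [Pt.excE_eq_one_of_yval (i := 6) (by rw [hy]; exact Option.some_ne_none d),
        Pt.excE_eq_one_of_yval (i := 7) (by rw [hy]; exact Option.some_ne_none d), div_one]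
    · have := key _ hV.generic.vUnit.inv hV
      convert this using 1
      field_simp
  rcases P with ⟨p, q⟩ | ⟨i, c⟩ | i
  · have : q = none := hy
    subst this
    have : p = none := hx
    subst this
    exact absurd hP Pt.not_valid_none_none
  · have : i = 6 ∨ i = 7 := by
      revert hx hy
      fin_cases i <;> simp [Pt.yval, cenY, Pt.xval, cenX]
    rcases this with rfl | rfl
    · exact absurd (Or.inl ⟨c, rfl⟩) hon
    · refine ⟨UnitAt.one.congr ?_, fun hV => ⟨_, exc_ratio_mem a 7 c, key _ (hV.generic _) hV⟩⟩
      simp [Pt.excE, centre, x0]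
  · have : i = 6 ∨ i = 7 := by
      revert hx hy
      fin_cases i <;> simp [Pt.yval, cenY, Pt.xval, cenX]
    rcases this with rfl | rfl
    · exact absurd (Or.inr (Or.inl rfl)) hon
    · exact absurd (Or.inr (Or.inr rfl)) hon

theorem off_curve (ha : Admissible a) (hP : P.Valid a) {k : Fin 5} (hon : ¬ OnCurve P k) :
    UnitAt (P.ring a) (secD k * localEq a (clsD k) (P.ring a)) ∧
      (IsCurve V (curveCoord k).1 (curveCoord k).2 → ∃ r ∈ P.ring a, r ∉ V) := by
  fin_cases k
  · exact off_zero ha hP hon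
  · exact off_one ha hP hon
  · exact off_two ha hP hon
  · exact off_three ha hP hon
  · exact off_four ha hP hon

theorem OnD.onCurve (ha : Admissible a) (hP : P.Valid a) {k : Fin 5} (h : OnD a k (P.ring a)) :
    OnCurve P k := by
  by_contra hon
  obtain ⟨V, -⟩ := exists_isCurve isCoord_cx_cy
  exact h.2 (off_curve (V := V) ha hP hon).1

end offCurve

/-! ### Points on a component, and irreducibility of the components -/

section onCurve

variable {a : Fin 5 → ℂ} {P : Pt} {V : ValuationSubring FuncField}

/-- At a point with coordinates `s, t` such that `s = 0` is the curve and `t` is a coordinate on it,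
`s` is not a unit because `1/s` is not in `V`. -/
theorem IsCurve.on {u v s t E : FuncField} (hV : IsCurve V u v) (hs : s ∈ V.nonunits)
    (ht : IsGeneric V t) (s0 : s ≠ 0) {R : Subalgebra ℂ FuncField} (hR : R = localRing s t)
    (hE : E = s) :
    VanishesAt R E ∧ (∀ r ∈ R, r ∈ V) ∧ ∀ r ∈ R, r ∈ V.nonunits ↔ ∃ r' ∈ R, r = E * r' := by
  subst hR hE
  have h := localRing_on_curve hV.cst_mem hs ht (UnitAt.one.congr (div_self s0).symm) s0
  have hE : E ∈ localRing E t := ⟨X 0, 1, by simp, by simp, by simp⟩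
  refine ⟨⟨hE, fun hu => ?_⟩, h⟩
  rw [V.mem_nonunits_iff_or] at hs
  exact hs.elim s0 (fun h' => h' (h.1 _ hu.2.2))

theorem IsGeneric.par (hcst : ∀ c, cst c ∈ V) {z : FuncField} (h : IsGeneric V z) (p : Option ℂ) :
    IsGeneric V (par z p) := by
  rcases p with _ | c
  · exact h.inv hcst
  · exact h.sub_cst c

theorem div_mem_nonunits {s t : FuncField} (hs : s ∈ V.nonunits) (ht : VUnit V t) :
    s / t ∈ V.nonunits := by
  rw [div_eq_mul_inv]
  exact mul_mem_nonunits hs ht.2.2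

/-- At the points of `D_k` the ideal of the functions vanishing on `D_k` is generated by the local
equation. -/
theorem on_curve (ha : Admissible a) (hP : P.Valid a) {k : Fin 5} (hon : OnCurve P k)
    (hV : IsCurve V (curveCoord k).1 (curveCoord k).2) :
    OnD a k (P.ring a) ∧ (∀ r ∈ P.ring a, r ∈ V) ∧ ∀ r ∈ P.ring a, r ∈ V.nonunits ↔
      ∃ r' ∈ P.ring a, r = secD k * localEq a (clsD k) (P.ring a) * r' := by
  rw [OnD]
  have x0 := cx_ne_zero
  have y0 := cy_ne_zero
  have n0 := cx_sub_cst_ne_zero (a 0)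
  have n1 := cx_sub_cst_ne_zero (a 1)
  have hg := hV.generic
  have hn := hV.nonunit
  have hc := hV.cst_mem
  have h1 : ∀ {τ}, IsGeneric V τ → IsGeneric V (τ - 1) := fun h => by
    simpa using h.sub_cst 1
  fin_cases k
  · change OnCurve P 0 at hon
    change IsGeneric V cx at hg
    change cy ∈ V.nonunits at hn
    rw [show (⟨0, by decide⟩ : Fin 5) = 0 from rfl, eqD_zero ha hP]
    rcases hon with ⟨p, rfl⟩ | rfl | rfl
    · refine hV.on (s := cy) (t := par cx p) hn (hg.par hc p) y0 ?_ ?_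
      · rw [localRing_swap]
        simp [Pt.ring, Pt.u, Pt.v]
      · simp [Pt.excE, Pt.yval, Pt.pole]
    · refine hV.on (s := cy / (cx - cst (a 0))) (t := cx - cst (a 0))
        (div_mem_nonunits hn (hg _)) (hg.sub_cst _) (div_ne_zero y0 n0) ?_ ?_
      · rw [localRing_swap]
        simp [Pt.ring, Pt.u, Pt.v, centre]
      · simp [Pt.excE, Pt.yval, Pt.pole, centre, cenY]
    · refine hV.on (s := cy / (cx - cst (a 1))) (t := cx - cst (a 1))
        (div_mem_nonunits hn (hg _)) (hg.sub_cst _) (div_ne_zero y0 n1) ?_ ?_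
      · rw [localRing_swap]
        simp [Pt.ring, Pt.u, Pt.v, centre]
      · simp [Pt.excE, Pt.yval, Pt.pole, centre, cenY]
  · change OnCurve P 1 at hon
    change IsGeneric V cy at hg
    change cx⁻¹ ∈ V.nonunits at hn
    rw [show (⟨1, by decide⟩ : Fin 5) = 1 from rfl, eqD_one ha hP]
    rcases hon with ⟨d, rfl⟩ | rfl | rfl
    · refine hV.on (s := cx⁻¹) (t := cy - cst d) hn (hg.sub_cst d) (inv_ne_zero x0) rfl ?_
      simp [Pt.excE, Pt.xval, Pt.pole]
    · refine hV.on (s := cx⁻¹ / (cy - 1)) (t := cy - 1)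
        (div_mem_nonunits hn (h1 hg).vUnit) (h1 hg)
        (div_ne_zero (inv_ne_zero x0) (h1 hg).vUnit.1) rfl ?_
      simp [Pt.excE, Pt.xval, Pt.pole, centre, cenX]
    · refine hV.on (s := cx⁻¹ / cy⁻¹) (t := cy⁻¹)
        (div_mem_nonunits hn hg.vUnit.inv) (hg.inv hc)
        (div_ne_zero (inv_ne_zero x0) (inv_ne_zero y0)) rfl ?_
      simp [Pt.excE, Pt.xval, Pt.pole, centre, cenX]
  · change OnCurve P 2 at hon
    change IsGeneric V (cx / cy) at hg
    change cx⁻¹ ∈ V.nonunits at hn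
    rw [show (⟨2, by decide⟩ : Fin 5) = 2 from rfl, eqD_two ha hP]
    rcases hon with ⟨c, rfl⟩ | rfl | rfl
    · refine hV.on (s := cx⁻¹) (t := cy⁻¹ / cx⁻¹ - cst c) hn ?_ (inv_ne_zero x0) rfl ?_
      · rw [inv_div_inv]
        exact hg.sub_cst c
      · simp [Pt.excE, centre]
    · refine hV.on (s := cy⁻¹) (t := cx⁻¹ / cy⁻¹) ?_ ?_ (inv_ne_zero y0) ?_ ?_
      · have : cy⁻¹ = cx⁻¹ * (cx / cy) := by field_simp
        rw [this]
        exact mul_mem_nonunits hn hg.vUnit.2.1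
      · have := hg.inv hc
        rwa [inv_div, ← inv_div_inv] at this
      · rw [localRing_swap]
        rfl
      · simp [Pt.excE, centre]
    · refine hV.on (s := cx⁻¹ / (cx / cy - cst (a 4)⁻¹)) (t := cx / cy - cst (a 4)⁻¹)
        (div_mem_nonunits hn (hg _)) (hg.sub_cst _) (div_ne_zero (inv_ne_zero x0) (hg _).1) rfl ?_
      simp [Pt.excE, centre]
  · change OnCurve P 3 at hon
    change IsGeneric V cx at hg
    change cy⁻¹ ∈ V.nonunits at hn
    rw [show (⟨3, by decide⟩ : Fin 5) = 3 from rfl, eqD_three ha hP]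
    rcases hon with ⟨c, rfl⟩ | rfl | rfl
    · refine hV.on (s := cy⁻¹) (t := cx - cst c) hn (hg.sub_cst c) (inv_ne_zero y0) ?_ ?_
      · rw [localRing_swap]
        rfl
      · simp [Pt.excE, Pt.yval, Pt.pole]
    · refine hV.on (s := cy⁻¹ / (cx - 1)) (t := cx - 1)
        (div_mem_nonunits hn (h1 hg).vUnit) (h1 hg)
        (div_ne_zero (inv_ne_zero y0) (h1 hg).vUnit.1) ?_ ?_
      · rw [localRing_swap]
        simp [Pt.ring, Pt.u, Pt.v, centre]
      · simp [Pt.excE, Pt.yval, Pt.pole, centre, cenY]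
    · refine hV.on (s := cy⁻¹ / cx⁻¹) (t := cx⁻¹)
        (div_mem_nonunits hn hg.vUnit.inv) (hg.inv hc)
        (div_ne_zero (inv_ne_zero y0) (inv_ne_zero x0)) ?_ ?_
      · rw [localRing_swap]
        simp [Pt.ring, Pt.u, Pt.v, centre]
      · simp [Pt.excE, Pt.yval, Pt.pole, centre, cenY]
  · change OnCurve P 4 at hon
    change IsGeneric V cy at hg
    change cx ∈ V.nonunits at hn
    rw [show (⟨4, by decide⟩ : Fin 5) = 4 from rfl, eqD_four ha hP]
    rcases hon with ⟨q, rfl⟩ | rfl | rfl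
    · refine hV.on (s := cx) (t := par cy q) hn (hg.par hc q) x0 ?_ ?_
      · simp [Pt.ring, Pt.u, Pt.v]
      · simp [Pt.excE, Pt.xval, Pt.pole]
    · refine hV.on (s := cx / (cy - cst (a 2))) (t := cy - cst (a 2))
        (div_mem_nonunits hn (hg _)) (hg.sub_cst _) (div_ne_zero x0 (hg _).1) rfl ?_
      simp [Pt.excE, Pt.xval, Pt.pole, centre, cenX]
    · refine hV.on (s := cx / (cy - cst (a 3))) (t := cy - cst (a 3))
        (div_mem_nonunits hn (hg _)) (hg.sub_cst _) (div_ne_zero x0 (hg _).1) rfl ?_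
      simp [Pt.excE, Pt.xval, Pt.pole, centre, cenX]

theorem exists_onCurve (a : Fin 5 → ℂ) (k : Fin 5) : ∃ P : Pt, P.Valid a ∧ OnCurve P k := by
  fin_cases k
  · exact ⟨Pt.base none (some 0), Pt.valid_none_some.mpr zero_ne_one, Or.inl ⟨none, rfl⟩⟩
  · exact ⟨Pt.corner 6, trivial, Or.inr (Or.inr rfl)⟩
  · exact ⟨Pt.corner 6, trivial, Or.inr (Or.inl rfl)⟩
  · exact ⟨Pt.base (some 0) none, Pt.valid_some_none.mpr zero_ne_one, Or.inl ⟨0, rfl⟩⟩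
  · exact ⟨Pt.base (some 0) none, Pt.valid_some_none.mpr zero_ne_one, Or.inl ⟨none, rfl⟩⟩

theorem isPrimeDivisor_clsD (ha : Admissible a) (k : Fin 5) :
    IsPrimeDivisor a (clsD k) (secD k) := by
  obtain ⟨V, hV⟩ := exists_isCurve (isCoord_curveCoord k)
  refine ⟨V, ?_, fun R hR => ?_⟩
  · obtain ⟨P, hP, hon⟩ := exists_onCurve a k
    exact ⟨_, (mem_surface_iff ha _).mpr ⟨P, hP, rfl⟩, (on_curve ha hP hon hV).2.1⟩
  · obtain ⟨P, hP, rfl⟩ := (mem_surface_iff ha R).mp hR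
    by_cases hon : OnCurve P k
    · have := (on_curve ha hP hon hV).2
      exact ⟨fun _ => this.2, fun h => absurd this.1 h⟩
    · obtain ⟨h1, h2⟩ := off_curve (V := V) ha hP hon
      obtain ⟨r, hr, hrV⟩ := h2 hV
      exact ⟨fun h => absurd (h r hr) hrV, fun _ => h1⟩

theorem OnCurve.onD (ha : Admissible a) (hP : P.Valid a) {k : Fin 5} (hon : OnCurve P k) :
    OnD a k (P.ring a) := by
  obtain ⟨V, hV⟩ := exists_isCurve (isCoord_curveCoord k)
  exact (on_curve ha hP hon hV).1

theorem secD_mul_localEq_mem (ha : Admissible a) (hP : P.Valid a) (k : Fin 5) :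
    secD k * localEq a (clsD k) (P.ring a) ∈ P.ring a := by
  by_cases hon : OnCurve P k
  · exact (hon.onD ha hP).1
  · obtain ⟨V, -⟩ := exists_isCurve isCoord_cx_cy
    exact (off_curve (V := V) ha hP hon).1.2.1

end onCurve

/-! ### The period map -/

/-- Rational functions with the same divisors as the classes `α_j` along the curves `D_k`. -/
def periodFun (a : Fin 5 → ℂ) : Fin 5 → Fin 5 → FuncField :=
  ![![(cx - cst (a 0))⁻¹, cx⁻¹, (cx - cst (a 4)⁻¹ * cy)⁻¹, cy⁻¹, (cy - cst (a 2))⁻¹],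
    ![(cx - cst (a 0)) / (cx - cst (a 1)), 1, 1, 1, 1],
    ![(cx - cst (a 0))⁻¹, cx⁻¹, cx⁻¹, (cx - 1)⁻¹, 1],
    ![1, (cy - 1)⁻¹, cy⁻¹, cy⁻¹, (cy - cst (a 2))⁻¹],
    ![1, 1, 1, 1, (cy - cst (a 2)) / (cy - cst (a 3))]]

/-- The values at the nodes `D_k ∩ D_{k+1}` of the ratios of these functions. -/
def periodVal (a : Fin 5 → ℂ) : Fin 5 → Fin 5 → ℂ :=
  ![![1, 1, -(a 4)⁻¹, 1, a 2 / a 0], ![1, 1, 1, 1, a 0 / a 1], ![1, 1, 1, -1, -(a 0)⁻¹],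
    ![-1, 1, 1, 1, -a 2], ![1, 1, 1, 1, a 3 / a 2]]

theorem hasVal_sub_div_cy {s t : FuncField} (hy : HasVal s t cy⁻¹ 0) (c : ℂ) :
    HasVal s t ((cy - cst c) / cy) 1 :=
  (HasEv.sub HasEv.one (HasEv.mul (HasVal.cst c) hy)).congr (by
    have := cy_ne_zero
    field_simp) (by ring)

section period

variable {a : Fin 5 → ℂ} {P : Pt}

theorem localEq_root (ha : Admissible a) (hP : P.Valid a) (j : Fin 5) :
    localEq a (root j) (P.ring a) =
      ![Pt.pole cx (P.xval a) * Pt.pole cy (P.yval a) /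
          (P.excE a 0 * P.excE a 2 * P.excE a 6 * P.excE a 7),
        P.excE a 0 / P.excE a 1, Pt.pole cx (P.xval a) / (P.excE a 0 * P.excE a 4),
        Pt.pole cy (P.yval a) / (P.excE a 2 * P.excE a 5), P.excE a 2 / P.excE a 3] j := by
  rw [Pt.localEq_eq ha hP, Fin.prod_univ_eight]
  fin_cases j <;> simp [root] <;> field_simp

theorem cy_sub_cst_ne_zero (c : ℂ) : cy - cst c ≠ 0 := sub_ne_zero.mpr (cy_ne_cst c)

theorem cy_sub_one_ne_zero : cy - 1 ≠ 0 := by simpa using cy_sub_cst_ne_zero 1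

theorem cx_sub_mul_ne_zero (c : ℂ) : cx - cst c * cy ≠ 0 := by
  intro h
  have h1 := cy_ne_zero
  have h2 : IsCoord cx⁻¹ (cx / cy) := isCoord_curveCoord 2
  refine h2.right_ne_cst c ?_
  rw [div_eq_iff h1]
  linear_combination h

/-- The functions are local equations at the point, up to units. -/
def IsTrivialization (a : Fin 5 → ℂ) (k : Fin 5) (P : Pt) : Prop :=
  ∀ j, UnitAt (P.ring a) (periodFun a j k / ![Pt.pole cx (P.xval a) * Pt.pole cy (P.yval a) /
          (P.excE a 0 * P.excE a 2 * P.excE a 6 * P.excE a 7),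
        P.excE a 0 / P.excE a 1, Pt.pole cx (P.xval a) / (P.excE a 0 * P.excE a 4),
        Pt.pole cy (P.yval a) / (P.excE a 2 * P.excE a 5), P.excE a 2 / P.excE a 3] j)


theorem isTrivialization_of {k : Fin 5} {u₀ u₁ u₂ u₃ u₄ : FuncField} (h₀ : UnitAt (P.ring a) u₀)
    (h₁ : UnitAt (P.ring a) u₁) (h₂ : UnitAt (P.ring a) u₂) (h₃ : UnitAt (P.ring a) u₃)
    (h₄ : UnitAt (P.ring a) u₄)
    (h : ∀ j, ![u₀, u₁, u₂, u₃, u₄] j =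
      periodFun a j k / ![Pt.pole cx (P.xval a) * Pt.pole cy (P.yval a) /
          (P.excE a 0 * P.excE a 2 * P.excE a 6 * P.excE a 7),
        P.excE a 0 / P.excE a 1, Pt.pole cx (P.xval a) / (P.excE a 0 * P.excE a 4),
        Pt.pole cy (P.yval a) / (P.excE a 2 * P.excE a 5), P.excE a 2 / P.excE a 3] j) :
    IsTrivialization a k P := by
  intro j
  rw [← h j]
  fin_cases j
  exacts [h₀, h₁, h₂, h₃, h₄]

theorem isTrivialization_zero_base {c : ℂ} (h0 : c ≠ a 0) (h1 : c ≠ a 1) :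
    IsTrivialization a 0 (Pt.base (some c) (some 0)) := by
  have x0 := cx_ne_zero
  have y0 := cy_ne_zero
  have n0 := cx_sub_cst_ne_zero (a 0)
  have n1 := cx_sub_cst_ne_zero (a 1)
  have hc := Pt.isCoord a (Pt.base (some c) (some 0))
  have hv := Pt.hasPVal a (Pt.base (some c) (some 0))
  have hx := hasPVal_some.mp hv.1
  have u0 := (hx.sub_cst (a 0)).unitAt hc (sub_ne_zero.mpr h0)
  have u1 := (hx.sub_cst (a 1)).unitAt hc (sub_ne_zero.mpr h1)
  refine isTrivialization_of u0.inv (u0.div u1) u0.inv UnitAt.one UnitAt.one fun j => ?_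
  fin_cases j <;> simp [periodFun, Pt.excE, Pt.xval, Pt.yval, Pt.pole]

theorem isTrivialization_zero_inf :
    IsTrivialization a 0 (Pt.base none (some 0)) := by
  have x0 := cx_ne_zero
  have y0 := cy_ne_zero
  have n0 := cx_sub_cst_ne_zero (a 0)
  have n1 := cx_sub_cst_ne_zero (a 1)
  have hc := Pt.isCoord a (Pt.base none (some 0))
  have hv := Pt.hasPVal a (Pt.base none (some 0))
  have hx := hasPVal_none.mp hv.1
  have u0 := IsMapping.unitAt_sub_div hc hx (a 0)
  have u1 := IsMapping.unitAt_sub_div hc hx (a 1)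
  refine isTrivialization_of u0.inv (u0.div u1) u0.inv UnitAt.one UnitAt.one fun j => ?_
  fin_cases j <;> simp [periodFun, Pt.excE, Pt.xval, Pt.yval, Pt.pole] <;>
    field_simp

theorem isTrivialization_zero_exc (ha : Admissible a) :
    IsTrivialization a 0 (Pt.exc 0 0) := by
  have x0 := cx_ne_zero
  have y0 := cy_ne_zero
  have n0 := cx_sub_cst_ne_zero (a 0)
  have n1 := cx_sub_cst_ne_zero (a 1)
  have hc := Pt.isCoord a (Pt.exc 0 0)
  have hv := Pt.hasPVal a (Pt.exc 0 0)
  have hx := hasPVal_some.mp hv.1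
  have u1 := (hx.sub_cst (a 1)).unitAt hc (sub_ne_zero.mpr ha.2.1)
  refine isTrivialization_of UnitAt.one u1.inv UnitAt.one UnitAt.one UnitAt.one fun j => ?_
  fin_cases j <;> simp [periodFun, Pt.excE, Pt.xval, Pt.yval, cenX, cenY, Pt.pole, centre] <;>
    field_simp

theorem isTrivialization_zero_exc' (ha : Admissible a) :
    IsTrivialization a 0 (Pt.exc 1 0) := by
  have x0 := cx_ne_zero
  have y0 := cy_ne_zero
  have n0 := cx_sub_cst_ne_zero (a 0)
  have n1 := cx_sub_cst_ne_zero (a 1)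
  have hc := Pt.isCoord a (Pt.exc 1 0)
  have hv := Pt.hasPVal a (Pt.exc 1 0)
  have hx := hasPVal_some.mp hv.1
  have u0 := (hx.sub_cst (a 0)).unitAt hc (sub_ne_zero.mpr ha.2.1.symm)
  refine isTrivialization_of u0.inv u0 u0.inv UnitAt.one UnitAt.one fun j => ?_
  fin_cases j <;> simp [periodFun, Pt.excE, Pt.xval, Pt.yval, cenX, cenY, Pt.pole, centre] <;>
    field_simp

theorem isTrivialization_one_base {d : ℂ} (h : d ≠ 1) :
    IsTrivialization a 1 (Pt.base none (some d)) := by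
  have x0 := cx_ne_zero
  have y0 := cy_ne_zero
  have m4 := cy_sub_one_ne_zero
  have hc := Pt.isCoord a (Pt.base none (some d))
  have hv := Pt.hasPVal a (Pt.base none (some d))
  have hy := hasPVal_some.mp hv.2
  have u := hy.sub_one.unitAt hc (sub_ne_zero.mpr h)
  refine isTrivialization_of UnitAt.one UnitAt.one UnitAt.one u.inv UnitAt.one fun j => ?_
  fin_cases j <;> simp [periodFun, Pt.excE, Pt.xval, Pt.yval, Pt.pole] <;>
    field_simp

theorem isTrivialization_one_corner :
    IsTrivialization a 1 (Pt.corner 5) := by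
  have x0 := cx_ne_zero
  have y0 := cy_ne_zero
  have m4 := cy_sub_one_ne_zero
  refine isTrivialization_of UnitAt.one UnitAt.one UnitAt.one UnitAt.one UnitAt.one fun j => ?_
  fin_cases j <;> simp [periodFun, Pt.excE, Pt.xval, Pt.yval, cenX, cenY, Pt.pole, centre] <;>
    field_simp

theorem isTrivialization_one_corner' :
    IsTrivialization a 1 (Pt.corner 6) := by
  have x0 := cx_ne_zero
  have y0 := cy_ne_zero
  have m4 := cy_sub_one_ne_zero
  have hc := Pt.isCoord a (Pt.corner 6)
  have hv := Pt.hasPVal a (Pt.corner 6)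
  have hy := hasPVal_none.mp hv.2
  have u := (hasVal_sub_div_cy hy 1).unitAt hc one_ne_zero
  rw [cst_one] at u
  refine isTrivialization_of UnitAt.one UnitAt.one UnitAt.one u.inv UnitAt.one fun j => ?_
  fin_cases j <;> simp [periodFun, Pt.excE, Pt.xval, Pt.yval, cenX, cenY, Pt.pole, centre] <;>
    field_simp

theorem isTrivialization_two_exc {c : ℂ} (h : c ≠ (a 4)⁻¹) :
    IsTrivialization a 2 (Pt.exc 6 c) := by
  have x0 := cx_ne_zero
  have y0 := cy_ne_zero
  have r0 := cx_sub_mul_ne_zero (a 4)⁻¹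
  have hc := Pt.isCoord a (Pt.exc 6 c)
  have hv := Pt.hasPVal a (Pt.exc 6 c)
  have hr : HasVal _ _ (cy⁻¹ / cx⁻¹) c := hasVal_exc_ratio c
  have u := (hr.sub_cst (a 4)⁻¹).unitAt hc (sub_ne_zero.mpr h)
  rw [inv_div_inv] at u
  refine isTrivialization_of u.inv UnitAt.one UnitAt.one UnitAt.one UnitAt.one fun j => ?_
  fin_cases j <;> simp [periodFun, Pt.excE, Pt.xval, Pt.yval, cenX, cenY, Pt.pole, centre] <;>
    field_simp

theorem isTrivialization_two_corner :
    IsTrivialization a 2 (Pt.corner 6) := by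
  have x0 := cx_ne_zero
  have y0 := cy_ne_zero
  have r0 := cx_sub_mul_ne_zero (a 4)⁻¹
  have hc := Pt.isCoord a (Pt.corner 6)
  have hv := Pt.hasPVal a (Pt.corner 6)
  have hr : HasVal (cx⁻¹ / cy⁻¹) cy⁻¹ (cx⁻¹ / cy⁻¹) 0 := HasEv.left
  have hs : HasVal (cx⁻¹ / cy⁻¹) cy⁻¹ (1 - cst (a 4)⁻¹ * (cx⁻¹ / cy⁻¹)) (1 - (a 4)⁻¹ * 0) :=
    HasEv.sub HasEv.one (HasEv.mul (HasVal.cst (a 4)⁻¹) hr)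
  have u := hs.unitAt hc (by simp)
  rw [inv_div_inv] at u
  refine isTrivialization_of u.inv UnitAt.one UnitAt.one UnitAt.one UnitAt.one fun j => ?_
  fin_cases j <;> simp [periodFun, Pt.excE, Pt.xval, Pt.yval, cenX, cenY, Pt.pole, centre] <;>
    field_simp

theorem isTrivialization_two_corner' :
    IsTrivialization a 2 (Pt.corner 7) := by
  have x0 := cx_ne_zero
  have y0 := cy_ne_zero
  have r0 := cx_sub_mul_ne_zero (a 4)⁻¹
  have hc := Pt.isCoord a (Pt.corner 7)
  have hv := Pt.hasPVal a (Pt.corner 7)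
  have m : cx / cy - cst (a 4)⁻¹ ≠ 0 := (isCoord_centre a 7).right_ne_zero
  have r1 := cx_sub_mul_ne_zero (1 / a 4)
  refine isTrivialization_of UnitAt.one UnitAt.one UnitAt.one UnitAt.one UnitAt.one fun j => ?_
  fin_cases j <;> simp [periodFun, Pt.excE, Pt.xval, Pt.yval, cenX, cenY, Pt.pole, centre] <;>
    field_simp

theorem isTrivialization_three_base {c : ℂ} (h : c ≠ 1) :
    IsTrivialization a 3 (Pt.base (some c) none) := by
  have x0 := cx_ne_zero
  have y0 := cy_ne_zero
  have n4 := cx_sub_one_ne_zero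
  have hc := Pt.isCoord a (Pt.base (some c) none)
  have hv := Pt.hasPVal a (Pt.base (some c) none)
  have hx := hasPVal_some.mp hv.1
  have u := hx.sub_one.unitAt hc (sub_ne_zero.mpr h)
  refine isTrivialization_of UnitAt.one UnitAt.one u.inv UnitAt.one UnitAt.one fun j => ?_
  fin_cases j <;> simp [periodFun, Pt.excE, Pt.xval, Pt.yval, Pt.pole] <;>
    field_simp

theorem isTrivialization_three_exc :
    IsTrivialization a 3 (Pt.exc 4 0) := by
  have x0 := cx_ne_zero
  have y0 := cy_ne_zero
  have n4 := cx_sub_one_ne_zero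
  refine isTrivialization_of UnitAt.one UnitAt.one UnitAt.one UnitAt.one UnitAt.one fun j => ?_
  fin_cases j <;> simp [periodFun, Pt.excE, Pt.xval, Pt.yval, cenX, cenY, Pt.pole, centre] <;>
    field_simp

theorem isTrivialization_three_exc' :
    IsTrivialization a 3 (Pt.exc 6 0) := by
  have x0 := cx_ne_zero
  have y0 := cy_ne_zero
  have n4 := cx_sub_one_ne_zero
  have hc := Pt.isCoord a (Pt.exc 6 0)
  have hv := Pt.hasPVal a (Pt.exc 6 0)
  have hx := hasPVal_none.mp hv.1
  have u := IsMapping.unitAt_sub_div hc hx 1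
  rw [cst_one] at u
  refine isTrivialization_of UnitAt.one UnitAt.one u.inv UnitAt.one UnitAt.one fun j => ?_
  fin_cases j <;> simp [periodFun, Pt.excE, Pt.xval, Pt.yval, cenX, cenY, Pt.pole, centre] <;>
    field_simp

theorem isTrivialization_four_base {d : ℂ} (h2 : d ≠ a 2) (h3 : d ≠ a 3) :
    IsTrivialization a 4 (Pt.base (some 0) (some d)) := by
  have x0 := cx_ne_zero
  have y0 := cy_ne_zero
  have m2 := cy_sub_cst_ne_zero (a 2)
  have m3 := cy_sub_cst_ne_zero (a 3)
  have hc := Pt.isCoord a (Pt.base (some 0) (some d))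
  have hv := Pt.hasPVal a (Pt.base (some 0) (some d))
  have hy := hasPVal_some.mp hv.2
  have u2 := (hy.sub_cst (a 2)).unitAt hc (sub_ne_zero.mpr h2)
  have u3 := (hy.sub_cst (a 3)).unitAt hc (sub_ne_zero.mpr h3)
  refine isTrivialization_of u2.inv UnitAt.one UnitAt.one u2.inv (u2.div u3) fun j => ?_
  fin_cases j <;> simp [periodFun, Pt.excE, Pt.xval, Pt.yval, Pt.pole]

theorem isTrivialization_four_inf :
    IsTrivialization a 4 (Pt.base (some 0) none) := by
  have x0 := cx_ne_zero
  have y0 := cy_ne_zero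
  have m2 := cy_sub_cst_ne_zero (a 2)
  have m3 := cy_sub_cst_ne_zero (a 3)
  have hc := Pt.isCoord a (Pt.base (some 0) none)
  have hv := Pt.hasPVal a (Pt.base (some 0) none)
  have hy := hasPVal_none.mp hv.2
  have u2 := (hasVal_sub_div_cy hy (a 2)).unitAt hc one_ne_zero
  have u3 := (hasVal_sub_div_cy hy (a 3)).unitAt hc one_ne_zero
  refine isTrivialization_of u2.inv UnitAt.one UnitAt.one u2.inv (u2.div u3) fun j => ?_
  fin_cases j <;> simp [periodFun, Pt.excE, Pt.xval, Pt.yval, Pt.pole] <;>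
    field_simp

theorem isTrivialization_four_corner (ha : Admissible a) :
    IsTrivialization a 4 (Pt.corner 2) := by
  have x0 := cx_ne_zero
  have y0 := cy_ne_zero
  have m2 := cy_sub_cst_ne_zero (a 2)
  have m3 := cy_sub_cst_ne_zero (a 3)
  have hc := Pt.isCoord a (Pt.corner 2)
  have hv := Pt.hasPVal a (Pt.corner 2)
  have hy := hasPVal_some.mp hv.2
  have u3 := (hy.sub_cst (a 3)).unitAt hc (sub_ne_zero.mpr ha.2.2)
  refine isTrivialization_of UnitAt.one UnitAt.one UnitAt.one UnitAt.one u3.inv fun j => ?_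
  fin_cases j <;> simp [periodFun, Pt.excE, Pt.xval, Pt.yval, cenX, cenY, Pt.pole, centre] <;>
    field_simp

theorem isTrivialization_four_corner' (ha : Admissible a) :
    IsTrivialization a 4 (Pt.corner 3) := by
  have x0 := cx_ne_zero
  have y0 := cy_ne_zero
  have m2 := cy_sub_cst_ne_zero (a 2)
  have m3 := cy_sub_cst_ne_zero (a 3)
  have hc := Pt.isCoord a (Pt.corner 3)
  have hv := Pt.hasPVal a (Pt.corner 3)
  have hy := hasPVal_some.mp hv.2
  have u2 := (hy.sub_cst (a 2)).unitAt hc (sub_ne_zero.mpr ha.2.2.symm)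
  refine isTrivialization_of u2.inv UnitAt.one UnitAt.one u2.inv u2 fun j => ?_
  fin_cases j <;> simp [periodFun, Pt.excE, Pt.xval, Pt.yval, cenX, cenY, Pt.pole, centre] <;>
    field_simp

/-- The functions are local equations of the classes at the points of the curves. -/
theorem isTrivialization (ha : Admissible a) (hP : P.Valid a) {k : Fin 5} (hon : OnCurve P k) :
    IsTrivialization a k P := by
  fin_cases k
  · rcases hon with ⟨_ | c, rfl⟩ | rfl | rfl
    · exact isTrivialization_zero_inf
    · have := (Pt.valid_some_some.mp hP).1 rfl
      exact isTrivialization_zero_base this.1 this.2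
    · exact isTrivialization_zero_exc ha
    · exact isTrivialization_zero_exc' ha
  · rcases hon with ⟨d, rfl⟩ | rfl | rfl
    · exact isTrivialization_one_base (Pt.valid_none_some.mp hP)
    · exact isTrivialization_one_corner
    · exact isTrivialization_one_corner'
  · rcases hon with ⟨c, rfl⟩ | rfl | rfl
    · exact isTrivialization_two_exc (hP rfl)
    · exact isTrivialization_two_corner
    · exact isTrivialization_two_corner'
  · rcases hon with ⟨c, rfl⟩ | rfl | rfl
    · exact isTrivialization_three_base (Pt.valid_some_none.mp hP)
    · exact isTrivialization_three_exc
    · exact isTrivialization_three_exc'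
  · rcases hon with ⟨_ | d, rfl⟩ | rfl | rfl
    · exact isTrivialization_four_inf
    · have := (Pt.valid_some_some.mp hP).2 rfl
      exact isTrivialization_four_base this.1 this.2
    · exact isTrivialization_four_corner ha
    · exact isTrivialization_four_corner' ha

/-- The nodes of the anticanonical cycle. -/
def node : Fin 5 → Pt :=
  ![Pt.base none (some 0), Pt.corner 6, Pt.exc 6 0, Pt.base (some 0) none,
    Pt.base (some 0) (some 0)]

theorem eq_node {k : Fin 5} (hP : P.Valid a) (h : OnCurve P k) (h' : OnCurve P (k + 1)) :
    P = node k := by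
  fin_cases k
  · rcases h with ⟨p, rfl⟩ | rfl | rfl <;> rcases h' with ⟨d, h'⟩ | h' | h' <;> simp at h'
    obtain ⟨rfl, rfl⟩ := h'
    rfl
  · rcases h with ⟨p, rfl⟩ | rfl | rfl <;> rcases h' with ⟨d, h'⟩ | h' | h' <;> simp at h'
    rfl
  · rcases h with ⟨p, rfl⟩ | rfl | rfl <;> rcases h' with ⟨d, h'⟩ | h' | h' <;> simp at h'
    subst h'
    rfl
  · rcases h with ⟨p, rfl⟩ | rfl | rfl <;> rcases h' with ⟨d, h'⟩ | h' | h' <;> simp at h'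
    obtain ⟨rfl, rfl⟩ := h'
    rfl
  · rcases h with ⟨p, rfl⟩ | rfl | rfl <;> rcases h' with ⟨d, h'⟩ | h' | h' <;> simp at h'
    obtain ⟨rfl, rfl⟩ := h'
    rfl

theorem periodVal_of {k : Fin 5} {u v u₀ u₁ u₂ u₃ u₄ : FuncField} {c₀ c₁ c₂ c₃ c₄ : ℂ}
    (h₀ : HasVal u v u₀ c₀) (h₁ : HasVal u v u₁ c₁) (h₂ : HasVal u v u₂ c₂)
    (h₃ : HasVal u v u₃ c₃) (h₄ : HasVal u v u₄ c₄)
    (h : ∀ j, ![u₀, u₁, u₂, u₃, u₄] j = periodFun a j (k + 1) / periodFun a j k)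
    (h' : ∀ j, ![c₀, c₁, c₂, c₃, c₄] j = periodVal a j k) (j : Fin 5) :
    HasVal u v (periodFun a j (k + 1) / periodFun a j k) (periodVal a j k) := by
  rw [← h j, ← h' j]
  fin_cases j
  exacts [h₀, h₁, h₂, h₃, h₄]

/-- The functions are normalized so that most ratios are `1`. Apart from signs, the nontrivial
values occur at the origin `D₄ ∩ D₀`, which sees `a₁, …, a₄`, and at `D₂ ∩ D₃`, which sees the
position `1/a₅` of `P₈` on `D₂`. -/
theorem hasVal_node (ha : Admissible a) (k j : Fin 5) :
    HasVal ((node k).u a) ((node k).v a) (periodFun a j (k + 1) / periodFun a j k)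
      (periodVal a j k) := by
  have x0 := cx_ne_zero
  have y0 := cy_ne_zero
  have n0 := cx_sub_cst_ne_zero (a 0)
  have n1 := cx_sub_cst_ne_zero (a 1)
  have m2 := cy_sub_cst_ne_zero (a 2)
  have m3 := cy_sub_cst_ne_zero (a 3)
  have n4 := cx_sub_one_ne_zero
  have m4 := cy_sub_one_ne_zero
  have r0 := cx_sub_mul_ne_zero (a 4)⁻¹
  have r1 := cx_sub_mul_ne_zero (1 / a 4)
  have a0 := ha.1 0
  have a1 := ha.1 1
  have a2 := ha.1 2
  have a3 := ha.1 3
  have hc := (node k).isCoord a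
  have hv := (node k).hasPVal a
  have one : HasVal ((node k).u a) ((node k).v a) 1 1 := HasEv.one
  fin_cases k
  · have hx := hasPVal_none.mp hv.1
    have hy := hasPVal_some.mp hv.2
    have u0 := hasVal_sub_div hx (a 0)
    have u1 := hasVal_sub_div hx (a 1)
    refine periodVal_of u0 (u1.div hc u0 one_ne_zero) u0
      (hy.sub_one.inv hc (by simp)) one (fun i => ?_) (fun i => ?_) j <;> fin_cases i <;>
      simp [periodFun, periodVal] <;> field_simp
  · have hy := hasPVal_none.mp hv.2
    have hr : HasVal (cx⁻¹ / cy⁻¹) cy⁻¹ (cx⁻¹ / cy⁻¹) 0 := HasEv.left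
    have hs : HasVal (cx⁻¹ / cy⁻¹) cy⁻¹ (1 - cst (a 4)⁻¹ * (cx⁻¹ / cy⁻¹)) (1 - (a 4)⁻¹ * 0) :=
      HasEv.sub HasEv.one (HasEv.mul (HasVal.cst (a 4)⁻¹) hr)
    have u := hs.inv hc (by simp)
    rw [inv_div_inv] at u
    have u1 := hasVal_sub_div_cy hy 1
    refine periodVal_of u one one u1 one (fun i => ?_) (fun i => ?_) j <;> fin_cases i <;>
      simp [periodFun, periodVal] <;> field_simp
  · have hx := hasPVal_none.mp hv.1
    have hr : HasVal cx⁻¹ (cy⁻¹ / cx⁻¹ - cst 0) (cy⁻¹ / cx⁻¹) 0 := hasVal_exc_ratio 0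
    have u : HasVal cx⁻¹ (cy⁻¹ / cx⁻¹ - cst 0) (cx / cy - cst (a 4)⁻¹) (-(a 4)⁻¹) :=
      (hr.sub_cst (a 4)⁻¹).congr (by rw [inv_div_inv]) (zero_sub _)
    have u1 := (hasVal_sub_div hx 1).inv hc one_ne_zero
    refine periodVal_of u one u1 one one (fun i => ?_) (fun i => ?_) j <;> fin_cases i <;>
      simp [periodFun, periodVal] <;> field_simp
  · have hx := hasPVal_some.mp hv.1
    have hy := hasPVal_none.mp hv.2
    have u2 := (hasVal_sub_div_cy hy (a 2)).inv hc one_ne_zero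
    have u3 := (hasVal_sub_div_cy hy (a 3)).inv hc one_ne_zero
    refine periodVal_of u2 one hx.sub_one u2 (u3.div hc u2 (by simp)) (fun i => ?_) (fun i => ?_) j <;>
      fin_cases i <;> simp [periodFun, periodVal] <;> field_simp
  · have hx := hasPVal_some.mp hv.1
    have hy := hasPVal_some.mp hv.2
    have v0 := hx.sub_cst (a 0)
    have v1 := hx.sub_cst (a 1)
    have w2 := hy.sub_cst (a 2)
    have w3 := hy.sub_cst (a 3)
    have z0 : 0 - a 0 ≠ 0 := by simpa using a0
    have z1 : 0 - a 1 ≠ 0 := by simpa using a1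
    have z2 : 0 - a 2 ≠ 0 := by simpa using a2
    refine periodVal_of (w2.div hc v0 z0) (v0.div hc v1 z1) (v0.inv hc z0) w2 (w3.div hc w2 z2)
      (fun i => ?_) (fun i => ?_) j <;> fin_cases i <;> simp [periodFun, periodVal] <;> field_simp

theorem isExpPeriod_root (ha : Admissible a) (j : Fin 5) :
    IsExpPeriod a (root j) (∏ k, periodVal a j k) := by
  refine ⟨periodFun a j, periodVal a j, fun k R hR hD => ?_, fun k R hR hD hD' => ?_, rfl⟩
  · obtain ⟨P, hP, rfl⟩ := (mem_surface_iff ha R).mp hR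
    rw [localEq_root ha hP]
    exact isTrivialization ha hP (hD.onCurve ha hP) j
  · obtain ⟨P, hP, rfl⟩ := (mem_surface_iff ha R).mp hR
    have := eq_node hP (hD.onCurve ha hP) (hD'.onCurve ha hP)
    subst this
    exact (vanishesAt_localRing_iff (Pt.isCoord a _)).mpr (hasVal_node ha k j).sub_self

/-- Local equations and their trivializations multiply when classes are added, and so do the values
at the nodes. -/
theorem IsExpPeriod.add (ha : Admissible a) {l m : Pic} {c d : ℂ} (h : IsExpPeriod a l c)
    (h' : IsExpPeriod a m d) : IsExpPeriod a (l + m) (c * d) := by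
  obtain ⟨ψ, e, h1, h2, rfl⟩ := h
  obtain ⟨ψ', e', h1', h2', rfl⟩ := h'
  refine ⟨fun k => ψ k * ψ' k, fun k => e k * e' k, fun k R hR hD => ?_,
    fun k R hR hD hD' => ?_, Finset.prod_mul_distrib.symm⟩
  · have := (h1 k R hR hD).mul (h1' k R hR hD)
    obtain ⟨P, hP, rfl⟩ := (mem_surface_iff ha R).mp hR
    refine this.congr ?_
    rw [div_mul_div_comm]
    congr 1
    rw [Pt.localEq_eq ha hP, Pt.localEq_eq ha hP, Pt.localEq_eq ha hP]
    have p1 := Pt.pole_ne_zero cx_ne_zero (P.xval a)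
    have p2 := Pt.pole_ne_zero cy_ne_zero (P.yval a)
    have p3 := fun i => P.excE_ne_zero a i
    have : ∀ i, P.excE a i ^ (l + m) (i.natAdd 2) =
        P.excE a i ^ l (i.natAdd 2) * P.excE a i ^ m (i.natAdd 2) :=
      fun i => zpow_add₀ (p3 i) _ _
    rw [Finset.prod_congr rfl fun i _ => this i, Finset.prod_mul_distrib, Pi.add_apply,
      Pi.add_apply, zpow_add₀ p1, zpow_add₀ p2]
    ring
  · have v1 := h2 k R hR hD hD'
    have v2 := h2' k R hR hD hD'
    obtain ⟨P, hP, rfl⟩ := (mem_surface_iff ha R).mp hR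
    have hc := P.isCoord a
    rw [Pt.ring, vanishesAt_localRing_iff hc] at v1 v2 ⊢
    have := HasEv.mul (HasVal.of_sub v1) (HasVal.of_sub v2)
    rw [div_mul_div_comm] at this
    exact HasVal.sub_self this

theorem isExpPeriod_root' (ha : Admissible a) (j : Fin 5) :
    IsExpPeriod a (root j) (![-a 2 / (a 0 * a 4), a 0 / a 1, 1 / a 0, a 2, a 3 / a 2] j) := by
  have := isExpPeriod_root ha j
  convert this using 1
  fin_cases j <;> simp [periodVal, Fin.prod_univ_five]
  field_simp

/-- `-K` is the sum of the five roots, and the product of their periods is `q`. -/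
theorem isExpPeriod_antiK (ha : Admissible a) : IsExpPeriod a antiK (qParam a) := by
  have h := isExpPeriod_root' ha
  have := ((((h 0).add ha (h 1)).add ha (h 2)).add ha (h 3)).add ha (h 4)
  have e : root 0 + root 1 + root 2 + root 3 + root 4 = antiK := by decide
  rw [e] at this
  convert this using 1
  have a0 := ha.1 0
  have a1 := ha.1 1
  have a2 := ha.1 2
  have a4 := ha.1 4
  simp [qParam]
  field_simp

end period

/-! ### First order expansions at a point -/

section jets

open DualNumber

variable {s t r : FuncField} {α β : ℂ}

theorem isUnit_aeval_dualNumber (α β : ℂ) {q : MvPolynomial (Fin 2) ℂ}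
    (hq : constantCoeff q ≠ 0) :
    IsUnit (aeval ![(α • ε : ℂ[ε]), β • ε] q) := by
  rw [TrivSqZeroExt.isUnit_iff_isUnit_fst, isUnit_iff_ne_zero]
  have e : (TrivSqZeroExt.fstHom ℂ ℂ ℂ).comp (aeval ![(α • ε : ℂ[ε]), β • ε]) =
      aeval ![(0 : ℂ), 0] := by
    ext i
    fin_cases i <;> simp
  have := DFunLike.congr_fun e q
  rw [aeval_zero_zero] at this
  change (aeval ![(α • ε : ℂ[ε]), β • ε] q).fst = _ at this
  rwa [this]

/-- The coefficient of `ε` is the derivative at the point in the direction `(α, β)`. -/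
theorem exists_jet (h : r ∈ localRing s t) (α β : ℂ) :
    ∃ κ : ℂ[ε], HasEv s t (α • ε) (β • ε) r κ ∧ HasVal s t r κ.fst := by
  obtain ⟨κ, hκ⟩ := HasEv.of_mem (fun q hq => isUnit_aeval_dualNumber α β hq) h
  refine ⟨κ, hκ, ?_⟩
  have := hκ.map (TrivSqZeroExt.fstHom ℂ ℂ ℂ)
  simpa [HasVal] using this

theorem exists_jet_of_mem_maxIdeal (hc : IsCoord s t) {r : localRing s t}
    (h : r ∈ maxIdeal (localRing s t)) (α β : ℂ) :
    ∃ κ : ℂ[ε], HasEv s t (α • ε) (β • ε) (r : FuncField) κ ∧ κ.fst = 0 := by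
  induction h using Submodule.span_induction with
  | mem x hx =>
    obtain ⟨κ, h1, h2⟩ := exists_jet x.2 α β
    exact ⟨κ, h1, h2.unique hc ((vanishesAt_localRing_iff hc).mp hx)⟩
  | zero => exact ⟨0, HasEv.zero, rfl⟩
  | add x y _ _ hx hy =>
    obtain ⟨κ, h1, h2⟩ := hx
    obtain ⟨κ', h1', h2'⟩ := hy
    exact ⟨κ + κ', h1.add h1', by simp [h2, h2']⟩
  | smul a x _ hx =>
    obtain ⟨κ, h1, h2⟩ := hx
    obtain ⟨κ', h1', -⟩ := exists_jet a.2 α β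
    exact ⟨κ' * κ, h1'.mul h1, by simp [h2]⟩

/-- The functions in the square of the maximal ideal vanish to second order. -/
theorem hasEv_of_mem_maxIdeal_sq (hc : IsCoord s t) {r : localRing s t}
    (h : r ∈ maxIdeal (localRing s t) ^ 2) (α β : ℂ) :
    HasEv s t (α • ε) (β • ε) (r : FuncField) (0 : ℂ[ε]) := by
  rw [pow_two] at h
  induction h using Submodule.mul_induction_on' with
  | mem_mul_mem x hx y hy =>
    obtain ⟨κ, h1, h2⟩ := exists_jet_of_mem_maxIdeal hc hx α β
    obtain ⟨κ', h1', h2'⟩ := exists_jet_of_mem_maxIdeal hc hy α β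
    refine (h1.mul h1').congr rfl ?_
    ext <;> simp [h2, h2']
  | add x _ y _ hx hy => exact (hx.add hy).congr rfl (add_zero 0)

/-- The test for singular points of a fibre: one direction with nonzero derivative, or a wrong
value, shows that `r - c` is not in the square of the maximal ideal. -/
theorem eq_of_sub_cst_mem_maxIdeal_sq (hc : IsCoord s t) {c : ℂ}
    (h : r - cst c ∈ localRing s t)
    (hm : (⟨r - cst c, h⟩ : localRing s t) ∈ maxIdeal (localRing s t) ^ 2) {α β : ℂ} {κ : ℂ[ε]}
    (hr : HasEv s t (α • ε) (β • ε) r κ) : κ.fst = c ∧ κ.snd = 0 := by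
  have h0 := hasEv_of_mem_maxIdeal_sq hc hm α β
  have h1 := (hr.sub (HasEv.cst c)).unique hc h0
  rw [sub_eq_zero] at h1
  subst h1
  exact ⟨rfl, rfl⟩

theorem hasEv_of_sub_cst {A : Type*} [CommRing A] [Algebra ℂ A] {σ τ κ : A} {c : ℂ}
    (h : HasEv s t σ τ (r - cst c) κ) : HasEv s t σ τ r (κ + algebraMap ℂ A c) :=
  (h.add (HasEv.cst c)).congr (sub_add_cancel _ _) rfl

end jets

/-! ### The conserved quantity -/

/-- The conserved quantity. -/
def invK (t : ℂ) : FuncField := ofPoly (hkyG t) / ofPoly hkyF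

/-- A function in terms of which the conserved quantity is a square up to a function of `z`. -/
def ratA (t : ℂ) (z w : FuncField) : FuncField :=
  ((z - 1) * w + (z ^ 2 - cst t ^ 2) / w - z ^ 2) / z

theorem ofPoly_hkyF : ofPoly hkyF = cx ^ 2 * cy ^ 2 := by
  simp [hkyF, ofPoly, cx, cy]

theorem ofPoly_hkyG (t : ℂ) : ofPoly (hkyG t) =
    2 * cx ^ 2 * cy ^ 3 + 2 * cx ^ 3 * cy ^ 2 + cx ^ 2 * cy ^ 4 + cx ^ 4 * cy ^ 2
      - 2 * cx ^ 3 * cy ^ 3 - 2 * cx * cy ^ 4 - 2 * cx ^ 4 * cy + cx ^ 4 + cy ^ 4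
      + 2 * cst t ^ 2 * (cx * cy ^ 2 + cx ^ 2 * cy - cy ^ 2 - cx ^ 2) + cst t ^ 4 := by
  have : ofPoly (C t) = cst t := rfl
  simp only [ofPoly] at this
  have h2 : algebraMap (MvPolynomial (Fin 2) ℂ) FuncField 2 = 2 := map_ofNat _ 2
  simp [hkyG, ofPoly, cx, cy, this, h2]

/-- For fixed `x` the quantity depends on `y` only through `(x - 1)y + (x² - t²)/y`. The mirror
formula below holds because `f` and `g` are symmetric in `x` and `y`. -/
theorem invK_eq (t : ℂ) : invK t =
    ratA t cx cy ^ 2 + 2 + 4 * cst t ^ 2 * cx⁻¹ - 4 * cst t ^ 2 * cx⁻¹ ^ 2 := by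
  have x0 := cx_ne_zero
  have y0 := cy_ne_zero
  rw [invK, ratA, ofPoly_hkyF, ofPoly_hkyG]
  field_simp
  ring

theorem invK_eq' (t : ℂ) : invK t =
    ratA t cy cx ^ 2 + 2 + 4 * cst t ^ 2 * cy⁻¹ - 4 * cst t ^ 2 * cy⁻¹ ^ 2 := by
  have x0 := cx_ne_zero
  have y0 := cy_ne_zero
  rw [invK, ratA, ofPoly_hkyF, ofPoly_hkyG]
  field_simp
  ring

/-- In the mirror formula the mapping replaces `y` by `x` and `x` by `(x² - t²)/((x - 1)y)`. This
turns `(y - 1)x` into `(x² - t²)/y` and `(y² - t²)/x` into `(x - 1)y`, so the two summands are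
interchanged and the formula in terms of `x` results. -/
theorem map_invK {t : ℂ} {φ : FuncField ≃ₐ[ℂ] FuncField}
    (h : IsMapping φ (hkyParam t)) : φ (invK t) = invK t := by
  have x0 := cx_ne_zero
  have y0 := cy_ne_zero
  have n1 := cx_sub_one_ne_zero
  have n2 : cx - cst t ≠ 0 := cx_sub_cst_ne_zero t
  have n3 : cx + cst t ≠ 0 := by
    have := cx_sub_cst_ne_zero (-t)
    rwa [cst_neg, sub_neg_eq_add] at this
  have hX : φ cx = (cx ^ 2 - cst t ^ 2) / (cy * (cx - 1)) := by
    rw [h.map_x]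
    simp [ratF, hkyParam, cst_neg]
    field_simp
    ring
  have n4 : cx ^ 2 - cst t ^ 2 ≠ 0 := by
    rw [sq_sub_sq]
    exact mul_ne_zero n3 n2
  conv_lhs => rw [invK_eq']
  conv_rhs => rw [invK_eq]
  have hA : φ (ratA t cy cx) = ratA t cx cy := by
    simp only [ratA, map_div₀, map_add, map_sub, map_mul, map_pow, map_one, h.map_y,
      IsMapping.map_cst, hX]
    field_simp
    ring
  simp only [map_sub, map_add, map_mul, map_pow, map_inv₀, h.map_y, IsMapping.map_cst, hA,
    map_ofNat]

/-! ### The points on the anticanonical cycle -/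

section antiK

variable {a : Fin 5 → ℂ} {P : Pt}

/-- The local equation of the anticanonical cycle. -/
def eqK (a : Fin 5 → ℂ) (P : Pt) : FuncField :=
  cx * cy * (Pt.pole cx (P.xval a) ^ 2 * Pt.pole cy (P.yval a) ^ 2 / ∏ i, P.excE a i)

theorem localEq_add (ha : Admissible a) (hP : P.Valid a) (l m : Pic) :
    localEq a (l + m) (P.ring a) = localEq a l (P.ring a) * localEq a m (P.ring a) := by
  rw [Pt.localEq_eq ha hP, Pt.localEq_eq ha hP, Pt.localEq_eq ha hP]
  have p1 := Pt.pole_ne_zero cx_ne_zero (P.xval a)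
  have p2 := Pt.pole_ne_zero cy_ne_zero (P.yval a)
  have p3 := fun i => P.excE_ne_zero a i
  have : ∀ i, P.excE a i ^ (l + m) (i.natAdd 2) =
      P.excE a i ^ l (i.natAdd 2) * P.excE a i ^ m (i.natAdd 2) :=
    fun i => zpow_add₀ (p3 i) _ _
  rw [Finset.prod_congr rfl fun i _ => this i, Finset.prod_mul_distrib, Pi.add_apply,
    Pi.add_apply, zpow_add₀ p1, zpow_add₀ p2]
  ring

theorem eqK_eq (ha : Admissible a) (hP : P.Valid a) :
    cx * cy * localEq a antiK (P.ring a) = eqK a P := by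
  rw [Pt.localEq_eq ha hP, eqK]
  simp [antiK, Fin.prod_univ_eight]
  field_simp
  exact Or.inl trivial

theorem eqK_eq_prod (ha : Admissible a) (hP : P.Valid a) :
    eqK a P = ∏ k, secD k * localEq a (clsD k) (P.ring a) := by
  rw [← eqK_eq ha hP, ← sum_clsD, Finset.prod_mul_distrib, Fin.sum_univ_five, localEq_add ha hP,
    localEq_add ha hP, localEq_add ha hP, localEq_add ha hP]
  simp [Fin.prod_univ_five, secD]
  exact Or.inl (mul_comm _ _)

theorem eqK_mem (ha : Admissible a) (hP : P.Valid a) : eqK a P ∈ P.ring a := by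
  rw [eqK_eq_prod ha hP]
  exact prod_mem fun k _ => secD_mul_localEq_mem ha hP k

theorem hasVal_eqK (ha : Admissible a) (hP : P.Valid a) {k : Fin 5} (hon : OnCurve P k) :
    HasVal (P.u a) (P.v a) (eqK a P) 0 := by
  have hc := P.isCoord a
  have h1 := (vanishesAt_localRing_iff hc).mp (hon.onD ha hP)
  -- The equation of the cycle is the product of those of its components; one factor vanishes and
  -- the others are regular.
  rw [eqK_eq_prod ha hP, ← Finset.mul_prod_erase _ _ (Finset.mem_univ k)]
  have h2 : ∏ j ∈ Finset.univ.erase k, secD j * localEq a (clsD j) (P.ring a) ∈ P.ring a :=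
    prod_mem fun j _ => secD_mul_localEq_mem ha hP j
  obtain ⟨d, hd⟩ := (mem_localRing_iff hc).mp h2
  exact (HasEv.mul h1 hd).congr rfl (zero_mul d)

theorem eqK_ne_zero (a : Fin 5 → ℂ) (P : Pt) : eqK a P ≠ 0 :=
  mul_ne_zero (mul_ne_zero cx_ne_zero cy_ne_zero) (div_ne_zero
    (mul_ne_zero (pow_ne_zero _ (Pt.pole_ne_zero cx_ne_zero _))
      (pow_ne_zero _ (Pt.pole_ne_zero cy_ne_zero _)))
    (Finset.prod_ne_zero_iff.mpr fun i _ => P.excE_ne_zero a i))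

end antiK

/-! ### The order of the poles of `k` along the cycle -/

section onCycle

variable {t : ℂ} {P : Pt}

/-- If `E` is an equation of the cycle, then `k E² = (AE)² + 2E² + 4t² E (E/z) - 4t² (E/z)²`, whose
value is `p² - 4t²η²`. It remains to find `p` and `η` at each type of point, using whichever of the
two formulas for `k` is convenient. -/
theorem unitAt_invK_of {u v E z w : FuncField} {p η : ℂ} (hc : IsCoord u v)
    (hz : invK t = ratA t z w ^ 2 + 2 + 4 * cst t ^ 2 * z⁻¹ - 4 * cst t ^ 2 * z⁻¹ ^ 2)
    (hE : HasVal u v E 0) (hA : HasVal u v (ratA t z w * E) p) (hη : HasVal u v (E / z) η)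
    (h : p ^ 2 - 4 * t ^ 2 * η ^ 2 ≠ 0) : UnitAt (localRing u v) (invK t * E ^ 2) := by
  have h2 : HasVal u v (cst 2) 2 := HasVal.cst 2
  have h4 : HasVal u v (cst (4 * t ^ 2)) (4 * t ^ 2) := HasVal.cst _
  have := ((hA.pow 2).add (h2.mul (hE.pow 2))).add
    ((h4.mul (hE.mul hη)).sub (h4.mul (hη.pow 2)))
  refine HasVal.unitAt hc (HasEv.congr this ?_ ?_) h
  · have e2 : cst 2 = 2 := map_ofNat _ 2
    have e4 : cst 4 = 4 := map_ofNat _ 4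
    rw [hz, cst_mul, cst_pow, e2, e4]
    ring
  · ring

theorem hasVal_sub {u v z : FuncField} {c : ℂ} (h : HasVal u v z c) (β : ℂ) :
    HasVal u v (z ^ 2 - cst β ^ 2) (c ^ 2 - β ^ 2) :=
  (h.pow 2).sub ((HasVal.cst β : HasVal u v _ _).pow 2)

theorem unitAt_invK_base_zero {c d : ℂ} (h : c = 0 ∨ d = 0) (h1 : d = 0 → c ^ 2 ≠ t ^ 2)
    (h2 : c = 0 → d ^ 2 ≠ t ^ 2) :
    UnitAt ((Pt.base (some c) (some d)).ring (hkyParam t))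
      (invK t * eqK (hkyParam t) (Pt.base (some c) (some d)) ^ 2) := by
  have x0 := cx_ne_zero
  have y0 := cy_ne_zero
  have hc := Pt.isCoord (hkyParam t) (Pt.base (some c) (some d))
  have hv := Pt.hasPVal (hkyParam t) (Pt.base (some c) (some d))
  have hx := hasPVal_some.mp hv.1
  have hy := hasPVal_some.mp hv.2
  have e : eqK (hkyParam t) (Pt.base (some c) (some d)) = cx * cy := by
    simp [eqK, Pt.xval, Pt.yval, Pt.pole, Pt.excE]
  rw [e]
  have hA := (((hx.sub_one).mul (hy.pow 2)).add (hasVal_sub hx t)).sub ((hx.pow 2).mul hy)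
  refine unitAt_invK_of hc (invK_eq t) ((HasEv.mul hx hy).congr rfl ?_)
    (HasEv.congr hA ?_ rfl) (HasEv.congr hy ?_ rfl) ?_
  · rcases h with rfl | rfl <;> simp
  · rw [ratA]
    field_simp
  · field_simp
  -- The value `p² - 4t²η²` is `(d² - t²)²` on `x = 0` and `(c² - t²)²` on `y = 0`; it is nonzero
  -- because the centres are excluded.
  · rcases h with rfl | rfl
    · have := sub_ne_zero.mpr (h2 rfl)
      have : (d ^ 2 - t ^ 2) ^ 2 ≠ 0 := pow_ne_zero 2 this
      contrapose! this
      linear_combination this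
    · have := sub_ne_zero.mpr (h1 rfl)
      have : (c ^ 2 - t ^ 2) ^ 2 ≠ 0 := pow_ne_zero 2 this
      contrapose! this
      linear_combination this

theorem unitAt_invK_base_left {d : ℂ} (h : d ≠ 1) :
    UnitAt ((Pt.base none (some d)).ring (hkyParam t))
      (invK t * eqK (hkyParam t) (Pt.base none (some d)) ^ 2) := by
  have x0 := cx_ne_zero
  have y0 := cy_ne_zero
  have hc := Pt.isCoord (hkyParam t) (Pt.base none (some d))
  have hv := Pt.hasPVal (hkyParam t) (Pt.base none (some d))
  have hx := hasPVal_none.mp hv.1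
  have hy := hasPVal_some.mp hv.2
  have e : eqK (hkyParam t) (Pt.base none (some d)) = cy * cx⁻¹ := by
    simp [eqK, Pt.xval, Pt.yval, Pt.pole, Pt.excE]
    field_simp
  rw [e]
  have hA := (((hy.pow 2).mul (hx.sub (hx.pow 2))).add (HasEv.one.sub
    (((HasVal.cst t : HasVal _ _ _ _).pow 2).mul (hx.pow 2)))).sub hy
  refine unitAt_invK_of hc (invK_eq t) ((HasEv.mul hy hx).congr rfl (mul_zero d))
    (HasEv.congr hA ?_ rfl) (HasEv.congr (hy.mul (hx.pow 2)) ?_ rfl) ?_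
  · rw [ratA]
    field_simp
  · field_simp
  · have : (d - 1) ^ 2 ≠ 0 := pow_ne_zero 2 (sub_ne_zero.mpr h)
    contrapose! this
    linear_combination this

theorem unitAt_invK_base_right {c : ℂ} (h : c ≠ 1) :
    UnitAt ((Pt.base (some c) none).ring (hkyParam t))
      (invK t * eqK (hkyParam t) (Pt.base (some c) none) ^ 2) := by
  have x0 := cx_ne_zero
  have y0 := cy_ne_zero
  have hc := Pt.isCoord (hkyParam t) (Pt.base (some c) none)
  have hv := Pt.hasPVal (hkyParam t) (Pt.base (some c) none)
  have hx := hasPVal_some.mp hv.1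
  have hy := hasPVal_none.mp hv.2
  have e : eqK (hkyParam t) (Pt.base (some c) none) = cx * cy⁻¹ := by
    simp [eqK, Pt.xval, Pt.yval, Pt.pole, Pt.excE]
    field_simp
  rw [e]
  have hA := (hx.sub_one.add ((hasVal_sub hx t).mul (hy.pow 2))).sub ((hx.pow 2).mul hy)
  refine unitAt_invK_of hc (invK_eq t) ((HasEv.mul hx hy).congr rfl (mul_zero c))
    (HasEv.congr hA ?_ rfl) (HasEv.congr hy ?_ rfl) ?_
  · rw [ratA]
    field_simp
  · field_simp
  · have : (c - 1) ^ 2 ≠ 0 := pow_ne_zero 2 (sub_ne_zero.mpr h)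
    contrapose! this
    linear_combination this

/-- The points of `D_k` on the exceptional curves over the points `(β, 0)` and `(0, β)`. -/
theorem unitAt_invK_pole {u v z w : FuncField} {β : ℂ} (hβ : β ^ 2 = t ^ 2) (hβ0 : β ≠ 0)
    (hc : IsCoord u v)
    (hz : invK t = ratA t z w ^ 2 + 2 + 4 * cst t ^ 2 * z⁻¹ - 4 * cst t ^ 2 * z⁻¹ ^ 2)
    (z0 : z ≠ 0) (w0 : w ≠ 0) (zβ : z - cst β ≠ 0)
    (h1 : HasVal u v z β) (h2 : HasVal u v w 0) (h3 : HasVal u v (w / (z - cst β)) 0) :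
    UnitAt (localRing u v) (invK t * (z * (w / (z - cst β))) ^ 2) := by
  have hA := ((h3.mul (h1.sub_one.mul h2)).add (h1.add (HasVal.cst β))).sub ((h1.pow 2).mul h3)
  refine unitAt_invK_of hc hz ((HasEv.mul h1 h3).congr rfl (mul_zero β))
    (HasEv.congr hA ?_ rfl) (HasEv.congr h3 ?_ rfl) ?_
  · have : cst t ^ 2 = cst β ^ 2 := by rw [← cst_pow, ← cst_pow, hβ]
    rw [ratA, this]
    field_simp
    ring
  · field_simp
  · have : β ^ 2 ≠ 0 := pow_ne_zero 2 hβ0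
    contrapose! this
    linear_combination this / 4

/-- The points of `D_k` on the exceptional curves over the points `(1, ∞)` and `(∞, 1)`. -/
theorem unitAt_invK_one {u v z w : FuncField} (hc : IsCoord u v)
    (hz : invK t = ratA t z w ^ 2 + 2 + 4 * cst t ^ 2 * z⁻¹ - 4 * cst t ^ 2 * z⁻¹ ^ 2)
    (z0 : z ≠ 0) (w0 : w ≠ 0) (z1 : z - 1 ≠ 0)
    (h1 : HasVal u v z 1) (h2 : HasVal u v w⁻¹ 0) (h3 : HasVal u v (w⁻¹ / (z - 1)) 0) :
    UnitAt (localRing u v) (invK t * (z * (w⁻¹ / (z - 1))) ^ 2) := by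
  have hA := (HasEv.one.add (h3.mul ((hasVal_sub h1 t).mul h2))).sub (h3.mul (h1.pow 2))
  refine unitAt_invK_of hc hz ((HasEv.mul h1 h3).congr rfl (mul_zero 1))
    (HasEv.congr hA ?_ rfl) (HasEv.congr h3 ?_ rfl) ?_
  · rw [ratA]
    field_simp
  · field_simp
  · simp

theorem unitAt_invK_six {c : ℂ} (h : c ≠ 1) :
    UnitAt ((Pt.exc 6 c).ring (hkyParam t)) (invK t * eqK (hkyParam t) (Pt.exc 6 c) ^ 2) := by
  have x0 := cx_ne_zero
  have y0 := cy_ne_zero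
  have hc := Pt.isCoord (hkyParam t) (Pt.exc 6 c)
  have hv := Pt.hasPVal (hkyParam t) (Pt.exc 6 c)
  have hx := hasPVal_none.mp hv.1
  have hy := hasPVal_none.mp hv.2
  have hr : HasVal ((Pt.exc 6 c).u (hkyParam t)) ((Pt.exc 6 c).v (hkyParam t)) (cy⁻¹ / cx⁻¹) c :=
    hasVal_exc_ratio c
  have e : eqK (hkyParam t) (Pt.exc 6 c) = cy⁻¹ := by
    simp [eqK, Pt.xval, Pt.yval, Pt.pole, Pt.excE, cenX, cenY, centre]
    field_simp
  rw [e]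
  have hA := (((HasEv.one.sub hx).add (hr.mul hy)).sub
    ((((HasVal.cst t : HasVal _ _ _ _).pow 2).mul hx).mul (hy.pow 2))).sub hr
  refine unitAt_invK_of hc (invK_eq t) hy (HasEv.congr hA ?_ rfl)
    (HasEv.congr (hy.mul hx) ?_ rfl) ?_
  · rw [ratA]
    field_simp
    ring
  · field_simp
  · have : (c - 1) ^ 2 ≠ 0 := pow_ne_zero 2 (sub_ne_zero.mpr h)
    contrapose! this
    linear_combination this

theorem unitAt_invK_corner_six :
    UnitAt ((Pt.corner 6).ring (hkyParam t)) (invK t * eqK (hkyParam t) (Pt.corner 6) ^ 2) := by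
  have x0 := cx_ne_zero
  have y0 := cy_ne_zero
  have hc := Pt.isCoord (hkyParam t) (Pt.corner 6)
  have hv := Pt.hasPVal (hkyParam t) (Pt.corner 6)
  have hx := hasPVal_none.mp hv.1
  have hy := hasPVal_none.mp hv.2
  have hr : HasVal ((Pt.corner 6).u (hkyParam t)) ((Pt.corner 6).v (hkyParam t))
    (cx⁻¹ / cy⁻¹) 0 := HasEv.left
  have e : eqK (hkyParam t) (Pt.corner 6) = cx⁻¹ := by
    simp [eqK, Pt.xval, Pt.yval, Pt.pole, Pt.excE, cenX, cenY, centre]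
    field_simp
  rw [e]
  have hA := (((hr.sub (hr.mul hx)).add hy).sub
    ((((HasVal.cst t : HasVal _ _ _ _).pow 2).mul (hx.pow 2)).mul hy)).sub HasEv.one
  refine unitAt_invK_of hc (invK_eq t) hx (HasEv.congr hA ?_ rfl)
    (HasEv.congr (hx.pow 2) ?_ rfl) ?_
  · rw [ratA]
    field_simp
    ring
  · field_simp
  · simp

theorem unitAt_invK_corner_seven :
    UnitAt ((Pt.corner 7).ring (hkyParam t)) (invK t * eqK (hkyParam t) (Pt.corner 7) ^ 2) := by
  have x0 := cx_ne_zero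
  have y0 := cy_ne_zero
  have hc := Pt.isCoord (hkyParam t) (Pt.corner 7)
  have hv := Pt.hasPVal (hkyParam t) (Pt.corner 7)
  have hx := hasPVal_none.mp hv.1
  have hy := hasPVal_none.mp hv.2
  have hu : HasVal ((Pt.corner 7).u (hkyParam t)) ((Pt.corner 7).v (hkyParam t))
    (cx⁻¹ / (cx / cy - cst 1⁻¹)) 0 := HasEv.left
  have hr : HasVal ((Pt.corner 7).u (hkyParam t)) ((Pt.corner 7).v (hkyParam t)) (cx / cy) 1 :=
    (hasVal_ratio_seven (hkyParam t) (Or.inr rfl)).congr rfl inv_one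
  have hr' := (hr.inv hc one_ne_zero).congr (inv_div _ _) inv_one
  have m0 : cx / cy - cst 1⁻¹ ≠ 0 := (isCoord_centre (hkyParam t) 7).right_ne_zero
  rw [inv_one, cst_one] at hu m0
  have n0 : cx - cy ≠ 0 := by
    contrapose! m0
    field_simp
    linear_combination m0
  have e : eqK (hkyParam t) (Pt.corner 7) = cx⁻¹ / (cx / cy - 1) * (cx / cy) := by
    simp [eqK, Pt.xval, Pt.yval, Pt.pole, Pt.excE, cenX, cenY, centre, Fin.prod_univ_eight,
      hkyParam]
    field_simp
  have hE : HasVal ((Pt.corner 7).u (hkyParam t)) ((Pt.corner 7).v (hkyParam t))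
    (cx⁻¹ / (cx / cy - 1) * (cx / cy)) 0 := (hu.mul hr).congr rfl (zero_mul 1)
  rw [e]
  have hA := (hE.mul ((hr.sub hr').sub
    ((((HasVal.cst t : HasVal _ _ _ _).pow 2).mul hx).mul hy))).sub HasEv.one
  refine unitAt_invK_of hc (invK_eq t) hE (HasEv.congr hA ?_ rfl)
    (HasEv.congr (hE.mul hx) ?_ rfl) ?_
  · rw [ratA]
    field_simp
    ring
  · field_simp
  · simp

theorem unitAt_invK (ht : t ≠ 0) (hP : P.Valid (hkyParam t)) {k : Fin 5} (hon : OnCurve P k) :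
    UnitAt (P.ring (hkyParam t)) (invK t * eqK (hkyParam t) P ^ 2) := by
  have x0 := cx_ne_zero
  have y0 := cy_ne_zero
  have htn : -t ≠ 0 := neg_ne_zero.mpr ht
  have hbb : ∀ c d, (Pt.base (some c) (some d)).Valid (hkyParam t) → c = 0 ∨ d = 0 →
      UnitAt ((Pt.base (some c) (some d)).ring (hkyParam t))
        (invK t * eqK (hkyParam t) (Pt.base (some c) (some d)) ^ 2) := by
    intro c d hP h
    have := Pt.valid_some_some.mp hP
    refine unitAt_invK_base_zero h (fun e e' => ?_) (fun e e' => ?_)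
    · rcases sq_eq_sq_iff_eq_or_eq_neg.mp e' with e' | e'
      · exact (this.1 e).1 e'
      · exact (this.1 e).2 e'
    · rcases sq_eq_sq_iff_eq_or_eq_neg.mp e' with e' | e'
      · exact (this.2 e).1 e'
      · exact (this.2 e).2 e'
  have hleft : ∀ i β, β ^ 2 = t ^ 2 → β ≠ 0 → centre (hkyParam t) i = (cx - cst β, cy) →
      eqK (hkyParam t) (Pt.exc i 0) = cx * (cy / (cx - cst β)) → HasVal ((Pt.exc i 0).u (hkyParam t))
        ((Pt.exc i 0).v (hkyParam t)) cx β →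
      UnitAt ((Pt.exc i 0).ring (hkyParam t)) (invK t * eqK (hkyParam t) (Pt.exc i 0) ^ 2) := by
    intro i β hβ hβ0 hi e hx
    have hc := Pt.isCoord (hkyParam t) (Pt.exc i 0)
    have hc1 := isCoord_centre (hkyParam t) i
    have h2 := hasVal_exc_right hc1 0
    have h3 := hasVal_exc_ratio (u := (centre (hkyParam t) i).1) (v := (centre (hkyParam t) i).2) 0
    rw [e]
    refine unitAt_invK_pole hβ hβ0 hc (invK_eq t) x0 y0 (cx_sub_cst_ne_zero β) hx ?_ ?_
    · rw [hi] at h2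
      change HasVal (centre (hkyParam t) i).1 ((centre (hkyParam t) i).2 / _ - cst 0) _ _
      rwa [hi]
    · rw [hi] at h3
      change HasVal (centre (hkyParam t) i).1 ((centre (hkyParam t) i).2 / _ - cst 0) _ _
      rwa [hi]
  have hright : ∀ i β, β ^ 2 = t ^ 2 → β ≠ 0 → centre (hkyParam t) i = (cx, cy - cst β) →
      eqK (hkyParam t) (Pt.corner i) = cy * (cx / (cy - cst β)) →
      HasVal ((Pt.corner i).u (hkyParam t)) ((Pt.corner i).v (hkyParam t)) cy β →
      UnitAt ((Pt.corner i).ring (hkyParam t)) (invK t * eqK (hkyParam t) (Pt.corner i) ^ 2) := by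
    intro i β hβ hβ0 hi e hy
    have hc := Pt.isCoord (hkyParam t) (Pt.corner i)
    have hc1 := isCoord_centre (hkyParam t) i
    have h2 := hasVal_corner_left hc1
    rw [e]
    refine unitAt_invK_pole hβ hβ0 hc (invK_eq' t) y0 x0 (cy_sub_cst_ne_zero β) hy ?_ ?_
    · rw [hi] at h2
      change HasVal ((centre (hkyParam t) i).1 / _) (centre (hkyParam t) i).2 _ _
      rwa [hi]
    · change HasVal ((centre (hkyParam t) i).1 / _) (centre (hkyParam t) i).2 _ _
      rw [hi]
      exact HasEv.left
  fin_cases k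
  · rcases hon with ⟨_ | c, rfl⟩ | rfl | rfl
    · exact unitAt_invK_base_left zero_ne_one
    · exact hbb _ _ hP (Or.inr rfl)
    · refine hleft 0 t rfl ht rfl ?_ (hasPVal_some.mp (Pt.hasPVal _ _).1)
      simp [eqK, Pt.xval, Pt.yval, Pt.pole, Pt.excE, cenX, cenY, centre, hkyParam]
      field_simp
    · refine hleft 1 (-t) (neg_sq t) htn rfl ?_ (hasPVal_some.mp (Pt.hasPVal _ _).1)
      simp [eqK, Pt.xval, Pt.yval, Pt.pole, Pt.excE, cenX, cenY, centre, hkyParam]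
      field_simp
  · rcases hon with ⟨d, rfl⟩ | rfl | rfl
    · exact unitAt_invK_base_left (Pt.valid_none_some.mp hP)
    · have hc := Pt.isCoord (hkyParam t) (Pt.corner 5)
      have hv := Pt.hasPVal (hkyParam t) (Pt.corner 5)
      have e : eqK (hkyParam t) (Pt.corner 5) = cy * (cx⁻¹ / (cy - 1)) := by
        simp [eqK, Pt.xval, Pt.yval, Pt.pole, Pt.excE, cenX, cenY, centre]
        field_simp
      rw [e]
      exact unitAt_invK_one hc (invK_eq' t) y0 x0 cy_sub_one_ne_zero (hasPVal_some.mp hv.2)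
        (hasPVal_none.mp hv.1) HasEv.left
    · exact unitAt_invK_corner_six
  · rcases hon with ⟨c, rfl⟩ | rfl | rfl
    · exact unitAt_invK_six (by simpa [hkyParam] using hP rfl)
    · exact unitAt_invK_corner_six
    · exact unitAt_invK_corner_seven
  · rcases hon with ⟨c, rfl⟩ | rfl | rfl
    · exact unitAt_invK_base_right (Pt.valid_some_none.mp hP)
    · have hc := Pt.isCoord (hkyParam t) (Pt.exc 4 0)
      have hv := Pt.hasPVal (hkyParam t) (Pt.exc 4 0)
      have e : eqK (hkyParam t) (Pt.exc 4 0) = cx * (cy⁻¹ / (cx - 1)) := by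
        simp [eqK, Pt.xval, Pt.yval, Pt.pole, Pt.excE, cenX, cenY, centre]
        field_simp
      rw [e]
      exact unitAt_invK_one hc (invK_eq t) x0 y0 cx_sub_one_ne_zero (hasPVal_some.mp hv.1)
        (hasPVal_none.mp hv.2) (hasVal_exc_ratio 0)
    · exact unitAt_invK_six zero_ne_one
  · rcases hon with ⟨_ | d, rfl⟩ | rfl | rfl
    · exact unitAt_invK_base_right zero_ne_one
    · exact hbb _ _ hP (Or.inl rfl)
    · refine hright 2 t rfl ht rfl ?_ (hasPVal_some.mp (Pt.hasPVal _ _).2)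
      simp [eqK, Pt.xval, Pt.yval, Pt.pole, Pt.excE, cenX, cenY, centre, hkyParam]
      field_simp
    · refine hright 3 (-t) (neg_sq t) htn rfl ?_ (hasPVal_some.mp (Pt.hasPVal _ _).2)
      simp [eqK, Pt.xval, Pt.yval, Pt.pole, Pt.excE, cenX, cenY, centre, hkyParam]
      field_simp

end onCycle

/-! ### The points off the anticanonical cycle -/

section offCycle

open DualNumber

variable {t : ℂ} {P : Pt}

/-- The two orders of the coordinate functions. -/
def IsPair (z w : FuncField) : Prop := (z = cx ∧ w = cy) ∨ (z = cy ∧ w = cx)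

namespace IsPair

variable {z w : FuncField}

theorem isCoord (h : IsPair z w) : IsCoord z w := by
  rcases h with ⟨rfl, rfl⟩ | ⟨rfl, rfl⟩
  exacts [isCoord_cx_cy, isCoord_cx_cy.swap]

theorem invK_eq (h : IsPair z w) (t : ℂ) :
    invK t = ratA t z w ^ 2 + 2 + 4 * cst t ^ 2 * z⁻¹ - 4 * cst t ^ 2 * z⁻¹ ^ 2 := by
  rcases h with ⟨rfl, rfl⟩ | ⟨rfl, rfl⟩
  exacts [HKY.invK_eq t, invK_eq' t]

end IsPair

/-- The charts at the points off the anticanonical cycle. -/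
theorem exists_chart (hP : P.Valid (hkyParam t)) (hoff : ∀ k, ¬ OnCurve P k) :
    ∃ u v, IsCoord u v ∧ P.ring (hkyParam t) = localRing u v ∧
      ((∃ c d, c ≠ 0 ∧ d ≠ 0 ∧ u = cx - cst c ∧ v = cy - cst d) ∨
      ∃ z w, IsPair z w ∧ ∃ e, (∃ β, β ^ 2 = t ^ 2 ∧ u = w ∧ v = (z - cst β) / w - cst e) ∨
        (u = w⁻¹ ∧ v = (z - 1) / w⁻¹ - cst e) ∨ (u = z⁻¹ ∧ v = (z / w - 1) / z⁻¹ - cst e)) := by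
  have hxy : IsPair cx cy := Or.inl ⟨rfl, rfl⟩
  have hyx : IsPair cy cx := Or.inr ⟨rfl, rfl⟩
  have hcorner : ∀ i, (Pt.corner i).ring (hkyParam t) = localRing (centre (hkyParam t) i).2
      ((centre (hkyParam t) i).1 / (centre (hkyParam t) i).2 - cst 0) := by
    intro i
    rw [cst_zero, sub_zero, localRing_swap]
    rfl
  have hswap : ∀ i c, c ≠ 0 → (Pt.exc i c).ring (hkyParam t) = localRing (centre (hkyParam t) i).2
      ((centre (hkyParam t) i).1 / (centre (hkyParam t) i).2 - cst c⁻¹) := fun i c hc =>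
    localRing_exc_swap (isCoord_centre _ i) hc
  have hc1 : ∀ i e, IsCoord (centre (hkyParam t) i).2
      ((centre (hkyParam t) i).1 / (centre (hkyParam t) i).2 - cst e) := fun i e =>
    (isCoord_centre _ i).swap.div.sub_cst e
  have hc2 : ∀ i e, IsCoord (centre (hkyParam t) i).1
      ((centre (hkyParam t) i).2 / (centre (hkyParam t) i).1 - cst e) := fun i e =>
    (isCoord_centre _ i).div.sub_cst e
  simp only [Fin.forall_fin_succ, OnCurve] at hoff
  simp at hoff
  obtain ⟨h0, h1, h2, h3, h4⟩ := hoff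
  rcases P with ⟨_ | c, _ | d⟩ | ⟨i, c⟩ | i
  · exact absurd hP Pt.not_valid_none_none
  · exact absurd rfl (h1.1 d)
  · exact absurd rfl (h3.1 c)
  · refine ⟨_, _, Pt.isCoord (hkyParam t) _, rfl, Or.inl ⟨c, d, ?_, ?_, rfl, rfl⟩⟩
    · rintro rfl
      exact h4.1 _ rfl
    · rintro rfl
      exact h0.1 _ rfl
  · fin_cases i
    · refine ⟨_, _, hc1 0 _, hswap 0 c ?_, Or.inr ⟨_, _, hxy, c⁻¹, Or.inl ⟨t, rfl, rfl, rfl⟩⟩⟩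
      rintro rfl
      exact h0.2.1 rfl
    · refine ⟨_, _, hc1 1 _, hswap 1 c ?_,
        Or.inr ⟨_, _, hxy, c⁻¹, Or.inl ⟨-t, neg_sq t, rfl, rfl⟩⟩⟩
      rintro rfl
      exact h0.2.2 rfl
    · exact ⟨_, _, hc2 2 _, rfl, Or.inr ⟨_, _, hyx, c, Or.inl ⟨t, rfl, rfl, rfl⟩⟩⟩
    · exact ⟨_, _, hc2 3 _, rfl, Or.inr ⟨_, _, hyx, c, Or.inl ⟨-t, neg_sq t, rfl, rfl⟩⟩⟩
    · refine ⟨_, _, hc1 4 _, hswap 4 c ?_, Or.inr ⟨_, _, hxy, c⁻¹, Or.inr (Or.inl ⟨rfl, rfl⟩)⟩⟩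
      rintro rfl
      exact h3.2.1 rfl
    · exact ⟨_, _, hc2 5 _, rfl, Or.inr ⟨_, _, hyx, c, Or.inr (Or.inl ⟨rfl, rfl⟩)⟩⟩
    · exact absurd rfl (h2.1 c)
    · refine ⟨_, _, hc2 7 c, rfl, Or.inr ⟨_, _, hxy, c, Or.inr (Or.inr ⟨rfl, ?_⟩)⟩⟩
      change (cx / cy - cst (1 : ℂ)⁻¹) / cx⁻¹ - cst c = _
      rw [inv_one, cst_one]
  · fin_cases i
    · exact ⟨_, _, hc1 0 0, hcorner 0, Or.inr ⟨_, _, hxy, 0, Or.inl ⟨t, rfl, rfl, rfl⟩⟩⟩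
    · exact ⟨_, _, hc1 1 0, hcorner 1, Or.inr ⟨_, _, hxy, 0, Or.inl ⟨-t, neg_sq t, rfl, rfl⟩⟩⟩
    · exact absurd rfl h4.2.1
    · exact absurd rfl h4.2.2
    · exact ⟨_, _, hc1 4 0, hcorner 4, Or.inr ⟨_, _, hxy, 0, Or.inr (Or.inl ⟨rfl, rfl⟩)⟩⟩
    · exact absurd rfl h1.2.1
    · exact absurd rfl h1.2.2
    · exact absurd rfl h2.2.2

variable {u v z w : FuncField} {σ τ : ℂ[ε]}

theorem HasEv.inv_dual {r : FuncField} {κ : ℂ[ε]} (hc : IsCoord u v) (h : HasEv u v σ τ r κ)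
    (h0 : κ.fst ≠ 0) : HasEv u v σ τ r⁻¹ κ⁻¹ :=
  h.inv hc (TrivSqZeroExt.mul_inv_cancel h0)

theorem hasEv_invK (h : IsPair z w) {ι ζ : ℂ[ε]} (hA : HasEv u v σ τ (ratA t z w) ι)
    (hz : HasEv u v σ τ z⁻¹ ζ) : HasEv u v σ τ (invK t) (ι ^ 2 + algebraMap ℂ ℂ[ε] 2 +
      algebraMap ℂ ℂ[ε] (4 * t ^ 2) * ζ - algebraMap ℂ ℂ[ε] (4 * t ^ 2) * ζ ^ 2) := by
  refine HasEv.congr ((((hA.pow 2).add (HasEv.cst 2)).add ((HasEv.cst (4 * t ^ 2)).mul hz)).sub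
    ((HasEv.cst (4 * t ^ 2)).mul (hz.pow 2))) ?_ rfl
  have e2 : cst 2 = 2 := map_ofNat _ 2
  have e4 : cst 4 = 4 := map_ofNat _ 4
  rw [h.invK_eq, cst_mul, cst_pow, e2, e4]

/-- The value of the conserved quantity. -/
def valK (t c d : ℂ) : ℂ :=
  (((c - 1) * d + (c ^ 2 - t ^ 2) / d - c ^ 2) / c) ^ 2 + 2 + 4 * t ^ 2 / c - 4 * t ^ 2 / c ^ 2

/-- The values of the conserved quantity on its singular fibres. -/
def critK (t : ℂ) : Set ℂ :=
  {2 + t ^ 2, 4 * t - 2, -4 * t - 2, 2} ∪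
    {k | ∃ c d, ((d = 2 ∧ (c - 2) ^ 2 = t ^ 2) ∨ (d = c ∧ c ^ 3 - 2 * c ^ 2 + t ^ 2 = 0)) ∧
      k = valK t c d}

theorem finite_cubic_roots (t : ℂ) : {x : ℂ | x ^ 3 - 2 * x ^ 2 + t ^ 2 = 0}.Finite := by
  have : (.X ^ 3 - .C 2 * .X ^ 2 + .C (t ^ 2) : Polynomial ℂ).Monic := by monicity!
  refine (Polynomial.finite_setOfPred_isRoot this.ne_zero).subset fun x hx => ?_
  simpa [Polynomial.IsRoot] using hx

theorem finite_square_roots (t : ℂ) : {x : ℂ | (x - 2) ^ 2 = t ^ 2}.Finite := by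
  refine (Set.toFinite {2 + t, 2 - t}).subset fun x hx => ?_
  rcases sq_eq_sq_iff_eq_or_eq_neg.mp hx with h | h
  · exact Or.inl (by linear_combination h)
  · exact Or.inr (by rw [Set.mem_singleton_iff]; linear_combination h)

theorem finite_critK (t : ℂ) : (critK t).Finite := by
  refine Set.Finite.union (by simp) ?_
  refine (((finite_square_roots t).image fun c => valK t c 2).union
    ((finite_cubic_roots t).image fun c => valK t c c)).subset ?_
  rintro k ⟨c, d, ⟨rfl, h⟩ | ⟨rfl, h⟩, rfl⟩
  exacts [Or.inl ⟨_, h, rfl⟩, Or.inr ⟨_, h, rfl⟩]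

/-- The hypotheses say that both partial derivatives vanish. The derivative in `y` is a product. If
`A = 0`, the other derivative reduces to `4t²(c - 2)`, so `c = 2` and the value is `2 + t²`.
Otherwise `(c - 1)d² = c² - t²`, and eliminating `t²` from the other derivative leaves `(d - 2)(d -
c) = 0`. -/
theorem valK_critical {c d : ℂ} (hc : c ≠ 0) (hd : d ≠ 0)
    (hx : 2 * ((c - 1) * d + (c ^ 2 - t ^ 2) / d - c ^ 2) *
      (c * (d + 2 * c / d) - ((c - 1) * d + (c ^ 2 - t ^ 2) / d) - c ^ 2) = 4 * t ^ 2 * (c - 2))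
    (hy : ((c - 1) * d + (c ^ 2 - t ^ 2) / d - c ^ 2) * ((c - 1) - (c ^ 2 - t ^ 2) / d ^ 2) = 0)
    (ht : t ≠ 0) : valK t c d ∈ critK t := by
  rcases mul_eq_zero.mp hy with h | h
  · rw [h, mul_zero, zero_mul] at hx
    have h2 : c = 2 := by
      have : c - 2 = 0 := by
        rcases mul_eq_zero.mp hx.symm with h' | h'
        · exact absurd h' (mul_ne_zero (by norm_num) (pow_ne_zero 2 ht))
        · exact h'
      linear_combination this
    refine Or.inl (Or.inl ?_)
    rw [valK, h, h2]
    ring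
  · have h' : (c - 1) * d ^ 2 = c ^ 2 - t ^ 2 := by
      field_simp at h
      linear_combination h
    have e : (c ^ 2 - t ^ 2) / d = (c - 1) * d := by
      rw [← h']
      field_simp
    rw [e] at hx
    have h2 : (d - 2) * (d - c) = 0 := by
      have : c ^ 3 * ((d - 2) * (d - c)) = 0 := by
        have ht2 : t ^ 2 = c ^ 2 - (c - 1) * d ^ 2 := by linear_combination h'
        rw [ht2] at hx
        field_simp at hx
        linear_combination (-1 / 2) * hx
      exact (mul_eq_zero.mp this).resolve_left (pow_ne_zero 3 hc)
    refine Or.inr ⟨c, d, ?_, rfl⟩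
    rcases mul_eq_zero.mp h2 with h2 | h2
    · obtain rfl : d = 2 := by linear_combination h2
      exact Or.inl ⟨rfl, by linear_combination -h'⟩
    · obtain rfl : d = c := by linear_combination h2
      exact Or.inr ⟨rfl, by linear_combination h'⟩

@[simp] theorem fst_algebraMap_dualNumber (c : ℂ) : (algebraMap ℂ ℂ[ε] c).fst = c := rfl

@[simp] theorem snd_algebraMap_dualNumber (c : ℂ) : (algebraMap ℂ ℂ[ε] c).snd = 0 := rfl

/-- The coefficients of `α` and `β` are the partial derivatives, with the denominators `c³` cleared.
-/
theorem exists_jet_torus {c d : ℂ} (hc0 : c ≠ 0) (hd0 : d ≠ 0) (α β : ℂ) :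
    ∃ κ : ℂ[ε], HasEv (cx - cst c) (cy - cst d) (α • ε) (β • ε) (invK t) κ ∧
      κ.fst = valK t c d ∧
      c ^ 3 * κ.snd = α * (2 * ((c - 1) * d + (c ^ 2 - t ^ 2) / d - c ^ 2) *
        (c * (d + 2 * c / d) - ((c - 1) * d + (c ^ 2 - t ^ 2) / d) - c ^ 2)
          - 4 * t ^ 2 * (c - 2)) + β * (2 * c * (((c - 1) * d + (c ^ 2 - t ^ 2) / d - c ^ 2) *
        ((c - 1) - (c ^ 2 - t ^ 2) / d ^ 2))) := by
  have hc := (isCoord_cx_cy.swap.sub_cst c).swap.sub_cst d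
  have hx : HasEv (cx - cst c) (cy - cst d) (α • ε : ℂ[ε]) (β • ε) cx _ :=
    hasEv_of_sub_cst HasEv.left
  have hy : HasEv (cx - cst c) (cy - cst d) (α • ε : ℂ[ε]) (β • ε) cy _ :=
    hasEv_of_sub_cst HasEv.right
  have hx' := hx.inv_dual hc (by simpa using hc0)
  have hy' := hy.inv_dual hc (by simpa using hd0)
  have hA := ((((hx.sub HasEv.one).mul hy).add (((hx.pow 2).sub
    (HasEv.cst (t ^ 2))).mul hy')).sub (hx.pow 2)).mul hx'
  refine ⟨_, hasEv_invK (Or.inl ⟨rfl, rfl⟩) (hA.congr ?_ rfl) hx', ?_, ?_⟩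
  · rw [ratA, cst_pow]
    rfl
  · simp [valK, TrivSqZeroExt.fst_inv]
    field_simp
  · simp [TrivSqZeroExt.fst_inv, TrivSqZeroExt.snd_inv, pow_two]
    field_simp
    ring

/-- The direction of `y` is used if the derivative there is nonzero; otherwise the direction of `x`
decides. -/
theorem exists_jet_crit_torus (ht : t ≠ 0) {c d : ℂ} (hc0 : c ≠ 0) (hd0 : d ≠ 0) :
    ∃ (α β : ℂ) (κ : ℂ[ε]), HasEv (cx - cst c) (cy - cst d) (α • ε) (β • ε) (invK t) κ ∧
      (κ.snd = 0 → κ.fst ∈ critK t) := by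
  obtain ⟨κ, h1, h2, h3⟩ := exists_jet_torus (t := t) hc0 hd0 1 0
  obtain ⟨κ', h1', h2', h3'⟩ := exists_jet_torus (t := t) hc0 hd0 0 1
  by_cases h : κ'.snd = 0
  · refine ⟨1, 0, κ, h1, fun h0 => ?_⟩
    rw [h2]
    refine valK_critical hc0 hd0 ?_ ?_ ht
    · rw [h0] at h3
      linear_combination -h3
    · rw [h] at h3'
      have : 2 * c ≠ 0 := mul_ne_zero two_ne_zero hc0
      refine (mul_eq_zero.mp (?_ : 2 * c * _ = 0)).resolve_left this
      linear_combination -h3'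
  · exact ⟨0, 1, κ', h1', fun h0 => absurd h0 h⟩

/-- The direction is tangent to the exceptional curve `u = 0`. -/
theorem hasEv_exc {e : ℂ} {r : FuncField} :
    HasEv u (r - cst e) ((0 : ℂ) • ε : ℂ[ε]) ((1 : ℂ) • ε) r (algebraMap ℂ ℂ[ε] e + ε) :=
  (hasEv_of_sub_cst HasEv.right).congr rfl (by rw [one_smul, add_comm])

/-- On this exceptional curve `k` restricts to `(2e - β)² + 4β - 2`. Its only critical point is `2e
= β`, with value `4β - 2` for `β = ±t`. -/
theorem exists_jet_pole (h : IsPair z w) {β e : ℂ} (hβ : β ^ 2 = t ^ 2) (hβ0 : β ≠ 0)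
    (hc : IsCoord w ((z - cst β) / w - cst e)) :
    ∃ κ : ℂ[ε], HasEv w ((z - cst β) / w - cst e) ((0 : ℂ) • ε) ((1 : ℂ) • ε) (invK t) κ ∧
      (κ.snd = 0 → κ.fst ∈ critK t) := by
  have z0 := h.isCoord.left_ne_zero
  have w0 := h.isCoord.right_ne_zero
  have hw : HasEv w ((z - cst β) / w - cst e) ((0 : ℂ) • ε : ℂ[ε]) ((1 : ℂ) • ε) w 0 :=
    HasEv.left.congr rfl (zero_smul _ _)
  have hr : HasEv w ((z - cst β) / w - cst e) ((0 : ℂ) • ε : ℂ[ε]) ((1 : ℂ) • ε) _ _ := hasEv_exc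
  have hz := ((hr.mul hw).add (HasEv.cst β)).congr
    (by rw [div_mul_cancel₀ _ w0, sub_add_cancel] : _ = z) (by rw [mul_zero, zero_add])
  have hz' := hz.inv_dual hc (by simpa using hβ0)
  have hA := (((hw.mul (hz.sub HasEv.one)).add ((hz.add (HasEv.cst β)).mul hr)).sub
    (hz.pow 2)).mul hz'
  refine ⟨_, hasEv_invK h (hA.congr ?_ rfl) hz', fun h0 => ?_⟩
  · have : cst t ^ 2 = cst β ^ 2 := by rw [← cst_pow, ← cst_pow, hβ]
    rw [ratA, this]
    field_simp
    ring
  · have he : 2 * e = β := by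
      simp [TrivSqZeroExt.fst_inv, TrivSqZeroExt.snd_inv, pow_two] at h0
      field_simp at h0
      linear_combination h0 / 4
    simp [TrivSqZeroExt.fst_inv]
    refine Or.inl ?_
    rcases sq_eq_sq_iff_eq_or_eq_neg.mp hβ with rfl | rfl
    · refine Or.inr (Or.inl ?_)
      field_simp
      subst he
      ring
    · refine Or.inr (Or.inr (Or.inl ?_))
      obtain rfl : t = -(2 * e) := by rw [he, neg_neg]
      have e0 : e ≠ 0 := by
        rintro rfl
        simp at hβ0
      field_simp
      ring

/-- On this exceptional curve `k` restricts to `(e - 1)² + 2`. -/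
theorem exists_jet_one (h : IsPair z w) {e : ℂ} (hc : IsCoord w⁻¹ ((z - 1) / w⁻¹ - cst e)) :
    ∃ κ : ℂ[ε], HasEv w⁻¹ ((z - 1) / w⁻¹ - cst e) ((0 : ℂ) • ε) ((1 : ℂ) • ε) (invK t) κ ∧
      (κ.snd = 0 → κ.fst ∈ critK t) := by
  have z0 := h.isCoord.left_ne_zero
  have w0 := h.isCoord.right_ne_zero
  have hw : HasEv w⁻¹ ((z - 1) / w⁻¹ - cst e) ((0 : ℂ) • ε : ℂ[ε]) ((1 : ℂ) • ε) w⁻¹ 0 :=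
    HasEv.left.congr rfl (zero_smul _ _)
  have hr : HasEv w⁻¹ ((z - 1) / w⁻¹ - cst e) ((0 : ℂ) • ε : ℂ[ε]) ((1 : ℂ) • ε) _ _ := hasEv_exc
  have hz := ((hr.mul hw).add HasEv.one).congr
    (by rw [div_mul_cancel₀ _ (inv_ne_zero w0), sub_add_cancel] : _ = z)
    (by rw [mul_zero, zero_add])
  have hz' := hz.inv hc (mul_one 1)
  have hA := ((hr.add (((hz.pow 2).sub (HasEv.cst (t ^ 2))).mul hw)).sub (hz.pow 2)).mul hz'
  refine ⟨_, hasEv_invK h (hA.congr ?_ rfl) hz', fun h0 => ?_⟩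
  · rw [ratA, cst_pow]
    field_simp
  · have he : e = 1 := by
      simp [pow_two] at h0
      linear_combination h0
    simp [he]
    exact Or.inl (Or.inr (Or.inr (Or.inr rfl)))

/-- On the exceptional curve over `P₈` the function `k` restricts to `e² + 2`. -/
theorem exists_jet_inf (h : IsPair z w) {e : ℂ} (hc : IsCoord z⁻¹ ((z / w - 1) / z⁻¹ - cst e)) :
    ∃ κ : ℂ[ε], HasEv z⁻¹ ((z / w - 1) / z⁻¹ - cst e) ((0 : ℂ) • ε) ((1 : ℂ) • ε) (invK t) κ ∧
      (κ.snd = 0 → κ.fst ∈ critK t) := by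
  have z0 := h.isCoord.left_ne_zero
  have w0 := h.isCoord.right_ne_zero
  have hz : HasEv z⁻¹ ((z / w - 1) / z⁻¹ - cst e) ((0 : ℂ) • ε : ℂ[ε]) ((1 : ℂ) • ε) z⁻¹ 0 :=
    HasEv.left.congr rfl (zero_smul _ _)
  have hr : HasEv z⁻¹ ((z / w - 1) / z⁻¹ - cst e) ((0 : ℂ) • ε : ℂ[ε]) ((1 : ℂ) • ε) _ _ :=
    hasEv_exc
  have hq := ((hr.mul hz).add HasEv.one).congr
    (by rw [div_mul_cancel₀ _ (inv_ne_zero z0), sub_add_cancel] : _ = z / w)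
    (by rw [mul_zero, zero_add])
  have hq' := hq.inv hc (mul_one 1)
  have hA := (((hr.mul hq').neg.sub hq').add hq).sub
    (((HasEv.cst (t ^ 2)).mul (hz.pow 2)).mul hq)
  refine ⟨_, hasEv_invK h (hA.congr ?_ rfl) hz, fun h0 => ?_⟩
  · rw [ratA, cst_pow]
    field_simp
    ring
  · have he : e = 0 := by
      simpa [pow_two] using h0
    simp [he]
    exact Or.inl (Or.inr (Or.inr (Or.inr rfl)))

theorem exists_jet_off (ht : t ≠ 0) (hP : P.Valid (hkyParam t)) (hoff : ∀ k, ¬ OnCurve P k) :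
    ∃ u v, IsCoord u v ∧ P.ring (hkyParam t) = localRing u v ∧
      ∃ (α β : ℂ) (κ : ℂ[ε]), HasEv u v (α • ε) (β • ε) (invK t) κ ∧
        (κ.snd = 0 → κ.fst ∈ critK t) := by
  obtain ⟨u, v, hc, hR, h⟩ := exists_chart hP hoff
  refine ⟨u, v, hc, hR, ?_⟩
  rcases h with ⟨c, d, hc0, hd0, rfl, rfl⟩ | ⟨z, w, h, e, ⟨β, hβ, rfl, rfl⟩ | ⟨rfl, rfl⟩ | ⟨rfl, rfl⟩⟩
  · exact exists_jet_crit_torus ht hc0 hd0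
  · refine ⟨0, 1, exists_jet_pole h hβ ?_ hc⟩
    rintro rfl
    exact pow_ne_zero 2 ht (by rw [← hβ, zero_pow two_ne_zero])
  · exact ⟨0, 1, exists_jet_one h hc⟩
  · exact ⟨0, 1, exists_jet_inf h hc⟩

theorem invK_mem_off (ht : t ≠ 0) (hP : P.Valid (hkyParam t)) (hoff : ∀ k, ¬ OnCurve P k) :
    invK t ∈ P.ring (hkyParam t) := by
  obtain ⟨u, v, hc, hR, α, β, κ, h, -⟩ := exists_jet_off ht hP hoff
  rw [hR]
  have := h.map (TrivSqZeroExt.fstHom ℂ ℂ ℂ)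
  exact HasVal.mem hc (c := κ.fst) (by simpa [HasVal] using this)

/-- The divisor of `invK t` is bounded below by minus twice the anticanonical cycle. -/
theorem invK_mul_sq_mem (ht : t ≠ 0) (hP : P.Valid (hkyParam t)) :
    invK t * eqK (hkyParam t) P ^ 2 ∈ P.ring (hkyParam t) := by
  by_cases hon : ∃ k, OnCurve P k
  · obtain ⟨k, hk⟩ := hon
    exact (unitAt_invK ht hP hk).2.1
  · push Not at hon
    exact mul_mem (invK_mem_off ht hP hon) (pow_mem (eqK_mem (admissible_hkyParam ht) hP) 2)

theorem hasVal_invK_inv (ht : t ≠ 0) (hP : P.Valid (hkyParam t)) {k : Fin 5} (hon : OnCurve P k) :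
    HasVal (P.u (hkyParam t)) (P.v (hkyParam t)) (invK t)⁻¹ 0 := by
  have hc := P.isCoord (hkyParam t)
  have h1 := hasVal_eqK (admissible_hkyParam ht) hP hon
  obtain ⟨c, h0, h2⟩ := (unitAt_localRing_iff hc).mp (unitAt_invK ht hP hon)
  have e0 := eqK_ne_zero (hkyParam t) P
  refine ((h1.pow 2).mul (h2.inv hc h0)).congr ?_ (by simp)
  field_simp

theorem invK_ne_zero (ht : t ≠ 0) : invK t ≠ 0 := by
  obtain ⟨P, hP, hon⟩ := exists_onCurve (hkyParam t) 0
  have := (unitAt_invK ht hP hon).1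
  exact left_ne_zero_of_mul this

theorem invK_mem_or_inv_mem (ht : t ≠ 0) {R : Subalgebra ℂ FuncField}
    (hR : R ∈ surface (hkyParam t)) : invK t ∈ R ∨ (invK t)⁻¹ ∈ R := by
  obtain ⟨P, hP, rfl⟩ := (mem_surface_iff (admissible_hkyParam ht) R).mp hR
  by_cases hon : ∃ k, OnCurve P k
  · obtain ⟨k, hk⟩ := hon
    exact Or.inr ((hasVal_invK_inv ht hP hk).mem (P.isCoord _))
  · push Not at hon
    exact Or.inl (invK_mem_off ht hP hon)

/-- The fibres of the conserved quantity are nonsingular with finitely many exceptions. -/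
theorem invK_sub_notMem_sq (ht : t ≠ 0) {c : ℂ} (hcr : c ∉ critK t) {R : Subalgebra ℂ FuncField}
    (hR : R ∈ surface (hkyParam t)) (h : invK t - cst c ∈ R) :
    (⟨invK t - cst c, h⟩ : R) ∉ maxIdeal R ^ 2 := by
  obtain ⟨P, hP, rfl⟩ := (mem_surface_iff (admissible_hkyParam ht) R).mp hR
  by_cases hon : ∃ k, OnCurve P k
  · obtain ⟨k, hk⟩ := hon
    have h1 := add_mem h ((P.ring (hkyParam t)).algebraMap_mem c)
    rw [show algebraMap ℂ FuncField c = cst c from rfl, sub_add_cancel] at h1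
    exact absurd h1 ((hasVal_invK_inv ht hP hk).notMem (P.isCoord _) (invK_ne_zero ht))
  · push Not at hon
    obtain ⟨u, v, hc, hR, α, β, κ, hκ, hsnd⟩ := exists_jet_off ht hP hon
    generalize P.ring (hkyParam t) = R at *
    subst hR
    intro hm
    obtain ⟨h1, h2⟩ := eq_of_sub_cst_mem_maxIdeal_sq hc h hm hκ
    exact hcr (h1 ▸ hsnd h2)

end offCycle

/-! ### Functions with poles at infinity only -/

section polynomial

open Polynomial.Bivariate

theorem aeval_equivMvPolynomial {A : Type*} [CommRing A] [Algebra ℂ A] (z w : A)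
    (P : Polynomial (Polynomial ℂ)) :
    aeval ![z, w] (equivMvPolynomial ℂ P) = Polynomial.aevalAeval z w P := by
  have : (aeval ![z, w]).comp (equivMvPolynomial ℂ).toAlgHom =
      (Polynomial.aevalAeval z w : Polynomial (Polynomial ℂ) →ₐ[ℂ] A) := by
    apply Polynomial.algHom_ext'
    · ext
      simp
    · simp
  exact DFunLike.congr_fun this P

theorem eval_equivMvPolynomial (c d : ℂ) (P : Polynomial (Polynomial ℂ)) :
    aeval ![c, d] (equivMvPolynomial ℂ P) = P.evalEval c d := by
  rw [aeval_equivMvPolynomial, Polynomial.coe_aevalAeval_eq_evalEval]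

theorem evalEval_swap (c d : ℂ) (P : Polynomial (Polynomial ℂ)) :
    (Polynomial.Bivariate.swap P).evalEval c d = P.evalEval d c := by
  rw [← Polynomial.coe_aevalAeval_eq_evalEval, ← Polynomial.coe_aevalAeval_eq_evalEval,
    Polynomial.Bivariate.aevalAeval_swap]

theorem coeff_coeff_swap (P : Polynomial (Polynomial ℂ)) (i j : ℕ) :
    ((Polynomial.Bivariate.swap P).coeff i).coeff j = (P.coeff j).coeff i := by
  induction P using Polynomial.induction_on' with
  | add P Q hP hQ => simp [hP, hQ]
  | monomial n p =>
    induction p using Polynomial.induction_on' with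
    | add p q hp hq => simp [hp, hq]
    | monomial m r =>
      rw [Polynomial.Bivariate.swap_monomial_monomial]
      simp only [Polynomial.coeff_monomial]
      split_ifs <;> simp_all [Polynomial.coeff_monomial]

theorem eq_zero_of_finite {p : Polynomial ℂ} {S : Set ℂ} (hS : S.Finite)
    (h : ∀ c ∉ S, p.eval c = 0) : p = 0 :=
  p.eq_zero_of_infinite_isRoot (hS.infinite_compl.mono h)

/-- A polynomial in two variables without zeros on almost all vertical lines does not depend on the
second variable. -/
theorem natDegree_eq_zero_of_no_zeros {P : Polynomial (Polynomial ℂ)} {S : Set ℂ} (hS : S.Finite)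
    (h : ∀ c ∉ S, ∀ d, P.evalEval c d ≠ 0) : P.natDegree = 0 := by
  by_contra hn
  have hP : P ≠ 0 := by
    rintro rfl
    exact hn rfl
  -- For `c` outside `S` the polynomial `P(c, ·)` has no zeros and is constant. If the degree were
  -- positive, the leading coefficient would vanish at all these `c`.
  apply Polynomial.leadingCoeff_ne_zero.mpr hP
  refine eq_zero_of_finite hS fun c hc => ?_
  have h1 : (P.map (Polynomial.evalRingHom c)).natDegree = 0 := by
    by_contra h0
    obtain ⟨d, hd⟩ := IsAlgClosed.exists_root (P.map (Polynomial.evalRingHom c))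
      (fun e => h0 (Polynomial.natDegree_eq_of_degree_eq_some e))
    refine h c hc d ?_
    rwa [Polynomial.IsRoot, Polynomial.map_evalRingHom_eval] at hd
  have h2 := Polynomial.coeff_eq_zero_of_natDegree_lt
    (h1.trans_lt (Nat.pos_of_ne_zero hn) : _ < P.natDegree)
  rwa [Polynomial.coeff_map] at h2

theorem exists_eq_C_of_no_zeros {q : MvPolynomial (Fin 2) ℂ} {S : Set ℂ} (hS : S.Finite)
    (h : ∀ c ∉ S, ∀ d, aeval ![c, d] q ≠ 0) (h' : ∀ d ∉ S, ∀ c, aeval ![c, d] q ≠ 0) :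
    ∃ k : ℂ, q = C k := by
  obtain ⟨P, rfl⟩ := (equivMvPolynomial ℂ).surjective q
  simp only [eval_equivMvPolynomial] at h h'
  have h1 := natDegree_eq_zero_of_no_zeros hS h
  have h2 : (Polynomial.Bivariate.swap P).natDegree = 0 :=
    natDegree_eq_zero_of_no_zeros hS fun d hd c => by
      rw [evalEval_swap]
      exact h' d hd c
  obtain ⟨p, rfl⟩ := Polynomial.natDegree_eq_zero.mp h1
  rw [Polynomial.Bivariate.swap_C, Polynomial.natDegree_map_eq_of_injective
    Polynomial.C_injective] at h2
  obtain ⟨k, rfl⟩ := Polynomial.natDegree_eq_zero.mp h2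
  exact ⟨k, by simp⟩

/-- A function that is regular at almost all points of the affine plane is a polynomial. -/
theorem exists_eq_ofPoly {s : FuncField} {S : Set ℂ} (hS : S.Finite)
    (h : ∀ c d, c ∉ S ∨ d ∉ S → s ∈ localRing (cx - cst c) (cy - cst d)) :
    ∃ p, s = ofPoly p := by
  -- In a reduced fraction `q` divides the denominator of every other representation. So `q` can
  -- vanish only at points with both coordinates in the finite set `S`, and must be constant.
  obtain ⟨p, q, hpq, rfl⟩ := IsFractionRing.exists_reduced_fraction (A := MvPolynomial (Fin 2) ℂ) s
  have hq0 : ofPoly q ≠ 0 := IsFractionRing.to_map_ne_zero_of_mem_nonZeroDivisors q.2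
  have key : ∀ c d, c ∉ S ∨ d ∉ S → aeval ![c, d] (q : MvPolynomial (Fin 2) ℂ) ≠ 0 := by
    intro c d hcd
    obtain ⟨p', q', h1, -, h3⟩ := h c d hcd
    have e : ∀ r : MvPolynomial (Fin 2) ℂ, aeval ![cx - cst c, cy - cst d] r =
        ofPoly (aeval ![X 0 - C c, X 1 - C d] r) := by
      intro r
      have : (aeval ![cx - cst c, cy - cst d] : MvPolynomial (Fin 2) ℂ →ₐ[ℂ] FuncField) =
          (Algebra.algHom ℂ (MvPolynomial (Fin 2) ℂ) FuncField).comp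
            (aeval ![X 0 - C c, X 1 - C d]) := by
        ext i
        fin_cases i
        · simp [cx, ofPoly]
          rfl
        · simp [cy, ofPoly]
          rfl
      exact DFunLike.congr_fun this r
    rw [e, e, IsFractionRing.mk'_eq_div, div_mul_eq_mul_div] at h3
    have h4 : ofPoly (p * aeval ![X 0 - C c, X 1 - C d] q') =
        ofPoly (aeval ![X 0 - C c, X 1 - C d] p' * q) := by
      change _ / ofPoly q = _ at h3
      rw [div_eq_iff hq0] at h3
      simpa [ofPoly] using h3
    have h5 := IsFractionRing.injective (MvPolynomial (Fin 2) ℂ) FuncField h4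
    have h6 : (q : MvPolynomial (Fin 2) ℂ) ∣ aeval ![X 0 - C c, X 1 - C d] q' :=
      hpq.symm.dvd_of_dvd_mul_left (Dvd.intro_left _ h5.symm)
    obtain ⟨r, hr⟩ := h6
    intro h0
    have h7 := congrArg (aeval ![c, d] : MvPolynomial (Fin 2) ℂ →ₐ[ℂ] ℂ) hr
    rw [map_mul, h0, zero_mul] at h7
    have h8 : ∀ r : MvPolynomial (Fin 2) ℂ,
        (aeval ![c, d] : MvPolynomial (Fin 2) ℂ →ₐ[ℂ] ℂ) (aeval ![X 0 - C c, X 1 - C d] r) =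
          aeval ![0, 0] r := by
      intro r
      have : (aeval ![c, d] : MvPolynomial (Fin 2) ℂ →ₐ[ℂ] ℂ).comp
          (aeval ![X 0 - C c, X 1 - C d]) = aeval ![0, 0] := by
        ext i
        fin_cases i <;> simp
      exact DFunLike.congr_fun this r
    rw [h8, aeval_zero_zero] at h7
    exact h1 h7
  obtain ⟨k, hk⟩ := exists_eq_C_of_no_zeros hS (fun c hc d => key c d (Or.inl hc))
    (fun d hd c => key c d (Or.inr hd))
  have hk0 : ofPoly q = cst k := by
    rw [hk]
    rfl
  refine ⟨C k⁻¹ * p, ?_⟩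
  have hkk : ofPoly (C k⁻¹) = (ofPoly q)⁻¹ := by
    rw [hk0, ← cst_inv]
    rfl
  have : ofPoly (C k⁻¹ * p) = ofPoly (C k⁻¹) * ofPoly p := map_mul _ _ _
  rw [this, hkk, IsFractionRing.mk'_eq_div, div_eq_inv_mul]
  rfl

/-- A bound for the degree of a polynomial from the pole order along the line at infinity. -/
theorem natDegree_le_of_mem {z w : FuncField} (hc : IsCoord z w) {P : Polynomial (Polynomial ℂ)}
    {S : Set ℂ} (hS : S.Finite) {n : ℕ} (h : ∀ c ∉ S,
      Polynomial.aevalAeval z w P * w⁻¹ ^ n ∈ localRing (z - cst c) w⁻¹) : P.natDegree ≤ n := by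
  by_contra! hn
  have hP : P ≠ 0 := by
    rintro rfl
    simp at hn
  have w0 := hc.right_ne_zero
  apply Polynomial.leadingCoeff_ne_zero.mpr hP
  refine eq_zero_of_finite hS fun c hcS => ?_
  have hc' : IsCoord (z - cst c) w⁻¹ := (hc.swap.sub_cst c).swap.inv
  have hz : HasVal (z - cst c) w⁻¹ z c := HasVal.of_sub HasEv.left
  have hw : HasVal (z - cst c) w⁻¹ w⁻¹ 0 := HasEv.right
  obtain ⟨κ, hκ⟩ := (mem_localRing_iff hc').mp (h c hcS)
  -- If the degree exceeded `n`, then `P w^(-deg P)` would vanish at `(c, ∞)`. Its value there is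
  -- the leading coefficient at `c`, which would vanish for almost all `c`.
  have h1 : HasVal (z - cst c) w⁻¹ (Polynomial.aevalAeval z w P * w⁻¹ ^ P.natDegree) 0 := by
    refine (hκ.mul (hw.pow (P.natDegree - n))).congr ?_ ?_
    · rw [mul_assoc, ← pow_add, Nat.add_sub_cancel' hn.le]
    · rw [zero_pow (Nat.sub_ne_zero_of_lt hn), mul_zero]
  have hpoly : ∀ p : Polynomial ℂ, HasVal (z - cst c) w⁻¹ (Polynomial.aeval z p) (p.eval c) := by
    intro p
    induction p using Polynomial.induction_on' with
    | add p q hp hq => simpa using hp.add hq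
    | monomial m r =>
      rw [Polynomial.aeval_monomial, Polynomial.eval_monomial]
      exact (HasVal.cst r).mul (hz.pow m)
  have hsum : ∀ (I : Finset ℕ), (∀ i ∈ I, i ≤ P.natDegree) → HasVal (z - cst c) w⁻¹
      (∑ i ∈ I, Polynomial.aeval z (P.coeff i) * w⁻¹ ^ (P.natDegree - i))
      (∑ i ∈ I, (P.coeff i).eval c * 0 ^ (P.natDegree - i)) := by
    intro I hI
    induction I using Finset.induction_on with
    | empty => exact HasEv.zero
    | insert a I ha ih =>
      rw [Finset.sum_insert ha, Finset.sum_insert ha]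
      exact ((hpoly _).mul (hw.pow _)).add (ih fun i hi => hI i (Finset.mem_insert_of_mem hi))
  have h2 := hsum (Finset.range (P.natDegree + 1)) (fun i hi => by
    have := Finset.mem_range.mp hi
    omega)
  have h3 : Polynomial.aevalAeval z w P * w⁻¹ ^ P.natDegree =
      ∑ i ∈ Finset.range (P.natDegree + 1),
        Polynomial.aeval z (P.coeff i) * w⁻¹ ^ (P.natDegree - i) := by
    rw [congrArg (Polynomial.aevalAeval z w) P.as_sum_range_C_mul_X_pow, map_sum, Finset.sum_mul]
    refine Finset.sum_congr rfl fun i hi => ?_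
    obtain ⟨m, hm⟩ := Nat.exists_eq_add_of_le (Nat.lt_succ_iff.mp (Finset.mem_range.mp hi))
    rw [map_mul, map_pow, Polynomial.aevalAeval_C, Polynomial.aevalAeval_Y, mul_assoc, hm, pow_add,
      Nat.add_sub_cancel_left, ← mul_assoc (w ^ i), ← mul_pow, mul_inv_cancel₀ w0, one_pow, one_mul]
  rw [h3] at h1
  have h4 := h2.unique hc' h1
  rw [Finset.sum_range_succ, Finset.sum_eq_zero, zero_add, Nat.sub_self, pow_zero, mul_one] at h4
  · exact h4
  · intro i hi
    rw [zero_pow (Nat.sub_ne_zero_of_lt (Finset.mem_range.mp hi)), mul_zero]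

/-- A polynomial of bidegree `(4, 4)` with the given coefficients. -/
def biquartic {A : Type*} [CommRing A] [Algebra ℂ A] (k : ℕ → ℕ → ℂ) (ξ η : A) : A :=
  ∑ i ∈ Finset.range 5, ∑ j ∈ Finset.range 5, algebraMap ℂ A (k i j) * ξ ^ i * η ^ j

theorem aevalAeval_eq_biquartic {A : Type*} [CommRing A] [Algebra ℂ A] (z w : A)
    {P : Polynomial (Polynomial ℂ)} (h : P.natDegree ≤ 4)
    (h' : (Polynomial.Bivariate.swap P).natDegree ≤ 4) :
    Polynomial.aevalAeval z w P = biquartic (fun i j => (P.coeff j).coeff i) z w := by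
  have h1 : ∀ j, (P.coeff j).natDegree ≤ 4 := by
    intro j
    rw [Polynomial.natDegree_le_iff_coeff_eq_zero]
    intro i hi
    rw [← coeff_coeff_swap, Polynomial.coeff_eq_zero_of_natDegree_lt (h'.trans_lt hi),
      Polynomial.coeff_zero]
  rw [biquartic, Finset.sum_comm]
  conv_lhs => rw [P.as_sum_range' 5 (by omega)]
  rw [map_sum]
  refine Finset.sum_congr rfl fun j _ => ?_
  rw [← Polynomial.C_mul_X_pow_eq_monomial, map_mul, map_pow, Polynomial.aevalAeval_C,
    Polynomial.aevalAeval_Y, ← Finset.sum_mul]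
  congr 1
  conv_lhs => rw [(P.coeff j).as_sum_range' 5 (by have := h1 j; omega)]
  rw [map_sum]
  exact Finset.sum_congr rfl fun i _ => Polynomial.aeval_monomial _

end polynomial

/-! ### Conditions on the coefficients of a biquartic polynomial -/

section biquartic

open DualNumber

variable {k : ℕ → ℕ → ℂ} {u v z w : FuncField}

theorem HasEv.sum {A : Type*} [CommRing A] [Algebra ℂ A] {σ τ : A} {ι : Type*} (I : Finset ι)
    {f : ι → FuncField} {κ : ι → A} (h : ∀ i ∈ I, HasEv u v σ τ (f i) (κ i)) :
    HasEv u v σ τ (∑ i ∈ I, f i) (∑ i ∈ I, κ i) := by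
  classical
  induction I using Finset.induction_on with
  | empty => exact HasEv.zero
  | insert a I ha ih =>
    rw [Finset.sum_insert ha, Finset.sum_insert ha]
    exact (h a (Finset.mem_insert_self a I)).add
      (ih fun i hi => h i (Finset.mem_insert_of_mem hi))

theorem HasEv.biquartic {A : Type*} [CommRing A] [Algebra ℂ A] {σ τ ξ η : A}
    (hz : HasEv u v σ τ z ξ) (hw : HasEv u v σ τ w η) (k : ℕ → ℕ → ℂ) :
    HasEv u v σ τ (biquartic k z w) (HKY.biquartic k ξ η) :=
  HasEv.sum _ fun i _ => HasEv.sum _ fun j _ =>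
    ((HasEv.cst (k i j)).mul (hz.pow i)).mul (hw.pow j)

/-- Passing to the chart at infinity reverses the order of the coefficients, so the conditions at
infinite centres reduce to those at finite ones. -/
theorem biquartic_mul_inv_right (k : ℕ → ℕ → ℂ) (w0 : w ≠ 0) :
    biquartic k z w * w⁻¹ ^ 4 = biquartic (fun i j => k i (4 - j)) z w⁻¹ := by
  rw [biquartic, biquartic, Finset.sum_mul]
  refine Finset.sum_congr rfl fun i _ => ?_
  rw [Finset.sum_mul, ← Finset.sum_range_reflect]
  refine Finset.sum_congr rfl fun j hj => ?_
  have hj' : j ≤ 4 := Nat.lt_succ_iff.mp (Finset.mem_range.mp hj)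
  have e : w⁻¹ ^ 4 = w⁻¹ ^ (4 - j) * w⁻¹ ^ j := by rw [← pow_add, Nat.sub_add_cancel hj']
  rw [show 5 - 1 - j = 4 - j from rfl, e, mul_assoc, ← mul_assoc (w ^ (4 - j)), ← mul_pow, mul_inv_cancel₀ w0,
    one_pow, one_mul]

theorem biquartic_mul_inv_left (k : ℕ → ℕ → ℂ) (z0 : z ≠ 0) :
    biquartic k z w * z⁻¹ ^ 4 = biquartic (fun i j => k (4 - i) j) z⁻¹ w := by
  have e : ∀ (k : ℕ → ℕ → ℂ) (z w : FuncField),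
      biquartic k z w = biquartic (fun i j => k j i) w z := by
    intro k z w
    rw [biquartic, biquartic, Finset.sum_comm]
    exact Finset.sum_congr rfl fun i _ => Finset.sum_congr rfl fun j _ => by ring
  rw [e, biquartic_mul_inv_right _ z0, e]

/-- A function divisible by the square of the equation of an exceptional curve vanishes to second
order at the centre. -/
theorem biquartic_dual_eq_zero (hc : IsCoord u v) {α β : ℂ}
    (h : ∀ e, biquartic k (u + cst α) (v + cst β) * u⁻¹ ^ 2 ∈ localRing u (v / u - cst e)) (e : ℂ) :
    biquartic k (algebraMap ℂ ℂ[ε] α + ε) (algebraMap ℂ ℂ[ε] β + e • ε) = 0 := by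
  have hc' := hc.div.sub_cst e
  have u0 := hc.left_ne_zero
  -- This is the arc `(u, v) = (ε, eε)` through the centre with slope `e`; on it the factor `u²`
  -- becomes `ε² = 0`.
  obtain ⟨κ, h1, -⟩ := exists_jet (h e) 1 0
  have hu : HasEv u (v / u - cst e) ((1 : ℂ) • ε : ℂ[ε]) ((0 : ℂ) • ε) u ε :=
    HasEv.left.congr rfl (one_smul _ _)
  have hr : HasEv u (v / u - cst e) ((1 : ℂ) • ε : ℂ[ε]) ((0 : ℂ) • ε) (v / u) _ :=
    hasEv_of_sub_cst HasEv.right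
  have hv := (hr.mul hu).congr (div_mul_cancel₀ v u0)
    (by rw [zero_smul, zero_add, Algebra.smul_def] : _ = e • (ε : ℂ[ε]))
  have h2 := ((hu.add (HasEv.cst α)).biquartic (hv.add (HasEv.cst β)) k)
  have h3 := (h1.mul (hu.pow 2)).congr
    (by rw [mul_assoc, ← mul_pow, inv_mul_cancel₀ u0, one_pow, mul_one] : _ = biquartic k _ _)
    (by rw [pow_two, eps_mul_eps, mul_zero])
  rw [← h2.unique hc' h3, add_comm _ ε, add_comm _ (e • ε)]

/-- The slope `0` gives the value and the derivative in the first variable; the difference with the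
slope `1` gives the derivative in the second. -/
theorem biquartic_double_left {α : ℂ}
    (h : ∀ e : ℂ, biquartic k (algebraMap ℂ ℂ[ε] α + ε) (algebraMap ℂ ℂ[ε] 0 + e • ε) = 0) :
    k 0 0 + k 1 0 * α + k 2 0 * α ^ 2 + k 3 0 * α ^ 3 + k 4 0 * α ^ 4 = 0 ∧
    k 1 0 + 2 * k 2 0 * α + 3 * k 3 0 * α ^ 2 + 4 * k 4 0 * α ^ 3 = 0 ∧
    k 0 1 + k 1 1 * α + k 2 1 * α ^ 2 + k 3 1 * α ^ 3 + k 4 1 * α ^ 4 = 0 := by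
  have h0 := h 0
  have h1 := h 1
  rw [TrivSqZeroExt.ext_iff] at h0 h1
  simp [biquartic, Finset.sum_range_succ, TrivSqZeroExt.snd_pow] at h0 h1
  refine ⟨?_, ?_, ?_⟩
  · linear_combination h0.1
  · linear_combination h0.2
  · linear_combination h1.2 - h0.2

theorem biquartic_double_right {β : ℂ}
    (h : ∀ e : ℂ, biquartic k (algebraMap ℂ ℂ[ε] 0 + ε) (algebraMap ℂ ℂ[ε] β + e • ε) = 0) :
    k 0 0 + k 0 1 * β + k 0 2 * β ^ 2 + k 0 3 * β ^ 3 + k 0 4 * β ^ 4 = 0 ∧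
    k 0 1 + 2 * k 0 2 * β + 3 * k 0 3 * β ^ 2 + 4 * k 0 4 * β ^ 3 = 0 ∧
    k 1 0 + k 1 1 * β + k 1 2 * β ^ 2 + k 1 3 * β ^ 3 + k 1 4 * β ^ 4 = 0 := by
  have h0 := h 0
  have h1 := h 1
  rw [TrivSqZeroExt.ext_iff] at h0 h1
  simp [biquartic, Finset.sum_range_succ, TrivSqZeroExt.snd_pow] at h0 h1
  refine ⟨?_, ?_, ?_⟩
  · linear_combination h0.1
  · linear_combination h1.2 - h0.2
  · linear_combination h0.2

theorem coeff_eq_zero_of_X_pow_four {a b c d : ℂ} {κ : PowerSeries ℂ}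
    (h : PowerSeries.C a + PowerSeries.C b * PowerSeries.X + PowerSeries.C c * PowerSeries.X ^ 2 +
      PowerSeries.C d * PowerSeries.X ^ 3 = PowerSeries.X ^ 4 * κ) :
    a = 0 ∧ b = 0 ∧ c = 0 ∧ d = 0 := by
  have := fun n => congrArg (PowerSeries.coeff n) h
  have h0 := this 0
  have h1 := this 1
  have h2 := this 2
  have h3 := this 3
  simp [PowerSeries.coeff_X_pow_mul', PowerSeries.coeff_X_pow, PowerSeries.coeff_C] at h0 h1 h2 h3
  exact ⟨h0, h1, h2, h3⟩

/-- The arc `X ↦ (X, (1 + cX)X)` passes through the point and the infinitely near point of slope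
`1`; only the terms of order less than four matter. -/
theorem biquartic_expansion {A : Type*} [CommRing A] [Algebra ℂ A] (k : ℕ → ℕ → ℂ) (X : A)
    (c : ℂ) : ∃ r, biquartic k X ((1 + algebraMap ℂ A c * X) * X) =
      algebraMap ℂ A (k 0 0) + algebraMap ℂ A (k 1 0 + k 0 1) * X +
        algebraMap ℂ A (k 2 0 + k 1 1 + k 0 2 + c * k 0 1) * X ^ 2 +
        algebraMap ℂ A (k 3 0 + k 2 1 + k 1 2 + k 0 3 + c * (k 1 1 + 2 * k 0 2)) * X ^ 3 +
        X ^ 4 * r := by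
  set f := algebraMap ℂ A
  refine ⟨(∑ i ∈ Finset.range 5, ∑ j ∈ Finset.range 5,
    if 4 ≤ i + j then f (k i j) * X ^ (i + j - 4) * (1 + f c * X) ^ j else 0) +
      (f (k 0 2) * f c ^ 2 + f (k 1 2) * (2 * f c + f c ^ 2 * X) +
        f (k 0 3) * (3 * f c + 3 * f c ^ 2 * X + f c ^ 3 * X ^ 2) + f (k 2 1) * f c), ?_⟩
  have h2 : f 2 = 2 := map_ofNat _ 2
  simp only [biquartic, Finset.sum_range_succ, Finset.range_zero, Finset.sum_empty, map_add,
    map_mul, h2]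
  norm_num
  ring

/-- The conditions for double points at a point and at an infinitely near point. -/
theorem biquartic_double_near (h : ∀ c : ℂ, ∃ κ : PowerSeries ℂ, biquartic k PowerSeries.X
      ((1 + algebraMap ℂ (PowerSeries ℂ) c * PowerSeries.X) * PowerSeries.X) =
        PowerSeries.X ^ 4 * κ) :
    k 0 0 = 0 ∧ k 1 0 + k 0 1 = 0 ∧ k 0 1 = 0 ∧ k 2 0 + k 1 1 + k 0 2 = 0 ∧
      k 3 0 + k 2 1 + k 1 2 + k 0 3 = 0 := by
  -- Double points at the centre and at the infinitely near centre give order at least `2 + 2` along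
  -- every such arc. The values `c = 0` and `c = 1` separate the conditions.
  have key : ∀ c : ℂ, k 0 0 = 0 ∧ k 1 0 + k 0 1 = 0 ∧ k 2 0 + k 1 1 + k 0 2 + c * k 0 1 = 0 ∧
      k 3 0 + k 2 1 + k 1 2 + k 0 3 + c * (k 1 1 + 2 * k 0 2) = 0 := by
    intro c
    obtain ⟨κ, hκ⟩ := h c
    obtain ⟨r, hr⟩ := biquartic_expansion k (PowerSeries.X : PowerSeries ℂ) c
    refine coeff_eq_zero_of_X_pow_four (κ := κ - r) ?_
    rw [mul_sub, ← hκ, hr, add_sub_cancel_right]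
    rfl
  obtain ⟨h1, h2, h3, h4⟩ := key 0
  obtain ⟨-, -, h3', -⟩ := key 1
  refine ⟨h1, h2, ?_, ?_, ?_⟩
  · linear_combination h3' - h3
  · linear_combination h3
  · linear_combination h4

end biquartic

/-! ### The linear systems `|-K|` and `|-2K|` -/

section linearSystems

variable {t : ℂ} {P : Pt} {s : FuncField}

theorem localEq_antiK {a : Fin 5 → ℂ} (ha : Admissible a) (hP : P.Valid a) :
    localEq a antiK (P.ring a) =
      Pt.pole cx (P.xval a) ^ 2 * Pt.pole cy (P.yval a) ^ 2 / ∏ i, P.excE a i :=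
  mul_left_cancel₀ (mul_ne_zero cx_ne_zero cy_ne_zero) (eqK_eq ha hP)

theorem localEq_two_antiK {a : Fin 5 → ℂ} (ha : Admissible a) (hP : P.Valid a) :
    localEq a ((2 : ℤ) • antiK) (P.ring a) = localEq a antiK (P.ring a) ^ 2 := by
  rw [two_smul, localEq_add ha hP, pow_two]

theorem mem_sections_iff {a : Fin 5 → ℂ} (ha : Admissible a) (l : Pic) :
    s ∈ sections a l ↔ ∀ P : Pt, P.Valid a → s * localEq a l (P.ring a) ∈ P.ring a := by
  refine ⟨fun h P hP => h _ ((mem_surface_iff ha _).mpr ⟨P, hP, rfl⟩), fun h R hR => ?_⟩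
  obtain ⟨P, hP, rfl⟩ := (mem_surface_iff ha R).mp hR
  exact h P hP

theorem mul_mem_sections {a : Fin 5 → ℂ} (ha : Admissible a) :
    cx * cy ∈ sections a antiK := by
  rw [mem_sections_iff ha]
  intro P hP
  rw [eqK_eq ha hP]
  exact eqK_mem ha hP

theorem mul_mul_mem_sections {a : Fin 5 → ℂ} (ha : Admissible a) (h : s ∈ sections a antiK) :
    s * (cx * cy) ∈ sections a ((2 : ℤ) • antiK) := by
  rw [mem_sections_iff ha] at h ⊢
  intro P hP
  rw [localEq_two_antiK ha hP]
  convert! mul_mem (h P hP) (mul_mem_sections ha _ ((mem_surface_iff ha _).mpr ⟨P, hP, rfl⟩)) using 1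
  ring

theorem hkyF_mem_sections {a : Fin 5 → ℂ} (ha : Admissible a) :
    ofPoly hkyF ∈ sections a ((2 : ℤ) • antiK) := by
  have e : ofPoly hkyF = cx * cy * (cx * cy) := by
    rw [ofPoly_hkyF]
    ring
  rw [e]
  exact mul_mul_mem_sections ha (mul_mem_sections ha)

theorem ofPoly_hkyG_eq (t : ℂ) : ofPoly (hkyG t) = invK t * (cx * cy) ^ 2 := by
  have x0 := cx_ne_zero
  have y0 := cy_ne_zero
  rw [invK, ofPoly_hkyF]
  field_simp

theorem hkyG_mem_sections (ht : t ≠ 0) :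
    ofPoly (hkyG t) ∈ sections (hkyParam t) ((2 : ℤ) • antiK) := by
  have ha := admissible_hkyParam ht
  rw [mem_sections_iff ha]
  intro P hP
  rw [localEq_two_antiK ha hP, ofPoly_hkyG_eq, mul_assoc, ← mul_pow, eqK_eq ha hP]
  exact invK_mul_sq_mem ht hP

theorem mem_of_mem_sections (ht : t ≠ 0) (h : s ∈ sections (hkyParam t) ((2 : ℤ) • antiK))
    (hP : P.Valid (hkyParam t)) {r : FuncField}
    (hr : s * (Pt.pole cx (P.xval (hkyParam t)) ^ 2 * Pt.pole cy (P.yval (hkyParam t)) ^ 2 /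
      ∏ i, P.excE (hkyParam t) i) ^ 2 = r) : r ∈ P.ring (hkyParam t) := by
  have ha := admissible_hkyParam ht
  have := (mem_sections_iff ha _).mp h P hP
  rwa [localEq_two_antiK ha hP, localEq_antiK ha hP, hr] at this

/-- The class is trivial on the affine plane away from the centres, whose coordinates lie in `{0, t,
-t}`, so a section is a polynomial. The coefficients of `H_x` and `H_y` in `-2K` bound both degrees
by `4`. -/
theorem exists_eq_biquartic (ht : t ≠ 0) (h : s ∈ sections (hkyParam t) ((2 : ℤ) • antiK)) :
    ∃ k, s = biquartic k cx cy := by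
  obtain ⟨p, rfl⟩ := exists_eq_ofPoly (S := {0, t, -t}) (Set.toFinite _) (s := s) (by
    intro c d hcd
    refine mem_of_mem_sections (P := Pt.base (some c) (some d)) ht h (Pt.valid_some_some.mpr ?_) ?_
    · simp only [Set.mem_insert_iff, Set.mem_singleton_iff, not_or] at hcd
      rcases hcd with hcd | hcd
      · exact ⟨fun _ => hcd.2, fun e => absurd e hcd.1⟩
      · exact ⟨fun e => absurd e hcd.1, fun _ => hcd.2⟩
    · simp [Pt.xval, Pt.yval, Pt.pole, Pt.excE])
  obtain ⟨P, rfl⟩ := (Polynomial.Bivariate.equivMvPolynomial ℂ).surjective p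
  have e : ofPoly (Polynomial.Bivariate.equivMvPolynomial ℂ P) = Polynomial.aevalAeval cx cy P := by
    rw [← aeval_equivMvPolynomial]
    exact DFunLike.congr_fun (MvPolynomial.algHom_ext (f := Algebra.algHom ℂ _ FuncField)
      (g := aeval ![cx, cy]) (by
        intro i
        fin_cases i
        · simp [cx, ofPoly]
          rfl
        · simp [cy, ofPoly]
          rfl)) _
  rw [e] at h ⊢
  refine ⟨_, aevalAeval_eq_biquartic cx cy ?_ ?_⟩
  · refine natDegree_le_of_mem isCoord_cx_cy (Set.finite_singleton (1 : ℂ)) fun c hc => ?_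
    refine mem_of_mem_sections (P := Pt.base (some c) none) ht h (Pt.valid_some_none.mpr hc) ?_
    simp [Pt.xval, Pt.yval, Pt.pole, Pt.excE]
    exact Or.inl (by ring)
  · refine natDegree_le_of_mem isCoord_cx_cy.swap (Set.finite_singleton (1 : ℂ)) fun c hc => ?_
    rw [Polynomial.Bivariate.aevalAeval_swap, localRing_swap]
    refine mem_of_mem_sections (P := Pt.base none (some c)) ht h (Pt.valid_none_some.mpr hc) ?_
    simp [Pt.xval, Pt.yval, Pt.pole, Pt.excE]
    exact Or.inl (by ring)

/-- These are the conditions for double points at `P₁, …, P₄` (with `β = ±t`), at `P₅`, at `P₆`, and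
at `P₇` with the infinitely near `P₈`. -/
theorem biquartic_conditions (ht : t ≠ 0) {k : ℕ → ℕ → ℂ}
    (h : biquartic k cx cy ∈ sections (hkyParam t) ((2 : ℤ) • antiK)) :
    (∀ β, β ^ 2 = t ^ 2 →
      (k 0 0 + k 1 0 * β + k 2 0 * β ^ 2 + k 3 0 * β ^ 3 + k 4 0 * β ^ 4 = 0 ∧
      k 1 0 + 2 * k 2 0 * β + 3 * k 3 0 * β ^ 2 + 4 * k 4 0 * β ^ 3 = 0 ∧
      k 0 1 + k 1 1 * β + k 2 1 * β ^ 2 + k 3 1 * β ^ 3 + k 4 1 * β ^ 4 = 0) ∧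
      (k 0 0 + k 0 1 * β + k 0 2 * β ^ 2 + k 0 3 * β ^ 3 + k 0 4 * β ^ 4 = 0 ∧
      k 0 1 + 2 * k 0 2 * β + 3 * k 0 3 * β ^ 2 + 4 * k 0 4 * β ^ 3 = 0 ∧
      k 1 0 + k 1 1 * β + k 1 2 * β ^ 2 + k 1 3 * β ^ 3 + k 1 4 * β ^ 4 = 0)) ∧
    (k 0 4 + k 1 4 + k 2 4 + k 3 4 + k 4 4 = 0 ∧ k 1 4 + 2 * k 2 4 + 3 * k 3 4 + 4 * k 4 4 = 0 ∧
      k 0 3 + k 1 3 + k 2 3 + k 3 3 + k 4 3 = 0) ∧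
    (k 4 0 + k 4 1 + k 4 2 + k 4 3 + k 4 4 = 0 ∧ k 4 1 + 2 * k 4 2 + 3 * k 4 3 + 4 * k 4 4 = 0 ∧
      k 3 0 + k 3 1 + k 3 2 + k 3 3 + k 3 4 = 0) ∧
    k 4 4 = 0 ∧ k 3 4 + k 4 3 = 0 ∧ k 4 3 = 0 ∧ k 2 4 + k 3 3 + k 4 2 = 0 ∧
      k 1 4 + k 2 3 + k 3 2 + k 4 1 = 0 := by
  have x0 := cx_ne_zero
  have y0 := cy_ne_zero
  have x1 := cx_sub_one_ne_zero
  have hval : ∀ i c, i ≠ 6 → (Pt.exc i c).Valid (hkyParam t) := fun i c hi e => absurd e hi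
  refine ⟨fun β hβ => ⟨?_, ?_⟩, ?_, ?_, ?_⟩
  · have n0 := cx_sub_cst_ne_zero β
    refine biquartic_double_left (biquartic_dual_eq_zero
      (isCoord_cx_cy.swap.sub_cst β).swap fun e => ?_)
    rw [sub_add_cancel, cst_zero, add_zero]
    rcases sq_eq_sq_iff_eq_or_eq_neg.mp hβ with rfl | rfl
    · refine mem_of_mem_sections (P := Pt.exc 0 e) ht h (hval _ _ (by decide)) ?_
      simp [Pt.xval, Pt.yval, Pt.pole, Pt.excE, cenX, cenY, centre, hkyParam]
    · refine mem_of_mem_sections (P := Pt.exc 1 e) ht h (hval _ _ (by decide)) ?_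
      simp [Pt.xval, Pt.yval, Pt.pole, Pt.excE, cenX, cenY, centre, hkyParam]
  · refine biquartic_double_right (biquartic_dual_eq_zero (isCoord_cx_cy.sub_cst β) fun e => ?_)
    rw [sub_add_cancel, cst_zero, add_zero]
    rcases sq_eq_sq_iff_eq_or_eq_neg.mp hβ with rfl | rfl
    · refine mem_of_mem_sections (P := Pt.exc 2 e) ht h (hval _ _ (by decide)) ?_
      simp [Pt.xval, Pt.yval, Pt.pole, Pt.excE, cenX, cenY, centre]
    · refine mem_of_mem_sections (P := Pt.exc 3 e) ht h (hval _ _ (by decide)) ?_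
      simp [Pt.xval, Pt.yval, Pt.pole, Pt.excE, cenX, cenY, centre]
  · have := biquartic_double_left (k := fun i j => k i (4 - j)) (α := 1)
      (biquartic_dual_eq_zero (isCoord_centre (hkyParam t) 4) fun e => by
        have e1 : (centre (hkyParam t) 4).1 + cst 1 = cx := by
          rw [cst_one]
          exact sub_add_cancel _ _
        have e2 : (centre (hkyParam t) 4).2 + cst 0 = cy⁻¹ := by
          rw [cst_zero, add_zero]
          rfl
        rw [e1, e2, ← biquartic_mul_inv_right k y0]
        refine mem_of_mem_sections (P := Pt.exc 4 e) ht h (hval _ _ (by decide)) ?_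
        simp [Pt.xval, Pt.yval, Pt.pole, Pt.excE, cenX, cenY, centre]
        field_simp)
    simpa using this
  · have := biquartic_double_right (k := fun i j => k (4 - i) j) (β := 1)
      (biquartic_dual_eq_zero (isCoord_centre (hkyParam t) 5) fun e => by
        have e1 : (centre (hkyParam t) 5).1 + cst 0 = cx⁻¹ := by
          rw [cst_zero, add_zero]
          rfl
        have e2 : (centre (hkyParam t) 5).2 + cst 1 = cy := by
          rw [cst_one]
          exact sub_add_cancel _ _
        rw [e1, e2, ← biquartic_mul_inv_left k x0]
        refine mem_of_mem_sections (P := Pt.exc 5 e) ht h (hval _ _ (by decide)) ?_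
        simp [Pt.xval, Pt.yval, Pt.pole, Pt.excE, cenX, cenY, centre]
        field_simp)
    simpa using this
  -- At the points over `P₈` the total transforms of `P₇` and `P₈` both have the equation `1/x`.
  -- Hence the reversed polynomial is divisible by `x⁻⁴` there, in particular on the arcs `y⁻¹ = (1
  -- + c x⁻¹) x⁻¹`.
  · have := biquartic_double_near (k := fun i j => k (4 - i) (4 - j)) fun c => by
      have hc := Pt.isCoord (hkyParam t) (Pt.exc 7 c)
      have hm : biquartic k cx cy * cy⁻¹ ^ 4 ∈ (Pt.exc 7 c).ring (hkyParam t) := by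
        refine mem_of_mem_sections (P := Pt.exc 7 c) ht h (hval _ _ (by decide)) ?_
        simp [Pt.xval, Pt.yval, Pt.pole, Pt.excE, cenX, cenY, centre, Fin.prod_univ_eight]
        field_simp
        exact Or.inl trivial
      obtain ⟨κ, hκ⟩ := HasEv.of_mem (s := (PowerSeries.X : PowerSeries ℂ)) (t := 0) (by
        intro q hq
        rw [PowerSeries.isUnit_iff_constantCoeff, isUnit_iff_ne_zero]
        have e : (PowerSeries.constantCoeff (R := ℂ)).comp
            (aeval ![(PowerSeries.X : PowerSeries ℂ), 0]).toRingHom =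
            constantCoeff := by
          apply MvPolynomial.ringHom_ext
          · intro r
            simp
          · intro i
            fin_cases i <;> simp
        have := RingHom.congr_fun e q
        change PowerSeries.constantCoeff (aeval _ q) = _ at this
        rwa [this]) hm
      have hu : HasEv ((Pt.exc 7 c).u (hkyParam t)) ((Pt.exc 7 c).v (hkyParam t))
        (PowerSeries.X : PowerSeries ℂ) 0 cx⁻¹ PowerSeries.X := HasEv.left
      have hr : HasEv ((Pt.exc 7 c).u (hkyParam t)) ((Pt.exc 7 c).v (hkyParam t))
          (PowerSeries.X : PowerSeries ℂ) 0 ((cx / cy - cst (1 : ℂ)⁻¹) / cx⁻¹) _ :=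
        hasEv_of_sub_cst HasEv.right
      have hy := ((HasEv.one.add (hr.mul hu)).mul hu).congr (by
        rw [inv_one, cst_one]
        field_simp
        ring : _ = cy⁻¹) rfl
      have h1 := hu.biquartic hy (fun i j => k (4 - i) (4 - j))
      have h2 := ((hu.pow 4).mul hκ).congr (by
        rw [biquartic_mul_inv_right k y0, mul_comm, biquartic_mul_inv_left _ x0] :
          _ = biquartic (fun i j => k (4 - i) (4 - j)) cx⁻¹ cy⁻¹) rfl
      refine ⟨κ, ?_⟩
      rw [zero_add] at h1
      exact h1.unique hc h2
    simp at this
    obtain ⟨h1, h2, h3, h4, h5⟩ := this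
    exact ⟨h1, by linear_combination h2, h3, h4, by linear_combination h5⟩

end linearSystems

/-! ### Solution of the linear conditions, and the dimensions -/

section linearSystems

variable {t : ℂ} {s : FuncField}

/-- The conditions determine all coefficients except those of `x⁴`, which is the coefficient of `g`,
and of `x²y²`, which belongs to `f`. -/
theorem biquartic_coeff_eq (ht : t ≠ 0) {k : ℕ → ℕ → ℂ}
    (h : biquartic k cx cy ∈ sections (hkyParam t) ((2 : ℤ) • antiK)) :
    biquartic k cx cy = k 4 0 • ofPoly (hkyG t) + k 2 2 • ofPoly hkyF := by
  obtain ⟨h1, ⟨a1, a2, a3⟩, ⟨b1, b2, b3⟩, c1, c2, c3, c4, c5⟩ := biquartic_conditions ht h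
  obtain ⟨⟨p1, p2, p3⟩, q1, q2, q3⟩ := h1 t rfl
  obtain ⟨⟨p1', p2', p3'⟩, q1', q2', q3'⟩ := h1 (-t) (neg_sq t)
  -- Vanishing at `±t` means divisibility by `x² - t²`.
  have axis : ∀ a₀ a₁ a₂ a₃ a₄ : ℂ, a₀ + a₁ * t + a₂ * t ^ 2 + a₃ * t ^ 3 + a₄ * t ^ 4 = 0 →
      a₀ + a₁ * -t + a₂ * (-t) ^ 2 + a₃ * (-t) ^ 3 + a₄ * (-t) ^ 4 = 0 →
      a₁ = - a₃ * t ^ 2 ∧ a₀ = - a₂ * t ^ 2 - a₄ * t ^ 4 := by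
    intro a₀ a₁ a₂ a₃ a₄ h h'
    refine ⟨mul_right_cancel₀ ht ?_, ?_⟩
    · linear_combination (h - h') / 2
    · linear_combination (h + h') / 2
  -- Double zeros at `±t` leave only the multiples of `(x² - t²)²`.
  have double : ∀ a₀ a₁ a₂ a₃ a₄ : ℂ, a₀ + a₁ * t + a₂ * t ^ 2 + a₃ * t ^ 3 + a₄ * t ^ 4 = 0 →
      a₀ + a₁ * -t + a₂ * (-t) ^ 2 + a₃ * (-t) ^ 3 + a₄ * (-t) ^ 4 = 0 →
      a₁ + 2 * a₂ * t + 3 * a₃ * t ^ 2 + 4 * a₄ * t ^ 3 = 0 →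
      a₁ + 2 * a₂ * -t + 3 * a₃ * (-t) ^ 2 + 4 * a₄ * (-t) ^ 3 = 0 →
      a₀ = t ^ 4 * a₄ ∧ a₁ = 0 ∧ a₂ = -2 * t ^ 2 * a₄ ∧ a₃ = 0 := by
    intro a₀ a₁ a₂ a₃ a₄ h h' d d'
    obtain ⟨e1, e0⟩ := axis _ _ _ _ _ h h'
    have e3 : a₃ = 0 := by
      have : t ^ 2 * a₃ = 0 := by linear_combination (d + d') / 4 - e1 / 2
      exact (mul_eq_zero.mp this).resolve_left (pow_ne_zero 2 ht)
    have e2 : a₂ = -2 * t ^ 2 * a₄ := mul_right_cancel₀ ht (by linear_combination (d - d') / 4)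
    refine ⟨?_, ?_, e2, e3⟩
    · linear_combination e0 - t ^ 2 * e2
    · rw [e1, e3]
      ring
  obtain ⟨k00, k10, k20, k30⟩ := double _ _ _ _ _ p1 p1' p2 p2'
  obtain ⟨k00', k01, k02, k03⟩ := double _ _ _ _ _ q1 q1' q2 q2'
  obtain ⟨k11, e01⟩ := axis _ _ _ _ _ p3 p3'
  obtain ⟨k11', e10⟩ := axis _ _ _ _ _ q3 q3'
  have t2 : t ^ 2 ≠ 0 := pow_ne_zero 2 ht
  have k04 : k 0 4 = k 4 0 := mul_left_cancel₀ (pow_ne_zero 4 ht) (by rw [← k00, ← k00'])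
  have k34 : k 3 4 = 0 := by linear_combination c2 - c3
  have k24 : k 2 4 = k 4 0 := by linear_combination a2 - a1 - 2 * k34 - 3 * c1 + k04
  have k14 : k 1 4 = -2 * k 4 0 := by linear_combination a2 - 2 * k24 - 3 * k34 - 4 * c1
  have k42 : k 4 2 = k 4 0 := by linear_combination b2 - b1 - 2 * c3 - 3 * c1
  have k41 : k 4 1 = -2 * k 4 0 := by linear_combination b2 - 2 * k42 - 3 * c3 - 4 * c1
  have k33 : k 3 3 = -2 * k 4 0 := by linear_combination c4 - k24 - k42
  have k21 : k 2 1 = 2 * t ^ 2 * k 4 0 :=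
    mul_right_cancel₀ t2 (by linear_combination e01 - k01 - t ^ 4 * k41)
  have k12 : k 1 2 = 2 * t ^ 2 * k 4 0 :=
    mul_right_cancel₀ t2 (by linear_combination e10 - k10 - t ^ 4 * k14)
  have k31 : k 3 1 = k 1 3 := mul_right_cancel₀ t2 (by linear_combination k11 - k11')
  -- The last condition at `P₈` closes the system: combined with those at `P₅` and `P₆` it gives `2
  -- k₁₃ = 0`.
  have k13 : k 1 3 = 0 := by
    linear_combination (a3 + b3 - c5 - k03 - k30 - 2 * k33 - c3 - k34 + k14 + k41 - k31) / 2
  have k23 : k 2 3 = 2 * k 4 0 := by linear_combination a3 - k03 - k13 - k33 - c3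
  have k32 : k 3 2 = 2 * k 4 0 := by linear_combination b3 - k30 - k31 - k13 - k33 - k34
  have k11z : k 1 1 = 0 := by rw [k11', k13]; ring
  have hs : ∀ (c : ℂ) (r : FuncField), c • r = cst c * r := fun c r => Algebra.smul_def c r
  have ha : ∀ c : ℂ, algebraMap ℂ FuncField c = cst c := fun c => rfl
  have e2 : cst 2 = 2 := map_ofNat _ 2
  rw [hs, hs, ofPoly_hkyF, ofPoly_hkyG]
  simp only [biquartic, Finset.sum_range_succ, Finset.range_zero, Finset.sum_empty, ha]
  rw [k00, k10, k20, k30, k01, k02, k03, k11z, k04, k34, k24, k14, k42, k41, k33, k21, k12, k31,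
    k13, k23, k32, c1, c3]
  simp only [cst_mul, cst_pow, cst_neg, cst_zero, e2]
  ring

theorem hasVal_hkyG_zero (t : ℂ) : HasVal cx cy (ofPoly (hkyG t)) (t ^ 4) := by
  have e : ∀ p : MvPolynomial (Fin 2) ℂ, ofPoly p = aeval ![cx, cy] p := fun p =>
    DFunLike.congr_fun (MvPolynomial.algHom_ext (f := Algebra.algHom ℂ _ FuncField)
      (g := aeval ![cx, cy]) (by
        intro i
        fin_cases i
        · simp [cx, ofPoly]
          rfl
        · simp [cy, ofPoly]
          rfl)) p
  rw [e]
  refine (HasEv.aeval (hkyG t)).congr rfl ?_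
  simp [hkyG]

theorem sections_two_antiK (ht : t ≠ 0) : sections (hkyParam t) ((2 : ℤ) • antiK) =
    Submodule.span ℂ {ofPoly hkyF, ofPoly (hkyG t)} := by
  apply le_antisymm
  · intro s hs
    obtain ⟨k, rfl⟩ := exists_eq_biquartic ht hs
    rw [Submodule.mem_span_pair]
    exact ⟨k 2 2, k 4 0, by rw [biquartic_coeff_eq ht hs, add_comm]⟩
  · rw [Submodule.span_le]
    rintro s (rfl | rfl)
    · exact hkyF_mem_sections (admissible_hkyParam ht)
    · exact hkyG_mem_sections ht

/-- At the origin `f` and `xy` vanish, while `g` has the value `t⁴ ≠ 0`. -/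
theorem eq_zero_of_combination (ht : t ≠ 0) {δ γ : ℂ} {r : FuncField} (hr : r ∈ localRing cx cy)
    (h : δ • ofPoly hkyF + γ • ofPoly (hkyG t) = r * (cx * cy)) : γ = 0 := by
  obtain ⟨κ, hκ⟩ := (mem_localRing_iff isCoord_cx_cy).mp hr
  have hx : HasVal cx cy cx 0 := HasEv.left
  have hy : HasVal cx cy cy 0 := HasEv.right
  have h1 := ((HasVal.cst δ).mul ((hx.pow 2).mul (hy.pow 2))).add
    ((HasVal.cst γ).mul (hasVal_hkyG_zero t))
  have h2 := (hκ.mul (HasEv.mul hx hy)).congr h.symm rfl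
  rw [ofPoly_hkyF, Algebra.smul_def, Algebra.smul_def] at h2
  have h3 := h1.unique isCoord_cx_cy h2
  simp at h3
  exact h3.resolve_right ht

/-- The product of a section of `-K` with `xy` is a combination of `f = (xy)²` and `g`. It vanishes
at the origin, so `g` does not occur, and cancelling `xy` leaves a multiple of `xy`. -/
theorem sections_antiK (ht : t ≠ 0) :
    sections (hkyParam t) antiK = Submodule.span ℂ {cx * cy} := by
  have ha := admissible_hkyParam ht
  apply le_antisymm
  · intro s hs
    have h1 := mul_mul_mem_sections ha hs
    rw [sections_two_antiK ht, Submodule.mem_span_pair] at h1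
    obtain ⟨δ, γ, h1⟩ := h1
    have hr : s ∈ localRing cx cy := by
      have hP : (Pt.base (some 0) (some 0)).Valid (hkyParam t) :=
        Pt.valid_some_some.mpr ⟨fun _ => ⟨ht.symm, (neg_ne_zero.mpr ht).symm⟩,
          fun _ => ⟨ht.symm, (neg_ne_zero.mpr ht).symm⟩⟩
      have := (mem_sections_iff ha _).mp hs _ hP
      rw [localEq_antiK ha hP] at this
      simpa [Pt.xval, Pt.yval, Pt.pole, Pt.excE, Pt.ring, Pt.u, Pt.v] using this
    have h0 := eq_zero_of_combination ht hr h1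
    rw [h0, zero_smul, add_zero, ofPoly_hkyF] at h1
    rw [Submodule.mem_span_singleton]
    refine ⟨δ, mul_right_cancel₀ (mul_ne_zero cx_ne_zero cy_ne_zero) ?_⟩
    rw [← h1, smul_mul_assoc]
    congr 1
    ring
  · rw [Submodule.span_singleton_le_iff_mem]
    exact mul_mem_sections ha

theorem dimLinSys_antiK (ht : t ≠ 0) : dimLinSys (hkyParam t) antiK = 0 := by
  rw [dimLinSys, sections_antiK ht, finrank_span_singleton (mul_ne_zero cx_ne_zero cy_ne_zero)]
  rfl

theorem dimLinSys_two_antiK (ht : t ≠ 0) :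
    dimLinSys (hkyParam t) ((2 : ℤ) • antiK) = 1 := by
  have hf : ofPoly hkyF ≠ 0 := by
    rw [ofPoly_hkyF]
    exact mul_ne_zero (pow_ne_zero 2 cx_ne_zero) (pow_ne_zero 2 cy_ne_zero)
  have hli : LinearIndependent ℂ ![ofPoly hkyF, ofPoly (hkyG t)] := by
    rw [LinearIndependent.pair_iff]
    intro δ γ h
    have h0 := eq_zero_of_combination ht (zero_mem (localRing cx cy)) (h.trans (zero_mul _).symm)
    rw [h0, zero_smul, add_zero] at h
    exact ⟨(smul_eq_zero.mp h).resolve_right hf, h0⟩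
  have h2 := finrank_span_eq_card hli
  rw [Matrix.range_cons, Matrix.range_cons, Matrix.range_empty, Set.union_empty,
    Set.singleton_union, Fintype.card_fin] at h2
  rw [dimLinSys, sections_two_antiK ht, h2]
  rfl

theorem isHalphen_hkyParam (ht : t ≠ 0) : IsHalphen (hkyParam t) 2 := by
  refine ⟨fun k h1 h2 => ?_, dimLinSys_two_antiK ht⟩
  obtain rfl : k = 1 := by omega
  rw [Nat.cast_one, one_smul]
  exact dimLinSys_antiK ht

end linearSystems

/-! ### Irreducibility of the fibres -/

section irreducible

open Polynomial.Bivariate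

variable {t c : ℂ}

/-- The polynomial under the root in `x² + √R = (x - 1) y + (x² - t²) / y`. -/
def radR (t c : ℂ) : Polynomial ℂ :=
  Polynomial.C (c - 2) * Polynomial.X ^ 2 - Polynomial.C (4 * t ^ 2) * Polynomial.X +
    Polynomial.C (4 * t ^ 2)

/-- The discriminant that decides on a factorization into two quadratic factors. -/
def radD (t c : ℂ) : Polynomial ℂ :=
  (Polynomial.X ^ 2 - Polynomial.C 4 * Polynomial.X + Polynomial.C (c + 2)) ^ 2 -
    Polynomial.C 4 * radR t c

theorem eval_radR (x : ℂ) : (radR t c).eval x = (c - 2) * x ^ 2 - 4 * t ^ 2 * x + 4 * t ^ 2 := by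
  simp [radR]

theorem eval_radD (x : ℂ) : (radD t c).eval x = (x ^ 2 - 4 * x + (c + 2)) ^ 2 -
    4 * ((c - 2) * x ^ 2 - 4 * t ^ 2 * x + 4 * t ^ 2) := by
  simp [radD, eval_radR]

theorem natDegree_le_of_sq {p r : Polynomial ℂ} {n : ℕ} (h : p.natDegree ≤ 2 * n)
    (hr : p = r ^ 2) : r.natDegree ≤ n := by
  rw [hr, Polynomial.natDegree_pow] at h
  omega

/-- A quadratic polynomial is a square only if its discriminant vanishes, and up to a nonzero factor
the discriminant is `c - 2 - t²`. The coefficients are extracted from the values at `0, 1, -1`. -/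
theorem radR_ne_sq (ht : t ≠ 0) (hc : c ≠ 2 + t ^ 2) (r : Polynomial ℂ) : radR t c ≠ r ^ 2 := by
  intro h
  have hd : r.natDegree ≤ 1 := natDegree_le_of_sq (by rw [radR]; compute_degree) h
  obtain ⟨a, b, rfl⟩ := Polynomial.exists_eq_X_add_C_of_natDegree_le_one hd
  have key : ∀ x : ℂ, (c - 2) * x ^ 2 - 4 * t ^ 2 * x + 4 * t ^ 2 = (a * x + b) ^ 2 := fun x => by
    rw [← eval_radR, h]
    simp
  have h0 := key 0
  have h1 := key 1
  have h2 := key (-1)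
  have e0 : b ^ 2 = 4 * t ^ 2 := by linear_combination -h0
  have e1 : 2 * a * b = -4 * t ^ 2 := by linear_combination (h2 - h1) / 2
  have e2 : a ^ 2 = c - 2 := by linear_combination h0 - (h1 + h2) / 2
  have : t ^ 2 * (c - (2 + t ^ 2)) = 0 := by
    linear_combination (-a ^ 2 * e0 - 4 * t ^ 2 * e2) / 4 + (2 * a * b - 4 * t ^ 2) * e1 / 16
  rcases mul_eq_zero.mp this with h | h
  · exact pow_ne_zero 2 ht h
  · exact hc (sub_eq_zero.mp h)

/-- Comparing coefficients with `(ax² + bx + d)²` gives `a² = 1` and `b = -4a`; the coefficients of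
`x²` and `x` are then compatible only for `c = 2 + t²`. -/
theorem radD_ne_sq (hc : c ≠ 2 + t ^ 2) (r : Polynomial ℂ) : radD t c ≠ r ^ 2 := by
  intro h
  have hd : r.natDegree ≤ 2 := natDegree_le_of_sq (by rw [radD, radR]; compute_degree) h
  have key : ∀ x : ℂ, (x ^ 2 - 4 * x + (c + 2)) ^ 2 -
      4 * ((c - 2) * x ^ 2 - 4 * t ^ 2 * x + 4 * t ^ 2) =
        (r.coeff 2 * x ^ 2 + r.coeff 1 * x + r.coeff 0) ^ 2 := fun x => by
    rw [← eval_radD, h, Polynomial.eval_pow, Polynomial.eval_eq_sum_range' (n := 3) (by omega)]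
    simp [Finset.sum_range_succ]
    ring
  have h0 := key 0
  have h1 := key 1
  have h2 := key (-1)
  have h3 := key 2
  have h4 := key (-2)
  generalize r.coeff 2 = a at *
  generalize r.coeff 1 = b at *
  generalize r.coeff 0 = d at *
  have e4 : a ^ 2 = 1 := by linear_combination -(h3 - 4 * h1 + 6 * h0 - 4 * h2 + h4) / 24
  have e3 : 2 * a * b = -8 := by linear_combination -(h3 - 2 * h1 + 2 * h2 - h4) / 12
  have e2 : b ^ 2 + 2 * a * d = 28 - 2 * c := by
    linear_combination -(-h3 + 16 * h1 - 30 * h0 + 16 * h2 - h4) / 24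
  have e1 : 2 * b * d = 16 * t ^ 2 - 8 * c - 16 := by
    linear_combination -(8 * (h1 - h2) - (h3 - h4)) / 12
  have eb : b = -4 * a := by linear_combination a * e3 / 2 - b * e4
  rw [eb] at e1 e2
  apply hc
  linear_combination e1 / 16 + e2 / 4 - 4 * e4

/-- `ℂ[x]` is integrally closed, so a square root in its fraction field is a polynomial. -/
theorem exists_sq_of_sq {L : Type*} [Field L] [Algebra (Polynomial ℂ) L]
    [IsFractionRing (Polynomial ℂ) L] {p : Polynomial ℂ} {z : L}
    (h : z ^ 2 = algebraMap (Polynomial ℂ) L p) : ∃ r, p = r ^ 2 := by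
  obtain ⟨r, hr⟩ := IsIntegrallyClosed.exists_algebraMap_eq_of_isIntegral_pow (R := Polynomial ℂ)
    (x := z) two_pos (h ▸ isIntegral_algebraMap)
  refine ⟨r, IsFractionRing.injective (Polynomial ℂ) L ?_⟩
  rw [← h, ← hr, map_pow]

/-- The factorizations of a quartic `(y² + s)² - 2 m y (y² + s) + n y²` into quadratic factors. -/
theorem exists_sq_of_factor {L : Type*} [Field L] {m s n a b a' b' : L} (h1 : a + a' = -2 * m)
    (h2 : b + b' + a * a' = 2 * s + n) (h3 : a * b' + a' * b = -2 * m * s) (h4 : b * b' = s ^ 2)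
    (hs : s ≠ 0) (hm : 2 * m ≠ 0) :
    (∃ z, z ^ 2 = m ^ 2 - n) ∨ ∃ z, z ^ 2 = (4 * s + n) ^ 2 - 16 * m ^ 2 * s := by
  have b0 : b ≠ 0 := by
    rintro rfl
    exact pow_ne_zero 2 hs (by rw [← h4, zero_mul])
  -- The quartic is invariant under `y ↦ s/y`. If `b = s`, the factors are invariant themselves and
  -- `y + s/y` satisfies a quadratic equation that splits. Otherwise the involution interchanges the
  -- two factors, which is the relation `a'b = as`.
  by_cases hbs : b = s
  · subst hbs
    have hb' : b' = b := mul_left_cancel₀ b0 (by rw [h4, pow_two])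
    exact Or.inl ⟨m + a, by linear_combination (a) * h1 - h2 + hb'⟩
  · have h5 : a' * b = a * s := by
      have : (b - s) * (a' * b - a * s) = 0 := by
        linear_combination b * h3 - a * h4 - s * b * h1
      rcases mul_eq_zero.mp this with h | h
      · exact absurd (sub_eq_zero.mp h) hbs
      · exact sub_eq_zero.mp h
    have h6 : a * (b + s) = -2 * m * b := by linear_combination b * h1 - h5
    have hbs' : b + s ≠ 0 := by
      intro h
      rw [h, mul_zero] at h6
      exact mul_ne_zero hm b0 (by linear_combination h6)
    have h7 : a' * (b + s) = -2 * m * s := by linear_combination (b + s) * h1 - h6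
    have h8 : (b + s) ^ 4 - (4 * s + n) * b * (b + s) ^ 2 + 4 * m ^ 2 * s * b ^ 2 = 0 := by
      linear_combination b * (b + s) ^ 2 * h2 - (b + s) ^ 2 * h4 - b * (b + s) * a' * h6 +
        2 * m * b ^ 2 * h7
    -- Divided by `b²`, `h8` is a quadratic equation for `(b + s)²/b`, so its discriminant is a
    -- square.
    refine Or.inr ⟨2 * ((b + s) ^ 2 / b) - (4 * s + n), ?_⟩
    field_simp
    linear_combination 4 * h8

/-- The curve `g = c f` as a polynomial in `y` over `ℂ[x]`. -/
def fibP (t c : ℂ) : Polynomial (Polynomial ℂ) :=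
  .C ((Polynomial.X - 1) ^ 2) * .X ^ 4 - .C (2 * .X ^ 2 * (Polynomial.X - 1)) * .X ^ 3 +
    .C (.X ^ 4 + 2 * .X ^ 3 - .C c * .X ^ 2 + 2 * .C (t ^ 2) * .X - 2 * .C (t ^ 2)) * .X ^ 2 -
    .C (2 * .X ^ 2 * (.X ^ 2 - .C (t ^ 2))) * .X + .C ((.X ^ 2 - .C (t ^ 2)) ^ 2)

theorem equivMvPolynomial_fibP : equivMvPolynomial ℂ (fibP t c) = hkyG t - C c * hkyF := by
  have e : ∀ p : Polynomial ℂ, equivMvPolynomial ℂ (Polynomial.C p) = Polynomial.aeval (X 0) p := by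
    intro p
    have := aeval_equivMvPolynomial (X 0 : MvPolynomial (Fin 2) ℂ) (X 1) (Polynomial.C p)
    rw [Polynomial.aevalAeval_C] at this
    rw [← this]
    have e2 : (![X 0, X 1] : Fin 2 → MvPolynomial (Fin 2) ℂ) = X := by
      ext i
      fin_cases i <;> rfl
    rw [e2, aeval_X_left_apply]
  have h2 : Polynomial.aeval (X 0 : MvPolynomial (Fin 2) ℂ) (2 : Polynomial ℂ) = 2 := map_ofNat _ 2
  simp only [fibP, map_add, map_sub, map_mul, map_pow, e, equivMvPolynomial_X, Polynomial.aeval_X,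
    Polynomial.aeval_C, h2, map_one, hkyG, hkyF, algebraMap_eq]
  ring

theorem natDegree_fibP : (fibP t c).natDegree = 4 := by
  have h1 : (Polynomial.X - 1 : Polynomial ℂ) ≠ 0 := by
    simpa using Polynomial.X_sub_C_ne_zero (1 : ℂ)
  rw [fibP]
  compute_degree!

theorem coeff_quartic {R : Type*} [CommRing R] (p₀ p₁ p₂ p₃ p₄ : R) :
    let P : Polynomial R := .C p₄ * .X ^ 4 - .C p₃ * .X ^ 3 + .C p₂ * .X ^ 2 - .C p₁ * .X + .C p₀
    P.coeff 0 = p₀ ∧ P.coeff 1 = -p₁ ∧ P.coeff 2 = p₂ ∧ P.coeff 3 = -p₃ ∧ P.coeff 4 = p₄ := by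
  simp [Polynomial.coeff_X, Polynomial.coeff_C]

theorem coeff_fibP (t c : ℂ) :
    (fibP t c).coeff 0 = (.X ^ 2 - .C (t ^ 2)) ^ 2 ∧
    (fibP t c).coeff 1 = -(2 * .X ^ 2 * (.X ^ 2 - .C (t ^ 2))) ∧
    (fibP t c).coeff 2 =
      .X ^ 4 + 2 * .X ^ 3 - .C c * .X ^ 2 + 2 * .C (t ^ 2) * .X - 2 * .C (t ^ 2) ∧
    (fibP t c).coeff 3 = -(2 * .X ^ 2 * (Polynomial.X - 1)) ∧
    (fibP t c).coeff 4 = (Polynomial.X - 1) ^ 2 :=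
  coeff_quartic _ _ _ _ _

/-- The leading coefficient is `(x - 1)²`, and the coefficient of `y²` has the value `3 - c` at `x =
1`. -/
theorem isPrimitive_fibP (hc : c ≠ 3) : (fibP t c).IsPrimitive := by
  intro r hr
  rw [Polynomial.C_dvd_iff_dvd_coeff] at hr
  obtain ⟨-, -, e2, -, e4⟩ := coeff_fibP t c
  have h4 := hr 4
  have h2 := hr 2
  rw [e4] at h4
  rw [e2] at h2
  have hcop : IsCoprime ((Polynomial.X - 1 : Polynomial ℂ) ^ 2)
      (.X ^ 4 + 2 * .X ^ 3 - .C c * .X ^ 2 + 2 * .C (t ^ 2) * .X - 2 * .C (t ^ 2)) := by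
    apply IsCoprime.pow_left
    have : (Polynomial.X - 1 : Polynomial ℂ) = Polynomial.X - Polynomial.C 1 := by simp
    rw [this, (Polynomial.irreducible_X_sub_C (1 : ℂ)).coprime_iff_not_dvd,
      Polynomial.dvd_iff_isRoot, Polynomial.IsRoot]
    simp
    contrapose! hc
    linear_combination -hc
  exact hcop.isUnit_of_dvd' h4 h2

theorem sq_sub_ne_zero (t : ℂ) : (Polynomial.X ^ 2 - Polynomial.C (t ^ 2) : Polynomial ℂ) ≠ 0 :=
  Polynomial.X_pow_sub_C_ne_zero two_pos _

theorem X_sub_one_ne_zero : (Polynomial.X - 1 : Polynomial ℂ) ≠ 0 := by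
  simpa using Polynomial.X_sub_C_ne_zero (1 : ℂ)

/-- The curve has no component that is the graph of a rational function. -/
theorem natDegree_ne_one_of_mul (L : Type*) [Field L] [Algebra (Polynomial ℂ) L]
    [IsFractionRing (Polynomial ℂ) L] (ht : t ≠ 0) (hc : c ≠ 2 + t ^ 2) {f g : Polynomial (Polynomial ℂ)}
    (h : fibP t c = f * g) : f.natDegree ≠ 1 := by
  intro hf
  let i : Polynomial ℂ →+* L := algebraMap _ _
  have hi : Function.Injective i := IsFractionRing.injective (Polynomial ℂ) L
  obtain ⟨a, ha, b, rfl⟩ := Polynomial.natDegree_eq_one.mp hf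
  have ha' : i a ≠ 0 := (map_ne_zero_iff i hi).mpr ha
  obtain ⟨y, hy⟩ : ∃ y : L, i a * y + i b = 0 := ⟨-(i b) / i a, by
    field_simp
    ring⟩
  have hy2 := congrArg (Polynomial.eval₂ i y) h
  rw [Polynomial.eval₂_mul] at hy2
  simp only [fibP, Polynomial.eval₂_add, Polynomial.eval₂_sub, Polynomial.eval₂_mul,
    Polynomial.eval₂_pow, Polynomial.eval₂_C, Polynomial.eval₂_X, hy, zero_mul] at hy2
  have hR : i (radR t c) = i (.C (c - 2)) * i .X ^ 2 - i (.C (4 * t ^ 2)) * i .X +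
      i (.C (4 * t ^ 2)) := by simp [radR]
  have e2 : i 2 = 2 := map_ofNat _ 2
  have e4 : i (.C 4) = 4 := map_ofNat (i.comp Polynomial.C) 4
  have ec : i (.C (c - 2)) = i (.C c) - 2 := by
    rw [map_sub, map_sub]
    exact congrArg _ (map_ofNat (i.comp Polynomial.C) 2)
  rw [ec, Polynomial.C_mul, map_mul, e4] at hR
  have hU : i (.X ^ 2 - .C (t ^ 2)) ≠ 0 := (map_ne_zero_iff i hi).mpr (sq_sub_ne_zero t)
  simp only [map_sub, map_mul, map_pow, map_add, e2, map_one] at hy2 hU hR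
  have y0 : y ≠ 0 := by
    rintro rfl
    refine pow_ne_zero 2 hU ?_
    linear_combination hy2
  -- A rational root `y` makes `(x - 1)y + (x² - t²)/y - x²` a rational square root of `R`.
  obtain ⟨r, hr⟩ := exists_sq_of_sq (L := L) (p := radR t c)
      (z := ((i .X - 1) * y ^ 2 + (i .X ^ 2 - i (.C t) ^ 2)) / y - i .X ^ 2) (by
    change _ = i _
    rw [hR]
    field_simp
    linear_combination hy2)
  exact radR_ne_sq ht hc r hr

/-- Divided by `(x - 1)²`, the quartic has the form of `exists_sq_of_factor` with `m = x²/(x - 1)`,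
`s = (x² - t²)/(x - 1)` and `n = (x⁴ - R)/(x - 1)²`. The two discriminants are `R/(x - 1)²` and
`x⁴D/(x - 1)⁴`, so `R` or `D` would be a square. -/
theorem natDegree_ne_two_of_mul (L : Type*) [Field L] [Algebra (Polynomial ℂ) L]
    [IsFractionRing (Polynomial ℂ) L] (ht : t ≠ 0) (hc : c ≠ 2 + t ^ 2) {f g : Polynomial (Polynomial ℂ)}
    (h : fibP t c = f * g) : ¬ (f.natDegree = 2 ∧ g.natDegree = 2) := by
  rintro ⟨hf, hg⟩
  let i : Polynomial ℂ →+* L := algebraMap _ _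
  have hi : Function.Injective i := IsFractionRing.injective (Polynomial ℂ) L
  have ef : f = .C (f.coeff 2) * .X ^ 2 + .C (f.coeff 1) * .X + .C (f.coeff 0) := by
    conv_lhs => rw [f.as_sum_range_C_mul_X_pow, hf]
    simp [Finset.sum_range_succ]
    ring
  have eg : g = .C (g.coeff 2) * .X ^ 2 + .C (g.coeff 1) * .X + .C (g.coeff 0) := by
    conv_lhs => rw [g.as_sum_range_C_mul_X_pow, hg]
    simp [Finset.sum_range_succ]
    ring
  have efg : f * g = .C (f.coeff 2 * g.coeff 2) * .X ^ 4 -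
      .C (-(f.coeff 2 * g.coeff 1 + f.coeff 1 * g.coeff 2)) * .X ^ 3 +
      .C (f.coeff 2 * g.coeff 0 + f.coeff 1 * g.coeff 1 + f.coeff 0 * g.coeff 2) * .X ^ 2 -
      .C (-(f.coeff 1 * g.coeff 0 + f.coeff 0 * g.coeff 1)) * .X +
      .C (f.coeff 0 * g.coeff 0) := by
    conv_lhs => rw [ef, eg]
    simp only [map_add, map_mul, map_neg]
    ring
  obtain ⟨k0, k1, k2, k3, k4⟩ := coeff_fibP t c
  obtain ⟨l0, l1, l2, l3, l4⟩ := coeff_quartic (f.coeff 0 * g.coeff 0)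
    (-(f.coeff 1 * g.coeff 0 + f.coeff 0 * g.coeff 1))
    (f.coeff 2 * g.coeff 0 + f.coeff 1 * g.coeff 1 + f.coeff 0 * g.coeff 2)
    (-(f.coeff 2 * g.coeff 1 + f.coeff 1 * g.coeff 2)) (f.coeff 2 * g.coeff 2)
  rw [← efg, ← h] at l0 l1 l2 l3 l4
  have m0 := congrArg i (k0.symm.trans l0)
  have m1 := congrArg i (k1.symm.trans l1)
  have m2 := congrArg i (k2.symm.trans l2)
  have m3 := congrArg i (k3.symm.trans l3)
  have m4 := congrArg i (k4.symm.trans l4)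
  have e2 : i 2 = 2 := map_ofNat _ 2
  have e4 : i (.C 4) = 4 := map_ofNat (i.comp Polynomial.C) 4
  have e2' : i (.C 2) = 2 := map_ofNat (i.comp Polynomial.C) 2
  have hU : i (.X ^ 2 - .C (t ^ 2)) ≠ 0 := (map_ne_zero_iff i hi).mpr (sq_sub_ne_zero t)
  have hx1 : i (.X - 1) ≠ 0 := (map_ne_zero_iff i hi).mpr X_sub_one_ne_zero
  have hx : i .X ≠ 0 := (map_ne_zero_iff i hi).mpr Polynomial.X_ne_zero
  have hf2 : i (f.coeff 2) ≠ 0 := by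
    intro h0
    rw [map_mul, h0, zero_mul, map_pow] at m4
    exact pow_ne_zero 2 hx1 m4
  have hg2 : i (g.coeff 2) ≠ 0 := by
    intro h0
    rw [map_mul i (f.coeff 2), h0, mul_zero, map_pow] at m4
    exact pow_ne_zero 2 hx1 m4
  simp only [map_sub, map_mul, map_pow, map_add, map_neg, e2, map_one, neg_neg] at m0 m1 m2 m3 m4 hU hx1
  generalize i (f.coeff 2) = a₂ at *
  generalize i (f.coeff 1) = a₁ at *
  generalize i (f.coeff 0) = a₀ at *
  generalize i (g.coeff 2) = b₂ at *
  generalize i (g.coeff 1) = b₁ at *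
  generalize i (g.coeff 0) = b₀ at *
  have hR : i (radR t c) = (i (.C c) - 2) * i .X ^ 2 - 4 * i (.C t) ^ 2 * i .X +
      4 * i (.C t) ^ 2 := by
    simp only [radR, map_sub, map_mul, map_pow, map_add, e4, e2']
  have hD : i (radD t c) = (i .X ^ 2 - 4 * i .X + (i (.C c) + 2)) ^ 2 - 4 * i (radR t c) := by
    simp only [radD, map_sub, map_mul, map_pow, map_add, e4, e2']
  have h2 : (2 : L) ≠ 0 := e2 ▸ (map_ne_zero_iff i hi).mpr two_ne_zero
  have key := exists_sq_of_factor (L := L) (a := a₁ / a₂) (a' := b₁ / b₂) (b := a₀ / a₂)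
    (b' := b₀ / b₂) (m := i .X ^ 2 / (i .X - 1)) (s := (i .X ^ 2 - i (.C t) ^ 2) / (i .X - 1))
    (n := i .X ^ 4 / (i .X - 1) ^ 2 - i (radR t c) / (i .X - 1) ^ 2) (by
      field_simp
      linear_combination -(i .X - 1) * m3 - 2 * i .X ^ 2 * m4) (by
      rw [hR]
      field_simp
      linear_combination -(i .X - 1) ^ 2 * m2 + (i .X ^ 4 + 2 * i .X ^ 3 - i (.C c) * i .X ^ 2 +
        2 * i (.C t) ^ 2 * i .X - 2 * i (.C t) ^ 2) * m4) (by
      field_simp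
      linear_combination -(i .X - 1) ^ 2 * m1 - 2 * i .X ^ 2 * (i .X ^ 2 - i (.C t) ^ 2) * m4) (by
      field_simp
      linear_combination -(i .X - 1) ^ 2 * m0 + (i .X ^ 2 - i (.C t) ^ 2) ^ 2 * m4) (div_ne_zero hU hx1)
      (mul_ne_zero h2 (div_ne_zero (pow_ne_zero 2 hx) hx1))
  rcases key with ⟨z, hz⟩ | ⟨z, hz⟩
  · obtain ⟨r, hr⟩ := exists_sq_of_sq (L := L) (p := radR t c) (z := z * (i .X - 1)) (by
      change _ = i _
      rw [mul_pow, hz]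
      field_simp
      ring)
    exact radR_ne_sq ht hc r hr
  · obtain ⟨r, hr⟩ := exists_sq_of_sq (L := L) (p := radD t c)
      (z := z * (i .X - 1) ^ 2 / i .X ^ 2) (by
      change _ = i _
      rw [div_pow, mul_pow, hz, hD, hR]
      field_simp
      ring)
    exact radD_ne_sq hc r hr

/-- The general fibre is irreducible. -/
theorem irreducible_fibre (ht : t ≠ 0) (hc : c ≠ 2 + t ^ 2) (hc3 : c ≠ 3) :
    Irreducible (fibP t c) := by
  have hdeg := natDegree_fibP (t := t) (c := c)
  have h0 : fibP t c ≠ 0 := by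
    intro h
    rw [h] at hdeg
    simp at hdeg
  refine ⟨fun hu => ?_, fun f g h => ?_⟩
  · rw [Polynomial.natDegree_eq_zero_of_isUnit hu] at hdeg
    omega
  · have hf0 : f ≠ 0 := by
      rintro rfl
      exact h0 (by rw [h, zero_mul])
    have hg0 : g ≠ 0 := by
      rintro rfl
      exact h0 (by rw [h, mul_zero])
    have hsum : f.natDegree + g.natDegree = 4 := by
      rw [← Polynomial.natDegree_mul hf0 hg0, ← h, hdeg]
    have hunit : ∀ p : Polynomial (Polynomial ℂ), p ∣ fibP t c → p.natDegree = 0 → IsUnit p := by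
      intro p hp hp0
      obtain ⟨r, rfl⟩ := Polynomial.natDegree_eq_zero.mp hp0
      exact (isPrimitive_fibP hc3 r hp).map Polynomial.C
    have n1 := natDegree_ne_one_of_mul (FractionRing (Polynomial ℂ)) ht hc h
    have n1' := natDegree_ne_one_of_mul (FractionRing (Polynomial ℂ)) ht hc (h.trans (mul_comm f g))
    have n2 := natDegree_ne_two_of_mul (FractionRing (Polynomial ℂ)) ht hc h
    by_cases hf : f.natDegree = 0
    · exact Or.inl (hunit f ⟨g, h⟩ hf)
    · exact Or.inr (hunit g ⟨f, h.trans (mul_comm f g)⟩ (by omega))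

end irreducible

/-! ### The quartic of the fibres -/

section quartic

variable {t c e : ℂ}

theorem exists_four_roots {Q : Polynomial ℂ} (hm : Q.Monic) (hd : Q.natDegree = 4)
    (h : ∀ p, Q.eval p = 0 → Q.derivative.eval p ≠ 0) :
    ∃ r r₁ r₂ r₃ : ℂ, [r, r₁, r₂, r₃].Nodup ∧ Q = (.X - .C r) * ((.X - .C r₁) *
      ((.X - .C r₂) * (.X - .C r₃))) := by
  have hs := IsAlgClosed.splits Q
  have hcard := hs.natDegree_eq_card_roots
  have hprod := hs.eq_prod_roots_of_monic hm
  have hnd : Q.roots.Nodup := by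
    rw [Multiset.nodup_iff_count_le_one]
    intro p
    rw [Polynomial.count_roots]
    by_contra! hlt
    obtain ⟨h1, h2⟩ := (Polynomial.one_lt_rootMultiplicity_iff_isRoot hm.ne_zero).mp hlt
    exact h p h1 h2
  obtain ⟨l, hl⟩ := Quot.exists_rep Q.roots
  change (l : Multiset ℂ) = _ at hl
  rw [← hl] at hcard hprod hnd
  rw [hd, Multiset.coe_card] at hcard
  match l, hcard with
  | [r, r₁, r₂, r₃], _ =>
    refine ⟨r, r₁, r₂, r₃, by simpa using hnd, hprod.trans ?_⟩
    simp

/-- With `w = x² + e x + p`, the discriminant of `(x - 1) y² - w y + (x² - t²)` is, up to a square,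
the value at `p` of this polynomial. -/
def quartic (t e : ℂ) : Polynomial ℂ :=
  (.C (4 * t ^ 2) - .X ^ 2) ^ 2 +
    .C (2 * e - 4) * ((.C (4 * t ^ 2) - .X ^ 2) * (.C (2 * e) * .X + .C (4 * t ^ 2))) +
    (.C (e ^ 2 + 4) + .C 2 * .X) * (.C (2 * e) * .X + .C (4 * t ^ 2)) ^ 2

theorem aeval_quartic {K : Type*} [CommRing K] [Algebra ℂ K] (p : K) :
    Polynomial.aeval p (quartic t e) = (4 * algebraMap ℂ K t ^ 2 - p ^ 2) ^ 2 +
      (2 * algebraMap ℂ K e - 4) * ((4 * algebraMap ℂ K t ^ 2 - p ^ 2) *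
        (2 * algebraMap ℂ K e * p + 4 * algebraMap ℂ K t ^ 2)) +
      (algebraMap ℂ K e ^ 2 + 4 + 2 * p) *
        (2 * algebraMap ℂ K e * p + 4 * algebraMap ℂ K t ^ 2) ^ 2 := by
  simp only [quartic, map_add, map_sub, map_mul, map_pow, Polynomial.aeval_C, Polynomial.aeval_X,
    map_ofNat]

theorem monic_quartic : (quartic t e).Monic ∧ (quartic t e).natDegree = 4 := by
  have h : quartic t e = .X ^ 4 + (.C (4 * e ^ 2 + 8 * e) * .X ^ 3 +
      .C (8 * t ^ 2 + 24 * e * t ^ 2 + 4 * e ^ 4 + 16 * e ^ 2) * .X ^ 2 +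
      .C (8 * e * t ^ 2 * (2 * e - 4) + (e ^ 2 + 4) * (16 * e * t ^ 2) + 32 * t ^ 4) * .X +
      .C (16 * t ^ 4 + 16 * t ^ 4 * (2 * e - 4) + 16 * t ^ 4 * (e ^ 2 + 4))) := by
    simp only [quartic, map_add, map_sub, map_mul, map_pow, map_ofNat]
    ring
  rw [h]
  constructor
  · monicity!
  · compute_degree!

/-- The values for which the quartic has a double root or the fibre is reducible. -/
def degK (t : ℂ) : Set ℂ :=
  {2, 2 + t ^ 2, 3} ∪ ⋃ x ∈ {x : ℂ | (x - 2) ^ 2 = t ^ 2} ∪ {x : ℂ | x ^ 3 - 2 * x ^ 2 + t ^ 2 = 0},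
    {c | (c - 2 + (x - 2) ^ 2) ^ 2 = 4 * (c - 2) * x ^ 2 - 16 * t ^ 2 * x + 16 * t ^ 2}

theorem finite_degK (t : ℂ) : (degK t).Finite := by
  refine (Set.toFinite _).union (((finite_square_roots t).union (finite_cubic_roots t)).biUnion
    fun x _ => ?_)
  have : (.X ^ 2 + (.C (2 * ((x - 2) ^ 2 - 2) - 4 * x ^ 2) * .X + .C (((x - 2) ^ 2 - 2) ^ 2 +
      8 * x ^ 2 + 16 * t ^ 2 * x - 16 * t ^ 2)) : Polynomial ℂ).Monic := by monicity!
  refine (Polynomial.finite_setOfPred_isRoot this.ne_zero).subset fun c hc => ?_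
  simp only [Set.mem_ofPred_eq, Polynomial.IsRoot, Polynomial.eval_add, Polynomial.eval_mul,
    Polynomial.eval_pow, Polynomial.eval_X, Polynomial.eval_C] at hc ⊢
  linear_combination hc

/-- With `L = 2ep + 4t²` and `N = 4t² - p²` the quartic is `N² + (2e - 4)NL + (e² + 4 + 2p)L²`. At a
double root with `L = 0` also `N = 0`, which forces `e² = t²`. Otherwise one passes to `x = N/L`,
which is the original coordinate on the conic, and eliminates `p` and `e`. -/
theorem derivative_quartic_ne_zero (he : e ^ 2 = c - 2) (hc : c ∉ degK t) {p : ℂ} (ht : t ≠ 0)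
    (h0 : (quartic t e).eval p = 0) : (quartic t e).derivative.eval p ≠ 0 := by
  intro h1
  rw [← Polynomial.coe_aeval_eq_eval, aeval_quartic] at h0
  simp only [Algebra.algebraMap_self, RingHom.id_apply] at h0
  simp [quartic, Polynomial.derivative_pow] at h1
  obtain ⟨L, hL⟩ : ∃ L, L = 2 * e * p + 4 * t ^ 2 := ⟨_, rfl⟩
  rw [← hL] at h0 h1
  apply hc
  by_cases hL0 : L = 0
  · subst hL0
    have hN : 4 * t ^ 2 - p ^ 2 = 0 := by
      apply pow_eq_zero_iff two_ne_zero |>.mp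
      linear_combination h0
    refine Or.inl (Or.inr (Or.inl ?_))
    have : t ^ 2 * (e ^ 2 - t ^ 2) = 0 := by
      linear_combination (-2 * e * p + 4 * t ^ 2) / 16 * hL + e ^ 2 / 4 * hN
    rcases mul_eq_zero.mp this with h | h
    · exact absurd h (pow_ne_zero 2 ht)
    · linear_combination h - he
  · obtain ⟨x, hx⟩ : ∃ x, x * L = 4 * t ^ 2 - p ^ 2 := ⟨_, div_mul_cancel₀ _ hL0⟩
    rw [← hx] at h0 h1
    have hV : x ^ 2 + (2 * e - 4) * x + e ^ 2 + 4 + 2 * p = 0 := by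
      apply mul_left_cancel₀ (pow_ne_zero 2 hL0)
      linear_combination h0
    have hD : (x + e - 2) * (p + e * x) = e * p + 2 * t ^ 2 := by
      apply mul_left_cancel₀ hL0
      linear_combination -h1 / 4 + e * L * hV + L / 2 * hL
    -- Elimination of `p` from `V = 0` and `xL = N` gives this equation between `c` and `x`; the
    -- double root gives in addition `hA`, which is linear in `c`. Eliminating `c` from the two
    -- confines `x` to a finite set.
    have hB : (c - 2 + (x - 2) ^ 2) ^ 2 = 4 * (c - 2) * x ^ 2 - 16 * t ^ 2 * x + 16 * t ^ 2 := by
      rw [← he]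
      linear_combination (e ^ 2 + (x - 2) ^ 2 - 2 * (p + e * x)) * hV + 4 * hx - 4 * x * hL
    have hA : (c - 2) * (x + 2) = 4 * t ^ 2 + (x - 2) ^ 3 := by
      rw [← he]
      linear_combination 2 * hD - (x - 2) * hV
    have : ((x - 2) ^ 2 - t ^ 2) * (x ^ 3 - 2 * x ^ 2 + t ^ 2) = 0 := by
      linear_combination ((c - 2) * (x + 2) + 4 * t ^ 2 + (x - 2) ^ 3 +
        2 * (x + 2) * (x - 2) ^ 2 - 4 * x ^ 2 * (x + 2)) / 16 * hA - (x + 2) ^ 2 / 16 * hB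
    refine Or.inr (Set.mem_biUnion (x := x) ?_ hB)
    rcases mul_eq_zero.mp this with h | h
    · exact Or.inl (sub_eq_zero.mp h)
    · exact Or.inr h

end quartic

/-! ### Function fields of elliptic curves -/

section functionField

variable {K : Type*} [Field K] [Algebra ℂ K]

theorem transcendental_of_notMem_range {z : K} (hz : z ∉ Set.range (algebraMap ℂ K)) :
    Transcendental ℂ z := by
  intro h
  obtain ⟨f, hf, hroot⟩ := h
  refine hz ((IsAlgClosed.splits f).mem_range_of_isRoot hf ?_)
  rwa [Polynomial.IsRoot, Polynomial.eval_map_algebraMap]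

/-- A field generated by a transcendental element and a second one that satisfy a Weierstrass
equation is the function field of the curve. -/
theorem nonempty_algEquiv_functionField (W : WeierstrassCurve ℂ) {S Y : K}
    (hS : Transcendental ℂ S)
    (h : (W.toAffine.polynomial).eval₂ (Polynomial.aeval (R := ℂ) S) Y = 0)
    (htop : ∀ F : IntermediateField ℂ K, S ∈ F → Y ∈ F → F = ⊤) :
    Nonempty (K ≃ₐ[ℂ] W.toAffine.FunctionField) := by
  let φ : W.toAffine.CoordinateRing →ₐ[ℂ] K :=
    AdjoinRoot.liftAlgHom W.toAffine.polynomial (Polynomial.aeval S) Y h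
  have : Module.Finite (Polynomial ℂ) W.toAffine.CoordinateRing :=
    .of_basis (WeierstrassCurve.Affine.CoordinateRing.basis W.toAffine)
  have hφ : Function.Injective φ := by
    rw [RingHom.injective_iff_ker_eq_bot φ]
    -- The coordinate ring is a domain finite over `ℂ[X]`, so a nonzero kernel would meet `ℂ[X]`,
    -- contrary to the transcendence of `S`.
    apply Ideal.eq_bot_of_comap_eq_bot (R := Polynomial ℂ)
    rw [eq_bot_iff]
    intro p hp
    rw [Ideal.mem_comap, RingHom.mem_ker] at hp
    have e : φ (algebraMap _ _ p) = Polynomial.aeval S p := AdjoinRoot.liftAlgHom_of ..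
    exact transcendental_iff.mp hS p (e ▸ hp)
  let Ψ : W.toAffine.FunctionField →ₐ[ℂ] K := IsFractionRing.liftAlgHom hφ
  have hΨ : ∀ a, Ψ (algebraMap _ _ a) = φ a := fun a => IsFractionRing.lift_algebraMap hφ a
  refine ⟨(AlgEquiv.ofBijective Ψ ⟨Ψ.toRingHom.injective, ?_⟩).symm⟩
  have := htop Ψ.fieldRange
    ⟨algebraMap _ _ (algebraMap (Polynomial ℂ) _ .X), by
      change Ψ _ = _
      rw [hΨ]
      exact (AdjoinRoot.liftAlgHom_of ..).trans (Polynomial.aeval_X S)⟩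
    ⟨algebraMap _ _ (AdjoinRoot.root _), by
      change Ψ _ = _
      rw [hΨ]
      exact AdjoinRoot.liftAlgHom_root ..⟩
  rwa [AlgHom.fieldRange_eq_top] at this

/-- The substitution `P ↦ q/P` moves the root `P = 0` to infinity, leaving a cubic; the choice of
`q` makes it monic. -/
theorem weierstrass_of_quartic {L : Type*} [Field L] {P d₁ d₂ d₃ q v : L} (hP : P ≠ 0) (hq : q = d₁ * d₂ * d₃)
    (hv : v ^ 2 = P * ((P + d₁) * ((P + d₂) * (P + d₃)))) :
    (q * v / P ^ 2) ^ 2 = (q / P) ^ 3 + (d₂ * d₃ + d₁ * d₃ + d₁ * d₂) * (q / P) ^ 2 +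
      q * (d₁ + d₂ + d₃) * (q / P) + q ^ 2 := by
  field_simp
  rw [hv, hq]
  ring

/-- A double cover of the line branched over four points is elliptic. -/
theorem exists_isElliptic_of_sq_eq {r r₁ r₂ r₃ : ℂ} (hr : [r, r₁, r₂, r₃].Nodup) {p v : K}
    (hp : p ∉ Set.range (algebraMap ℂ K))
    (hv : v ^ 2 = (p - algebraMap ℂ K r) * ((p - algebraMap ℂ K r₁) * ((p - algebraMap ℂ K r₂) *
      (p - algebraMap ℂ K r₃))))
    (htop : ∀ F : IntermediateField ℂ K, p ∈ F → v ∈ F → F = ⊤) :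
    ∃ W : WeierstrassCurve ℂ, W.IsElliptic ∧ Nonempty (K ≃ₐ[ℂ] W.toAffine.FunctionField) := by
  simp only [List.nodup_cons, List.mem_cons, List.not_mem_nil, not_or, or_false] at hr
  obtain ⟨⟨n1, n2, n3⟩, ⟨n12, n13⟩, n23, -⟩ := hr
  have d1 := sub_ne_zero.mpr n1
  have d2 := sub_ne_zero.mpr n2
  have d3 := sub_ne_zero.mpr n3
  have d12 := sub_ne_zero.mpr n12
  have d13 := sub_ne_zero.mpr n13
  have d23 := sub_ne_zero.mpr n23
  have hpr : p - algebraMap ℂ K r ≠ 0 := fun h => hp ⟨r, (sub_eq_zero.mp h).symm⟩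
  obtain ⟨q, hq⟩ : ∃ q, q = (r - r₁) * (r - r₂) * (r - r₃) := ⟨_, rfl⟩
  have hq0 : q ≠ 0 := hq ▸ mul_ne_zero (mul_ne_zero d1 d2) d3
  have hqK : algebraMap ℂ K q ≠ 0 := (map_ne_zero _).mpr hq0
  have hS : algebraMap ℂ K q / (p - algebraMap ℂ K r) ∉ Set.range (algebraMap ℂ K) := by
    rintro ⟨z, hz⟩
    have hz0 : algebraMap ℂ K z ≠ 0 := hz ▸ div_ne_zero hqK hpr
    refine hp ⟨r + q / z, ?_⟩
    rw [map_add, map_div₀, hz]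
    field_simp
    ring
  refine ⟨⟨0, (r - r₂) * (r - r₃) + (r - r₁) * (r - r₃) + (r - r₁) * (r - r₂), 0,
    q * ((r - r₁) + (r - r₂) + (r - r₃)), q ^ 2⟩, ⟨?_⟩, nonempty_algEquiv_functionField _
      (Y := algebraMap ℂ K q * v / (p - algebraMap ℂ K r) ^ 2)
      (transcendental_of_notMem_range hS) ?_ fun F h1 h2 => htop F ?_ ?_⟩
  · rw [isUnit_iff_ne_zero]
    have : WeierstrassCurve.Δ ⟨0, (r - r₂) * (r - r₃) + (r - r₁) * (r - r₃) + (r - r₁) * (r - r₂), 0,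
        q * ((r - r₁) + (r - r₂) + (r - r₃)), q ^ 2⟩ =
        16 * q ^ 2 * ((r₁ - r₂) * (r₁ - r₃) * (r₂ - r₃)) ^ 2 := by
      simp only [WeierstrassCurve.Δ, WeierstrassCurve.b₂, WeierstrassCurve.b₄,
        WeierstrassCurve.b₆, WeierstrassCurve.b₈, hq]
      ring
    rw [this]
    exact mul_ne_zero (mul_ne_zero (by norm_num) (pow_ne_zero 2 hq0))
      (pow_ne_zero 2 (mul_ne_zero (mul_ne_zero d12 d13) d23))
  · simp only [WeierstrassCurve.Affine.polynomial, Polynomial.eval₂_sub, Polynomial.eval₂_add,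
      Polynomial.eval₂_mul, Polynomial.eval₂_pow, Polynomial.eval₂_X, Polynomial.eval₂_C, map_zero,
      Polynomial.eval₂_zero, RingHom.coe_coe, map_add, map_mul, map_sub, map_pow, Polynomial.aeval_X, Polynomial.aeval_C]
    have := weierstrass_of_quartic (q := algebraMap ℂ K q) hpr
      (by rw [hq, map_mul, map_mul]) (hv.trans (by
      rw [← sub_add_sub_cancel p (algebraMap ℂ K r) (algebraMap ℂ K r₁),
        ← sub_add_sub_cancel p (algebraMap ℂ K r) (algebraMap ℂ K r₂),
        ← sub_add_sub_cancel p (algebraMap ℂ K r) (algebraMap ℂ K r₃),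
        ← map_sub, ← map_sub, ← map_sub]))
    simp only [map_sub] at this
    linear_combination this
  -- The change of variables is inverted by `p = r + q/S`; below, `v` is recovered from `Y` as `q
  -- Y/S²`.
  · have h3 := F.add_mem (F.algebraMap_mem r) (F.mul_mem (F.algebraMap_mem q) (F.inv_mem h1))
    convert h3 using 1
    field_simp
    ring
  · have h3 := F.mul_mem h2 (F.inv_mem (F.mul_mem h1 h1))
    have h4 := F.mul_mem h3 (F.algebraMap_mem q)
    convert h4 using 1
    field_simp

end functionField

/-! ### The elliptic fibration -/

section fibration

variable {t c : ℂ}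

/-- The general fibre is birational to a double cover of the line branched over four points. -/
theorem exists_isElliptic_of_fibre {K : Type*} [Field K] [Algebra ℂ K] (ht : t ≠ 0)
    (hc : c ∉ degK t) {x y : K} (hF : Polynomial.aevalAeval x y (fibP t c) = 0)
    (hind : ∀ P : Polynomial (Polynomial ℂ), P ≠ 0 → P.natDegree < 4 →
      Polynomial.aevalAeval x y P ≠ 0)
    (htop : ∀ F : IntermediateField ℂ K, x ∈ F → y ∈ F → F = ⊤) :
    ∃ W : WeierstrassCurve ℂ, W.IsElliptic ∧ Nonempty (K ≃ₐ[ℂ] W.toAffine.FunctionField) := by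
  -- A square root of the leading coefficient of `R` gives a point at infinity of the conic, through
  -- which it is parametrized.
  obtain ⟨e, he⟩ := IsAlgClosed.exists_pow_nat_eq (c - 2) two_pos
  have e0 : e ≠ 0 := by
    rintro rfl
    exact hc (Or.inl (Or.inl (by linear_combination -he)))
  obtain ⟨r, r₁, r₂, r₃, hnd, hQ⟩ := exists_four_roots (monic_quartic (t := t) (e := e)).1
    monic_quartic.2 fun p => derivative_quartic_ne_zero he hc ht
  have ev : ∀ z : Polynomial ℂ, Polynomial.aevalAeval (R := ℂ) x y (.C z) = Polynomial.aeval x z :=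
    Polynomial.aevalAeval_C x y
  have evX : Polynomial.aevalAeval (R := ℂ) x y .X = y := by simp
  have x0 : x ≠ 0 := by
    simpa using hind (.C .X) (by simp) (by simp)
  have x1 : x - 1 ≠ 0 := by
    simpa using hind (.C (.X - 1)) (Polynomial.C_ne_zero.mpr X_sub_one_ne_zero) (by
      rw [Polynomial.natDegree_C]
      norm_num)
  have y0 : y ≠ 0 := by
    simpa using hind .X (by simp) (by simp)
  have h2 : (2 : K) ≠ 0 := by
    have := (map_ne_zero (algebraMap ℂ K)).mpr (two_ne_zero (α := ℂ))
    rwa [map_ofNat] at this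
  obtain ⟨w, hw⟩ : ∃ w, w * y = (x - 1) * y ^ 2 + (x ^ 2 - algebraMap ℂ K t ^ 2) :=
    ⟨_, div_mul_cancel₀ _ y0⟩
  -- On the conic `(w - x²)² = R(x)` put `w - x² = ex + p`. As `e² = c - 2`, the quadratic terms
  -- cancel and `x(2ep + 4t²) = 4t² - p²`, so `x` is a rational function of `p`.
  obtain ⟨p, hp⟩ : ∃ p, p = w - x ^ 2 - algebraMap ℂ K e * x := ⟨_, rfl⟩
  -- A constant `p` would give an equation of degree `2` for `y` over `ℂ[x]`.
  have hpr : p ∉ Set.range (algebraMap ℂ K) := by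
    rintro ⟨z, rfl⟩
    have hdeg : (.C (.X - 1) * .X ^ 2 - .C (.X ^ 2 + .C e * .X + .C z) * .X + .C (.X ^ 2 - .C (t ^ 2)) :
        Polynomial (Polynomial ℂ)).natDegree = 2 := by
      have := X_sub_one_ne_zero
      compute_degree!
    refine hind (.C (.X - 1) * .X ^ 2 - .C (.X ^ 2 + .C e * .X + .C z) * .X +
      .C (.X ^ 2 - .C (t ^ 2))) (fun h => ?_) (by omega) ?_
    · rw [h] at hdeg
      simp at hdeg
    · simp only [map_add, map_sub, map_mul, map_pow, ev, evX,
        Polynomial.aeval_X, Polynomial.aeval_C, map_one]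
      linear_combination -hw - y * hp
  have hL : 2 * algebraMap ℂ K e * p + 4 * algebraMap ℂ K t ^ 2 ≠ 0 := by
    intro h
    refine hpr ⟨-2 * t ^ 2 / e, ?_⟩
    have e0' : algebraMap ℂ K e ≠ 0 := (map_ne_zero _).mpr e0
    simp only [map_div₀, map_mul, map_neg, map_pow, map_ofNat]
    rw [div_eq_iff e0']
    apply mul_left_cancel₀ h2
    linear_combination -h
  have he' := congrArg (algebraMap ℂ K) he
  simp only [fibP, map_add, map_sub, map_mul, map_pow, ev, evX, map_ofNat,
    Polynomial.aeval_X, Polynomial.aeval_C, map_one] at hF he'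
  have hZ : (w - x ^ 2) ^ 2 = (algebraMap ℂ K c - 2) * x ^ 2 - 4 * algebraMap ℂ K t ^ 2 * x +
      4 * algebraMap ℂ K t ^ 2 := by
    apply mul_right_cancel₀ (pow_ne_zero 2 y0)
    linear_combination hF + (w * y + (x - 1) * y ^ 2 + (x ^ 2 - algebraMap ℂ K t ^ 2) -
      2 * x ^ 2 * y) * hw
  have hx : x * (2 * algebraMap ℂ K e * p + 4 * algebraMap ℂ K t ^ 2) =
      4 * algebraMap ℂ K t ^ 2 - p ^ 2 := by
    rw [hp]
    linear_combination hZ - x ^ 2 * he'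
  -- The square root of the discriminant of `(x - 1)y² - wy + (x² - t²)`, the equation that recovers
  -- `y` from `x` and `w`. Multiplied by `(2ep + 4t²)/x` it becomes a square root of the quartic in
  -- `p`.
  obtain ⟨u, hu⟩ : ∃ u, u = 2 * (x - 1) * y - w := ⟨_, rfl⟩
  have hu2 : u ^ 2 = x ^ 2 * (x ^ 2 + (2 * algebraMap ℂ K e - 4) * x + algebraMap ℂ K e ^ 2 + 4 +
      2 * p) := by
    have hwp : w = p + x ^ 2 + algebraMap ℂ K e * x := by linear_combination -hp
    rw [hu]
    linear_combination -4 * (x - 1) * hw + (w + p + x ^ 2 + algebraMap ℂ K e * x) * hwp + hx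
  refine exists_isElliptic_of_sq_eq hnd hpr
    (v := u * (2 * algebraMap ℂ K e * p + 4 * algebraMap ℂ K t ^ 2) / x) ?_ fun F h1 h3 => ?_
  · have hQp := congrArg (Polynomial.aeval p) hQ
    rw [aeval_quartic] at hQp
    simp only [map_mul, map_sub, Polynomial.aeval_X, Polynomial.aeval_C] at hQp
    rw [← hQp, ← hx, div_pow, mul_pow, hu2]
    generalize 2 * algebraMap ℂ K e * p + 4 * algebraMap ℂ K t ^ 2 = L
    field_simp
    ring
  · have hofNat : ∀ n : ℂ, algebraMap ℂ K n ∈ F := F.algebraMap_mem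
    have f2 : (2 : K) ∈ F := ofNat_mem F 2
    have f4 : (4 : K) ∈ F := ofNat_mem F 4
    have ft := pow_mem (hofNat t) 2
    -- The field generated by `p` and `v` contains successively `x`, `u`, `w` and `y`.
    have fL := F.add_mem (F.mul_mem (F.mul_mem f2 (hofNat e)) h1) (F.mul_mem f4 ft)
    have fx : x ∈ F := by
      rw [eq_div_of_mul_eq hL hx]
      exact F.div_mem (F.sub_mem (F.mul_mem f4 ft) (pow_mem h1 2)) fL
    have fu : u ∈ F := by
      have := F.div_mem (F.mul_mem h3 fx) fL
      rwa [div_mul_cancel₀ _ x0, mul_div_cancel_right₀ _ hL] at this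
    have fw : w ∈ F := by
      have := F.add_mem (F.add_mem h1 (pow_mem fx 2)) (F.mul_mem (hofNat e) fx)
      convert this using 1
      linear_combination -hp
    refine htop F fx ?_
    have := F.div_mem (F.add_mem fu fw) (F.mul_mem f2 (F.sub_mem fx F.one_mem))
    convert this using 1
    rw [hu, sub_add_cancel, mul_div_cancel_left₀ _ (mul_ne_zero h2 x1)]

open Polynomial.Bivariate in
/-- The function field of the general fibre. -/
theorem exists_functionField_fibre (ht : t ≠ 0) (hc : c ∉ degK t)
    (hirr : Irreducible (hkyG t - C c * hkyF)) :
    ∃ W : WeierstrassCurve ℂ, W.IsElliptic ∧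
      Nonempty (FractionRing (MvPolynomial (Fin 2) ℂ ⧸ Ideal.span {hkyG t - C c * hkyF}) ≃ₐ[ℂ]
        W.toAffine.FunctionField) := by
  let I : Ideal (MvPolynomial (Fin 2) ℂ) := Ideal.span {hkyG t - C c * hkyF}
  have : I.IsPrime := (Ideal.span_singleton_prime hirr.ne_zero).mpr hirr.prime
  let K := FractionRing (MvPolynomial (Fin 2) ℂ ⧸ I)
  let ψ : MvPolynomial (Fin 2) ℂ →ₐ[ℂ] K :=
    (IsScalarTower.toAlgHom ℂ (MvPolynomial (Fin 2) ℂ ⧸ I) K).comp (Ideal.Quotient.mkₐ ℂ I)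
  have hψ : ∀ P, ψ P = 0 ↔ hkyG t - C c * hkyF ∣ P := fun P => by
    rw [← Ideal.mem_span_singleton, ← Ideal.Quotient.eq_zero_iff_mem]
    exact (map_eq_zero_iff _ (IsFractionRing.injective (MvPolynomial (Fin 2) ℂ ⧸ I) K))
  have ev : ∀ P, Polynomial.aevalAeval (ψ (X 0)) (ψ (X 1)) P = ψ (equivMvPolynomial ℂ P) := by
    intro P
    rw [← aeval_equivMvPolynomial]
    have : (aeval ![ψ (X 0), ψ (X 1)] : MvPolynomial (Fin 2) ℂ →ₐ[ℂ] K) = ψ := by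
      ext i
      fin_cases i <;> simp
    rw [this]
  refine exists_isElliptic_of_fibre (K := K) ht hc (x := ψ (X 0)) (y := ψ (X 1)) ?_
    (fun P hP hd h => ?_) fun F hx hy => ?_
  · rw [ev, hψ, equivMvPolynomial_fibP]
  -- A nonzero polynomial vanishing on the fibre is a multiple of its equation, which has degree `4`
  -- in `y`.
  · rw [ev, hψ, ← equivMvPolynomial_fibP, map_dvd_iff] at h
    have := Polynomial.natDegree_le_of_dvd h hP
    rw [natDegree_fibP] at this
    omega
  · have hpoly : ∀ P, ψ P ∈ F := fun P => by
      induction P using MvPolynomial.induction_on with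
      | C a => exact (AlgHom.commutes ψ a).symm ▸ F.algebraMap_mem a
      | add p q hp hq => exact map_add ψ p q ▸ F.add_mem hp hq
      | mul_X p i hp =>
        rw [map_mul]
        fin_cases i
        exacts [F.mul_mem hp hx, F.mul_mem hp hy]
    rw [eq_top_iff]
    intro z _
    obtain ⟨a, b, -, rfl⟩ := IsFractionRing.div_surjective (A := MvPolynomial (Fin 2) ℂ ⧸ I) z
    obtain ⟨a, rfl⟩ := Ideal.Quotient.mk_surjective a
    obtain ⟨b, rfl⟩ := Ideal.Quotient.mk_surjective b
    exact F.div_mem (hpoly a) (hpoly b)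

theorem isEllipticFibration_hky (ht : t ≠ 0) :
    IsEllipticFibration (hkyParam t) hkyF (hkyG t) := by
  refine ⟨fun R hR => invK_mem_or_inv_mem ht hR,
    ((finite_critK t).union (finite_degK t)).subset fun c hc => ?_⟩
  by_contra hcu
  rw [Set.mem_union, not_or] at hcu
  have hirr : Irreducible (hkyG t - C c * hkyF) := by
    rw [← equivMvPolynomial_fibP, MulEquiv.irreducible_iff]
    exact irreducible_fibre ht (fun h => hcu.2 (Or.inl (Or.inr (Or.inl h))))
      (fun h => hcu.2 (Or.inl (Or.inr (Or.inr h))))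
  exact hc ⟨fun R hR h => invK_sub_notMem_sq ht hcu.1 hR h, hirr,
    exists_functionField_fibre ht hcu.2 hirr⟩

end fibration

end

end HKY

theorem mainTheorem4 :
    -- The HKY mapping: automorphism, linear systems, conserved quantity, type i-2.
    (∀ t : ℂ, t ≠ 0 →
      HKY.dimLinSys (HKY.hkyParam t) HKY.antiK = 0 ∧
      HKY.dimLinSys (HKY.hkyParam t) ((2 : ℤ) • HKY.antiK) = 1 ∧
      ∃ φ : HKY.FuncField ≃ₐ[ℂ] HKY.FuncField,
        φ HKY.cx = (HKY.cx - HKY.cst t) * (HKY.cx + HKY.cst t) / (HKY.cy * (HKY.cx - 1)) ∧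
        φ HKY.cy = HKY.cx ∧
        HKY.IsPullbackOfIso φ (HKY.surface (HKY.hkyParam t)) (HKY.surface (HKY.hkyParam t)) ∧
        φ (HKY.ofPoly (HKY.hkyG t) / HKY.ofPoly HKY.hkyF) =
          HKY.ofPoly (HKY.hkyG t) / HKY.ofPoly HKY.hkyF ∧
        HKY.IsCaseI (HKY.hkyParam t) φ 2 HKY.hkyF (HKY.hkyG t) ∧
        -- It is the member of the family below with `a = (t, -t, t, -t, 1)`, where `q = -1`.
        HKY.Admissible (HKY.hkyParam t) ∧
        HKY.IsDeautonomized (HKY.hkyParam t) φ ∧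
        HKY.evolve (HKY.hkyParam t) = HKY.hkyParam t ∧
        HKY.qParam (HKY.hkyParam t) = -1) ∧
    -- The surfaces of the family have type `A₄⁽¹⁾`, and `q = exp χ(-K)`.
    (∑ k, HKY.clsD k = HKY.antiK ∧ ∑ j, HKY.root j = HKY.antiK ∧
      (∀ i j, HKY.inter (HKY.clsD i) (HKY.clsD j) = -HKY.cartanA4 i j) ∧
      (∀ i j, HKY.inter (HKY.root i) (HKY.root j) = -HKY.cartanA4 i j) ∧
      (∀ l : HKY.Pic, (∀ k, HKY.inter l (HKY.clsD k) = 0) ↔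
        l ∈ Submodule.span ℤ (Set.range HKY.root))) ∧
    (∀ a : Fin 5 → ℂ, HKY.Admissible a →
      (∀ k, HKY.IsPrimeDivisor a (HKY.clsD k) (HKY.secD k)) ∧
      (∀ j, HKY.IsExpPeriod a (HKY.root j)
        (![-a 2 / (a 0 * a 4), a 0 / a 1, 1 / a 0, a 2, a 3 / a 2] j)) ∧
      HKY.IsExpPeriod a HKY.antiK (HKY.qParam a)) ∧
    -- The deautonomized mapping is a `q`-Painlevé equation on this family.
    (∀ a : Fin 5 → ℂ, HKY.Admissible a →
      HKY.Admissible (HKY.evolve a) ∧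
      HKY.qParam (HKY.evolve a) = HKY.qParam a ∧
      HKY.evolve^[4] a = ![a 0 / HKY.qParam a ^ 2, a 1 / HKY.qParam a ^ 2,
        a 2 / HKY.qParam a ^ 2, a 3 / HKY.qParam a ^ 2, a 4]) ∧
    ∃ Φ : HKY.Pic ≃ₗ[ℤ] HKY.Pic,
      (∀ l m, HKY.inter (Φ l) (Φ m) = HKY.inter l m) ∧
      (∀ k, Φ (HKY.clsD k) = HKY.clsD (k + 1)) ∧
      (∀ j, Φ (HKY.root j) =
        ![HKY.root 2 + HKY.root 3 + HKY.root 4, -HKY.root 4, -HKY.root 3,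
          HKY.root 0 + HKY.root 3 + HKY.root 4, HKY.root 1] j) ∧
      (∀ j, Φ (Φ (Φ (Φ (HKY.root j)))) =
        HKY.root j + (![0, 0, -2, 2, 0] : Fin 5 → ℤ) j • HKY.antiK) ∧
      ∀ a : Fin 5 → ℂ, HKY.Admissible a →
        ∃ φ : HKY.FuncField ≃ₐ[ℂ] HKY.FuncField,
          HKY.IsDeautonomized a φ ∧
          HKY.IsPullbackOfIso φ (HKY.surface a) (HKY.surface (HKY.evolve a)) ∧
          (a 0 ≠ 1 → a 1 ≠ 1 → HKY.InducesOnPic φ a (HKY.evolve a) Φ) := by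
  refine ⟨fun t ht => ?_, ⟨HKY.sum_clsD, HKY.sum_root, HKY.inter_clsD, HKY.inter_root,
    HKY.orthogonal_clsD_iff⟩, fun a ha => ⟨HKY.isPrimeDivisor_clsD ha, HKY.isExpPeriod_root' ha,
      HKY.isExpPeriod_antiK ha⟩, fun a ha => ⟨ha.evolve, HKY.qParam_evolve ha, HKY.evolve_four ha⟩,
    HKY.picMap, HKY.inter_picMap, HKY.picMap_clsD, HKY.picMap_root, HKY.picMap_four_root,
    fun a ha => ?_⟩
  · obtain ⟨φ, h⟩ := HKY.exists_isMapping (HKY.admissible_hkyParam ht)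
    have hd := h.isDeautonomized
    have hp := h.isPullbackOfIso
    rw [HKY.evolve_hkyParam ht] at hp
    have hk := HKY.map_invK h
    refine ⟨HKY.dimLinSys_antiK ht, HKY.dimLinSys_two_antiK ht, φ, ?_, hd.2, hp, hk,
      ⟨HKY.isHalphen_hkyParam ht, HKY.sections_two_antiK ht, HKY.isEllipticFibration_hky ht, hp, hk⟩,
      HKY.admissible_hkyParam ht, hd, HKY.evolve_hkyParam ht, HKY.qParam_hkyParam ht⟩
    rw [hd.1]
    simp [HKY.hkyParam, HKY.cst]
  · obtain ⟨φ, h⟩ := HKY.exists_isMapping ha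
    exact ⟨φ, h.isDeautonomized, h.isPullbackOfIso, h.inducesOnPic⟩
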